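/- **Setting.** Let $\sigma\in\{1,-1\}$ and $a=2^{-2/3}$. Consider for real-valued $u=u(x,y,t)$ the symmetrized modified Zakharov–Kuznetsov equation $$\partial_t u+(\partial_x^3+\partial_y^3)u+\sigma a(\partial_x+\partial_y)(u^3)=0\qquad\text{on }\mathbb R^2\times[0,\delta], \tag{1}$$ and, for real-valued $f\in H^1(\mathbb R^2)$, the energy $$E[f]=\frac12\int_{\mathbb R^2}|\nabla f|^2\,dx\,dy-\frac12\int_{\mathbb R^2}f_xf_y\,dx\,dy-\frac{\sigma a}4\int_{\mathbb R^2}f^4\,dx\,dy .$$ A solution of (1) in $H^s$ on $[0,\delta]$ is a real-valued $u\in C([0,\delta];H^s(\mathbb R^2))$ satisfying the equation in the sense of distributions on $\mathbb R^2\times(0,\delta)$. Write $\langle x\rangle=(1+|x|^2)^{1/2}$ and $\zeta=(\xi,\eta)$. For $s',b\in\mathbb R$ let $$\|v\|_{X_{s',b}}=\big\|\langle\zeta\rangle^{s'}\langle\tau-(\xi^3+\eta^3)\rangle^{b}\,\widehat v(\xi,\eta,\tau)\big\|_{L^2_{\xi,\eta,\tau}}$$ for tempered distributions $v$ on $\mathbb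 R^2\times\mathbb R$, where $\widehat v$ is the space-time Fourier transform with kernel $e^{-i(x\xi+y\eta+t\tau)}$. For $\delta>0$ let $\|w\|_{X^{\delta}_{s',b}}$ be the infimum of $\|v\|_{X_{s',b}}$ over all $v\in X_{s',b}$ with $v(t)=w(t)$ on $[0,\delta]$ (it is $+\infty$ if there is no such $v$). For $0<s<1$ and $N>0$ let $I_N$ be a Fourier multiplier operator $\widehat{I_Nf}(\zeta)=m_N(\zeta)\widehat f(\zeta)$ on $\mathbb R^2$, where $m_N$ is smooth, radially symmetric, non-increasing in $|\zeta|$, $m_N(\zeta)=1$ for $|\zeta|\le N$ and $m_N(\zeta)=(N/|\zeta|)^{1-s}$ for $|\zeta|\ge 2N$. The modified energy of $u$ is $E^1[u](t)=E[I_Nu(t)]$. **Proposition (almost conservation law).** Let $\frac34<s<1$, $\varepsilon>0$ and $\varepsilon'>0$. There are constants $C>0$ and $N_0\ge1$, depending only on $s,\varepsilon,\varepsilon'$, such that for every $\sigma\in\{1,-1\}$, every $N\ge N_0$, every symbol $m_N$ as above, every $\delta>0$ and every solution $u$ of (1) in $H^s$ on $[0,\delta]$, $$\big|E^1[u](\delta)-E^1[u](0)\big|\le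 C\,N^{-1+\varepsilon}\Big(\|I_Nu\|_{X^{\delta}_{1,\frac12+\varepsilon'}}^4+\|I_Nu\|_{X^{\delta}_{1,\frac12+\varepsilon'}}^6\Big).$$ -/

import Mathlib

open MeasureTheory Filter Topology FourierTransform
open scoped ENNReal ContDiff SchwartzMap

namespace SymmetrizedMZK

noncomputable section

/-- The spatial plane `ℝ²`, with variables `(x, y)` and dual variables `ζ = (ξ, η)`. -/
abbrev Plane : Type := EuclideanSpace ℝ (Fin 2)

/-- Space-time `ℝ² × ℝ`, with variables `(x, y, t)` and dual variables `(ξ, η, τ)`. -/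
abbrev SpaceTime : Type := EuclideanSpace ℝ (Fin 3)

/-- Complex-valued square integrable functions on the plane. -/
abbrev L2Plane : Type := Lp ℂ 2 (volume : Measure Plane)

/-- The point `(x, y, t)` of space-time, from the point `z = (x, y)` and the time `t`. -/
def pt (z : Plane) (t : ℝ) : SpaceTime := !₂[z 0, z 1, t]

/-- The Japanese bracket `⟨x⟩ = (1 + |x|²)^{1/2}`. -/
def jap {E : Type*} [NormedAddCommGroup E] (x : E) : ℝ := Real.sqrt (1 + ‖x‖ ^ 2)

/-! ### Sobolev norms and Fourier multipliers on the plane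

Frequencies are those of the transform `f̂(ζ) = ∫ f(z) e^{-i z·ζ} dz`. Mathlib's transform `𝓕`
has the kernel `e^{-2πi z·ξ}`, so that `f̂(ζ) = (𝓕 f)(ζ / 2π)`, and a symbol `a(ζ)` acts on `𝓕 f`
as multiplication by `a(2πξ)`. -/

/-- The norm `‖J^s f‖_{L²}` of `H^s(ℝ²)` (it is `∞` if `f ∉ H^s`). It is used for `s ≥ 0` only, where
`H^s ⊆ L²`. By Plancherel's theorem it is the `L²` norm of `⟨2πξ⟩^s (𝓕 f)(ξ)`. -/
def sobolevNorm (s : ℝ) (f : L2Plane) : ℝ≥0∞ :=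
  eLpNorm (fun ξ : Plane => ((jap ((2 * Real.pi) • ξ) ^ s : ℝ) : ℂ) *
    ((𝓕 f : L2Plane) : Plane → ℂ) ξ) 2 volume

open Classical in
/-- The Fourier multiplier operator on `L²(ℝ²)` with symbol `a(ζ)`, on its natural domain
`{f ∈ L² : a f̂ ∈ L²}` (and `0` off this domain). -/
def fourierMult (a : Plane → ℂ) (f : L2Plane) : L2Plane :=
  if h : MemLp (fun ξ : Plane => a ((2 * Real.pi) • ξ) *
      ((𝓕 f : L2Plane) : Plane → ℂ) ξ) 2 volume
  then 𝓕⁻ (h.toLp _) else 0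

/-- The partial derivative `∂_x` (`j = 0`) or `∂_y` (`j = 1`) of a function of `H¹(ℝ²)`: the Fourier
multiplier with symbol `i ζ_j`. -/
def partialDeriv (j : Fin 2) (f : L2Plane) : L2Plane :=
  fourierMult (fun ζ => Complex.I * (ζ j : ℂ)) f

/-! ### The equation and its energy -/

/-- The constant `a = 2^{-2/3}`. -/
def aConst : ℝ := (2 : ℝ) ^ (-(2 / 3) : ℝ)

/-- The energy
`E[f] = ½ ∫ |∇f|² - ½ ∫ f_x f_y - (σ a / 4) ∫ f⁴`
of a real-valued `f ∈ H¹(ℝ²)`. -/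
def energy (σ : ℝ) (f : L2Plane) : ℝ :=
  (1 / 2) * (∫ z, (‖partialDeriv 0 f z‖ ^ 2 + ‖partialDeriv 1 f z‖ ^ 2))
    - (1 / 2) * (∫ z, (partialDeriv 0 f z).re * (partialDeriv 1 f z).re)
    - (σ * aConst / 4) * (∫ z, (f z).re ^ 4)

/-- The partial derivative in the `j`-th variable of a test function on space-time
(`j = 0, 1, 2` for `x, y, t`). -/
def testDeriv (j : Fin 3) (φ : SpaceTime → ℝ) : SpaceTime → ℝ :=
  fun p => fderiv ℝ φ p (EuclideanSpace.single j 1)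

/-- `u` is a real-valued solution in `C([0,δ]; H^s(ℝ²))` of
`∂_t u + (∂_x³ + ∂_y³) u + σ a (∂_x + ∂_y)(u³) = 0` on `[0,δ]`; the equation holds in the sense of
distributions on `ℝ² × (0,δ)`. The values of `u` outside `[0,δ]` are irrelevant. -/
structure IsSolution (σ s δ : ℝ) (u : ℝ → L2Plane) : Prop where
  real_valued : ∀ t ∈ Set.Icc 0 δ, ∀ᵐ z, (u t z).im = 0
  mem_Hs : ∀ t ∈ Set.Icc 0 δ, sobolevNorm s (u t) < ⊤
  continuous : ∀ t ∈ Set.Icc 0 δ,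
    Tendsto (fun r => sobolevNorm s (u r - u t)) (𝓝[Set.Icc 0 δ] t) (𝓝 0)
  equation : ∀ φ : SpaceTime → ℝ, ContDiff ℝ ∞ φ → HasCompactSupport φ →
    tsupport φ ⊆ {p | 0 < p 2 ∧ p 2 < δ} →
    ∫ t in Set.Icc 0 δ, ∫ z : Plane,
      ((u t z).re * (testDeriv 2 φ (pt z t)
          + testDeriv 0 (testDeriv 0 (testDeriv 0 φ)) (pt z t)
          + testDeriv 1 (testDeriv 1 (testDeriv 1 φ)) (pt z t))
        + σ * aConst * (u t z).re ^ 3 *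
          (testDeriv 0 φ (pt z t) + testDeriv 1 φ (pt z t))) = 0

/-! ### Bourgain spaces -/

/-- The weight `⟨ζ⟩^s ⟨τ - (ξ³ + η³)⟩^b` at the point `(ξ, η, τ)`. -/
def bourgainWeight (s b : ℝ) (p : SpaceTime) : ℝ :=
  jap (!₂[p 0, p 1] : Plane) ^ s * jap (p 2 - (p 0 ^ 3 + p 1 ^ 3)) ^ b

/-- The tempered distribution `𝓕 v` is the function `g`. -/
def FourierIsFunction (v : 𝓢'(SpaceTime, ℂ)) (g : SpaceTime → ℂ) : Prop :=
  ∀ φ : 𝓢(SpaceTime, ℂ), Integrable (fun p => φ p * g p) volume ∧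
    (𝓕 v) φ = ∫ p, φ p * g p

/-- The norm of `X_{s,b}`: the `L²` norm of `⟨ζ⟩^s ⟨τ - (ξ³ + η³)⟩^b v̂(ξ,η,τ)`, where
`v̂(p) = (𝓕 v)(p / 2π)`. It is `∞` if `v̂` is not a function or if the weighted function is not
in `L²`. (If `𝓕 v` is a function then it is unique almost everywhere, so that the infimum is over
the representatives of one class and all its members are equal.) -/
def bourgainNorm (s b : ℝ) (v : 𝓢'(SpaceTime, ℂ)) : ℝ≥0∞ :=
  ⨅ (g : SpaceTime → ℂ) (_ : FourierIsFunction v g),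
    eLpNorm (fun p => (bourgainWeight s b p : ℂ) * g ((2 * Real.pi)⁻¹ • p)) 2 volume

/-- `v(t) = w(t)` for the times in `[0,T]`, for a distribution `v` and a curve `w` in `L²(ℝ²)` that
is continuous on `[0,T]`: the two agree as distributions on `ℝ² × (0,T)`. If `v ∈ X_{0,b}` with
`b > 1/2` then `v` is a continuous curve in `L²(ℝ²)`, and this says `v(t) = w(t)` for all
`t ∈ [0,T]`. -/
def AgreeOn (T : ℝ) (v : 𝓢'(SpaceTime, ℂ)) (w : ℝ → L2Plane) : Prop :=
  ∀ φ : 𝓢(SpaceTime, ℂ), tsupport φ ⊆ {p | 0 < p 2 ∧ p 2 < T} →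
    v φ = ∫ t in Set.Icc 0 T, ∫ z : Plane, φ (pt z t) * w t z

/-- The localized norm of `X_{s,b}^T`: the infimum of the `X_{s,b}` norms of the extensions
(`∞` if there is no extension in `X_{s,b}`). -/
def localBourgainNorm (s b T : ℝ) (w : ℝ → L2Plane) : ℝ≥0∞ :=
  ⨅ (v : 𝓢'(SpaceTime, ℂ)) (_ : AgreeOn T v w), bourgainNorm s b v

/-! ### The operator `I_N` and the modified energy -/

/-- `m` is a symbol of the kind defining `I_N`: smooth, radially symmetric, non-increasing in `|ζ|`,
equal to `1` for `|ζ| ≤ N` and to `(N/|ζ|)^{1-s}` for `|ζ| ≥ 2N`. -/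
structure IsISymbol (s N : ℝ) (m : Plane → ℝ) : Prop where
  smooth : ContDiff ℝ ∞ m
  radial : ∀ ζ ζ' : Plane, ‖ζ‖ = ‖ζ'‖ → m ζ = m ζ'
  antitone : ∀ ζ ζ' : Plane, ‖ζ‖ ≤ ‖ζ'‖ → m ζ' ≤ m ζ
  eq_one : ∀ ζ : Plane, ‖ζ‖ ≤ N → m ζ = 1
  eq_rpow : ∀ ζ : Plane, 2 * N ≤ ‖ζ‖ → m ζ = (N / ‖ζ‖) ^ (1 - s)

/-- The operator `I_N` with symbol `m`. -/
def IOp (m : Plane → ℝ) (f : L2Plane) : L2Plane :=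
  fourierMult (fun ζ => (m ζ : ℂ)) f

/-- The modified energy `E¹[u](t) = E[I_N u](t)`. -/
def modifiedEnergy (σ : ℝ) (m : Plane → ℝ) (u : ℝ → L2Plane) (t : ℝ) : ℝ :=
  energy σ (IOp m (u t))

end

end SymmetrizedMZK

namespace SymmetrizedMZK

noncomputable section

/-! ### Bilinear convolution bounds in `L²` -/

/-! The energy is conserved because the equation is Hamiltonian. Since `ξ³ + η³ = (ξ+η)(ξ² - ξη +
η²)`, with `D = 2π(ξ+η)` and `Q = 4π²(ξ² - ξη + η²)` the transform of a solution satisfies `û' =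
iD(Q û - σa (u³)^)`, and the bracket is the gradient of `E`. For `I_N u` this structure is broken
only because `I_N` does not commute with the cube. Put `y = (I_N u)^`, let `n₀` be the transform of
`(I_N u)³` and `n` that of `I_N(u³)`. Then the derivative of the energy is `-(σa Im⟨DQ y, n₀ - n⟩ +
a² Im⟨D n₀, n⟩)`, a quartic plus a sextic term (`inner_re_eq_neg_rateOf`).

All functions are cut into dyadic shells. If the three frequencies in a cube are small compared with
`N`, every multiplier of `I_N` involved equals 1. Low triples therefore drop out of `n₀ - n`, and
the purely low part of the sextic term is `Im⟨D f, f⟩ = 0`. In each remaining term some frequency is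
at least a constant times `N`.

These terms are controlled by a bilinear smoothing estimate (`bilBound_smoothing`,
`exists_lintegral_stPiece_mul_le`): pieces of a function of `X_{1,b}`, `b > 1/2`, at the frequencies
`2^{j₁}` and `2^{j₂}` have a product of size `2^{-(2-e) max(j₁,j₂)}` in `L²` of space-time. On the
Fourier side it follows by Cauchy–Schwarz from integrals of the modulation weight along the phase.
At fixed output frequency `(ξ,η)` the symmetrized phase is a sum of a quadratic in `x` and a
quadratic in `y`, with coefficients proportional to `ξ` and `η` (`disp_add_disp`). Separated
frequencies are treated by a change of variables in the dominant coordinate, comparable ones by the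
two-dimensional quadratic phase with a small loss `e`, and outputs with `|ξ| < 1` or `|η| < 1` by
slicing.

In the quartic term two bilinear estimates are paired. In the sextic term each cube is estimated in
`L²` by one bilinear estimate and a sup bound. The three inverse multipliers of `I_N` cost
`(2^k/N)^{3(1-s)}`, where `2^k` is the largest frequency in the cube, and `s > 3/4` makes this at
most `(2^k/N)^{1-3e}`. The powers of `2^k` then combine to `2^{-ek}`, which is summable, and
`N^{-1+3e}` remains (`quartic_dyadic_le`, `sextic_dyadic_le`).

The calculation is justified for rough solutions by truncation. The distributional equation becomes
an ordinary differential equation in `L²` for frequency-truncated transforms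
(`IsSolution.evolution_ae`), where `H^s ⊂ L⁴` makes the cube a continuous curve in `L¹`. The
truncated energies are differentiated (`hasDerivAt_truncEnergy`), bounded uniformly in the
truncations, and the truncations are removed. Any extension in `X_{1,b}` is identified with `I_N
u(t)` at every time of `(0,δ)` (`timeSlice_eq_fourier`), so the bound passes to the infimum over
extensions. -/

theorem sq_lintegral_mul_le {α : Type*} [MeasurableSpace α] (μ : Measure α) {f g : α → ℝ≥0∞}
    (hf : AEMeasurable f μ) (hg : AEMeasurable g μ) :
    (∫⁻ a, f a * g a ∂μ) ^ 2 ≤ (∫⁻ a, f a ^ 2 ∂μ) * ∫⁻ a, g a ^ 2 ∂μ := by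
  have h := ENNReal.lintegral_mul_le_Lp_mul_Lq μ Real.HolderConjugate.two_two hf hg
  calc (∫⁻ a, f a * g a ∂μ) ^ 2
      ≤ ((∫⁻ a, f a ^ (2 : ℝ) ∂μ) ^ (1 / 2 : ℝ) * (∫⁻ a, g a ^ (2 : ℝ) ∂μ) ^ (1 / 2 : ℝ)) ^ 2 := by
        gcongr; exact h
    _ = _ := by
        rw [mul_pow, ← ENNReal.rpow_natCast, ← ENNReal.rpow_natCast, ← ENNReal.rpow_mul,
          ← ENNReal.rpow_mul]
        norm_num

theorem ennreal_sqrt_sq (x : ℝ≥0∞) : (x ^ (1 / 2 : ℝ)) ^ 2 = x := by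
  rw [← ENNReal.rpow_natCast, ← ENNReal.rpow_mul]; norm_num

theorem ennreal_sqrt_le_of_le_sq {x y : ℝ≥0∞} (h : x ≤ y ^ 2) : x ^ (1 / 2 : ℝ) ≤ y := by
  calc x ^ (1 / 2 : ℝ) ≤ (y ^ 2) ^ (1 / 2 : ℝ) := by gcongr
    _ = y := by rw [← ENNReal.rpow_natCast, ← ENNReal.rpow_mul]; norm_num

theorem ennreal_le_sqrt_of_sq_le {x y : ℝ≥0∞} (h : x ^ 2 ≤ y) : x ≤ y ^ (1 / 2 : ℝ) := by
  calc x = (x ^ 2) ^ (1 / 2 : ℝ) := by rw [← ENNReal.rpow_natCast, ← ENNReal.rpow_mul]; norm_num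
    _ ≤ _ := by gcongr

theorem lintegral_mul_le_sqrt {α : Type*} [MeasurableSpace α] (μ : Measure α) {f g : α → ℝ≥0∞}
    (hf : AEMeasurable f μ) (hg : AEMeasurable g μ) :
    ∫⁻ a, f a * g a ∂μ ≤ (∫⁻ a, f a ^ 2 ∂μ) ^ (1 / 2 : ℝ) * (∫⁻ a, g a ^ 2 ∂μ) ^ (1 / 2 : ℝ) := by
  rw [← ENNReal.mul_rpow_of_nonneg _ _ (by norm_num)]
  exact ennreal_le_sqrt_of_sq_le (sq_lintegral_mul_le μ hf hg)

/-- Minkowski's integral inequality in `L²`: the square is written as a double integral in `a, a'`,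
the order of integration is exchanged, and Cauchy–Schwarz is applied in `x`. -/
theorem lintegral_sq_lintegral_le {α β : Type*} [MeasurableSpace α] [MeasurableSpace β]
    (μ : Measure α) (ν : Measure β) [SFinite μ] [SFinite ν] {f : α → β → ℝ≥0∞}
    (hf : Measurable (Function.uncurry f)) :
    ∫⁻ x, (∫⁻ a, f a x ∂μ) ^ 2 ∂ν ≤ (∫⁻ a, (∫⁻ x, f a x ^ 2 ∂ν) ^ (1 / 2 : ℝ) ∂μ) ^ 2 := by
  have hfa : ∀ a, Measurable (f a) := fun a => hf.comp measurable_prodMk_left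
  have hfx : ∀ x, Measurable (fun a => f a x) := fun x => hf.comp measurable_prodMk_right
  have hN : Measurable (fun a => (∫⁻ x, f a x ^ 2 ∂ν) ^ (1 / 2 : ℝ)) := by
    refine Measurable.pow_const ?_ _
    exact Measurable.lintegral_prod_right' (f := fun p : α × β => f p.1 p.2 ^ 2) (hf.pow_const 2)
  have e1 : ∀ x, (∫⁻ a, f a x ∂μ) ^ 2 = ∫⁻ a, ∫⁻ a', f a x * f a' x ∂μ ∂μ := by
    intro x
    rw [sq, ← lintegral_mul_const _ (hfx x)]
    congr 1; ext a
    rw [lintegral_const_mul _ (hfx x)]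
  have m3 : Measurable (fun p : β × α × α => f p.2.1 p.1 * f p.2.2 p.1) :=
    (hf.comp (by fun_prop : Measurable fun p : β × α × α => (p.2.1, p.1))).mul
      (hf.comp (by fun_prop : Measurable fun p : β × α × α => (p.2.2, p.1)))
  calc ∫⁻ x, (∫⁻ a, f a x ∂μ) ^ 2 ∂ν = ∫⁻ x, ∫⁻ a, ∫⁻ a', f a x * f a' x ∂μ ∂μ ∂ν := by
        simp_rw [e1]
    _ = ∫⁻ a, ∫⁻ x, ∫⁻ a', f a x * f a' x ∂μ ∂ν ∂μ := by
        refine lintegral_lintegral_swap ?_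
        refine Measurable.aemeasurable ?_
        exact Measurable.lintegral_prod_right'
          (f := fun p : (β × α) × α => f p.1.2 p.1.1 * f p.2 p.1.1)
          (m3.comp (by fun_prop : Measurable fun p : (β × α) × α => (p.1.1, p.1.2, p.2)))
    _ = ∫⁻ a, ∫⁻ a', ∫⁻ x, f a x * f a' x ∂ν ∂μ ∂μ := by
        congr 1; ext a
        refine lintegral_lintegral_swap (Measurable.aemeasurable ?_)
        exact m3.comp (by fun_prop : Measurable fun p : β × α => (p.1, a, p.2))
    _ ≤ ∫⁻ a, ∫⁻ a', (∫⁻ x, f a x ^ 2 ∂ν) ^ (1 / 2 : ℝ) * (∫⁻ x, f a' x ^ 2 ∂ν) ^ (1 / 2 : ℝ)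
          ∂μ ∂μ := by
        gcongr with a a'
        exact lintegral_mul_le_sqrt ν (hfa a).aemeasurable (hfa a').aemeasurable
    _ = _ := by
        rw [sq, ← lintegral_mul_const _ hN]
        congr 1; ext a
        rw [lintegral_const_mul _ hN]

/-- The bilinear operator with the kernel `k` is bounded `L² × L² → L²`, with constant `√C`. -/
def BilBound {X : Type*} [AddGroup X] [MeasureSpace X] (k : X → X → ℝ≥0∞) (C : ℝ≥0∞) : Prop :=
  ∀ f g : X → ℝ≥0∞, Measurable f → Measurable g →
    ∫⁻ x, (∫⁻ y, k y (x - y) * (f y * g (x - y))) ^ 2 ≤ C * ((∫⁻ y, f y ^ 2) * ∫⁻ y, g y ^ 2)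

theorem BilBound.mono {X : Type*} [AddGroup X] [MeasureSpace X] {k k' : X → X → ℝ≥0∞}
    {C C' : ℝ≥0∞} (h : BilBound k C) (hk : ∀ y z, k' y z ≤ k y z) (hC : C ≤ C') :
    BilBound k' C' := by
  intro f g hf hg
  refine le_trans ?_ ((h f g hf hg).trans (by gcongr))
  gcongr
  exact hk _ _

theorem BilBound.add {X : Type*} [AddGroup X] [MeasureSpace X] [MeasurableSub₂ X]
    [SFinite (volume : Measure X)] {k k' : X → X → ℝ≥0∞}
    {C C' : ℝ≥0∞} (h : BilBound k C) (h' : BilBound k' C') (hk : Measurable (Function.uncurry k)) :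
    BilBound (fun y z => k y z + k' y z) (2 * (C + C')) := by
  intro f g hf hg
  have hm : Measurable (fun p : X × X => k p.2 (p.1 - p.2) * (f p.2 * g (p.1 - p.2))) := by
    refine Measurable.mul (hk.comp (by fun_prop : Measurable fun p : X × X => (p.2, p.1 - p.2))) ?_
    fun_prop
  have hsq : ∀ a b : ℝ≥0∞, (a + b) ^ 2 ≤ 2 * (a ^ 2 + b ^ 2) := by
    intro a b
    have := ENNReal.rpow_add_le_mul_rpow_add_rpow a b (p := 2) (by norm_num)
    norm_num at this
    exact_mod_cast this
  calc ∫⁻ x, (∫⁻ y, (k y (x - y) + k' y (x - y)) * (f y * g (x - y))) ^ 2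
      ≤ ∫⁻ x, 2 * ((∫⁻ y, k y (x - y) * (f y * g (x - y))) ^ 2 +
          (∫⁻ y, k' y (x - y) * (f y * g (x - y))) ^ 2) := by
        gcongr with x
        refine le_trans ?_ (hsq _ _)
        gcongr
        simp_rw [add_mul]
        rw [lintegral_add_left]
        exact hm.comp (by fun_prop : Measurable fun y : X => (x, y))
    _ = 2 * ((∫⁻ x, (∫⁻ y, k y (x - y) * (f y * g (x - y))) ^ 2) +
          ∫⁻ x, (∫⁻ y, k' y (x - y) * (f y * g (x - y))) ^ 2) := by
        rw [lintegral_const_mul' _ _ (by norm_num), lintegral_add_left]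
        exact (hm.lintegral_prod_right).pow_const 2
    _ ≤ 2 * (C * ((∫⁻ y, f y ^ 2) * ∫⁻ y, g y ^ 2) + C' * ((∫⁻ y, f y ^ 2) * ∫⁻ y, g y ^ 2)) := by
        gcongr
        · exact h f g hf hg
        · exact h' f g hf hg
    _ = _ := by ring

theorem BilBound.const_mul {X : Type*} [AddGroup X] [MeasureSpace X] {k : X → X → ℝ≥0∞}
    {C : ℝ≥0∞} (h : BilBound k C) {c : ℝ≥0∞} (hc : c ≠ ⊤) :
    BilBound (fun y z => c * k y z) (c ^ 2 * C) := by
  intro f g hf hg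
  have e : ∀ x, (∫⁻ y, c * k y (x - y) * (f y * g (x - y))) ^ 2 =
      c ^ 2 * (∫⁻ y, k y (x - y) * (f y * g (x - y))) ^ 2 := fun x => by
    simp only [mul_assoc c]
    rw [lintegral_const_mul' _ _ hc, mul_pow]
  simp only [e]
  rw [lintegral_const_mul' _ _ (by finiteness), mul_assoc]
  gcongr
  exact h f g hf hg

/-- Cauchy–Schwarz in `y` separates the kernel from the functions. What is left of the functions
integrates to the product of their norms by translation invariance. -/
theorem BilBound.of_kernel {X : Type*} [AddCommGroup X] [MeasureSpace X] [MeasurableAdd₂ X]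
    [MeasurableSub₂ X]
    [SFinite (volume : Measure X)] [(volume : Measure X).IsAddRightInvariant]
    {k : X → X → ℝ≥0∞} {C : ℝ≥0∞} (hk : Measurable (Function.uncurry k))
    (h : ∀ x, ∫⁻ y, k y (x - y) ^ 2 ≤ C) : BilBound k C := by
  intro f g hf hg
  calc ∫⁻ x, (∫⁻ y, k y (x - y) * (f y * g (x - y))) ^ 2
      ≤ ∫⁻ x, C * ∫⁻ y, (f y * g (x - y)) ^ 2 := by
        gcongr with x
        refine (sq_lintegral_mul_le _ ?_ ?_).trans (by gcongr; exact h x)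
        · exact (hk.comp (by fun_prop : Measurable fun y : X => (y, x - y))).aemeasurable
        · exact Measurable.aemeasurable (by fun_prop)
    _ = C * ∫⁻ y, ∫⁻ x, (f y * g (x - y)) ^ 2 := by
        rw [lintegral_const_mul, lintegral_lintegral_swap]
        · exact Measurable.aemeasurable (by fun_prop)
        · exact Measurable.lintegral_prod_right'
            (f := fun p : X × X => (f p.2 * g (p.1 - p.2)) ^ 2) (by fun_prop)
    _ = _ := by
        congr 1
        simp_rw [mul_pow]
        rw [← lintegral_mul_const _ (by fun_prop)]
        congr 1; ext y
        rw [lintegral_const_mul _ (by fun_prop), lintegral_sub_right_eq_self (fun x => g x ^ 2)]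

theorem BilBound.symm {X : Type*} [AddCommGroup X] [MeasureSpace X] [MeasurableAdd₂ X]
    [MeasurableNeg X] [MeasurableSub₂ X] [(volume : Measure X).IsAddLeftInvariant]
    [(volume : Measure X).IsNegInvariant]
    {k : X → X → ℝ≥0∞} {C : ℝ≥0∞}
    (h : BilBound k C) : BilBound (fun y z => k z y) C := by
  intro f g hf hg
  have := h g f hg hf
  rw [mul_comm (∫⁻ y, f y ^ 2)]
  refine le_trans (le_of_eq ?_) this
  congr 1; ext x; congr 1
  rw [← lintegral_sub_left_eq_self _ x]
  congr 1; ext y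
  simp [mul_comm (f _)]

/-- Minkowski in the frozen coordinate `a₁` leaves `∫ √F(a₁) √G(a - a₁)`, which Cauchy–Schwarz
bounds uniformly in the output coordinate `a`. Integrating over `a ∈ S` then costs only the measure
of `S`. -/
theorem BilBound.of_slices {A X : Type*} [AddCommGroup A] [MeasureSpace A] [MeasurableAdd₂ A]
    [MeasurableSub₂ A] [MeasurableNeg A]
    [SFinite (volume : Measure A)] [(volume : Measure A).IsAddLeftInvariant]
    [(volume : Measure A).IsNegInvariant]
    [AddCommGroup X] [MeasureSpace X] [MeasurableAdd₂ X] [MeasurableSub₂ X]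
    [SFinite (volume : Measure X)] [MeasurableSub₂ (A × X)]
    {k : A × X → A × X → ℝ≥0∞} {C : ℝ≥0∞}
    (hk : Measurable (Function.uncurry k))
    (h : ∀ a₁ a₂, BilBound (fun y z => k (a₁, y) (a₂, z)) C) {S : Set A} (hS : MeasurableSet S)
    (hkS : ∀ p q, p.1 + q.1 ∉ S → k p q = 0) : BilBound k (volume S * C) := by
  intro f g hf hg
  set F : A → ℝ≥0∞ := fun a => ∫⁻ y, f (a, y) ^ 2 with hF
  set G : A → ℝ≥0∞ := fun a => ∫⁻ y, g (a, y) ^ 2 with hG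
  have hFm : Measurable F := Measurable.lintegral_prod_right' (f := fun p : A × X => f p ^ 2)
    (by fun_prop)
  have hGm : Measurable G := Measurable.lintegral_prod_right' (f := fun p : A × X => g p ^ 2)
    (by fun_prop)
  have hFe : ∫⁻ y, f y ^ 2 = ∫⁻ a, F a := lintegral_prod _ (by fun_prop)
  have hGe : ∫⁻ y, g y ^ 2 = ∫⁻ a, G a := lintegral_prod _ (by fun_prop)
  set T : A × X → A × X → ℝ≥0∞ := fun x y => k y (x - y) * (f y * g (x - y)) with hT
  have hTm : Measurable (Function.uncurry T) := by
    refine Measurable.mul (hk.comp (by fun_prop :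
      Measurable fun p : (A × X) × (A × X) => (p.2, p.1 - p.2))) ?_
    fun_prop
  have hTI : Measurable fun x => (∫⁻ y, T x y) ^ 2 := (hTm.lintegral_prod_right).pow_const 2
  rw [hFe, hGe]
  change ∫⁻ x, (∫⁻ y, T x y) ^ 2 ≤ _
  have e0 : ∫⁻ x, (∫⁻ y, T x y) ^ 2 = ∫⁻ a, ∫⁻ x, (∫⁻ y, T (a, x) y) ^ 2 :=
    lintegral_prod _ hTI.aemeasurable
  rw [e0]
  have key : ∀ a, ∫⁻ x, (∫⁻ y, T (a, x) y) ^ 2 ≤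
      S.indicator (fun _ => C * ((∫⁻ a, F a) * ∫⁻ a, G a)) a := by
    intro a
    by_cases ha : a ∈ S
    · rw [Set.indicator_of_mem ha]
      have e1 : ∀ x, ∫⁻ y, T (a, x) y = ∫⁻ a₁, ∫⁻ y, T (a, x) (a₁, y) := fun x =>
        lintegral_prod _ (hTm.comp measurable_prodMk_left).aemeasurable
      simp_rw [e1]
      refine (lintegral_sq_lintegral_le volume volume
        (f := fun a₁ x => ∫⁻ y, T (a, x) (a₁, y)) ?_).trans ?_
      · exact Measurable.lintegral_prod_right'
          (f := fun p : (A × X) × X => T (a, p.1.2) (p.1.1, p.2))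
          (hTm.comp (by fun_prop :
            Measurable fun p : (A × X) × X => ((a, p.1.2), (p.1.1, p.2))))
      · calc (∫⁻ a₁, (∫⁻ x, (∫⁻ y, T (a, x) (a₁, y)) ^ 2) ^ (1 / 2 : ℝ)) ^ 2
            ≤ (∫⁻ a₁, C ^ (1 / 2 : ℝ) * (F a₁ ^ (1 / 2 : ℝ) * G (a - a₁) ^ (1 / 2 : ℝ))) ^ 2 := by
              gcongr with a₁
              rw [← ENNReal.mul_rpow_of_nonneg _ _ (by norm_num),
                ← ENNReal.mul_rpow_of_nonneg _ _ (by norm_num)]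
              gcongr
              exact h a₁ (a - a₁) (fun y => f (a₁, y)) (fun y => g (a - a₁, y))
                (by fun_prop) (by fun_prop)
          _ = C * (∫⁻ a₁, F a₁ ^ (1 / 2 : ℝ) * G (a - a₁) ^ (1 / 2 : ℝ)) ^ 2 := by
              rw [lintegral_const_mul, mul_pow, ennreal_sqrt_sq]
              fun_prop
          _ ≤ C * ((∫⁻ a₁, F a₁) * ∫⁻ a₁, G (a - a₁)) := by
              gcongr
              refine (sq_lintegral_mul_le _ ?_ ?_).trans (le_of_eq ?_)
              · exact Measurable.aemeasurable (by fun_prop)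
              · exact Measurable.aemeasurable (by fun_prop)
              · simp_rw [ennreal_sqrt_sq]
          _ ≤ _ := by
              rw [lintegral_sub_left_eq_self G a]
    · rw [Set.indicator_of_notMem ha]
      refine le_of_eq ?_
      have : ∀ x y, T (a, x) y = 0 := by
        intro x y
        have : k y ((a, x) - y) = 0 := hkS _ _ (by simpa using ha)
        simp [hT, this]
      simp [this]
  refine (lintegral_mono key).trans ?_
  rw [lintegral_indicator hS, lintegral_const, Measure.restrict_apply_univ]
  exact le_of_eq (by ring)

end

noncomputable section

/-! ### The Japanese bracket -/

theorem jap_pos {E : Type*} [NormedAddCommGroup E] (x : E) : 0 < jap x :=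
  Real.sqrt_pos.2 (by positivity)

theorem jap_sq {E : Type*} [NormedAddCommGroup E] (x : E) : jap x ^ 2 = 1 + ‖x‖ ^ 2 :=
  Real.sq_sqrt (by positivity)

theorem one_le_jap {E : Type*} [NormedAddCommGroup E] (x : E) : 1 ≤ jap x :=
  Real.one_le_sqrt.2 (by nlinarith [norm_nonneg x])

theorem norm_le_jap {E : Type*} [NormedAddCommGroup E] (x : E) : ‖x‖ ≤ jap x :=
  Real.le_sqrt_of_sq_le (by linarith)

theorem jap_le_one_add_norm {E : Type*} [NormedAddCommGroup E] (x : E) : jap x ≤ 1 + ‖x‖ :=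
  Real.sqrt_le_iff.2 ⟨by positivity, by nlinarith [norm_nonneg x]⟩

theorem one_add_norm_le_two_mul_jap {E : Type*} [NormedAddCommGroup E] (x : E) :
    1 + ‖x‖ ≤ 2 * jap x := by
  linarith [one_le_jap x, norm_le_jap x]

theorem jap_le_jap {E F : Type*} [NormedAddCommGroup E] [NormedAddCommGroup F] {x : E} {y : F}
    (h : ‖x‖ ≤ ‖y‖) : jap x ≤ jap y :=
  Real.sqrt_le_sqrt (by gcongr)

@[fun_prop]
theorem continuous_jap {E : Type*} [NormedAddCommGroup E] : Continuous (jap : E → ℝ) := by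
  unfold jap; fun_prop

@[fun_prop]
theorem measurable_jap {E : Type*} [NormedAddCommGroup E] [MeasurableSpace E] [BorelSpace E] :
    Measurable (jap : E → ℝ) := continuous_jap.measurable

theorem lintegral_jap_rpow_lt_top {E : Type*} [NormedAddCommGroup E] [NormedSpace ℝ E]
    [FiniteDimensional ℝ E] [MeasurableSpace E] [BorelSpace E] (μ : Measure E) [μ.IsAddHaarMeasure]
    {r : ℝ} (hr : (Module.finrank ℝ E : ℝ) < r) :
    ∫⁻ x : E, ENNReal.ofReal (jap x ^ (-r)) ∂μ < ⊤ := by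
  have hr0 : 0 < r := lt_of_le_of_lt (by positivity) hr
  calc ∫⁻ x : E, ENNReal.ofReal (jap x ^ (-r)) ∂μ
      ≤ ∫⁻ x : E, ENNReal.ofReal ((1 / 2) ^ (-r)) * ENNReal.ofReal ((1 + ‖x‖) ^ (-r)) ∂μ := by
        gcongr with x
        rw [← ENNReal.ofReal_mul (by positivity), ← Real.mul_rpow (by norm_num) (by positivity)]
        refine ENNReal.ofReal_le_ofReal ?_
        refine Real.rpow_le_rpow_of_nonpos (by positivity) ?_ (by linarith)
        linarith [one_add_norm_le_two_mul_jap x]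
    _ < ⊤ := by
        rw [lintegral_const_mul _ (by fun_prop)]
        exact ENNReal.mul_lt_top ENNReal.ofReal_lt_top (finite_integral_one_add_norm hr)

/-! ### One-dimensional integrals with quadratic phases -/

/-- The weight is the Jacobian of `p ↦ c - k p²`, which is injective on each half-line. The two
half-lines give the factor 2. -/
theorem lintegral_deriv_mul_quadratic_le (k c : ℝ) (ψ : ℝ → ℝ≥0∞) :
    ∫⁻ p, ENNReal.ofReal |2 * k * p| * ψ (c - k * p ^ 2) ≤ 2 * ∫⁻ x, ψ x := by
  rcases eq_or_ne k 0 with rfl | hk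
  · simp
  have hd : ∀ p : ℝ, HasDerivAt (fun p => c - k * p ^ 2) (-(2 * k * p)) p := by
    intro p
    have := ((hasDerivAt_pow 2 p).const_mul k).const_sub c
    refine this.congr_deriv ?_
    push_cast; ring
  have hhalf : ∀ s : Set ℝ, MeasurableSet s → Set.InjOn (fun p : ℝ => c - k * p ^ 2) s →
      ∫⁻ p in s, ENNReal.ofReal |2 * k * p| * ψ (c - k * p ^ 2) ≤ ∫⁻ x, ψ x := by
    intro s hs hinj
    have := lintegral_image_eq_lintegral_abs_deriv_mul hs
      (fun p _ => (hd p).hasDerivWithinAt) hinj ψ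
    simp only [abs_neg] at this
    rw [← this]
    exact setLIntegral_le_lintegral _ _
  have hI : Set.InjOn (fun p : ℝ => c - k * p ^ 2) (Set.Ici 0) := by
    intro p hp q hq h
    have : p ^ 2 = q ^ 2 := by
      have : k * p ^ 2 = k * q ^ 2 := by simpa using h
      exact mul_left_cancel₀ hk this
    exact (pow_left_inj₀ hp hq two_ne_zero).1 this
  have hI' : Set.InjOn (fun p : ℝ => c - k * p ^ 2) (Set.Iio 0) := by
    intro p hp q hq h
    have h2 : (-p) ^ 2 = (-q) ^ 2 := by
      have : k * p ^ 2 = k * q ^ 2 := by simpa using h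
      simpa using mul_left_cancel₀ hk this
    have hp' : 0 ≤ -p := by simpa using le_of_lt hp
    have hq' : 0 ≤ -q := by simpa using le_of_lt hq
    simpa using (pow_left_inj₀ hp' hq' two_ne_zero).1 h2
  rw [← lintegral_add_compl _ (measurableSet_Ici (a := (0 : ℝ))), Set.compl_Ici,
    two_mul (∫⁻ x, ψ x)]
  exact add_le_add (hhalf _ measurableSet_Ici hI) (hhalf _ measurableSet_Iio hI')

/-- For `|p| ≥ R ≥ 1` the Jacobian is at least `2R`, which gives the decay `1/R`. For `r < 1` the
interval `[-1,1]`, where the phase may be stationary, contributes at most its length 2. -/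
theorem lintegral_quadratic_of_le_abs {k : ℝ} (hk : 1 ≤ |k|) (c : ℝ) {ψ : ℝ → ℝ≥0∞}
    (hψ : Measurable ψ) (hψ1 : ∀ x, ψ x ≤ 1) (r : ℝ) :
    ∫⁻ p in {p : ℝ | r ≤ |p|}, ψ (c - k * p ^ 2) ≤
      (2 + ∫⁻ x, ψ x) * ENNReal.ofReal (max 1 r)⁻¹ := by
  have hlarge : ∀ R : ℝ, 1 ≤ R → ∫⁻ p in {p : ℝ | R ≤ |p|}, ψ (c - k * p ^ 2) ≤
      (∫⁻ x, ψ x) * ENNReal.ofReal R⁻¹ := by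
    intro R hR
    have h0 : ∫⁻ p in {p : ℝ | R ≤ |p|}, ψ (c - k * p ^ 2) ≤
        ∫⁻ p : ℝ, ENNReal.ofReal (2 * R)⁻¹ * (ENNReal.ofReal |2 * k * p| * ψ (c - k * p ^ 2)) := by
      refine le_trans (setLIntegral_mono' (measurableSet_le measurable_const (by fun_prop))
        (fun p hp => ?_)) (setLIntegral_le_lintegral _ _)
      rw [← mul_assoc, ← ENNReal.ofReal_mul (by positivity)]
      refine le_mul_of_one_le_left (by positivity) ?_
      rw [← ENNReal.ofReal_one]
      refine ENNReal.ofReal_le_ofReal ?_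
      rw [abs_mul, abs_mul, abs_two]
      have hp' : R ≤ |p| := hp
      rw [le_inv_mul_iff₀ (by positivity)]
      nlinarith
    refine h0.trans ?_
    rw [lintegral_const_mul _ (by fun_prop)]
    calc _ ≤ ENNReal.ofReal (2 * R)⁻¹ * (2 * ∫⁻ x, ψ x) := by
          gcongr; exact lintegral_deriv_mul_quadratic_le k c ψ
      _ = (ENNReal.ofReal (2 * R)⁻¹ * ENNReal.ofReal 2) * ∫⁻ x, ψ x := by
          rw [mul_assoc]; norm_num
      _ = _ := by
          rw [← ENNReal.ofReal_mul (by positivity), mul_comm]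
          congr 2; field_simp
  rcases le_total 1 r with h1 | h1
  · rw [max_eq_right h1]
    refine (hlarge r h1).trans ?_
    gcongr
    exact le_add_self
  · rw [max_eq_left h1]
    calc ∫⁻ p in {p : ℝ | r ≤ |p|}, ψ (c - k * p ^ 2)
        ≤ ∫⁻ p : ℝ, ψ (c - k * p ^ 2) := setLIntegral_le_lintegral _ _
      _ = (∫⁻ p in {p : ℝ | 1 ≤ |p|}, ψ (c - k * p ^ 2)) +
            ∫⁻ p in {p : ℝ | 1 ≤ |p|}ᶜ, ψ (c - k * p ^ 2) :=
          (lintegral_add_compl _ (measurableSet_le measurable_const (by fun_prop))).symm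
      _ ≤ (∫⁻ x, ψ x) * ENNReal.ofReal 1⁻¹ + ∫⁻ p in Set.Icc (-1 : ℝ) 1, 1 := by
          refine add_le_add (hlarge 1 le_rfl) ?_
          · refine (lintegral_mono_set (t := Set.Icc (-1 : ℝ) 1) ?_).trans
              (lintegral_mono fun p => hψ1 _)
            intro p hp
            simp only [Set.mem_compl_iff, Set.mem_ofPred_eq, not_le] at hp
            exact ⟨(abs_lt.1 hp).1.le, (abs_lt.1 hp).2.le⟩
      _ = _ := by
          simp only [lintegral_const, Measure.restrict_apply_univ, Real.volume_Icc]
          norm_num [add_comm]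

theorem lintegral_quadratic_le {k : ℝ} (hk : 1 ≤ |k|) (c : ℝ) {ψ : ℝ → ℝ≥0∞}
    (hψ : Measurable ψ) (hψ1 : ∀ x, ψ x ≤ 1) :
    ∫⁻ p, ψ (c - k * p ^ 2) ≤ 2 + ∫⁻ x, ψ x := by
  have := lintegral_quadratic_of_le_abs hk c hψ hψ1 0
  simpa using this

theorem lintegral_lintegral_add_left {α β : Type*} [MeasurableSpace α] [MeasurableSpace β]
    (μ : Measure α) (ν : Measure β) [SFinite ν] {f g : α → β → ℝ≥0∞}
    (hf : Measurable (Function.uncurry f)) :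
    ∫⁻ x, ∫⁻ y, (f x y + g x y) ∂ν ∂μ =
      (∫⁻ x, ∫⁻ y, f x y ∂ν ∂μ) + ∫⁻ x, ∫⁻ y, g x y ∂ν ∂μ := by
  refine Eq.trans ?_ (lintegral_add_left
    (hf.lintegral_prod_right' : Measurable fun x => ∫⁻ y, f x y ∂ν) _)
  congr 1; ext x
  exact lintegral_add_left (hf.comp measurable_prodMk_left) _

/-- The two-dimensional quadratic phase, with a weight that decays like a small negative power. -/
theorem lintegral_quadratic₂_le {e : ℝ} (he : 0 < e) {ψ : ℝ → ℝ≥0∞} (hψ : Measurable ψ)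
    (hψ1 : ∀ x, ψ x ≤ 1) (hψi : ∫⁻ x, ψ x < ⊤) :
    ∃ C : ℝ≥0∞, C < ⊤ ∧ ∀ k l : ℝ, 1 ≤ |k| → 1 ≤ |l| → ∀ c : ℝ,
      ∫⁻ p, ∫⁻ q, ENNReal.ofReal ((max 1 (max |p| |q|)) ^ (-e)) *
        ψ (c - k * p ^ 2 - l * q ^ 2) ≤ C := by
  set D : ℝ≥0∞ := ∫⁻ p : ℝ, ENNReal.ofReal ((max 1 |p|) ^ (-(1 + e))) with hD
  have hDt : D < ⊤ := by
    have h1 : ∫⁻ p : ℝ, ENNReal.ofReal (jap p ^ (-(1 + e))) < ⊤ :=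
      lintegral_jap_rpow_lt_top volume (by simp; linarith)
    calc D ≤ ∫⁻ p : ℝ, ENNReal.ofReal ((1 / 2) ^ (-(1 + e))) *
          ENNReal.ofReal (jap p ^ (-(1 + e))) := by
          rw [hD]
          gcongr with p
          rw [← ENNReal.ofReal_mul (by positivity),
            ← Real.mul_rpow (by norm_num) (jap_pos p).le]
          refine ENNReal.ofReal_le_ofReal ?_
          refine Real.rpow_le_rpow_of_nonpos (by have := jap_pos p; positivity) ?_ (by linarith)
          have := jap_le_one_add_norm p
          rw [Real.norm_eq_abs] at this
          linarith [le_max_left 1 |p|, le_max_right 1 |p|]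
      _ < ⊤ := by
          rw [lintegral_const_mul _ (by fun_prop)]
          exact ENNReal.mul_lt_top ENNReal.ofReal_lt_top h1
  -- On `|p| ≤ |q|` the integral in `q` gains `max(1,|p|)⁻¹`. This leaves `∫ max(1,|p|)^{-1-e} dp`,
  -- which would diverge logarithmically for `e = 0`. The half `|q| ≤ |p|` is the same with the
  -- roles exchanged.
  have half : ∀ k l : ℝ, 1 ≤ |l| → ∀ c : ℝ,
      ∫⁻ p, ∫⁻ q in {q : ℝ | |p| ≤ |q|}, ENNReal.ofReal ((max 1 |p|) ^ (-e)) *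
        ψ (c - k * p ^ 2 - l * q ^ 2) ≤ (2 + ∫⁻ x, ψ x) * D := by
    intro k l hl c
    rw [hD, ← lintegral_const_mul _ (by fun_prop)]
    gcongr with p
    rw [lintegral_const_mul _ (by fun_prop)]
    calc _ ≤ ENNReal.ofReal ((max 1 |p|) ^ (-e)) *
          ((2 + ∫⁻ x, ψ x) * ENNReal.ofReal (max 1 |p|)⁻¹) := by
          gcongr; exact lintegral_quadratic_of_le_abs hl _ hψ hψ1 _
      _ = (2 + ∫⁻ x, ψ x) * (ENNReal.ofReal ((max 1 |p|) ^ (-e)) *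
            ENNReal.ofReal (max 1 |p|)⁻¹) := by ring
      _ = _ := by
          rw [← ENNReal.ofReal_mul (by positivity), ← Real.rpow_neg_one (max 1 |p|),
            ← Real.rpow_add (by positivity)]
          congr 3; ring_nf
  refine ⟨(2 + ∫⁻ x, ψ x) * D + (2 + ∫⁻ x, ψ x) * D, ?_, fun k l hk hl c => ?_⟩
  · finiteness
  calc ∫⁻ p, ∫⁻ q, ENNReal.ofReal ((max 1 (max |p| |q|)) ^ (-e)) *
        ψ (c - k * p ^ 2 - l * q ^ 2)
      ≤ ∫⁻ p, ∫⁻ q, ({q : ℝ | |p| ≤ |q|}.indicator (fun q => ENNReal.ofReal ((max 1 |p|) ^ (-e)) *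
          ψ (c - k * p ^ 2 - l * q ^ 2)) q + {p : ℝ | |q| ≤ |p|}.indicator (fun p =>
          ENNReal.ofReal ((max 1 |q|) ^ (-e)) * ψ (c - l * q ^ 2 - k * p ^ 2)) p) := by
        gcongr with p q
        rcases le_total |p| |q| with h | h
        · refine le_trans ?_ le_self_add
          rw [Set.indicator_of_mem (by exact h)]
          gcongr 1
          refine ENNReal.ofReal_le_ofReal
            (Real.rpow_le_rpow_of_nonpos (by positivity) ?_ (by linarith))
          exact max_le_max le_rfl (le_max_left _ _)
        · refine le_trans ?_ le_add_self
          rw [Set.indicator_of_mem (by exact h), sub_right_comm]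
          gcongr 1
          refine ENNReal.ofReal_le_ofReal
            (Real.rpow_le_rpow_of_nonpos (by positivity) ?_ (by linarith))
          exact max_le_max le_rfl (le_max_right _ _)
    _ = (∫⁻ p, ∫⁻ q in {q : ℝ | |p| ≤ |q|}, ENNReal.ofReal ((max 1 |p|) ^ (-e)) *
        ψ (c - k * p ^ 2 - l * q ^ 2)) + ∫⁻ q, ∫⁻ p in {p : ℝ | |q| ≤ |p|},
        ENNReal.ofReal ((max 1 |q|) ^ (-e)) * ψ (c - l * q ^ 2 - k * p ^ 2) := by
        have m1 : Measurable fun x : ℝ × ℝ => {q : ℝ | |x.1| ≤ |q|}.indicator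
            (fun q => ENNReal.ofReal ((max 1 |x.1|) ^ (-e)) *
              ψ (c - k * x.1 ^ 2 - l * q ^ 2)) x.2 := by
          have := Measurable.indicator (s := {x : ℝ × ℝ | |x.1| ≤ |x.2|})
            (f := fun x : ℝ × ℝ => ENNReal.ofReal ((max 1 |x.1|) ^ (-e)) *
              ψ (c - k * x.1 ^ 2 - l * x.2 ^ 2)) (by fun_prop)
              (measurableSet_le (by fun_prop) (by fun_prop))
          exact this
        have m2 : Measurable fun x : ℝ × ℝ => {p : ℝ | |x.2| ≤ |p|}.indicator
            (fun p => ENNReal.ofReal ((max 1 |x.2|) ^ (-e)) *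
              ψ (c - l * x.2 ^ 2 - k * p ^ 2)) x.1 := by
          have := Measurable.indicator (s := {x : ℝ × ℝ | |x.2| ≤ |x.1|})
            (f := fun x : ℝ × ℝ => ENNReal.ofReal ((max 1 |x.2|) ^ (-e)) *
              ψ (c - l * x.2 ^ 2 - k * x.1 ^ 2)) (by fun_prop)
              (measurableSet_le (by fun_prop) (by fun_prop))
          exact this
        have : ∀ p : ℝ, MeasurableSet {q : ℝ | |p| ≤ |q|} := fun p =>
          measurableSet_le measurable_const (by fun_prop)
        refine (lintegral_lintegral_add_left volume volume (f := fun p q : ℝ =>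
          {q : ℝ | |p| ≤ |q|}.indicator (fun q => ENNReal.ofReal ((max 1 |p|) ^ (-e)) *
          ψ (c - k * p ^ 2 - l * q ^ 2)) q) m1).trans ?_
        congr 1
        · simp_rw [lintegral_indicator (this _)]
        · rw [lintegral_lintegral_swap m2.aemeasurable]
          simp_rw [lintegral_indicator (this _)]
    _ ≤ _ := add_le_add (half k l hl c) (half l k hk c)

end

noncomputable section

/-! ### The bilinear estimate for the symmetrized group -/

instance volume_prod_isAddHaarMeasure {E F : Type*} [AddGroup E] [TopologicalSpace E]
    [MeasureSpace E] [AddGroup F] [TopologicalSpace F] [MeasureSpace F]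
    [(volume : Measure E).IsAddHaarMeasure] [(volume : Measure F).IsAddHaarMeasure]
    [SFinite (volume : Measure E)] [SFinite (volume : Measure F)]
    [MeasurableAdd E] [MeasurableAdd F] :
    (volume : Measure (E × F)).IsAddHaarMeasure :=
  Measure.prod.instIsAddHaarMeasure volume volume

/-- The integral over the time frequency is a convolution of two modulation weights. The shift by
`θ₁` and Fubini take one of them outside, and the other is left evaluated at the resonance function
`c - (θ₁ + θ₂)`. -/
theorem lintegral_lintegral_modulation_le {Y : Type*} [MeasurableSpace Y] (μ : Measure Y)
    [SFinite μ] {ψ : ℝ → ℝ≥0∞} (hψ : Measurable ψ) {a : Y → ℝ≥0∞} (ha : Measurable a)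
    {θ₁ θ₂ : Y → ℝ} (h₁ : Measurable θ₁) (h₂ : Measurable θ₂) {B : ℝ≥0∞}
    (hB : ∀ c, ∫⁻ y, a y * ψ (c - (θ₁ y + θ₂ y)) ∂μ ≤ B) (τ : ℝ) :
    ∫⁻ y, (∫⁻ t, a y * (ψ (t - θ₁ y) * ψ (τ - t - θ₂ y))) ∂μ ≤ (∫⁻ x, ψ x) * B := by
  calc ∫⁻ y, (∫⁻ t, a y * (ψ (t - θ₁ y) * ψ (τ - t - θ₂ y))) ∂μ
      = ∫⁻ y, (∫⁻ t, ψ t * (a y * ψ ((τ - t) - (θ₁ y + θ₂ y)))) ∂μ := by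
        congr 1; ext y
        rw [← lintegral_add_right_eq_self _ (θ₁ y)]
        congr 1; ext t
        rw [add_sub_cancel_right, mul_left_comm]
        congr 3; ring
    _ = ∫⁻ t, ψ t * ∫⁻ y, a y * ψ ((τ - t) - (θ₁ y + θ₂ y)) ∂μ := by
        rw [lintegral_lintegral_swap (Measurable.aemeasurable (by fun_prop))]
        congr 1; ext t
        rw [lintegral_const_mul _ (by fun_prop)]
    _ ≤ ∫⁻ t, ψ t * B := by gcongr; exact hB _
    _ = _ := lintegral_mul_const _ hψ

theorem lintegral_prod_prod {F : ℝ × ℝ × ℝ → ℝ≥0∞} (hF : Measurable F) :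
    ∫⁻ y, F y = ∫⁻ p : ℝ × ℝ, ∫⁻ t, F (p.1, p.2, t) := by
  have h1 : ∫⁻ y, F y = ∫⁻ x : ℝ, ∫⁻ z : ℝ × ℝ, F (x, z) := lintegral_prod _ hF.aemeasurable
  have h2 : ∫⁻ p : ℝ × ℝ, ∫⁻ t, F (p.1, p.2, t) = ∫⁻ x : ℝ, ∫⁻ y : ℝ, ∫⁻ t : ℝ, F (x, y, t) :=
    lintegral_prod _ (Measurable.aemeasurable (Measurable.lintegral_prod_right'
      (f := fun q : (ℝ × ℝ) × ℝ => F (q.1.1, q.1.2, q.2)) (by fun_prop)))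
  rw [h1, h2]
  congr 1; ext x
  exact lintegral_prod _ (by fun_prop)

/-- The bracket of the spatial frequency `(ξ, η)`. -/
def br (ξ η : ℝ) : ℝ := Real.sqrt (1 + ξ ^ 2 + η ^ 2)

/-- The dispersion relation `κ (ξ³ + η³)`. -/
def disp (κ ξ η : ℝ) : ℝ := κ * (ξ ^ 3 + η ^ 3)

@[fun_prop]
theorem measurable_br {α : Type*} [MeasurableSpace α] {f g : α → ℝ} (hf : Measurable f)
    (hg : Measurable g) : Measurable fun x => br (f x) (g x) := by
  unfold br; fun_prop

@[fun_prop]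
theorem measurable_disp {α : Type*} [MeasurableSpace α] {κ : ℝ} {f g : α → ℝ} (hf : Measurable f)
    (hg : Measurable g) : Measurable fun x => disp κ (f x) (g x) := by
  unfold disp; fun_prop

theorem br_pos (ξ η : ℝ) : 0 < br ξ η := Real.sqrt_pos.2 (by positivity)

theorem br_sq (ξ η : ℝ) : br ξ η ^ 2 = 1 + ξ ^ 2 + η ^ 2 := Real.sq_sqrt (by positivity)

theorem one_le_br (ξ η : ℝ) : 1 ≤ br ξ η := Real.one_le_sqrt.2 (by nlinarith)

theorem abs_left_le_br (ξ η : ℝ) : |ξ| ≤ br ξ η := Real.abs_le_sqrt (by nlinarith)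

theorem abs_right_le_br (ξ η : ℝ) : |η| ≤ br ξ η := Real.abs_le_sqrt (by nlinarith)

/-- Completing the square about half of the output frequency leaves no mixed term in `x` and `y`.
This decoupling is the advantage of the symmetrized form of the equation. -/
theorem disp_add_disp (κ ξ η x y : ℝ) : disp κ x y + disp κ (ξ - x) (η - y) =
    κ * (ξ ^ 3 + η ^ 3) / 4 + 3 * κ * ξ * (x - ξ / 2) ^ 2 + 3 * κ * η * (y - η / 2) ^ 2 := by
  unfold disp; ring

/-- The kernel on space-time with the symbol `a` and the modulation weights. -/
def stKernel (κ b : ℝ) (a : ℝ → ℝ → ℝ → ℝ → ℝ≥0∞) (y z : ℝ × ℝ × ℝ) : ℝ≥0∞ :=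
  a y.1 y.2.1 z.1 z.2.1 * (ENNReal.ofReal (jap (y.2.2 - disp κ y.1 y.2.1) ^ (-b)) *
    ENNReal.ofReal (jap (z.2.2 - disp κ z.1 z.2.1) ^ (-b)))

theorem ofReal_jap_rpow_sq (b x : ℝ) :
    ENNReal.ofReal (jap x ^ (-b)) ^ 2 = ENNReal.ofReal (jap x ^ (-(2 * b))) := by
  rw [← ENNReal.ofReal_pow (by have := jap_pos x; positivity), ← Real.rpow_natCast,
    ← Real.rpow_mul (jap_pos x).le]
  congr 2; push_cast; ring

theorem ofReal_jap_rpow_le_one {b : ℝ} (hb : 0 ≤ b) (x : ℝ) :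
    ENNReal.ofReal (jap x ^ (-b)) ≤ 1 := by
  rw [← ENNReal.ofReal_one]
  exact ENNReal.ofReal_le_ofReal (Real.rpow_le_one_of_one_le_of_nonpos (one_le_jap x) (by linarith))

theorem lintegral_modulation_lt_top {b : ℝ} (hb : 1 / 2 < b) :
    ∫⁻ x : ℝ, ENNReal.ofReal (jap x ^ (-(2 * b))) < ⊤ :=
  lintegral_jap_rpow_lt_top volume (by simp; linarith)

theorem measurable_stKernel (κ b : ℝ) {a : ℝ → ℝ → ℝ → ℝ → ℝ≥0∞}
    (ha : Measurable fun p : ℝ × ℝ × ℝ × ℝ => a p.1 p.2.1 p.2.2.1 p.2.2.2) :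
    Measurable (Function.uncurry (stKernel κ b a)) := by
  unfold stKernel
  refine Measurable.mul ?_ (by fun_prop)
  exact ha.comp (by fun_prop : Measurable fun p : (ℝ × ℝ × ℝ) × (ℝ × ℝ × ℝ) =>
    (p.1.1, p.1.2.1, p.2.1, p.2.2.1))

/-- Cauchy–Schwarz and the integration over the time frequency reduce a space-time bilinear bound to
an integral over the plane at fixed output frequency. -/
theorem bilBound_stKernel_of_phase (κ b : ℝ) {a : ℝ → ℝ → ℝ → ℝ → ℝ≥0∞}
    (ha : Measurable fun p : ℝ × ℝ × ℝ × ℝ => a p.1 p.2.1 p.2.2.1 p.2.2.2) {B : ℝ≥0∞}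
    (h : ∀ ξ η c, ∫⁻ p : ℝ × ℝ, a p.1 p.2 (ξ - p.1) (η - p.2) ^ 2 *
      ENNReal.ofReal (jap (c - (disp κ p.1 p.2 + disp κ (ξ - p.1) (η - p.2))) ^ (-(2 * b))) ≤ B) :
    BilBound (stKernel κ b a) ((∫⁻ x : ℝ, ENNReal.ofReal (jap x ^ (-(2 * b)))) * B) := by
  refine BilBound.of_kernel (measurable_stKernel κ b ha) ?_
  rintro ⟨ξ, η, τ⟩
  rw [lintegral_prod_prod]
  swap
  · exact ((measurable_stKernel κ b ha).comp (by fun_prop :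
      Measurable fun y : ℝ × ℝ × ℝ => (y, (ξ, η, τ) - y))).pow_const 2
  refine le_trans (le_of_eq ?_) (lintegral_lintegral_modulation_le volume
    (ψ := fun x => ENNReal.ofReal (jap x ^ (-(2 * b)))) (by fun_prop)
    (a := fun p : ℝ × ℝ => a p.1 p.2 (ξ - p.1) (η - p.2) ^ 2) ?_
    (θ₁ := fun p => disp κ p.1 p.2) (θ₂ := fun p => disp κ (ξ - p.1) (η - p.2))
    (by fun_prop) (by fun_prop) (h ξ η) τ)
  · simp only [stKernel, mul_pow, ofReal_jap_rpow_sq, Prod.mk_sub_mk]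
  · exact (ha.comp (by fun_prop : Measurable fun p : ℝ × ℝ =>
      (p.1, p.2, ξ - p.1, η - p.2))).pow_const 2

/-- The symbol `⟨ζ₁⟩ / ⟨ζ₂⟩` on the region where `ζ₁` is much larger than `ζ₂`. -/
def sepSymbol (x y x' y' : ℝ) : ℝ≥0∞ :=
  if 8 * br x' y' ≤ br x y then ENNReal.ofReal (br x y / br x' y') else 0

theorem measurable_sepSymbol :
    Measurable fun p : ℝ × ℝ × ℝ × ℝ => sepSymbol p.1 p.2.1 p.2.2.1 p.2.2.2 := by
  unfold sepSymbol
  exact Measurable.ite (measurableSet_le (by fun_prop) (by fun_prop)) (by fun_prop) (by fun_prop)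

/-- The right-hand side is the derivative of the phase in the first coordinate. If that coordinate
dominates in the large frequency and the other frequency is 8 times smaller, the derivative has the
full size of the square of the large frequency. -/
theorem sq_br_le_of_sep {κ : ℝ} (hκ : 1 ≤ κ) {x y x' y' : ℝ} (h : 8 * br x' y' ≤ br x y)
    (hxy : y ^ 2 ≤ x ^ 2) : br x y ^ 2 ≤ |3 * κ * (x + x') * (x - x')| := by
  have h1 : 64 * br x' y' ^ 2 ≤ br x y ^ 2 := by nlinarith [br_pos x' y']
  rw [br_sq, br_sq] at h1
  have h2 : br x y ^ 2 ≤ 3 * (x ^ 2 - x' ^ 2) := by rw [br_sq]; nlinarith [sq_nonneg y']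
  have h3 : 0 ≤ x ^ 2 - x' ^ 2 := by nlinarith [sq_nonneg (br x y)]
  calc br x y ^ 2 ≤ 3 * (x ^ 2 - x' ^ 2) := h2
    _ ≤ κ * (3 * (x ^ 2 - x' ^ 2)) := by nlinarith
    _ = 3 * κ * (x + x') * (x - x') := by ring
    _ ≤ _ := le_abs_self _

/-- The square of the large bracket is traded for the phase derivative in the dominant coordinate,
which will serve as a Jacobian. From the small bracket only the other coordinate is kept, to make
the remaining integral converge. -/
theorem sepSymbol_sq_le {κ : ℝ} (hκ : 1 ≤ κ) (x y x' y' : ℝ) : sepSymbol x y x' y' ^ 2 ≤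
    ENNReal.ofReal |3 * κ * (x + x') * (x - x')| * ENNReal.ofReal (jap y' ^ (-2 : ℝ)) +
    ENNReal.ofReal |3 * κ * (y + y') * (y - y')| * ENNReal.ofReal (jap x' ^ (-2 : ℝ)) := by
  unfold sepSymbol
  split_ifs with h
  swap
  · simp
  have hb := br_pos x' y'
  rw [← ENNReal.ofReal_pow (by have := br_pos x y; positivity), div_pow]
  have hj : ∀ u : ℝ, jap u ^ (-2 : ℝ) = (1 + u ^ 2)⁻¹ := by
    intro u
    rw [Real.rpow_neg (jap_pos u).le, Real.rpow_two, jap_sq, Real.norm_eq_abs, sq_abs]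
  rw [hj, hj]
  rcases le_total (y ^ 2) (x ^ 2) with hxy | hxy
  · refine le_trans ?_ le_self_add
    rw [← ENNReal.ofReal_mul (by positivity)]
    refine ENNReal.ofReal_le_ofReal ?_
    rw [div_eq_mul_inv]
    have h1 := sq_br_le_of_sep hκ h hxy
    have h2 : 1 + y' ^ 2 ≤ br x' y' ^ 2 := by rw [br_sq]; nlinarith
    gcongr
  · refine le_trans ?_ le_add_self
    rw [← ENNReal.ofReal_mul (by positivity)]
    refine ENNReal.ofReal_le_ofReal ?_
    rw [div_eq_mul_inv]
    have hs : ∀ u v : ℝ, br u v = br v u := fun u v => by unfold br; congr 1; ring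
    have h1 := sq_br_le_of_sep (x := y) (y := x) (x' := y') (y' := x') hκ
      (by rwa [hs y' x', hs y x]) hxy
    rw [hs y x] at h1
    have h2 : 1 + x' ^ 2 ≤ br x' y' ^ 2 := by rw [br_sq]; nlinarith
    gcongr

theorem lintegral_shifted_quadratic_le (k c s : ℝ) (ψ : ℝ → ℝ≥0∞) :
    ∫⁻ x, ENNReal.ofReal |2 * k * (x - s)| * ψ (c - k * (x - s) ^ 2) ≤ 2 * ∫⁻ x, ψ x := by
  rw [lintegral_sub_right_eq_self (fun x => ENNReal.ofReal |2 * k * x| * ψ (c - k * x ^ 2)) s]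
  exact lintegral_deriv_mul_quadratic_le k c ψ

theorem bilBound_sep {κ b : ℝ} (hκ : 1 ≤ κ) (hb : 1 / 2 < b) :
    ∃ C : ℝ≥0∞, C < ⊤ ∧ BilBound (stKernel κ b sepSymbol) C := by
  set Ψ : ℝ≥0∞ := ∫⁻ x : ℝ, ENNReal.ofReal (jap x ^ (-(2 * b))) with hΨ
  set D : ℝ≥0∞ := ∫⁻ x : ℝ, ENNReal.ofReal (jap x ^ (-2 : ℝ)) with hD
  have hΨt : Ψ < ⊤ := lintegral_modulation_lt_top hb
  have hDt : D < ⊤ := lintegral_jap_rpow_lt_top volume (by simp)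
  refine ⟨Ψ * (2 * Ψ * D + 2 * Ψ * D), by finiteness, ?_⟩
  refine bilBound_stKernel_of_phase κ b measurable_sepSymbol fun ξ η c => ?_
  set ψ : ℝ → ℝ≥0∞ := fun x => ENNReal.ofReal (jap x ^ (-(2 * b))) with hψ
  have hψm : Measurable ψ := by fun_prop
  -- The inner integral is a change of variables, bounded uniformly in `y`; the weight in `η - y` is
  -- then integrated.
  have half : ∀ k l ξ η c : ℝ, ∫⁻ y, ∫⁻ x, ENNReal.ofReal |2 * k * (x - ξ)| *
      ENNReal.ofReal (jap (η - y) ^ (-2 : ℝ)) * ψ (c - k * (x - ξ) ^ 2 - l * (y - η / 2) ^ 2) ≤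
        2 * Ψ * D := by
    intro k l ξ η c
    calc _ = ∫⁻ y, ENNReal.ofReal (jap (η - y) ^ (-2 : ℝ)) * ∫⁻ x,
          ENNReal.ofReal |2 * k * (x - ξ)| *
          ψ ((c - l * (y - η / 2) ^ 2) - k * (x - ξ) ^ 2) := by
          congr 1; ext y
          rw [← lintegral_const_mul _ (by fun_prop)]
          congr 1; ext x
          rw [sub_right_comm]; ring
      _ ≤ ∫⁻ y, ENNReal.ofReal (jap (η - y) ^ (-2 : ℝ)) * (2 * Ψ) := by
          gcongr
          exact lintegral_shifted_quadratic_le _ _ _ ψ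
      _ = _ := by
          rw [lintegral_mul_const _ (by fun_prop), lintegral_sub_left_eq_self
            (fun x : ℝ => ENNReal.ofReal (jap x ^ (-2 : ℝ))) η, mul_comm]
  calc ∫⁻ p : ℝ × ℝ, sepSymbol p.1 p.2 (ξ - p.1) (η - p.2) ^ 2 *
        ψ (c - (disp κ p.1 p.2 + disp κ (ξ - p.1) (η - p.2)))
      ≤ ∫⁻ p : ℝ × ℝ, (ENNReal.ofReal |2 * (3 * κ * ξ) * (p.1 - ξ / 2)| *
          ENNReal.ofReal (jap (η - p.2) ^ (-2 : ℝ)) *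
          ψ (c - κ * (ξ ^ 3 + η ^ 3) / 4 - 3 * κ * ξ * (p.1 - ξ / 2) ^ 2
            - 3 * κ * η * (p.2 - η / 2) ^ 2) +
        ENNReal.ofReal |2 * (3 * κ * η) * (p.2 - η / 2)| *
          ENNReal.ofReal (jap (ξ - p.1) ^ (-2 : ℝ)) *
          ψ (c - κ * (ξ ^ 3 + η ^ 3) / 4 - 3 * κ * η * (p.2 - η / 2) ^ 2
            - 3 * κ * ξ * (p.1 - ξ / 2) ^ 2)) := by
        gcongr with p
        have e1 : c - (disp κ p.1 p.2 + disp κ (ξ - p.1) (η - p.2)) =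
          c - κ * (ξ ^ 3 + η ^ 3) / 4 - 3 * κ * ξ * (p.1 - ξ / 2) ^ 2
            - 3 * κ * η * (p.2 - η / 2) ^ 2 := by rw [disp_add_disp]; ring
        have e2 : c - κ * (ξ ^ 3 + η ^ 3) / 4 - 3 * κ * η * (p.2 - η / 2) ^ 2
            - 3 * κ * ξ * (p.1 - ξ / 2) ^ 2 = c - κ * (ξ ^ 3 + η ^ 3) / 4
            - 3 * κ * ξ * (p.1 - ξ / 2) ^ 2 - 3 * κ * η * (p.2 - η / 2) ^ 2 := by ring
        rw [e1, e2, ← add_mul]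
        gcongr
        refine (sepSymbol_sq_le hκ _ _ _ _).trans (le_of_eq ?_)
        congr 4 <;> ring
    _ = (∫⁻ p : ℝ × ℝ, ENNReal.ofReal |2 * (3 * κ * ξ) * (p.1 - ξ / 2)| *
          ENNReal.ofReal (jap (η - p.2) ^ (-2 : ℝ)) *
          ψ (c - κ * (ξ ^ 3 + η ^ 3) / 4 - 3 * κ * ξ * (p.1 - ξ / 2) ^ 2
            - 3 * κ * η * (p.2 - η / 2) ^ 2)) +
        ∫⁻ p : ℝ × ℝ, ENNReal.ofReal |2 * (3 * κ * η) * (p.2 - η / 2)| *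
          ENNReal.ofReal (jap (ξ - p.1) ^ (-2 : ℝ)) *
          ψ (c - κ * (ξ ^ 3 + η ^ 3) / 4 - 3 * κ * η * (p.2 - η / 2) ^ 2
            - 3 * κ * ξ * (p.1 - ξ / 2) ^ 2) := lintegral_add_left (by fun_prop) _
    _ ≤ _ := by
        refine add_le_add ?_ ?_
        · refine (lintegral_prod_symm _ (by fun_prop)).le.trans ?_
          exact half (3 * κ * ξ) (3 * κ * η) (ξ / 2) η (c - κ * (ξ ^ 3 + η ^ 3) / 4)
        · refine (lintegral_prod _ (by fun_prop)).le.trans ?_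
          exact half (3 * κ * η) (3 * κ * ξ) (η / 2) ξ (c - κ * (ξ ^ 3 + η ^ 3) / 4)

end

/-! ### Low output frequencies, comparable frequencies, and the complete bilinear smoothing
estimate. -/

noncomputable section

theorem isNegInvariant_volume_prod (E F : Type*) [AddGroup E] [MeasureSpace E] [AddGroup F]
    [MeasureSpace F] [(volume : Measure E).IsNegInvariant] [(volume : Measure F).IsNegInvariant]
    [SFinite (volume : Measure E)] [SFinite (volume : Measure F)]
    [MeasurableNeg E] [MeasurableNeg F] : (volume : Measure (E × F)).IsNegInvariant :=
  ⟨((Measure.measurePreserving_neg (volume : Measure E)).prod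
    (Measure.measurePreserving_neg (volume : Measure F))).map_eq⟩

instance : (volume : Measure (ℝ × ℝ × ℝ)).IsNegInvariant :=
  have : (volume : Measure (ℝ × ℝ)).IsNegInvariant := isNegInvariant_volume_prod ℝ ℝ
  isNegInvariant_volume_prod ℝ (ℝ × ℝ)

theorem BilBound.comp_equiv {X Y : Type*} [AddGroup X] [MeasureSpace X] [AddGroup Y]
    [MeasureSpace Y] (e : X ≃ᵐ Y) (he : MeasurePreserving e) (hsub : ∀ x y, e (x - y) = e x - e y)
    {k : Y → Y → ℝ≥0∞} {C : ℝ≥0∞} (h : BilBound k C) :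
    BilBound (fun x x' => k (e x) (e x')) C := by
  intro f g hf hg
  have hi : ∀ F : Y → ℝ≥0∞, ∫⁻ x, F (e x) = ∫⁻ y, F y := fun F => he.lintegral_comp_emb
    e.measurableEmbedding F
  have := h (f ∘ e.symm) (g ∘ e.symm) (hf.comp e.symm.measurable) (hg.comp e.symm.measurable)
  rw [← hi, ← hi, ← hi] at this
  simp_rw [← hi (fun y => k y _ * _)] at this
  simpa [← hsub] using this

/-- The exchange of the two spatial frequencies. -/
def swapSpace : (ℝ × ℝ × ℝ) ≃ᵐ (ℝ × ℝ × ℝ) :=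
  (MeasurableEquiv.prodAssoc.symm.trans
    (MeasurableEquiv.prodCongr MeasurableEquiv.prodComm (MeasurableEquiv.refl ℝ))).trans
      MeasurableEquiv.prodAssoc

theorem swapSpace_apply (x : ℝ × ℝ × ℝ) : swapSpace x = (x.2.1, x.1, x.2.2) := rfl

theorem measurePreserving_swapSpace : MeasurePreserving swapSpace := by
  have h1 : MeasurePreserving (MeasurableEquiv.prodAssoc (α := ℝ) (β := ℝ) (γ := ℝ)) :=
    volume_preserving_prodAssoc
  have h2 : MeasurePreserving
      (MeasurableEquiv.prodCongr (MeasurableEquiv.prodComm (α := ℝ) (β := ℝ))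
        (MeasurableEquiv.refl ℝ)) :=
    (Measure.measurePreserving_swap (μ := (volume : Measure ℝ)) (ν := (volume : Measure ℝ))).prod
      (MeasurePreserving.id volume)
  exact h1.comp (h2.comp (h1.symm _))

/-- For fixed first frequencies the bilinear operator in the variables `(η, τ)` is bounded. -/
theorem bilBound_slice {κ b : ℝ} (hκ : 1 ≤ κ) (hb : 1 / 2 < b) :
    ∃ C : ℝ≥0∞, C < ⊤ ∧ ∀ x x' : ℝ, BilBound (fun y z : ℝ × ℝ =>
      ENNReal.ofReal (jap (y.2 - disp κ x y.1) ^ (-b)) *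
        ENNReal.ofReal (jap (z.2 - disp κ x' z.1) ^ (-b))) C := by
  set Ψ : ℝ≥0∞ := ∫⁻ x : ℝ, ENNReal.ofReal (jap x ^ (-(2 * b))) with hΨ
  have hΨt : Ψ < ⊤ := lintegral_modulation_lt_top hb
  set ψ : ℝ → ℝ≥0∞ := fun x => ENNReal.ofReal (jap x ^ (-(2 * b))) with hψ
  have hψm : Measurable ψ := by fun_prop
  have hψ1 : ∀ x, ψ x ≤ 1 := ofReal_jap_rpow_le_one (by linarith)
  refine ⟨2 * (Ψ * (2 + Ψ) + volume (Set.Ioo (-1 : ℝ) 1) * Ψ), by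
    rw [Real.volume_Ioo]; finiteness, fun x x' => ?_⟩
  set φ : ℝ → ℝ≥0∞ := fun x => ENNReal.ofReal (jap x ^ (-b)) with hφ
  have hφm : Measurable φ := by fun_prop
  have hφψ : ∀ x, φ x ^ 2 = ψ x := ofReal_jap_rpow_sq b
  -- For `|η| ≥ 1` the phase in `y` is quadratic with leading coefficient `3κη` of modulus at least
  -- 1, while `x` and `x'` enter only through the constant term.
  have large : BilBound (fun y z : ℝ × ℝ => if 1 ≤ |y.1 + z.1| then
      φ (y.2 - disp κ x y.1) * φ (z.2 - disp κ x' z.1) else 0) (Ψ * (2 + Ψ)) := by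
    have hm : Measurable (Function.uncurry fun y z : ℝ × ℝ => if 1 ≤ |y.1 + z.1| then
      φ (y.2 - disp κ x y.1) * φ (z.2 - disp κ x' z.1) else 0) :=
      Measurable.ite (measurableSet_le (by fun_prop) (by fun_prop)) (by fun_prop) (by fun_prop)
    refine BilBound.of_kernel hm ?_
    rintro ⟨η, τ⟩
    by_cases hη : 1 ≤ |η|
    swap
    · simp [hη]
    refine (lintegral_prod _ ?_).le.trans ?_
    · exact ((hm.comp (by fun_prop :
        Measurable fun y : ℝ × ℝ => (y, (η, τ) - y))).pow_const 2).aemeasurable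
    refine le_trans (le_of_eq ?_) (lintegral_lintegral_modulation_le volume hψm
      (a := fun _ => 1) measurable_const
      (θ₁ := fun y => disp κ x y) (θ₂ := fun y => disp κ x' (η - y))
      (by fun_prop) (by fun_prop) (B := 2 + Ψ) ?_ τ)
    · simp [hη, mul_pow, hφψ]
    · intro c
      have : ∀ y, c - (disp κ x y + disp κ x' (η - y)) =
          (c - κ * (x ^ 3 + x' ^ 3 + η ^ 3 / 4)) - 3 * κ * η * (y - η / 2) ^ 2 := by
        intro y; unfold disp; ring
      simp_rw [one_mul, this]
      rw [lintegral_sub_right_eq_self (fun y =>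
        ψ ((c - κ * (x ^ 3 + x' ^ 3 + η ^ 3 / 4)) - 3 * κ * η * y ^ 2)) (η / 2)]
      refine lintegral_quadratic_le ?_ _ hψm hψ1
      rw [abs_mul, abs_mul, abs_of_nonneg (by linarith : (0 : ℝ) ≤ κ)]
      norm_num
      nlinarith
  -- For `|η| < 1` the same slicing is applied in `η`. Only the time frequency is left, and there
  -- one modulation weight is integrable and the other is at most 1.
  have small : BilBound (fun y z : ℝ × ℝ => if y.1 + z.1 ∈ Set.Ioo (-1 : ℝ) 1 then
      φ (y.2 - disp κ x y.1) * φ (z.2 - disp κ x' z.1) else 0)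
      (volume (Set.Ioo (-1 : ℝ) 1) * Ψ) := by
    refine BilBound.of_slices ?_ (fun a₁ a₂ => ?_) measurableSet_Ioo ?_
    · refine Measurable.ite ?_ (by fun_prop) (by fun_prop)
      exact measurableSet_Ioo.preimage
        (by fun_prop : Measurable fun p : (ℝ × ℝ) × (ℝ × ℝ) => p.1.1 + p.2.1)
    · refine BilBound.mono (k := fun t t' => φ (t - disp κ x a₁) * φ (t' - disp κ x' a₂))
        (BilBound.of_kernel (by fun_prop) ?_) ?_ le_rfl
      · intro τ
        calc ∫⁻ t, (φ (t - disp κ x a₁) * φ (τ - t - disp κ x' a₂)) ^ 2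
            ≤ ∫⁻ t, ψ (t - disp κ x a₁) := by
              gcongr with t
              rw [mul_pow, hφψ, hφψ]
              exact mul_le_of_le_one_right (by positivity) (hψ1 _)
          _ = Ψ := lintegral_sub_right_eq_self ψ _
      · intro t t'
        dsimp only
        split_ifs
        · exact le_rfl
        · simp
    · intro p q h
      simp [h]
  refine (large.add small ?_).mono ?_ le_rfl
  · exact Measurable.ite (measurableSet_le (by fun_prop) (by fun_prop)) (by fun_prop)
      (by fun_prop)
  · intro y z
    by_cases h : 1 ≤ |y.1 + z.1|
    · simp [h, hφ]
    · have h' : y.1 + z.1 ∈ Set.Ioo (-1 : ℝ) 1 := by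
        rw [not_le, abs_lt] at h; exact h
      simp only [h', if_true]
      exact le_add_self

/-- The output frequency `ξ` is confined to an interval of length 2, so the uniform bounds for fixed
first frequencies can be added up over it. -/
theorem bilBound_low_left {κ b : ℝ} (hκ : 1 ≤ κ) (hb : 1 / 2 < b) :
    ∃ C : ℝ≥0∞, C < ⊤ ∧ BilBound (stKernel κ b
      fun x _ x' _ => if x + x' ∈ Set.Ioo (-1 : ℝ) 1 then 1 else 0) C := by
  obtain ⟨C, hC, h⟩ := bilBound_slice hκ hb
  refine ⟨volume (Set.Ioo (-1 : ℝ) 1) * C, by rw [Real.volume_Ioo]; finiteness, ?_⟩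
  refine BilBound.of_slices ?_ (fun a₁ a₂ => (h a₁ a₂).mono ?_ le_rfl) measurableSet_Ioo ?_
  · refine measurable_stKernel κ b (Measurable.ite ?_ (by fun_prop) (by fun_prop))
    exact measurableSet_Ioo.preimage
      (by fun_prop : Measurable fun p : ℝ × ℝ × ℝ × ℝ => p.1 + p.2.2.1)
  · intro y z
    simp only [stKernel]
    split_ifs <;> simp
  · intro p q h
    simp [stKernel, h]

/-- The dispersion relation is symmetric in the two spatial frequencies, so exchanging them reduces
this to the first coordinate. -/
theorem bilBound_low_right {κ b : ℝ} (hκ : 1 ≤ κ) (hb : 1 / 2 < b) :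
    ∃ C : ℝ≥0∞, C < ⊤ ∧ BilBound (stKernel κ b
      fun _ y _ y' => if y + y' ∈ Set.Ioo (-1 : ℝ) 1 then 1 else 0) C := by
  obtain ⟨C, hC, h⟩ := bilBound_low_left hκ hb
  refine ⟨C, hC, (h.comp_equiv swapSpace measurePreserving_swapSpace fun _ _ => rfl).mono
    (fun y z => le_of_eq ?_) le_rfl⟩
  simp only [stKernel, swapSpace_apply, disp, add_comm]
  congr!

/-- Both coefficients `3κξ` and `3κη` of the phase have modulus at least 1, so the two-dimensional
quadratic phase applies. The factor with exponent `-e` pays for its logarithmic divergence. -/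
theorem bilBound_high {κ b e : ℝ} (hκ : 1 ≤ κ) (hb : 1 / 2 < b) (he : 0 < e) :
    ∃ C : ℝ≥0∞, C < ⊤ ∧ BilBound (stKernel κ b fun x y x' y' => if 1 ≤ |x + x'| ∧ 1 ≤ |y + y'| then
      ENNReal.ofReal ((max (br x y) (br x' y')) ^ (-e)) else 0) C := by
  set Ψ : ℝ≥0∞ := ∫⁻ x : ℝ, ENNReal.ofReal (jap x ^ (-(2 * b))) with hΨ
  have hΨt : Ψ < ⊤ := lintegral_modulation_lt_top hb
  set ψ : ℝ → ℝ≥0∞ := fun x => ENNReal.ofReal (jap x ^ (-(2 * b))) with hψ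
  have hψm : Measurable ψ := by fun_prop
  have hψ1 : ∀ x, ψ x ≤ 1 := ofReal_jap_rpow_le_one (by linarith)
  obtain ⟨C, hC, hq⟩ := lintegral_quadratic₂_le (e := 2 * e) (by linarith) hψm hψ1 hΨt
  refine ⟨Ψ * C, by finiteness, ?_⟩
  refine bilBound_stKernel_of_phase κ b ?_ fun ξ η c => ?_
  · refine Measurable.ite (MeasurableSet.inter ?_ ?_) (by fun_prop) (by fun_prop)
    · exact measurableSet_le (f := fun _ => (1 : ℝ))
        (g := fun p : ℝ × ℝ × ℝ × ℝ => |p.1 + p.2.2.1|) (by fun_prop) (by fun_prop)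
    · exact measurableSet_le (f := fun _ => (1 : ℝ))
        (g := fun p : ℝ × ℝ × ℝ × ℝ => |p.2.1 + p.2.2.2|) (by fun_prop) (by fun_prop)
  by_cases hξη : 1 ≤ |ξ| ∧ 1 ≤ |η|
  swap
  · simp [hξη]
  simp only [add_sub_cancel, hξη, and_self, if_true]
  have habs : ∀ ξ : ℝ, 1 ≤ |ξ| → 1 ≤ |3 * κ * ξ| := by
    intro ξ h
    rw [abs_mul, abs_mul, abs_of_nonneg (by linarith : (0 : ℝ) ≤ κ)]
    norm_num
    nlinarith
  have hpt : ∀ p : ℝ × ℝ, ENNReal.ofReal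
      ((max (br p.1 p.2) (br (ξ - p.1) (η - p.2))) ^ (-e)) ^ 2 * ψ (c - (disp κ p.1 p.2 +
      disp κ (ξ - p.1) (η - p.2))) ≤ ENNReal.ofReal
      ((max 1 (max |p.1 - ξ / 2| |p.2 - η / 2|)) ^ (-(2 * e))) *
      ψ (c - κ * (ξ ^ 3 + η ^ 3) / 4 - 3 * κ * ξ * (p.1 - ξ / 2) ^ 2
            - 3 * κ * η * (p.2 - η / 2) ^ 2) := by
    intro p
    have e1 : c - (disp κ p.1 p.2 + disp κ (ξ - p.1) (η - p.2)) =
          c - κ * (ξ ^ 3 + η ^ 3) / 4 - 3 * κ * ξ * (p.1 - ξ / 2) ^ 2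
            - 3 * κ * η * (p.2 - η / 2) ^ 2 := by rw [disp_add_disp]; ring
    rw [e1]
    gcongr 1
    have hbp := br_pos p.1 p.2
    rw [← ENNReal.ofReal_pow (by positivity), ← Real.rpow_natCast, ← Real.rpow_mul (by positivity)]
    refine ENNReal.ofReal_le_ofReal ?_
    rw [show -e * ((2 : ℕ) : ℝ) = -(2 * e) by push_cast; ring]
    refine Real.rpow_le_rpow_of_nonpos (by positivity) ?_ (by linarith)
    -- The distance from `p` to half of the output frequency is half the difference of the two input
    -- frequencies, hence at most the larger bracket.
    refine max_le (le_max_of_le_left (one_le_br _ _)) (max_le ?_ ?_)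
    · have h1 := (abs_left_le_br p.1 p.2).trans (le_max_left _ (br (ξ - p.1) (η - p.2)))
      have h2 := (abs_left_le_br (ξ - p.1) (η - p.2)).trans (le_max_right (br p.1 p.2) _)
      rw [abs_le] at *
      constructor <;> linarith [h1.1, h1.2, h2.1, h2.2]
    · have h1 := (abs_right_le_br p.1 p.2).trans (le_max_left _ (br (ξ - p.1) (η - p.2)))
      have h2 := (abs_right_le_br (ξ - p.1) (η - p.2)).trans (le_max_right (br p.1 p.2) _)
      rw [abs_le] at *
      constructor <;> linarith [h1.1, h1.2, h2.1, h2.2]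
  refine (lintegral_mono hpt).trans ?_
  refine (lintegral_prod _ (by fun_prop)).le.trans ?_
  rw [← lintegral_add_right_eq_self _ (ξ / 2)]
  refine le_trans (le_of_eq ?_)
    (hq (3 * κ * ξ) (3 * κ * η) (habs _ hξη.1) (habs _ hξη.2) (c - κ * (ξ ^ 3 + η ^ 3) / 4))
  congr 1; ext x
  rw [← lintegral_add_right_eq_self _ (η / 2)]
  simp only [add_sub_cancel_right]

/-- The symbol of the bilinear smoothing estimate. -/
def smoothingSymbol (e x y x' y' : ℝ) : ℝ≥0∞ :=
  ENNReal.ofReal ((max (br x y) (br x' y')) ^ (2 - e) * ((br x y)⁻¹ * (br x' y')⁻¹))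

/-- The symbol is `big^{-e} · (big/small)` in terms of the two brackets. If the ratio is at least 8
it is dominated by `sepSymbol`. Otherwise the ratio is at most 8, and the three conditions on the
output frequency cover all cases. -/
theorem smoothingSymbol_le {e : ℝ} (he : 0 ≤ e) (x y x' y' : ℝ) :
    smoothingSymbol e x y x' y' ≤ (sepSymbol x y x' y' + sepSymbol x' y' x y) +
      8 * ((if x + x' ∈ Set.Ioo (-1 : ℝ) 1 then 1 else 0) +
        ((if y + y' ∈ Set.Ioo (-1 : ℝ) 1 then 1 else 0) +
      (if 1 ≤ |x + x'| ∧ 1 ≤ |y + y'| then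
        ENNReal.ofReal ((max (br x y) (br x' y')) ^ (-e)) else 0))) := by
  have main : ∀ x y x' y' : ℝ, br x' y' ≤ br x y → ENNReal.ofReal
      ((br x y) ^ (2 - e) * ((br x y)⁻¹ * (br x' y')⁻¹)) ≤ sepSymbol x y x' y' +
      8 * ((if x + x' ∈ Set.Ioo (-1 : ℝ) 1 then 1 else 0) +
        ((if y + y' ∈ Set.Ioo (-1 : ℝ) 1 then 1 else 0) +
      (if 1 ≤ |x + x'| ∧ 1 ≤ |y + y'| then ENNReal.ofReal ((br x y) ^ (-e)) else 0))) := by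
    intro x y x' y' hle
    have h1 := br_pos x y
    have h2 := br_pos x' y'
    have hA : br x y ^ (-e) ≤ 1 := Real.rpow_le_one_of_one_le_of_nonpos (one_le_br x y) (by linarith)
    have hE : (br x y) ^ (2 - e) * ((br x y)⁻¹ * (br x' y')⁻¹) =
        br x y ^ (-e) * (br x y / br x' y') := by
      rw [sub_eq_add_neg, Real.rpow_add h1, Real.rpow_two]
      field_simp
    rw [hE]
    by_cases hs : 8 * br x' y' ≤ br x y
    · refine le_trans ?_ le_self_add
      rw [sepSymbol, if_pos hs]
      exact ENNReal.ofReal_le_ofReal (mul_le_of_le_one_left (by positivity) hA)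
    · refine le_trans ?_ le_add_self
      have hE2 : ENNReal.ofReal (br x y ^ (-e) * (br x y / br x' y')) ≤
          8 * ENNReal.ofReal (br x y ^ (-e)) := by
        rw [show (8 : ℝ≥0∞) = ENNReal.ofReal 8 by norm_num, ← ENNReal.ofReal_mul (by norm_num),
          mul_comm]
        refine ENNReal.ofReal_le_ofReal ?_
        gcongr
        rw [div_le_iff₀ h2]
        linarith
      refine hE2.trans ?_
      gcongr
      have hA' : ENNReal.ofReal (br x y ^ (-e)) ≤ 1 := by
        rw [← ENNReal.ofReal_one]; exact ENNReal.ofReal_le_ofReal hA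
      by_cases hx : 1 ≤ |x + x'|
      · by_cases hy : 1 ≤ |y + y'|
        · rw [if_pos (c := 1 ≤ |x + x'| ∧ 1 ≤ |y + y'|) ⟨hx, hy⟩]
          exact le_add_self.trans le_add_self
        · have : y + y' ∈ Set.Ioo (-1 : ℝ) 1 := by rw [not_le, abs_lt] at hy; exact hy
          rw [if_pos this]
          exact hA'.trans (le_self_add.trans le_add_self)
      · have : x + x' ∈ Set.Ioo (-1 : ℝ) 1 := by rw [not_le, abs_lt] at hx; exact hx
        rw [if_pos this]
        exact hA'.trans le_self_add
  unfold smoothingSymbol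
  rcases le_total (br x' y') (br x y) with h | h
  · rw [max_eq_left h]
    refine (main x y x' y' h).trans ?_
    gcongr
    exact le_self_add
  · rw [max_eq_right h]
    have := main x' y' x y h
    rw [mul_comm (br x y)⁻¹, add_comm x, add_comm y]
    refine this.trans ?_
    gcongr
    exact le_add_self

theorem stKernel_swap (κ b : ℝ) (a : ℝ → ℝ → ℝ → ℝ → ℝ≥0∞) (y z : ℝ × ℝ × ℝ) :
    stKernel κ b a z y = stKernel κ b (fun x y x' y' => a x' y' x y) y z := by
  simp only [stKernel, mul_comm (ENNReal.ofReal (jap (z.2.2 - disp κ z.1 z.2.1) ^ (-b)))]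

theorem BilBound.combine {X : Type*} [AddCommGroup X] [MeasureSpace X] [MeasurableAdd₂ X]
    [MeasurableNeg X] [MeasurableSub₂ X] [(volume : Measure X).IsAddLeftInvariant]
    [(volume : Measure X).IsNegInvariant] [SFinite (volume : Measure X)]
    {K₁ K₂ K₃ K₄ : X → X → ℝ≥0∞} {C₁ C₂ C₃ C₄ : ℝ≥0∞} (h₁ : BilBound K₁ C₁) (h₂ : BilBound K₂ C₂)
    (h₃ : BilBound K₃ C₃) (h₄ : BilBound K₄ C₄) (m₁ : Measurable (Function.uncurry K₁))
    (m₂ : Measurable (Function.uncurry K₂)) (m₃ : Measurable (Function.uncurry K₃)) :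
    BilBound (fun y z => (K₁ y z + K₁ z y) + 8 * (K₂ y z + (K₃ y z + K₄ y z)))
      (2 * (2 * (C₁ + C₁) + 8 ^ 2 * (2 * (C₂ + 2 * (C₃ + C₄))))) :=
  (h₁.add h₁.symm m₁).add ((h₂.add (h₃.add h₄ m₃) m₂).const_mul (c := 8) (by norm_num))
    (m₁.add (m₁.comp measurable_swap))

/-- The bilinear smoothing estimate on the Fourier side. -/
theorem bilBound_smoothing {κ b e : ℝ} (hκ : 1 ≤ κ) (hb : 1 / 2 < b) (he : 0 < e) :
    ∃ C : ℝ≥0∞, C < ⊤ ∧ BilBound (stKernel κ b (smoothingSymbol e)) C := by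
  obtain ⟨C₁, hC₁, h₁⟩ := bilBound_sep hκ hb
  obtain ⟨C₂, hC₂, h₂⟩ := bilBound_low_left hκ hb
  obtain ⟨C₃, hC₃, h₃⟩ := bilBound_low_right hκ hb
  obtain ⟨C₄, hC₄, h₄⟩ := bilBound_high hκ hb he
  have m₁ := measurable_stKernel κ b measurable_sepSymbol
  have m₂ : Measurable (Function.uncurry (stKernel κ b
      fun x _ x' _ => if x + x' ∈ Set.Ioo (-1 : ℝ) 1 then 1 else 0)) := by
    refine measurable_stKernel κ b (Measurable.ite ?_ (by fun_prop) (by fun_prop))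
    exact measurableSet_Ioo.preimage
      (by fun_prop : Measurable fun p : ℝ × ℝ × ℝ × ℝ => p.1 + p.2.2.1)
  have m₃ : Measurable (Function.uncurry (stKernel κ b
      fun _ y _ y' => if y + y' ∈ Set.Ioo (-1 : ℝ) 1 then 1 else 0)) := by
    refine measurable_stKernel κ b (Measurable.ite ?_ (by fun_prop) (by fun_prop))
    exact measurableSet_Ioo.preimage
      (by fun_prop : Measurable fun p : ℝ × ℝ × ℝ × ℝ => p.2.1 + p.2.2.2)
  refine ⟨2 * (2 * (C₁ + C₁) + 8 ^ 2 * (2 * (C₂ + 2 * (C₃ + C₄)))), by finiteness,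
    (BilBound.combine h₁ h₂ h₃ h₄ m₁ m₂ m₃).mono (fun y z => ?_) le_rfl⟩
  rw [stKernel_swap κ b sepSymbol]
  simp only [stKernel]
  refine (mul_le_mul_left (smoothingSymbol_le he.le _ _ _ _) _).trans (le_of_eq ?_)
  ring

end

noncomputable section

/-! ### The Fourier transform of integrable and of square integrable functions -/

/-- A smooth compactly supported real function as a Schwartz function. -/
def schwartzOfReal {V : Type*} [NormedAddCommGroup V] [InnerProductSpace ℝ V] (g : V → ℝ)
    (hg : ContDiff ℝ ∞ g) (hc : HasCompactSupport g) : 𝓢(V, ℂ) :=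
  HasCompactSupport.toSchwartzMap (f := fun x => (g x : ℂ))
    (hc.comp_left (g := fun y : ℝ => (y : ℂ)) Complex.ofReal_zero)
    (Complex.ofRealCLM.contDiff.comp hg)

theorem schwartzOfReal_apply {V : Type*} [NormedAddCommGroup V]
    [InnerProductSpace ℝ V] (g : V → ℝ) (hg : ContDiff ℝ ∞ g) (hc : HasCompactSupport g) (x : V) :
    schwartzOfReal g hg hc x = (g x : ℂ) := rfl

section Fourier

variable {V : Type*} [NormedAddCommGroup V] [InnerProductSpace ℝ V] [FiniteDimensional ℝ V]
  [MeasurableSpace V] [BorelSpace V]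

theorem integral_fourier_mul_flip {f g : V → ℂ} (hf : Integrable f) (hg : Integrable g) :
    ∫ x, 𝓕 f x * g x = ∫ x, f x * 𝓕 g x := by
  have := VectorFourier.integral_fourierIntegral_smul_eq_flip (μ := (volume : Measure V))
    (ν := (volume : Measure V)) (L := innerₗ V) Real.continuous_fourierChar
    (by exact continuous_inner) hf hg
  rw [flip_innerₗ] at this
  exact this

theorem continuous_fourier {f : V → ℂ} (hf : Integrable f) : Continuous (𝓕 f) :=
  VectorFourier.fourierIntegral_continuous Real.continuous_fourierChar
    (by exact continuous_inner) hf

theorem continuous_fourierInv {f : V → ℂ} (hf : Integrable f) : Continuous (𝓕⁻ f) := by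
  have : 𝓕⁻ f = fun x => 𝓕 f (-x) := funext fun x => Real.fourierInv_eq_fourier_neg f x
  rw [this]
  exact (continuous_fourier hf).comp continuous_neg

theorem integral_fourierInv_mul_flip {f g : V → ℂ} (hf : Integrable f) (hg : Integrable g) :
    ∫ x, 𝓕⁻ f x * g x = ∫ x, f x * 𝓕⁻ g x := by
  rw [Real.fourierInv_eq_fourier_comp_neg f, integral_fourier_mul_flip hf.comp_neg hg,
    ← integral_neg_eq_self]
  simp [Real.fourierInv_eq_fourier_neg]

theorem enorm_fourierInv_le (f : V → ℂ) (x : V) : ‖𝓕⁻ f x‖ₑ ≤ ∫⁻ y, ‖f y‖ₑ := by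
  rw [Real.fourierInv_eq]
  refine (enorm_integral_le_lintegral_enorm _).trans (le_of_eq ?_)
  congr 1; ext y
  rw [← ofReal_norm, Circle.norm_smul, ofReal_norm]

theorem conj_fourier (f : V → ℂ) (x : V) :
    (starRingEnd ℂ) (𝓕 f x) = 𝓕⁻ (fun y => (starRingEnd ℂ) (f y)) x := by
  rw [Real.fourier_eq', Real.fourierInv_eq', ← integral_conj]
  congr 1; ext y
  simp only [smul_eq_mul, map_mul, ← Complex.exp_conj, Complex.conj_I, Complex.conj_ofReal]
  congr 2; push_cast; ring

theorem conj_fourierInv (f : V → ℂ) (x : V) :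
    (starRingEnd ℂ) (𝓕⁻ f x) = 𝓕 (fun y => (starRingEnd ℂ) (f y)) x := by
  have := conj_fourier (fun y => (starRingEnd ℂ) (f y)) x
  simp only [Complex.conj_conj] at this
  rw [← this, Complex.conj_conj]

theorem integral_mul_fourierInv_Lp (φ : 𝓢(V, ℂ)) (f : Lp (α := V) ℂ 2 volume) :
    ∫ x, φ x * (𝓕⁻ f : Lp (α := V) ℂ 2 volume) x = ∫ x, (𝓕⁻ φ) x * f x := by
  have h := congrArg (fun T : 𝓢'(V, ℂ) => T φ) (Lp.fourierInv_toTemperedDistribution_eq f)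
  simpa [TemperedDistribution.fourierInv_apply] using h.symm

theorem integral_mul_fourier_Lp (φ : 𝓢(V, ℂ)) (f : Lp (α := V) ℂ 2 volume) :
    ∫ x, φ x * (𝓕 f : Lp (α := V) ℂ 2 volume) x = ∫ x, (𝓕 φ) x * f x := by
  have h := congrArg (fun T : 𝓢'(V, ℂ) => T φ) (Lp.fourier_toTemperedDistribution_eq f)
  simpa [TemperedDistribution.fourier_apply] using h.symm

theorem locallyIntegrable_Lp_two (f : Lp (α := V) ℂ 2 volume) : LocallyIntegrable (f : V → ℂ) :=
  (Lp.memLp f).locallyIntegrable (by norm_num)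

/-- This links the transform on `L²`, defined abstractly, with the integral formula: both have the
same pairing with every test function. -/
theorem fourierInv_toLp_ae {a : V → ℂ} (h₁ : Integrable a) (h₂ : MemLp a 2 volume) :
    ((𝓕⁻ (h₂.toLp a : Lp (α := V) ℂ 2 volume) : Lp (α := V) ℂ 2 volume) : V → ℂ) =ᵐ[volume] 𝓕⁻ a := by
  refine ae_eq_of_integral_contDiff_smul_eq (locallyIntegrable_Lp_two _)
    (continuous_fourierInv h₁).locallyIntegrable fun g hg hc => ?_
  have e := integral_mul_fourierInv_Lp (schwartzOfReal g hg hc) (h₂.toLp a)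
  simp only [schwartzOfReal_apply] at e
  simp only [Complex.real_smul]
  rw [e, ← integral_congr_ae (h₂.coeFn_toLp.mono fun x hx => by
    rw [hx])]
  rw [SchwartzMap.fourierInv_coe]
  exact integral_fourierInv_mul_flip (schwartzOfReal g hg hc).integrable h₁

theorem fourier_toLp_ae {a : V → ℂ} (h₁ : Integrable a) (h₂ : MemLp a 2 volume) :
    ((𝓕 (h₂.toLp a : Lp (α := V) ℂ 2 volume) : Lp (α := V) ℂ 2 volume) : V → ℂ) =ᵐ[volume] 𝓕 a := by
  refine ae_eq_of_integral_contDiff_smul_eq (locallyIntegrable_Lp_two _)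
    (continuous_fourier h₁).locallyIntegrable fun g hg hc => ?_
  have e := integral_mul_fourier_Lp (schwartzOfReal g hg hc) (h₂.toLp a)
  simp only [schwartzOfReal_apply] at e
  simp only [Complex.real_smul]
  rw [e, ← integral_congr_ae (h₂.coeFn_toLp.mono fun x hx => by
    rw [hx])]
  rw [SchwartzMap.fourier_coe]
  exact integral_fourier_mul_flip (schwartzOfReal g hg hc).integrable h₁

/-- The convolution of two functions. -/
def conv (a₁ a₂ : V → ℂ) (x : V) : ℂ := ∫ y, a₁ y * a₂ (x - y)

theorem integrable_conv {a₁ a₂ : V → ℂ} (h₁ : Integrable a₁) (h₂ : Integrable a₂) :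
    Integrable (conv a₁ a₂) :=
  h₁.integrable_convolution (ContinuousLinearMap.mul ℂ ℂ) h₂

theorem enorm_conv_le (a₁ a₂ : V → ℂ) (x : V) :
    ‖conv a₁ a₂ x‖ₑ ≤ ∫⁻ y, ‖a₁ y‖ₑ * ‖a₂ (x - y)‖ₑ := by
  refine (enorm_integral_le_lintegral_enorm _).trans (le_of_eq ?_)
  simp_rw [enorm_mul]

theorem fourierInv_conv {a₁ a₂ : V → ℂ} (h₁ : Integrable a₁) (h₂ : Integrable a₂) (x : V) :
    𝓕⁻ (conv a₁ a₂) x = 𝓕⁻ a₁ x * 𝓕⁻ a₂ x := by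
  simp only [Real.fourierInv_eq_fourier_neg]
  exact Real.fourier_mul_convolution_eq h₁ h₂ (-x)

theorem lintegral_enorm_sq_toLp {a : V → ℂ} (h : MemLp a 2 volume) :
    ∫⁻ x, ‖(h.toLp a : Lp (α := V) ℂ 2 volume) x‖ₑ ^ 2 = ∫⁻ x, ‖a x‖ₑ ^ 2 :=
  lintegral_congr_ae (h.coeFn_toLp.mono fun x hx => by simp only [hx])

theorem enorm_Lp_two_sq (f : Lp (α := V) ℂ 2 volume) : ‖f‖ₑ ^ 2 = ∫⁻ x, ‖f x‖ₑ ^ 2 := by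
  rw [Lp.enorm_def, eLpNorm_eq_lintegral_rpow_enorm_toReal (by norm_num) (by norm_num)]
  rw [← ENNReal.rpow_natCast, ← ENNReal.rpow_mul]
  norm_num

theorem memLp_two_of_lintegral_lt_top {a : V → ℂ} (ha : AEStronglyMeasurable a)
    (h : ∫⁻ x, ‖a x‖ₑ ^ 2 < ⊤) : MemLp a 2 := by
  refine ⟨ha, ?_⟩
  rw [eLpNorm_lt_top_iff_lintegral_rpow_enorm_lt_top (by norm_num) (by norm_num)]
  simpa using h

theorem lintegral_lt_top_of_memLp_two {a : V → ℂ} (h : MemLp a 2 volume) : ∫⁻ x, ‖a x‖ₑ ^ 2 < ⊤ := by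
  have := h.2
  rw [eLpNorm_lt_top_iff_lintegral_rpow_enorm_lt_top (by norm_num) (by norm_num)] at this
  simpa using this

theorem lintegral_enorm_sq_fourierInv {a : V → ℂ} (h₁ : Integrable a) (h₂ : MemLp a 2 volume) :
    ∫⁻ x, ‖𝓕⁻ a x‖ₑ ^ 2 = ∫⁻ x, ‖a x‖ₑ ^ 2 := by
  have e : ∫⁻ x, ‖(𝓕⁻ (h₂.toLp a : Lp (α := V) ℂ 2 volume) : Lp (α := V) ℂ 2 volume) x‖ₑ ^ 2 =
      ∫⁻ x, ‖𝓕⁻ a x‖ₑ ^ 2 :=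
    lintegral_congr_ae ((fourierInv_toLp_ae h₁ h₂).mono fun x hx => by simp only [hx])
  rw [← e, ← enorm_Lp_two_sq]
  rw [← lintegral_enorm_sq_toLp h₂, ← enorm_Lp_two_sq]
  congr 1
  rw [← ofReal_norm, ← ofReal_norm, ← Lp.norm_fourier_eq, FourierInvPair.fourier_fourierInv_eq]

/-- Plancherel's theorem for a product of two functions. -/
theorem lintegral_enorm_sq_fourierInv_mul_le {a₁ a₂ : V → ℂ} (h₁ : Integrable a₁)
    (h₂ : Integrable a₂) : ∫⁻ x, (‖𝓕⁻ a₁ x‖ₑ * ‖𝓕⁻ a₂ x‖ₑ) ^ 2 ≤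
      ∫⁻ x, (∫⁻ y, ‖a₁ y‖ₑ * ‖a₂ (x - y)‖ₑ) ^ 2 := by
  have hle : ∫⁻ x, ‖conv a₁ a₂ x‖ₑ ^ 2 ≤ ∫⁻ x, (∫⁻ y, ‖a₁ y‖ₑ * ‖a₂ (x - y)‖ₑ) ^ 2 := by
    gcongr; exact enorm_conv_le _ _ _
  rcases eq_or_ne (∫⁻ x, (∫⁻ y, ‖a₁ y‖ₑ * ‖a₂ (x - y)‖ₑ) ^ 2) ⊤ with h | h
  · rw [h]; exact le_top
  have hc := integrable_conv h₁ h₂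
  have hc2 : MemLp (conv a₁ a₂) 2 volume :=
    memLp_two_of_lintegral_lt_top hc.1 (hle.trans_lt (lt_top_iff_ne_top.2 h))
  refine le_trans (le_of_eq ?_) hle
  rw [← lintegral_enorm_sq_fourierInv hc hc2]
  simp_rw [fourierInv_conv h₁ h₂, enorm_mul]

/-- Inversion is done in `L²`, so no continuity of `a` is needed. This matters below, where `a` is a
convolution of functions that are merely measurable. -/
theorem fourier_fourierInv_ae {a : V → ℂ} (h₁ : Integrable a) (h₂ : MemLp a 2 volume)
    (h₃ : Integrable (𝓕⁻ a)) : 𝓕 (𝓕⁻ a) =ᵐ[volume] a := by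
  have hm : MemLp (𝓕⁻ a) 2 volume := memLp_two_of_lintegral_lt_top h₃.1
    (by rw [lintegral_enorm_sq_fourierInv h₁ h₂]; exact lintegral_lt_top_of_memLp_two h₂)
  have e : (hm.toLp (𝓕⁻ a) : Lp (α := V) ℂ 2 volume) = 𝓕⁻ (h₂.toLp a : Lp (α := V) ℂ 2 volume) :=
    Lp.ext (hm.coeFn_toLp.trans (fourierInv_toLp_ae h₁ h₂).symm)
  have h4 := fourier_toLp_ae h₃ hm
  rw [e, FourierInvPair.fourier_fourierInv_eq] at h4
  exact h4.symm.trans h₂.coeFn_toLp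

theorem fourierInv_conj_neg {g h : Lp (α := V) ℂ 2 volume}
    (hh : (h : V → ℂ) =ᵐ[volume] fun ζ => (starRingEnd ℂ) (g (-ζ))) :
    ((𝓕⁻ h : Lp (α := V) ℂ 2 volume) : V → ℂ) =ᵐ[volume]
      fun z => (starRingEnd ℂ) ((𝓕⁻ g : Lp (α := V) ℂ 2 volume) z) := by
  have hcm : MemLp (fun z => (starRingEnd ℂ) ((𝓕⁻ g : Lp (α := V) ℂ 2 volume) z)) 2 volume :=
    (Lp.memLp (𝓕⁻ g : Lp (α := V) ℂ 2 volume)).star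
  refine ae_eq_of_integral_contDiff_smul_eq (locallyIntegrable_Lp_two _)
    (hcm.locallyIntegrable (by norm_num)) fun φ hφ hc => ?_
  have e1 := integral_mul_fourierInv_Lp (schwartzOfReal φ hφ hc) h
  have e2 := integral_mul_fourierInv_Lp (schwartzOfReal φ hφ hc) g
  simp only [schwartzOfReal_apply] at e1 e2
  simp only [Complex.real_smul]
  rw [e1]
  have e3 := congrArg (starRingEnd ℂ) e2
  rw [← integral_conj, ← integral_conj] at e3
  simp only [map_mul, Complex.conj_ofReal] at e3
  rw [e3, ← integral_neg_eq_self (μ := volume) (fun x : V =>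
    (starRingEnd ℂ) ((𝓕⁻ (schwartzOfReal φ hφ hc) : 𝓢(V, ℂ)) x) * (starRingEnd ℂ) (g x))]
  refine integral_congr_ae (hh.mono fun x hx => ?_)
  dsimp only
  rw [hx, SchwartzMap.fourierInv_coe, conj_fourierInv, Real.fourierInv_eq_fourier_neg]
  simp only [schwartzOfReal_apply, Complex.conj_ofReal]
  rfl

end Fourier

end

noncomputable section

/-! ### Bounded multipliers on the frequency side -/

/-- Bounded measurable symbols. -/
def BddSymbol (c : Plane → ℂ) : Prop := Measurable c ∧ ∃ B : ℝ, ∀ ζ, ‖c ζ‖ ≤ B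

/-- Bounded measurable symbols with bounded support. -/
def BddSupp (c : Plane → ℂ) : Prop := BddSymbol c ∧ ∃ r : ℝ, ∀ ζ, r < ‖ζ‖ → c ζ = 0

theorem BddSymbol.mul {c d : Plane → ℂ} (hc : BddSymbol c) (hd : BddSymbol d) :
    BddSymbol fun ζ => c ζ * d ζ := by
  obtain ⟨h1, B, hB⟩ := hc
  obtain ⟨h2, D, hD⟩ := hd
  refine ⟨h1.mul h2, B * D, fun ζ => ?_⟩
  rw [norm_mul]
  exact mul_le_mul (hB ζ) (hD ζ) (norm_nonneg _) ((norm_nonneg _).trans (hB ζ))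

theorem BddSymbol.conj {c : Plane → ℂ} (hc : BddSymbol c) :
    BddSymbol fun ζ => (starRingEnd ℂ) (c ζ) :=
  ⟨Complex.continuous_conj.measurable.comp hc.1, hc.2.imp fun B hB ζ => by
    rw [RCLike.norm_conj]; exact hB ζ⟩

theorem BddSupp.conj {c : Plane → ℂ} (hc : BddSupp c) :
    BddSupp fun ζ => (starRingEnd ℂ) (c ζ) :=
  ⟨hc.1.conj, hc.2.imp fun r hr ζ h => by simp [hr ζ h]⟩

theorem BddSupp.mul_right {c d : Plane → ℂ} (hc : BddSupp c) (hd : BddSymbol d) :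
    BddSupp fun ζ => c ζ * d ζ :=
  ⟨hc.1.mul hd, hc.2.imp fun r hr ζ h => by simp [hr ζ h]⟩

theorem BddSupp.mul_left {c d : Plane → ℂ} (hc : BddSymbol c) (hd : BddSupp d) :
    BddSupp fun ζ => c ζ * d ζ :=
  ⟨hc.mul hd.1, hd.2.imp fun r hr ζ h => by simp [hr ζ h]⟩

theorem BddSymbol.memLp_mul {c : Plane → ℂ} (hc : BddSymbol c) {f : Plane → ℂ}
    (hf : MemLp f 2 volume) : MemLp (fun ζ => c ζ * f ζ) 2 volume := by
  obtain ⟨hm, B, hB⟩ := hc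
  exact hf.of_le_mul (c := B) (hm.aestronglyMeasurable.mul hf.1)
    (ae_of_all _ fun ζ => by rw [norm_mul]; gcongr; exact hB ζ)

theorem BddSupp.memLp_two {c : Plane → ℂ} (hc : BddSupp c) : MemLp c 2 volume := by
  obtain ⟨⟨hm, B, hB⟩, r, hr⟩ := hc
  have : MemLp (Set.indicator (Metric.closedBall (0 : Plane) r) fun _ => (B : ℂ)) 2 volume :=
    memLp_indicator_const 2 measurableSet_closedBall _ (Or.inr measure_closedBall_lt_top.ne)
  refine this.of_le hm.aestronglyMeasurable (ae_of_all _ fun ζ => ?_)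
  by_cases h : ζ ∈ Metric.closedBall (0 : Plane) r
  · rw [Set.indicator_of_mem h]
    exact (hB ζ).trans (by simpa using le_abs_self B)
  · rw [Set.indicator_of_notMem h, hr ζ (by simpa using h)]

theorem BddSupp.integrable_mul {c : Plane → ℂ} (hc : BddSupp c) {f : Plane → ℂ}
    (hf : MemLp f 2 volume) : Integrable (fun ζ => c ζ * f ζ) :=
  hc.memLp_two.integrable_mul hf

open Classical in
/-- Multiplication by a bounded symbol. -/
def mulOp (c : Plane → ℂ) : L2Plane →L[ℂ] L2Plane :=
  if h : BddSymbol c then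
    LinearMap.mkContinuous
      { toFun := fun f => (h.memLp_mul (Lp.memLp f)).toLp _
        map_add' := fun f g => by
          refine Lp.ext ?_
          filter_upwards [(h.memLp_mul (Lp.memLp (f + g))).coeFn_toLp,
            Lp.coeFn_add ((h.memLp_mul (Lp.memLp f)).toLp _) ((h.memLp_mul (Lp.memLp g)).toLp _),
            (h.memLp_mul (Lp.memLp f)).coeFn_toLp, (h.memLp_mul (Lp.memLp g)).coeFn_toLp,
            Lp.coeFn_add f g] with ζ h1 h2 h3 h4 h5
          rw [h1, h2, Pi.add_apply, h3, h4, h5, Pi.add_apply, mul_add]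
        map_smul' := fun a f => by
          refine Lp.ext ?_
          filter_upwards [(h.memLp_mul (Lp.memLp (a • f))).coeFn_toLp,
            Lp.coeFn_smul a ((h.memLp_mul (Lp.memLp f)).toLp _),
            (h.memLp_mul (Lp.memLp f)).coeFn_toLp, Lp.coeFn_smul a f] with ζ h1 h2 h3 h4
          rw [h1, RingHom.id_apply, h2, Pi.smul_apply, h3, h4, Pi.smul_apply, smul_eq_mul,
            smul_eq_mul]
          ring }
      h.2.choose fun f => by
        refine Lp.norm_le_mul_norm_of_ae_le_mul ?_
        filter_upwards [(h.memLp_mul (Lp.memLp f)).coeFn_toLp] with ζ h1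
        rw [LinearMap.coe_mk, AddHom.coe_mk, h1, norm_mul]
        gcongr
        exact h.2.choose_spec ζ
  else 0

theorem mulOp_ae {c : Plane → ℂ} (h : BddSymbol c) (f : L2Plane) :
    (mulOp c f : Plane → ℂ) =ᵐ[volume] fun ζ => c ζ * f ζ := by
  rw [mulOp, dif_pos h]
  exact (h.memLp_mul (Lp.memLp f)).coeFn_toLp

theorem mulOp_eq_of_ae {c : Plane → ℂ} (h : BddSymbol c) {f g : L2Plane}
    (hg : (g : Plane → ℂ) =ᵐ[volume] fun ζ => c ζ * f ζ) : mulOp c f = g :=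
  Lp.ext ((mulOp_ae h f).trans hg.symm)

theorem mulOp_mulOp {c d : Plane → ℂ} (hc : BddSymbol c) (hd : BddSymbol d) (f : L2Plane) :
    mulOp c (mulOp d f) = mulOp (fun ζ => c ζ * d ζ) f := by
  refine mulOp_eq_of_ae hc ?_ |>.trans rfl
  filter_upwards [mulOp_ae hd f, mulOp_ae (hc.mul hd) f] with ζ h1 h2
  rw [h1, h2, mul_assoc]

theorem norm_mulOp_le {c : Plane → ℂ} (hc : Measurable c) {B : ℝ} (hB : ∀ ζ, ‖c ζ‖ ≤ B)
    (f : L2Plane) : ‖mulOp c f‖ ≤ B * ‖f‖ := by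
  refine Lp.norm_le_mul_norm_of_ae_le_mul ?_
  filter_upwards [mulOp_ae ⟨hc, B, hB⟩ f] with ζ h1
  rw [h1, norm_mul]
  gcongr
  exact hB ζ

theorem inner_mulOp {c : Plane → ℂ} (hc : BddSymbol c) (f g : L2Plane) :
    inner ℂ f (mulOp c g) = inner ℂ (mulOp (fun ζ => (starRingEnd ℂ) (c ζ)) f) g := by
  rw [L2.inner_def, L2.inner_def]
  refine integral_congr_ae ?_
  filter_upwards [mulOp_ae hc g, mulOp_ae hc.conj f] with ζ h1 h2
  rw [h1, h2]
  simp only [RCLike.inner_apply, map_mul, Complex.conj_conj]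
  ring

/-! ### The inverse Fourier transform as a map into `L²` and `L⁴` -/

/-- The Fourier inversion on `L²`. -/
def fInv : L2Plane →L[ℂ] L2Plane :=
  ((Lp.fourierTransformₗᵢ Plane ℂ).symm : L2Plane →L[ℂ] L2Plane)

theorem fInv_apply (f : L2Plane) : fInv f = (𝓕⁻ f : L2Plane) := rfl

theorem norm_fInv (f : L2Plane) : ‖fInv f‖ = ‖f‖ :=
  LinearIsometryEquiv.norm_map _ _

theorem fInv_mulOp_ae {c : Plane → ℂ} (hc : BddSupp c) (f : L2Plane) :
    (fInv (mulOp c f) : Plane → ℂ) =ᵐ[volume] 𝓕⁻ (fun ζ => c ζ * f ζ) := by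
  have h := fourierInv_toLp_ae (hc.integrable_mul (Lp.memLp f)) (hc.1.memLp_mul (Lp.memLp f))
  have e : mulOp c f = (hc.1.memLp_mul (Lp.memLp f)).toLp _ :=
    mulOp_eq_of_ae hc.1 (MemLp.coeFn_toLp _)
  rw [fInv_apply, e]
  exact h

end

/-! ### Bessel potentials and the embedding of `H^s` in `L⁴`. -/

noncomputable section

/-- The symbol `⟨2πζ⟩^{-s}`. -/
def japSymbol (s : ℝ) (ζ : Plane) : ℂ := ((jap ((2 * Real.pi) • ζ) ^ (-s) : ℝ) : ℂ)

theorem norm_le_norm_two_pi_smul {E : Type*} [NormedAddCommGroup E] [NormedSpace ℝ E] (x : E) :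
    ‖x‖ ≤ ‖(2 * Real.pi) • x‖ := by
  rw [norm_smul, Real.norm_of_nonneg (by positivity)]
  have := Real.pi_gt_three
  nlinarith [norm_nonneg x]

theorem norm_japSymbol (s : ℝ) (ζ : Plane) :
    ‖japSymbol s ζ‖ = jap ((2 * Real.pi) • ζ) ^ (-s) := by
  rw [japSymbol, Complex.norm_real, Real.norm_of_nonneg (Real.rpow_nonneg (jap_pos _).le _)]

theorem norm_japSymbol_le {s : ℝ} (hs : 0 ≤ s) (ζ : Plane) : ‖japSymbol s ζ‖ ≤ jap ζ ^ (-s) := by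
  rw [norm_japSymbol]
  exact Real.rpow_le_rpow_of_nonpos (jap_pos _) (jap_le_jap (norm_le_norm_two_pi_smul ζ))
    (by linarith)

theorem measurable_japSymbol (s : ℝ) : Measurable (japSymbol s) := by
  unfold japSymbol
  exact Complex.measurable_ofReal.comp (by fun_prop)

theorem bddSymbol_japSymbol {s : ℝ} (hs : 0 ≤ s) : BddSymbol (japSymbol s) :=
  ⟨measurable_japSymbol s, 1, fun ζ => (norm_japSymbol_le hs ζ).trans
    (Real.rpow_le_one_of_one_le_of_nonpos (one_le_jap ζ) (by linarith))⟩

/-- By `(ab)² ≤ (a⁴ + b⁴)/2` the fibre integral of the squared kernel is at most `∫ ⟨y⟩^{-4s}`,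
which is finite in the plane because `4s > 2`. -/
theorem bilBound_jap_rpow {s : ℝ} (hs : 1 / 2 < s) :
    ∃ C : ℝ≥0∞, C < ⊤ ∧ BilBound (fun y z : Plane =>
      ENNReal.ofReal (jap y ^ (-s)) * ENNReal.ofReal (jap z ^ (-s))) C := by
  refine ⟨∫⁻ y : Plane, ENNReal.ofReal (jap y ^ (-(4 * s))),
    lintegral_jap_rpow_lt_top volume (by simp; linarith), BilBound.of_kernel (by fun_prop) fun x => ?_⟩
  have h4 : ∀ y : Plane, ENNReal.ofReal (jap y ^ (-s)) ^ 4 = ENNReal.ofReal (jap y ^ (-(4 * s))) := by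
    intro y
    rw [← ENNReal.ofReal_pow (Real.rpow_nonneg (jap_pos y).le _), ← Real.rpow_natCast,
      ← Real.rpow_mul (jap_pos y).le]
    congr 2; push_cast; ring
  have h1 : ∀ a b : ℝ≥0∞, (a * b) ^ 2 ≤ 2⁻¹ * (a ^ 4 + b ^ 4) := by
    intro a b
    rcases eq_or_ne a ⊤ with rfl | ha
    · simp
    rcases eq_or_ne b ⊤ with rfl | hb
    · simp
    lift a to NNReal using ha
    lift b to NNReal using hb
    have : (a * b) ^ 2 ≤ 2⁻¹ * (a ^ 4 + b ^ 4) := by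
      rw [← NNReal.coe_le_coe]; push_cast
      nlinarith [sq_nonneg ((a : ℝ) ^ 2 - (b : ℝ) ^ 2)]
    have h2 : ((2⁻¹ : NNReal) : ℝ≥0∞) = 2⁻¹ := by norm_num [ENNReal.coe_inv]
    rw [← h2]
    exact_mod_cast this
  calc ∫⁻ y, (ENNReal.ofReal (jap y ^ (-s)) * ENNReal.ofReal (jap (x - y) ^ (-s))) ^ 2
      ≤ ∫⁻ y, 2⁻¹ * (ENNReal.ofReal (jap y ^ (-(4 * s))) +
          ENNReal.ofReal (jap (x - y) ^ (-(4 * s)))) := by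
        gcongr with y
        rw [← h4, ← h4]; exact h1 _ _
    _ = 2⁻¹ * ((∫⁻ y : Plane, ENNReal.ofReal (jap y ^ (-(4 * s)))) +
          ∫⁻ y : Plane, ENNReal.ofReal (jap y ^ (-(4 * s)))) := by
        rw [lintegral_const_mul _ (by fun_prop), lintegral_add_left (by fun_prop),
          lintegral_sub_left_eq_self (fun y : Plane => ENNReal.ofReal (jap y ^ (-(4 * s)))) x]
    _ ≤ _ := by
        rw [← two_mul, ← mul_assoc, ENNReal.inv_mul_cancel (by norm_num) (by norm_num), one_mul]

/-- The inverse Fourier transform of `⟨2πζ⟩^{-s} h`. -/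
def besselL2 (s : ℝ) : L2Plane →L[ℂ] L2Plane := fInv ∘L mulOp (japSymbol s)

/-- The indicator of a set as a symbol. -/
def indSymbol (S : Set Plane) (ζ : Plane) : ℂ := S.indicator (fun _ => 1) ζ

theorem norm_indSymbol_le (S : Set Plane) (ζ : Plane) : ‖indSymbol S ζ‖ ≤ 1 := by
  unfold indSymbol
  by_cases h : ζ ∈ S <;> simp [h]

theorem measurable_indSymbol {S : Set Plane} (hS : MeasurableSet S) : Measurable (indSymbol S) :=
  measurable_const.indicator hS

theorem bddSymbol_indSymbol {S : Set Plane} (hS : MeasurableSet S) : BddSymbol (indSymbol S) :=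
  ⟨measurable_indSymbol hS, 1, norm_indSymbol_le S⟩

theorem bddSupp_indSymbol {S : Set Plane} (hS : MeasurableSet S) {r : ℝ}
    (h : ∀ ζ ∈ S, ‖ζ‖ ≤ r) : BddSupp (indSymbol S) :=
  ⟨bddSymbol_indSymbol hS, r, fun ζ hζ => by
    simp only [indSymbol, Set.indicator_apply_eq_zero]
    exact fun hm => absurd (h ζ hm) (not_le.2 hζ)⟩

theorem tendsto_mulOp_indSymbol {S : ℕ → Set Plane} (hS : ∀ n, MeasurableSet (S n))
    (h : ∀ ζ, ∀ᶠ n in atTop, ζ ∈ S n) (f : L2Plane) :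
    Tendsto (fun n => mulOp (indSymbol (S n)) f) atTop (𝓝 f) := by
  rw [tendsto_iff_dist_tendsto_zero]
  have key : Tendsto (fun n => ∫⁻ ζ, ‖(indSymbol (S n) ζ - 1) * f ζ‖ₑ ^ 2) atTop (𝓝 0) := by
    have h0 : ∫⁻ _ : Plane, (0 : ℝ≥0∞) = 0 := by simp
    rw [← h0]
    refine tendsto_lintegral_of_dominated_convergence' (fun ζ => (2 * ‖f ζ‖ₑ) ^ 2) (fun n => ?_)
      (fun n => ae_of_all _ fun ζ => ?_) ?_ (ae_of_all _ fun ζ => ?_)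
    · exact ((((measurable_indSymbol (hS n)).sub_const 1).aestronglyMeasurable.mul
        (Lp.aestronglyMeasurable f)).enorm).pow_const 2
    · dsimp only
      rw [enorm_mul]
      gcongr
      refine (enorm_sub_le).trans ?_
      have := norm_indSymbol_le (S n) ζ
      have h1 : ‖indSymbol (S n) ζ‖ₑ ≤ 1 := by
        rw [← ofReal_norm, ← ENNReal.ofReal_one]; exact ENNReal.ofReal_le_ofReal this
      refine (add_le_add_left h1 _).trans ?_
      rw [enorm_one]; norm_num
    · simp_rw [mul_pow]
      rw [lintegral_const_mul' _ _ (by norm_num)]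
      exact ENNReal.mul_ne_top (by norm_num) (lintegral_lt_top_of_memLp_two (Lp.memLp f)).ne
    · refine tendsto_const_nhds.congr' ?_
      filter_upwards [h ζ] with n hn
      simp [indSymbol, hn]
  have e : ∀ n, dist (mulOp (indSymbol (S n)) f) f =
      ((∫⁻ ζ, ‖(indSymbol (S n) ζ - 1) * f ζ‖ₑ ^ 2) ^ (1 / 2 : ℝ)).toReal := by
    intro n
    rw [dist_eq_norm]
    have : ∫⁻ ζ, ‖(indSymbol (S n) ζ - 1) * f ζ‖ₑ ^ 2 = ‖mulOp (indSymbol (S n)) f - f‖ₑ ^ 2 := by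
      rw [enorm_Lp_two_sq]
      refine lintegral_congr_ae ?_
      filter_upwards [mulOp_ae (bddSymbol_indSymbol (hS n)) f,
        Lp.coeFn_sub (mulOp (indSymbol (S n)) f) f] with ζ h1 h2
      rw [h2, Pi.sub_apply, h1, sub_mul, one_mul]
    rw [this, ← ENNReal.rpow_natCast, ← ENNReal.rpow_mul]
    norm_num
  simp_rw [e]
  have := (ENNReal.continuous_rpow_const (y := 1 / 2)).tendsto 0 |>.comp key
  rw [ENNReal.zero_rpow_of_pos (by norm_num)] at this
  exact (ENNReal.tendsto_toReal ENNReal.zero_ne_top).comp this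

theorem measurableSet_norm_le (r : ℝ) : MeasurableSet {ζ : Plane | ‖ζ‖ ≤ r} :=
  measurableSet_le (by fun_prop) (by fun_prop)

/-- The embedding `H^s ⊂ L⁴` for `s > 1/2`: the fourth power of the `L⁴` norm is the squared `L²`
norm of the square of the function, and Plancherel turns that square into a self-convolution bounded
by `bilBound_jap_rpow`. -/
theorem exists_eLpNorm_besselL2_le {s : ℝ} (hs : 1 / 2 < s) :
    ∃ C : NNReal, ∀ f : L2Plane, eLpNorm (besselL2 s f) 4 volume ≤ C * ‖f‖ₑ := by
  obtain ⟨C, hC, hb⟩ := bilBound_jap_rpow hs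
  have hJ := bddSymbol_japSymbol (s := s) (by linarith)
  set S : ℕ → Set Plane := fun n => {ζ | ‖ζ‖ ≤ n}
  have hS : ∀ n, MeasurableSet (S n) := fun n => measurableSet_norm_le n
  have hSs : ∀ n, BddSupp (indSymbol (S n)) := fun n => bddSupp_indSymbol (hS n) fun ζ h => h
  have key : ∀ f : L2Plane, ∀ n, eLpNorm (besselL2 s (mulOp (indSymbol (S n)) f)) 4 volume ≤
      C ^ (1 / 4 : ℝ) * ‖f‖ₑ := by
    intro f n
    set c : Plane → ℂ := fun ζ => japSymbol s ζ * indSymbol (S n) ζ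
    have hc : BddSupp c := BddSupp.mul_left hJ (hSs n)
    have hi := hc.integrable_mul (Lp.memLp f)
    obtain ⟨f', hf', hff'⟩ := (Lp.aestronglyMeasurable f)
    have e1 : ∫⁻ z, ‖besselL2 s (mulOp (indSymbol (S n)) f) z‖ₑ ^ 4 ≤ C * (‖f‖ₑ ^ 2) ^ 2 := by
      calc ∫⁻ z, ‖besselL2 s (mulOp (indSymbol (S n)) f) z‖ₑ ^ 4
          = ∫⁻ z, (‖𝓕⁻ (fun ζ => c ζ * f ζ) z‖ₑ * ‖𝓕⁻ (fun ζ => c ζ * f ζ) z‖ₑ) ^ 2 := by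
            refine lintegral_congr_ae ?_
            rw [besselL2, ContinuousLinearMap.comp_apply, mulOp_mulOp hJ (hSs n).1]
            filter_upwards [fInv_mulOp_ae hc f] with z h1
            rw [h1]; ring
        _ ≤ ∫⁻ x, (∫⁻ y, ‖c y * f y‖ₑ * ‖c (x - y) * f (x - y)‖ₑ) ^ 2 :=
            lintegral_enorm_sq_fourierInv_mul_le hi hi
        _ ≤ ∫⁻ x, (∫⁻ y, ENNReal.ofReal (jap y ^ (-s)) * ENNReal.ofReal (jap (x - y) ^ (-s)) *
              (‖f' y‖ₑ * ‖f' (x - y)‖ₑ)) ^ 2 := by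
            refine lintegral_mono fun x => pow_le_pow_left' (lintegral_mono_ae ?_) 2
            have h2 : ∀ᵐ y : Plane, f (x - y) = f' (x - y) :=
              (volume.measurePreserving_sub_left x).quasiMeasurePreserving.ae_eq_comp hff'
            filter_upwards [hff', h2] with y h1 h2
            rw [h1, h2, enorm_mul (c y), enorm_mul (c (x - y)), mul_mul_mul_comm]
            have hce : ∀ y, ‖c y‖ₑ ≤ ENNReal.ofReal (jap y ^ (-s)) := fun y => by
              rw [← ofReal_norm]
              refine ENNReal.ofReal_le_ofReal ?_
              rw [norm_mul]
              exact (mul_le_of_le_one_right (norm_nonneg _) (norm_indSymbol_le _ _)).trans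
                (norm_japSymbol_le (by linarith) y)
            exact mul_le_mul' (mul_le_mul' (hce _) (hce _)) le_rfl
        _ ≤ C * ((∫⁻ y, ‖f' y‖ₑ ^ 2) * ∫⁻ y, ‖f' y‖ₑ ^ 2) :=
            hb _ _ hf'.measurable.enorm hf'.measurable.enorm
        _ = C * (‖f‖ₑ ^ 2) ^ 2 := by
            have : ∫⁻ y, ‖f y‖ₑ ^ 2 = ∫⁻ y, ‖f' y‖ₑ ^ 2 :=
              lintegral_congr_ae (hff'.mono fun y hy => by simp only [hy])
            rw [enorm_Lp_two_sq, this, sq]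
    rw [eLpNorm_eq_lintegral_rpow_enorm_toReal (by norm_num) (by norm_num)]
    have e2 : (4 : ℝ≥0∞).toReal = ((4 : ℕ) : ℝ) := by norm_num
    simp_rw [e2, ENNReal.rpow_natCast]
    calc (∫⁻ z, ‖besselL2 s (mulOp (indSymbol (S n)) f) z‖ₑ ^ 4) ^ (1 / ((4 : ℕ) : ℝ))
        ≤ (C * (‖f‖ₑ ^ 2) ^ 2) ^ (1 / ((4 : ℕ) : ℝ)) := by gcongr
      _ = C ^ (1 / 4 : ℝ) * ‖f‖ₑ := by
          rw [ENNReal.mul_rpow_of_nonneg _ _ (by norm_num), ← pow_mul, ← ENNReal.rpow_natCast,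
            ← ENNReal.rpow_mul]
          norm_num
  refine ⟨(C ^ (1 / 4 : ℝ)).toNNReal, fun f => ?_⟩
  rw [ENNReal.coe_toNNReal (by finiteness)]
  -- The bound holds for bounded frequencies, where the integral formula for the transform is
  -- available. An almost everywhere convergent subsequence and Fatou's lemma extend it to all of
  -- `L²`.
  have ht : Tendsto (fun n => besselL2 s (mulOp (indSymbol (S n)) f)) atTop (𝓝 (besselL2 s f)) :=
    ((besselL2 s).continuous.tendsto f).comp (tendsto_mulOp_indSymbol hS (fun ζ => by
      obtain ⟨n, hn⟩ := exists_nat_ge ‖ζ‖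
      filter_upwards [eventually_ge_atTop n] with k hk
      exact hn.trans (by exact_mod_cast hk)) f)
  obtain ⟨φ, -, hφ⟩ := (tendstoInMeasure_of_tendsto_Lp ht).exists_seq_tendsto_ae
  refine (Lp.eLpNorm_lim_le_liminf_eLpNorm (fun n => Lp.aestronglyMeasurable _) _ hφ).trans ?_
  exact (liminf_le_liminf (Eventually.of_forall fun n => key f (φ n))).trans (by simp)

end

noncomputable section

/-! ### Products and the trilinear map -/

/-- Complex-valued `L⁴` functions on the plane. -/
abbrev L4Plane : Type := Lp ℂ 4 (volume : Measure Plane)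

/-- Complex-valued integrable functions on the plane. -/
abbrev L1Plane : Type := Lp ℂ 1 (volume : Measure Plane)

instance : Fact ((1 : ℝ≥0∞) ≤ 4) := ⟨by norm_num⟩

instance : ENNReal.HolderTriple 4 4 2 :=
  ⟨by rw [← ENNReal.toReal_eq_toReal_iff' (by finiteness) (by finiteness),
    ENNReal.toReal_add (by finiteness) (by finiteness)]; norm_num⟩

theorem memLp_four_besselL2 {s : ℝ} (hs : 1 / 2 < s) (f : L2Plane) :
    MemLp (besselL2 s f) 4 volume :=
  ⟨Lp.aestronglyMeasurable _, ((exists_eLpNorm_besselL2_le hs).choose_spec f).trans_lt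
    (by rw [← ofReal_norm]; finiteness)⟩

open Classical in
/-- The map `besselL2` as a map into `L⁴`. -/
def besselL4 (s : ℝ) : L2Plane →L[ℂ] L4Plane :=
  if hs : 1 / 2 < s then
    LinearMap.mkContinuous
      { toFun := fun f => (memLp_four_besselL2 hs f).toLp _
        map_add' := fun f g => by
          refine Lp.ext ?_
          have e := Lp.coeFn_add (besselL2 s f) (besselL2 s g)
          rw [← map_add] at e
          filter_upwards [(memLp_four_besselL2 hs (f + g)).coeFn_toLp,
            Lp.coeFn_add ((memLp_four_besselL2 hs f).toLp _) ((memLp_four_besselL2 hs g).toLp _),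
            (memLp_four_besselL2 hs f).coeFn_toLp, (memLp_four_besselL2 hs g).coeFn_toLp,
            e] with ζ h1 h2 h3 h4 h5
          rw [h1, h2, Pi.add_apply, h3, h4, h5, Pi.add_apply]
        map_smul' := fun a f => by
          refine Lp.ext ?_
          have e := Lp.coeFn_smul a (besselL2 s f)
          rw [← map_smul] at e
          filter_upwards [(memLp_four_besselL2 hs (a • f)).coeFn_toLp,
            Lp.coeFn_smul a ((memLp_four_besselL2 hs f).toLp _),
            (memLp_four_besselL2 hs f).coeFn_toLp, e] with ζ h1 h2 h3 h4
          rw [h1, RingHom.id_apply, h2, Pi.smul_apply, h3, h4, Pi.smul_apply] }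
      (exists_eLpNorm_besselL2_le hs).choose fun f => by
        have h := (exists_eLpNorm_besselL2_le hs).choose_spec f
        rw [LinearMap.coe_mk, AddHom.coe_mk, Lp.norm_toLp]
        refine (ENNReal.toReal_mono (by rw [← ofReal_norm]; finiteness) h).trans (le_of_eq ?_)
        rw [ENNReal.toReal_mul, ENNReal.coe_toReal, toReal_enorm]
  else 0

theorem besselL4_ae {s : ℝ} (hs : 1 / 2 < s) (f : L2Plane) :
    (besselL4 s f : Plane → ℂ) =ᵐ[volume] besselL2 s f := by
  rw [besselL4, dif_pos hs]
  exact (memLp_four_besselL2 hs f).coeFn_toLp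

/-- The product of two `L⁴` functions. -/
def mulL4 : L4Plane →L[ℂ] L4Plane →L[ℂ] L2Plane :=
  (ContinuousLinearMap.mul ℂ ℂ).holderL volume 4 4 2

theorem mulL4_ae (f g : L4Plane) : (mulL4 f g : Plane → ℂ) =ᵐ[volume] fun z => f z * g z :=
  (ContinuousLinearMap.mul ℂ ℂ).coeFn_holder f g

/-- The product of two `L²` functions. -/
def mulL2 : L2Plane →L[ℂ] L2Plane →L[ℂ] L1Plane :=
  (ContinuousLinearMap.mul ℂ ℂ).holderL volume 2 2 1

theorem mulL2_ae (f g : L2Plane) : (mulL2 f g : Plane → ℂ) =ᵐ[volume] fun z => f z * g z :=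
  (ContinuousLinearMap.mul ℂ ℂ).coeFn_holder f g

/-- The product of two functions given by their Bessel potentials. -/
def besselMul (s : ℝ) : L2Plane →L[ℂ] L2Plane →L[ℂ] L2Plane :=
  mulL4.bilinearComp (besselL4 s) (besselL4 s)

theorem besselMul_ae {s : ℝ} (hs : 1 / 2 < s) (f g : L2Plane) :
    (besselMul s f g : Plane → ℂ) =ᵐ[volume] fun z => besselL2 s f z * besselL2 s g z := by
  filter_upwards [mulL4_ae (besselL4 s f) (besselL4 s g), besselL4_ae hs f, besselL4_ae hs g]
    with z h1 h2 h3
  rw [← h2, ← h3, ← h1]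
  rfl

/-- The product of three functions given by their Bessel potentials. -/
def besselCube (s : ℝ) : L2Plane →L[ℂ] L2Plane →L[ℂ] L2Plane →L[ℂ] L1Plane :=
  (ContinuousLinearMap.compL ℂ L2Plane L2Plane (L2Plane →L[ℂ] L1Plane)
    (mulL2.bilinearComp (ContinuousLinearMap.id ℂ L2Plane) (besselL2 s))) ∘L besselMul s

theorem besselCube_apply (s : ℝ) (f g h : L2Plane) :
    besselCube s f g h = mulL2 (besselMul s f g) (besselL2 s h) := rfl

theorem besselCube_ae {s : ℝ} (hs : 1 / 2 < s) (f g h : L2Plane) :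
    (besselCube s f g h : Plane → ℂ) =ᵐ[volume]
      fun z => besselL2 s f z * besselL2 s g z * besselL2 s h z := by
  rw [besselCube_apply]
  filter_upwards [mulL2_ae (besselMul s f g) (besselL2 s h), besselMul_ae hs f g] with z h1 h2
  rw [h1, h2]

/-! ### Truncated Fourier transforms of integrable functions -/

theorem BddSupp.memLp_mul_fourier {κ : Plane → ℂ} (hκ : BddSupp κ) (g : L1Plane) :
    MemLp (fun ζ => κ ζ * 𝓕 (g : Plane → ℂ) ζ) 2 volume := by
  refine (hκ.memLp_two).of_le_mul (c := ‖g‖) (hκ.1.1.aestronglyMeasurable.mul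
    (continuous_fourier (L1.integrable_coeFn g)).aestronglyMeasurable) (ae_of_all _ fun ζ => ?_)
  rw [norm_mul, mul_comm, L1.norm_eq_integral_norm]
  gcongr
  exact VectorFourier.norm_fourierIntegral_le_integral_norm _ _ _ _ _

theorem norm_fourier_L1_le (g : L1Plane) (ζ : Plane) : ‖𝓕 (g : Plane → ℂ) ζ‖ ≤ ‖g‖ := by
  rw [L1.norm_eq_integral_norm]
  exact VectorFourier.norm_fourierIntegral_le_integral_norm _ _ _ _ _

theorem fourier_congr_ae {f g : Plane → ℂ} (h : f =ᵐ[volume] g) : 𝓕 f = 𝓕 g := by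
  ext ζ
  rw [Real.fourier_eq, Real.fourier_eq]
  exact integral_congr_ae (h.mono fun z hz => by simp only [hz])

theorem fourierInv_congr_ae {V : Type*} [NormedAddCommGroup V] [InnerProductSpace ℝ V]
    [FiniteDimensional ℝ V] [MeasurableSpace V] [BorelSpace V] {f g : V → ℂ}
    (h : f =ᵐ[volume] g) : 𝓕⁻ f = 𝓕⁻ g := by
  ext ζ
  rw [Real.fourierInv_eq, Real.fourierInv_eq]
  exact integral_congr_ae (h.mono fun z hz => by simp only [hz])

theorem fourier_L1_add (f g : L1Plane) (ζ : Plane) :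
    𝓕 ((f + g : L1Plane) : Plane → ℂ) ζ = 𝓕 (f : Plane → ℂ) ζ + 𝓕 (g : Plane → ℂ) ζ := by
  rw [fourier_congr_ae (Lp.coeFn_add f g)]
  exact congrFun (VectorFourier.fourierIntegral_add Real.continuous_fourierChar
    (by exact continuous_inner) (L1.integrable_coeFn f) (L1.integrable_coeFn g)) ζ

theorem fourier_L1_smul (a : ℂ) (f : L1Plane) (ζ : Plane) :
    𝓕 ((a • f : L1Plane) : Plane → ℂ) ζ = a * 𝓕 (f : Plane → ℂ) ζ := by
  rw [fourier_congr_ae (Lp.coeFn_smul a f)]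
  exact congrFun (VectorFourier.fourierIntegral_const_smul _ _ _ _ a) ζ

open Classical in
/-- The map `g ↦ κ 𝓕 g` from `L¹` to `L²`. -/
def truncFourier (κ : Plane → ℂ) : L1Plane →L[ℂ] L2Plane :=
  if h : BddSupp κ then
    LinearMap.mkContinuous
      { toFun := fun g => (h.memLp_mul_fourier g).toLp _
        map_add' := fun f g => by
          refine Lp.ext ?_
          filter_upwards [(h.memLp_mul_fourier (f + g)).coeFn_toLp,
            Lp.coeFn_add ((h.memLp_mul_fourier f).toLp _) ((h.memLp_mul_fourier g).toLp _),
            (h.memLp_mul_fourier f).coeFn_toLp,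
            (h.memLp_mul_fourier g).coeFn_toLp] with ζ h1 h2 h3 h4
          rw [h1, h2, Pi.add_apply, h3, h4, fourier_L1_add, mul_add]
        map_smul' := fun a f => by
          refine Lp.ext ?_
          filter_upwards [(h.memLp_mul_fourier (a • f)).coeFn_toLp,
            Lp.coeFn_smul a ((h.memLp_mul_fourier f).toLp _),
            (h.memLp_mul_fourier f).coeFn_toLp] with ζ h1 h2 h3
          rw [h1, RingHom.id_apply, h2, Pi.smul_apply, h3, fourier_L1_smul, smul_eq_mul]
          ring }
      ‖h.memLp_two.toLp κ‖ fun g => by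
        refine (Lp.norm_le_mul_norm_of_ae_le_mul (c := ‖g‖) (g := h.memLp_two.toLp κ) ?_).trans_eq
          (mul_comm _ _)
        filter_upwards [(h.memLp_mul_fourier g).coeFn_toLp, h.memLp_two.coeFn_toLp] with ζ h1 h2
        rw [LinearMap.coe_mk, AddHom.coe_mk, h1, h2, norm_mul, mul_comm]
        gcongr
        exact norm_fourier_L1_le g ζ
  else 0

theorem truncFourier_ae {κ : Plane → ℂ} (h : BddSupp κ) (g : L1Plane) :
    (truncFourier κ g : Plane → ℂ) =ᵐ[volume] fun ζ => κ ζ * 𝓕 (g : Plane → ℂ) ζ := by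
  rw [truncFourier, dif_pos h]
  exact (h.memLp_mul_fourier g).coeFn_toLp

theorem mulOp_truncFourier {c κ : Plane → ℂ} (hc : BddSymbol c) (h : BddSupp κ) (g : L1Plane) :
    mulOp c (truncFourier κ g) = truncFourier (fun ζ => c ζ * κ ζ) g := by
  refine mulOp_eq_of_ae hc ?_
  filter_upwards [truncFourier_ae h g, truncFourier_ae (BddSupp.mul_left hc h) g] with ζ h1 h2
  rw [h1, h2, mul_assoc]

/-- Parseval for an integrable `g`. It turns the frequency-side pairing with a cube into an integral
of a product of four functions in physical space. -/
theorem inner_truncFourier {κ : Plane → ℂ} (h : BddSupp κ) (k : L2Plane) (g : L1Plane) :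
    inner ℂ k (truncFourier κ g) =
      ∫ z, (starRingEnd ℂ) (fInv (mulOp (fun ζ => (starRingEnd ℂ) (κ ζ)) k) z) * g z := by
  have hi := h.conj.integrable_mul (Lp.memLp k)
  have hi' := (LipschitzWith.integrable_comp_iff_of_antilipschitz (g := starRingEnd ℂ)
    (by exact Complex.isometry_conj.lipschitz) (by exact Complex.isometry_conj.antilipschitz)
    (map_zero _)).2 hi
  have e1 : inner ℂ k (truncFourier κ g) = ∫ ζ, (starRingEnd ℂ) ((starRingEnd ℂ) (κ ζ) * k ζ) *
      𝓕 (g : Plane → ℂ) ζ := by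
    rw [L2.inner_def]
    refine integral_congr_ae ?_
    filter_upwards [truncFourier_ae h g] with ζ h1
    rw [h1, RCLike.inner_apply, map_mul, Complex.conj_conj]
    ring
  rw [e1]
  have e2 := integral_fourier_mul_flip hi' (L1.integrable_coeFn g)
  simp only [Function.comp_apply] at e2
  refine e2.symm.trans (integral_congr_ae ?_)
  filter_upwards [fInv_mulOp_ae h.conj k] with z h1
  rw [h1, conj_fourierInv]
  rfl

/-- If `g ∈ L²` this is Plancherel. If not, the right-hand side is infinite unless `B = 0`, in which
case the symbol vanishes. -/
theorem norm_truncFourier_le {κ : Plane → ℂ} (h : BddSupp κ) {B : ℝ} (hB : ∀ ζ, ‖κ ζ‖ ≤ B)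
    (g : L1Plane) : ‖truncFourier κ g‖ₑ ^ 2 ≤ ENNReal.ofReal B ^ 2 * ∫⁻ z, ‖g z‖ₑ ^ 2 := by
  have hB0 : 0 ≤ B := (norm_nonneg _).trans (hB 0)
  rcases eq_or_ne (∫⁻ z, ‖g z‖ₑ ^ 2) ⊤ with ht | ht
  · rcases hB0.eq_or_lt with h0 | h0
    · rw [enorm_Lp_two_sq]
      refine (lintegral_congr_ae (g := fun _ => 0) ?_).trans_le (by simp)
      filter_upwards [truncFourier_ae h g] with ζ h1
      have : κ ζ = 0 := norm_le_zero_iff.1 ((hB ζ).trans h0.ge)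
      rw [h1, this]; simp
    · rw [ht, ENNReal.mul_top (by simpa using h0)]
      exact le_top
  have hg : MemLp g 2 volume :=
    memLp_two_of_lintegral_lt_top (Lp.aestronglyMeasurable g) (lt_top_iff_ne_top.2 ht)
  have e : truncFourier κ g = mulOp κ (𝓕 (hg.toLp _ : L2Plane) : L2Plane) := by
    refine (mulOp_eq_of_ae h.1 ?_).symm
    filter_upwards [truncFourier_ae h g, fourier_toLp_ae (L1.integrable_coeFn g) hg] with ζ h1 h2
    rw [h1, h2]
  have h2 : ‖truncFourier κ g‖ ≤ B * ‖(hg.toLp _ : L2Plane)‖ := by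
    rw [e, ← Lp.norm_fourier_eq (hg.toLp _ : L2Plane)]
    exact norm_mulOp_le h.1.1 hB _
  rw [← lintegral_enorm_sq_toLp hg, ← enorm_Lp_two_sq, ← mul_pow]
  refine pow_le_pow_left' ?_ 2
  rw [← ofReal_norm, ← ofReal_norm, ← ENNReal.ofReal_mul hB0]
  exact ENNReal.ofReal_le_ofReal h2

/-! ### Frequency support of products -/

theorem memLp_two_conv {a₁ a₂ : Plane → ℂ} (h₁ : Integrable a₁) (h₂ : Integrable a₂)
    (h₃ : MemLp a₂ 2 volume) : MemLp (conv a₁ a₂) 2 volume := by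
  refine memLp_two_of_lintegral_lt_top (integrable_conv h₁ h₂).1 ?_
  obtain ⟨b₁, hb₁, e₁⟩ := h₁.1
  obtain ⟨b₂, hb₂, e₂⟩ := h₂.1
  have hm : Measurable (Function.uncurry fun y x : Plane => ‖b₁ y‖ₑ * ‖b₂ (x - y)‖ₑ) := by
    have := hb₁.measurable
    have := hb₂.measurable
    unfold Function.uncurry
    fun_prop
  calc ∫⁻ x, ‖conv a₁ a₂ x‖ₑ ^ 2 ≤ ∫⁻ x, (∫⁻ y, ‖b₁ y‖ₑ * ‖b₂ (x - y)‖ₑ) ^ 2 := by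
        refine lintegral_mono fun x => pow_le_pow_left' ((enorm_conv_le _ _ x).trans
          (lintegral_mono_ae ?_)) 2
        have h2 : ∀ᵐ y : Plane, a₂ (x - y) = b₂ (x - y) :=
          (volume.measurePreserving_sub_left x).quasiMeasurePreserving.ae_eq_comp e₂
        filter_upwards [e₁, h2] with y h1 h2
        rw [h1, h2]
    _ ≤ (∫⁻ y, (∫⁻ x, (‖b₁ y‖ₑ * ‖b₂ (x - y)‖ₑ) ^ 2) ^ (1 / 2 : ℝ)) ^ 2 :=
        lintegral_sq_lintegral_le volume volume hm
    _ = (∫⁻ y, ‖b₁ y‖ₑ * (∫⁻ x, ‖b₂ x‖ₑ ^ 2) ^ (1 / 2 : ℝ)) ^ 2 := by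
        congr 2; ext y
        simp_rw [mul_pow]
        rw [lintegral_const_mul' _ _ (by finiteness),
          lintegral_sub_right_eq_self (fun x => ‖b₂ x‖ₑ ^ 2) y,
          ENNReal.mul_rpow_of_nonneg _ _ (by norm_num), ← ENNReal.rpow_natCast, ← ENNReal.rpow_mul]
        norm_num
    _ < ⊤ := by
        have h4 : ∫⁻ x, ‖b₂ x‖ₑ ^ 2 < ⊤ := by
          have := lintegral_lt_top_of_memLp_two h₃
          rwa [lintegral_congr_ae (g := fun x => ‖b₂ x‖ₑ ^ 2)
            (e₂.mono fun x hx => by simp only [hx])] at this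
        have h5 : ∫⁻ y, ‖b₁ y‖ₑ < ⊤ := by
          have := h₁.2
          rw [hasFiniteIntegral_iff_enorm] at this
          rwa [lintegral_congr_ae (g := fun x => ‖b₁ x‖ₑ)
            (e₁.mono fun x hx => by simp only [hx])] at this
        rw [lintegral_mul_const _ hb₁.measurable.enorm]
        finiteness

theorem conv_eq_zero {a₁ a₂ : Plane → ℂ} {r₁ r₂ : ℝ} (h₁ : ∀ ζ, r₁ < ‖ζ‖ → a₁ ζ = 0)
    (h₂ : ∀ ζ, r₂ < ‖ζ‖ → a₂ ζ = 0) (x : Plane) (hx : r₁ + r₂ < ‖x‖) : conv a₁ a₂ x = 0 := by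
  refine integral_eq_zero_of_ae (ae_of_all _ fun y => ?_)
  rcases lt_or_ge r₁ ‖y‖ with h | h
  · simp [h₁ y h]
  · have : r₂ < ‖x - y‖ := by linarith [norm_sub_norm_le x y]
    simp [h₂ _ this]

theorem besselL2_mulOp_ae {s : ℝ} (hs : 0 ≤ s) {c : Plane → ℂ} (hc : BddSupp c) (f : L2Plane) :
    (besselL2 s (mulOp c f) : Plane → ℂ) =ᵐ[volume]
      𝓕⁻ (fun ζ => japSymbol s ζ * c ζ * f ζ) := by
  rw [besselL2, ContinuousLinearMap.comp_apply, mulOp_mulOp (bddSymbol_japSymbol hs) hc.1]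
  exact fInv_mulOp_ae (BddSupp.mul_left (bddSymbol_japSymbol hs) hc) f

/-- The cube is the inverse transform of a double convolution, whose support lies in the sum of the
three supports. Inversion holds almost everywhere, hence the form of the statement. -/
theorem fourier_besselCube_support {s : ℝ} (hs : 1 / 2 < s) {c₁ c₂ c₃ : Plane → ℂ}
    (h₁ : BddSymbol c₁) (h₂ : BddSymbol c₂) (h₃ : BddSymbol c₃) {r : ℝ}
    (k₁ : ∀ ζ, r < ‖ζ‖ → c₁ ζ = 0) (k₂ : ∀ ζ, r < ‖ζ‖ → c₂ ζ = 0)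
    (k₃ : ∀ ζ, r < ‖ζ‖ → c₃ ζ = 0) (f g h : L2Plane) :
    ∀ᵐ ζ, 3 * r < ‖ζ‖ → 𝓕 (besselCube s (mulOp c₁ f) (mulOp c₂ g) (mulOp c₃ h) : Plane → ℂ) ζ = 0 := by
  have hJ := bddSymbol_japSymbol (s := s) (by linarith)
  have d₁ : BddSupp c₁ := ⟨h₁, r, k₁⟩
  have d₂ : BddSupp c₂ := ⟨h₂, r, k₂⟩
  have d₃ : BddSupp c₃ := ⟨h₃, r, k₃⟩
  set A : Plane → ℂ := fun ζ => japSymbol s ζ * c₁ ζ * f ζ with hA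
  set B : Plane → ℂ := fun ζ => japSymbol s ζ * c₂ ζ * g ζ with hB
  set D : Plane → ℂ := fun ζ => japSymbol s ζ * c₃ ζ * h ζ with hD
  have iA : Integrable A := (BddSupp.mul_left hJ d₁).integrable_mul (Lp.memLp f)
  have iB : Integrable B := (BddSupp.mul_left hJ d₂).integrable_mul (Lp.memLp g)
  have iD : Integrable D := (BddSupp.mul_left hJ d₃).integrable_mul (Lp.memLp h)
  have mD : MemLp D 2 volume := (hJ.mul h₃).memLp_mul (Lp.memLp h)
  have e : (besselCube s (mulOp c₁ f) (mulOp c₂ g) (mulOp c₃ h) : Plane → ℂ) =ᵐ[volume]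
      𝓕⁻ (conv (conv A B) D) := by
    filter_upwards [besselCube_ae hs (mulOp c₁ f) (mulOp c₂ g) (mulOp c₃ h),
      besselL2_mulOp_ae (by linarith) d₁ f, besselL2_mulOp_ae (by linarith) d₂ g,
      besselL2_mulOp_ae (by linarith) d₃ h] with z h1 h2 h3 h4
    rw [h1, h2, h3, h4, fourierInv_conv (integrable_conv iA iB) iD, fourierInv_conv iA iB]
  have i3 : Integrable (𝓕⁻ (conv (conv A B) D)) := (integrable_congr e).1 (L1.integrable_coeFn _)
  have := fourier_fourierInv_ae (integrable_conv (integrable_conv iA iB) iD)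
    (memLp_two_conv (integrable_conv iA iB) iD mD) i3
  rw [fourier_congr_ae e]
  filter_upwards [this] with ζ h1 hζ
  rw [h1]
  refine conv_eq_zero (r₁ := r + r) (r₂ := r) (fun x hx => conv_eq_zero (r₁ := r) (r₂ := r) ?_ ?_ x hx)
    ?_ ζ (by linarith)
  · intro ζ hζ; simp [hA, k₁ ζ hζ]
  · intro ζ hζ; simp [hB, k₂ ζ hζ]
  · intro ζ hζ; simp [hD, k₃ ζ hζ]

end

noncomputable section

/-! ### Real-valued functions and Hermitian transforms -/

/-- The symmetry of the Fourier transforms of real-valued functions. -/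
def IsHermitian (k : L2Plane) : Prop :=
  ∀ᵐ ζ, k ζ = (starRingEnd ℂ) (k (-ζ))

theorem IsHermitian.fInv_im {k : L2Plane} (hk : IsHermitian k) :
    ∀ᵐ z, (fInv k z).im = 0 := by
  filter_upwards [fourierInv_conj_neg (g := k) (h := k) hk] with z hz
  exact Complex.conj_eq_iff_im.1 hz.symm

theorem isHermitian_fourier {u : L2Plane} (hu : ∀ᵐ z, (u z).im = 0) :
    IsHermitian (𝓕 u : L2Plane) := by
  have hn : MeasurePreserving (Neg.neg : Plane → Plane) volume volume :=
    Measure.measurePreserving_neg volume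
  have hm : MemLp (fun ζ : Plane => (starRingEnd ℂ) ((𝓕 u : L2Plane) (-ζ))) 2 volume :=
    ((Lp.memLp (𝓕 u : L2Plane)).comp_measurePreserving hn).star
  have h1 := fourierInv_conj_neg (g := (𝓕 u : L2Plane)) (h := hm.toLp _) hm.coeFn_toLp
  rw [FourierPair.fourierInv_fourier_eq] at h1
  have h2 : (𝓕⁻ (hm.toLp _ : L2Plane) : L2Plane) = u := by
    refine Lp.ext ?_
    filter_upwards [h1, hu] with z hz huz
    rw [hz, Complex.conj_eq_iff_im.2 huz]
  have h3 : (hm.toLp _ : L2Plane) = 𝓕 u := by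
    have := congrArg (fun f : L2Plane => (𝓕 f : L2Plane)) h2
    simpa only [FourierInvPair.fourier_fourierInv_eq] using this
  have h4 := hm.coeFn_toLp
  rw [h3] at h4
  exact h4

theorem IsHermitian.mulOp {k : L2Plane} (hk : IsHermitian k) {c : Plane → ℂ} (hc : BddSymbol c)
    (he : ∀ ζ, c ζ = (starRingEnd ℂ) (c (-ζ))) : IsHermitian (mulOp c k) := by
  have h1 : ∀ᵐ ζ : Plane, SymmetrizedMZK.mulOp c k (-ζ) = c (-ζ) * k (-ζ) :=
    (Measure.measurePreserving_neg (volume : Measure Plane)).quasiMeasurePreserving.ae_eq_comp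
      (mulOp_ae hc k)
  filter_upwards [hk, mulOp_ae hc k, h1] with ζ h1 h2 h3
  rw [h2, h3, map_mul, ← he, ← h1]

/-! ### Coordinates on space-time -/

/-- The first two coordinates of a point of space-time. -/
def planePart (p : SpaceTime) : Plane := !₂[p 0, p 1]

theorem continuous_planePart : Continuous planePart := by
  unfold planePart
  refine (PiLp.continuous_toLp 2 _).comp (continuous_pi fun i => ?_)
  fin_cases i <;> simp <;> fun_prop

theorem continuous_pt : Continuous fun q : Plane × ℝ => pt q.1 q.2 := by
  unfold pt
  refine (PiLp.continuous_toLp 2 _).comp (continuous_pi fun i => ?_)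
  fin_cases i <;> simp <;> fun_prop

@[fun_prop]
theorem measurable_planePart : Measurable planePart := continuous_planePart.measurable

@[simp] theorem planePart_pt (z : Plane) (t : ℝ) : planePart (pt z t) = z := by
  ext i; fin_cases i <;> rfl

@[simp] theorem pt_zero (z : Plane) (t : ℝ) : pt z t 0 = z 0 := rfl
@[simp] theorem pt_one (z : Plane) (t : ℝ) : pt z t 1 = z 1 := rfl
@[simp] theorem pt_two (z : Plane) (t : ℝ) : pt z t 2 = t := rfl

theorem pt_planePart (p : SpaceTime) : pt (planePart p) (p 2) = p := by
  ext i; fin_cases i <;> rfl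

theorem inner_pt (ζ z : Plane) (τ t : ℝ) :
    inner ℝ (pt ζ τ) (pt z t) = inner ℝ ζ z + τ * t := by
  simp only [PiLp.inner_apply, Fin.sum_univ_three, Fin.sum_univ_two, pt_zero, pt_one, pt_two,
    RCLike.inner_apply, conj_trivial]
  ring

/-- The identification of `Plane × ℝ` with space-time. -/
def ptEquiv : (Plane × ℝ) ≃ᵐ SpaceTime where
  toFun q := pt q.1 q.2
  invFun p := (planePart p, p 2)
  left_inv q := by simp
  right_inv p := pt_planePart p
  measurable_toFun := continuous_pt.measurable
  measurable_invFun := measurable_planePart.prodMk (by fun_prop)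

theorem ptEquiv_apply (q : Plane × ℝ) : ptEquiv q = pt q.1 q.2 := rfl

theorem measurePreserving_ptEquiv : MeasurePreserving ptEquiv := by
  have h1 := (PiLp.volume_preserving_toLp (Fin 3)).comp
    (((volume_preserving_piFinSuccAbove (fun _ : Fin 3 => ℝ) 2).symm).comp
      ((Measure.measurePreserving_swap (μ := (volume : Measure (Fin 2 → ℝ)))
        (ν := (volume : Measure ℝ))).comp
        ((PiLp.volume_preserving_ofLp (Fin 2)).prod (MeasurePreserving.id (volume : Measure ℝ)))))
  have e : (ptEquiv : Plane × ℝ → SpaceTime) = WithLp.toLp 2 ∘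
      (MeasurableEquiv.piFinSuccAbove (fun _ : Fin 3 => ℝ) 2).symm ∘ Prod.swap ∘
        Prod.map WithLp.ofLp id := by
    ext q i
    fin_cases i <;> rfl
  rw [e]
  exact h1

/-- The identification of space-time with `ℝ × ℝ × ℝ`. -/
def coordEquiv : SpaceTime ≃ᵐ ℝ × ℝ × ℝ where
  toFun p := (p 0, p 1, p 2)
  invFun q := !₂[q.1, q.2.1, q.2.2]
  left_inv p := by ext i; fin_cases i <;> rfl
  right_inv q := rfl
  measurable_toFun := by
    change Measurable fun p : SpaceTime => (p 0, p 1, p 2)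
    fun_prop
  measurable_invFun := by
    refine Continuous.measurable ((PiLp.continuous_toLp 2 _).comp (continuous_pi fun i => ?_))
    fin_cases i <;> simp <;> fun_prop

theorem coordEquiv_apply (p : SpaceTime) : coordEquiv p = (p 0, p 1, p 2) := rfl

theorem measurePreserving_coordEquiv : MeasurePreserving coordEquiv := by
  have h1 := ((MeasurePreserving.id (volume : Measure ℝ)).prod
    (volume_preserving_finTwoArrow ℝ)).comp
      ((volume_preserving_piFinSuccAbove (fun _ : Fin 3 => ℝ) 0).comp
        (PiLp.volume_preserving_ofLp (Fin 3)))
  exact h1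

theorem lintegral_spaceTime {F : SpaceTime → ℝ≥0∞} (hF : AEMeasurable F) :
    ∫⁻ p, F p = ∫⁻ t : ℝ, ∫⁻ z : Plane, F (pt z t) := by
  rw [← measurePreserving_ptEquiv.lintegral_comp_emb ptEquiv.measurableEmbedding]
  exact lintegral_prod_symm _ (hF.comp_quasiMeasurePreserving
    measurePreserving_ptEquiv.quasiMeasurePreserving)

theorem lintegral_spaceTime' {F : SpaceTime → ℝ≥0∞} (hF : AEMeasurable F) :
    ∫⁻ p, F p = ∫⁻ z : Plane, ∫⁻ t : ℝ, F (pt z t) := by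
  rw [← measurePreserving_ptEquiv.lintegral_comp_emb ptEquiv.measurableEmbedding]
  exact lintegral_prod _ (hF.comp_quasiMeasurePreserving
    measurePreserving_ptEquiv.quasiMeasurePreserving)

theorem integrable_spaceTime_iff {F : SpaceTime → ℂ} :
    Integrable (fun q : Plane × ℝ => F (pt q.1 q.2)) ↔ Integrable F :=
  measurePreserving_ptEquiv.integrable_comp_emb ptEquiv.measurableEmbedding

theorem integral_spaceTime {F : SpaceTime → ℂ} (hF : Integrable F) :
    ∫ p, F p = ∫ z : Plane, ∫ t : ℝ, F (pt z t) := by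
  rw [← measurePreserving_ptEquiv.integral_comp ptEquiv.measurableEmbedding]
  exact integral_prod _ (integrable_spaceTime_iff.2 hF)

theorem integral_spaceTime_symm {F : SpaceTime → ℂ} (hF : Integrable F) :
    ∫ p, F p = ∫ t : ℝ, ∫ z : Plane, F (pt z t) := by
  rw [← measurePreserving_ptEquiv.integral_comp ptEquiv.measurableEmbedding]
  exact integral_prod_symm _ (integrable_spaceTime_iff.2 hF)

end

noncomputable section

/-! ### Bourgain norms on the Fourier side -/

/-- The weight `⟨ζ⟩ ⟨τ - 4π² (ξ³ + η³)⟩^b`. -/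
def stWeight (b : ℝ) (p : SpaceTime) : ℝ :=
  jap (planePart p) * jap (p 2 - disp (4 * Real.pi ^ 2) (p 0) (p 1)) ^ b

theorem stWeight_pos (b : ℝ) (p : SpaceTime) : 0 < stWeight b p :=
  mul_pos (jap_pos _) (Real.rpow_pos_of_pos (jap_pos _) _)

@[fun_prop]
theorem measurable_stWeight (b : ℝ) : Measurable (stWeight b) := by
  unfold stWeight; fun_prop

/-- The square of the weighted norm. -/
def bourgainSq (b : ℝ) (G : SpaceTime → ℂ) : ℝ≥0∞ :=
  ∫⁻ p, (ENNReal.ofReal (stWeight b p) * ‖G p‖ₑ) ^ 2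

theorem norm_planePart_sq (p : SpaceTime) : ‖planePart p‖ ^ 2 = p 0 ^ 2 + p 1 ^ 2 := by
  rw [EuclideanSpace.real_norm_sq_eq, Fin.sum_univ_two]; rfl

theorem jap_planePart (p : SpaceTime) : jap (planePart p) = br (p 0) (p 1) := by
  rw [jap, br, norm_planePart_sq, add_assoc]

/-- Substituting `2πp` gives `2πτ - (2π)³(ξ³+η³) = 2π(τ - 4π²(ξ³+η³))`, which is why the coefficient
of the dispersion is `4π²` from here on. The remaining factors `2π` only increase the brackets. -/
theorem stWeight_le_bourgainWeight {b : ℝ} (hb : 0 ≤ b) (p : SpaceTime) :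
    stWeight b p ≤ bourgainWeight 1 b ((2 * Real.pi) • p) := by
  unfold stWeight bourgainWeight
  have h1 : (!₂[((2 * Real.pi) • p) 0, ((2 * Real.pi) • p) 1] : Plane) =
      (2 * Real.pi) • planePart p := by
    ext i; fin_cases i <;> rfl
  have h2 : ((2 * Real.pi) • p) 2 - (((2 * Real.pi) • p) 0 ^ 3 + ((2 * Real.pi) • p) 1 ^ 3) =
      (2 * Real.pi) • (p 2 - disp (4 * Real.pi ^ 2) (p 0) (p 1)) := by
    simp only [PiLp.smul_apply, smul_eq_mul, disp]; ring
  rw [h1, h2, Real.rpow_one]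
  exact mul_le_mul (jap_le_jap (norm_le_norm_two_pi_smul _))
    (Real.rpow_le_rpow (jap_pos _).le (jap_le_jap (norm_le_norm_two_pi_smul _)) hb)
    (Real.rpow_nonneg (jap_pos _).le _) (jap_pos _).le

/-- The dilation multiplies the integral by `(2π)³ ≥ 1`; only the inequality is used. -/
theorem lintegral_le_lintegral_comp_smul {F : SpaceTime → ℝ≥0∞} :
    ∫⁻ p, F p ≤ ∫⁻ p, F ((2 * Real.pi)⁻¹ • p) := by
  have hπ := Real.pi_gt_three
  have h0 : (2 * Real.pi)⁻¹ ≠ 0 := by positivity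
  have hm := Measure.map_addHaar_smul (volume : Measure SpaceTime) h0
  have e := lintegral_map_equiv (μ := (volume : Measure SpaceTime)) F
    (Homeomorph.smulOfNeZero _ h0).toMeasurableEquiv
  have e' : Measure.map (Homeomorph.smulOfNeZero (α := SpaceTime) _ h0).toMeasurableEquiv
    (volume : Measure SpaceTime) = Measure.map (fun p => (2 * Real.pi)⁻¹ • p) volume := rfl
  rw [e', hm, lintegral_smul_measure] at e
  change _ ≤ ∫⁻ p, F ((Homeomorph.smulOfNeZero _ h0).toMeasurableEquiv p)
  rw [← e, smul_eq_mul]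
  refine le_mul_of_one_le_left' ?_
  rw [← ENNReal.ofReal_one]
  refine ENNReal.ofReal_le_ofReal ?_
  rw [inv_pow, inv_inv, abs_of_pos (by positivity)]
  exact one_le_pow₀ (by linarith)

theorem bourgainSq_le {b : ℝ} (hb : 0 ≤ b) (g : SpaceTime → ℂ) :
    bourgainSq b g ≤ eLpNorm (fun p => (bourgainWeight 1 b p : ℂ) * g ((2 * Real.pi)⁻¹ • p))
      2 volume ^ 2 := by
  rw [eLpNorm_eq_lintegral_rpow_enorm_toReal (by norm_num) (by norm_num), ← ENNReal.rpow_natCast,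
    ← ENNReal.rpow_mul]
  have e : (1 / (2 : ℝ≥0∞).toReal * ((2 : ℕ) : ℝ)) = 1 := by norm_num
  rw [e, ENNReal.rpow_one]
  calc bourgainSq b g ≤ ∫⁻ p, ‖(bourgainWeight 1 b ((2 * Real.pi) • p) : ℂ) * g p‖ₑ ^ 2 := by
        unfold bourgainSq
        gcongr with p
        rw [enorm_mul]
        gcongr
        rw [← ofReal_norm, Complex.norm_real]
        exact ENNReal.ofReal_le_ofReal ((stWeight_le_bourgainWeight hb p).trans (le_abs_self _))
    _ ≤ _ := lintegral_le_lintegral_comp_smul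
    _ = _ := lintegral_congr fun p => by
        rw [smul_smul, mul_inv_cancel₀ (by positivity), one_smul]
        norm_num

/-- Measurability of `g` is not assumed. It follows on each ball from the integrability of `φ g` for
a bump function `φ` equal to 1 there. -/
theorem FourierIsFunction.aestronglyMeasurable {v : 𝓢'(SpaceTime, ℂ)} {g : SpaceTime → ℂ}
    (h : FourierIsFunction v g) : AEStronglyMeasurable g volume := by
  have key : ∀ n : ℕ, AEStronglyMeasurable g (volume.restrict (Metric.ball (0 : SpaceTime) (n + 1))) := by
    intro n
    let β : ContDiffBump (0 : SpaceTime) := ⟨n + 1, n + 2, by positivity, by linarith⟩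
    have hi := ((h (schwartzOfReal β β.contDiff β.hasCompactSupport)).1.1).restrict
      (s := Metric.ball (0 : SpaceTime) (n + 1))
    refine hi.congr ?_
    filter_upwards [ae_restrict_mem measurableSet_ball] with p hp
    rw [schwartzOfReal_apply, β.one_of_mem_closedBall (Metric.ball_subset_closedBall hp)]
    simp
  have hU : (⋃ n : ℕ, Metric.ball (0 : SpaceTime) (n + 1)) = Set.univ := by
    refine Set.eq_univ_of_forall fun p => Set.mem_iUnion.2 ?_
    obtain ⟨n, hn⟩ := exists_nat_ge ‖p‖
    exact ⟨n, by simpa using lt_of_le_of_lt hn (by linarith)⟩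
  rw [← Measure.restrict_univ (μ := volume), ← hU]
  exact (aestronglyMeasurable_iUnion_iff).2 key

/-- Cauchy–Schwarz against the weight. At fixed `ζ` the inverse squared modulation weight has an
integral over `τ` that does not depend on `ζ`. -/
theorem lintegral_enorm_symbol_mul_le {b : ℝ} {G : SpaceTime → ℂ}
    (hG : AEStronglyMeasurable G) {c : Plane → ℂ} (hc : Measurable c) :
    ∫⁻ p, ‖c (planePart p) * G p‖ₑ ≤
      ((∫⁻ x : ℝ, ENNReal.ofReal (jap x ^ (-(2 * b)))) *
        ∫⁻ ζ, ‖c ζ‖ₑ ^ 2 * ENNReal.ofReal (jap ζ ^ (-2 : ℝ))) ^ (1 / 2 : ℝ) *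
        bourgainSq b G ^ (1 / 2 : ℝ) := by
  have e : ∀ p, ‖c (planePart p) * G p‖ₑ = ‖c (planePart p)‖ₑ * ENNReal.ofReal (stWeight b p)⁻¹ *
      (ENNReal.ofReal (stWeight b p) * ‖G p‖ₑ) := by
    intro p
    rw [enorm_mul, mul_assoc, ← mul_assoc (ENNReal.ofReal _), ← ENNReal.ofReal_mul
      (by have := stWeight_pos b p; positivity), inv_mul_cancel₀ (stWeight_pos b p).ne',
      ENNReal.ofReal_one, one_mul]
  have hm : Measurable fun p : SpaceTime =>
      ‖c (planePart p)‖ₑ * ENNReal.ofReal (stWeight b p)⁻¹ := by fun_prop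
  simp_rw [e]
  refine (lintegral_mul_le_sqrt _ hm.aemeasurable
    (AEMeasurable.mul (by fun_prop) hG.enorm)).trans ?_
  refine mul_le_mul_left (le_of_eq ?_) _
  congr 1
  rw [lintegral_spaceTime' (hm.pow_const 2).aemeasurable]
  have e2 : ∀ ζ : Plane, ∀ τ : ℝ, (‖c (planePart (pt ζ τ))‖ₑ *
      ENNReal.ofReal (stWeight b (pt ζ τ))⁻¹) ^ 2 =
      ‖c ζ‖ₑ ^ 2 * ENNReal.ofReal (jap ζ ^ (-2 : ℝ)) * ENNReal.ofReal (jap (τ -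
        disp (4 * Real.pi ^ 2) (ζ 0) (ζ 1)) ^ (-(2 * b))) := by
    intro ζ τ
    rw [planePart_pt, mul_pow, mul_assoc, ← ENNReal.ofReal_pow
      (by have := stWeight_pos b (pt ζ τ); positivity), ← ENNReal.ofReal_mul
      (Real.rpow_nonneg (jap_pos _).le _)]
    congr 2
    simp only [stWeight, planePart_pt, pt_two, pt_zero, pt_one]
    rw [mul_inv, mul_pow, ← Real.rpow_neg (jap_pos _).le, ← Real.rpow_natCast (_ ^ (-b)),
      ← Real.rpow_mul (jap_pos _).le, Real.rpow_neg (jap_pos _).le 2, inv_pow]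
    norm_num
    left; ring_nf
  simp_rw [e2]
  have e3 : ∀ ζ : Plane, ∫⁻ τ : ℝ, ‖c ζ‖ₑ ^ 2 * ENNReal.ofReal (jap ζ ^ (-2 : ℝ)) *
      ENNReal.ofReal (jap (τ - disp (4 * Real.pi ^ 2) (ζ 0) (ζ 1)) ^ (-(2 * b))) =
      (∫⁻ x : ℝ, ENNReal.ofReal (jap x ^ (-(2 * b)))) *
        (‖c ζ‖ₑ ^ 2 * ENNReal.ofReal (jap ζ ^ (-2 : ℝ))) := by
    intro ζ
    rw [lintegral_const_mul _ (by fun_prop), lintegral_sub_right_eq_self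
      (fun x => ENNReal.ofReal (jap x ^ (-(2 * b)))), mul_comm]
  simp_rw [e3]
  rw [lintegral_const_mul _ (by fun_prop)]

/-! ### Dyadic shells -/

/-- The dyadic shell `2^j ≤ ⟨ζ⟩ < 2^{j+1}`. -/
def shell (j : ℕ) : Set Plane := {ζ | 2 ^ j ≤ jap ζ ∧ jap ζ < 2 ^ (j + 1)}

theorem measurableSet_shell (j : ℕ) : MeasurableSet (shell j) :=
  (measurableSet_le (f := fun _ : Plane => (2 : ℝ) ^ j) (by fun_prop) measurable_jap).inter
    (measurableSet_lt (g := fun _ : Plane => (2 : ℝ) ^ (j + 1)) measurable_jap (by fun_prop))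

theorem norm_le_of_mem_shell {j : ℕ} {ζ : Plane} (h : ζ ∈ shell j) : ‖ζ‖ ≤ 2 ^ (j + 1) :=
  (norm_le_jap ζ).trans h.2.le

/-- Measurable symbols supported in a shell and bounded by `A`. -/
structure ShellSymbol (j : ℕ) (A : ℝ) (c : Plane → ℂ) : Prop where
  measurable : Measurable c
  norm_le : ∀ ζ, ‖c ζ‖ ≤ A
  eq_zero : ∀ ζ, ζ ∉ shell j → c ζ = 0

theorem ShellSymbol.nonneg {j : ℕ} {A : ℝ} {c : Plane → ℂ} (h : ShellSymbol j A c) : 0 ≤ A :=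
  (norm_nonneg _).trans (h.norm_le 0)

theorem ShellSymbol.bddSupp {j : ℕ} {A : ℝ} {c : Plane → ℂ} (h : ShellSymbol j A c) : BddSupp c :=
  ⟨⟨h.measurable, A, h.norm_le⟩, 2 ^ (j + 1), fun ζ hζ => h.eq_zero ζ fun hm =>
    absurd (norm_le_of_mem_shell hm) (not_le.2 hζ)⟩

theorem ShellSymbol.enorm_sq_mul_le {j : ℕ} {A : ℝ} {c : Plane → ℂ} (h : ShellSymbol j A c)
    (ζ : Plane) : ‖c ζ‖ₑ ^ 2 * ENNReal.ofReal (jap ζ ^ (-2 : ℝ)) ≤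
      (Metric.closedBall (0 : Plane) (2 ^ (j + 1))).indicator
        (fun _ => ENNReal.ofReal (A * (2 ^ j)⁻¹) ^ 2) ζ := by
  by_cases hζ : ζ ∈ shell j
  · rw [Set.indicator_of_mem (by simpa using norm_le_of_mem_shell hζ)]
    rw [← ofReal_norm, ← ENNReal.ofReal_pow (norm_nonneg _), ← ENNReal.ofReal_mul (by positivity),
      ← ENNReal.ofReal_pow (by have := h.nonneg; positivity)]
    refine ENNReal.ofReal_le_ofReal ?_
    have h1 : jap ζ ^ (-2 : ℝ) ≤ ((2 ^ j)⁻¹) ^ 2 := by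
      rw [Real.rpow_neg (jap_pos ζ).le, inv_pow]
      norm_num
      gcongr
      exact hζ.1
    rw [mul_pow]
    have h2 := pow_le_pow_left₀ (norm_nonneg _) (h.norm_le ζ) 2
    exact mul_le_mul h2 h1 (Real.rpow_nonneg (jap_pos ζ).le _) (by positivity)
  · rw [h.eq_zero ζ hζ]; simp

/-- Since the `L¹` norm of the transform bounds the sup norm, this is the embedding of shell pieces
of `X_{1,b}` in `L^∞`. In two dimensions the area of the shell, of order `4^j`, exactly compensates
the square of the weight, so no power of `2^j` is lost. -/
theorem exists_lintegral_enorm_shell_le {b : ℝ} (hb : 1 / 2 < b) :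
    ∃ C : ℝ, 0 ≤ C ∧ ∀ {G : SpaceTime → ℂ}, AEStronglyMeasurable G → ∀ {j : ℕ} {A : ℝ}
      {c : Plane → ℂ}, ShellSymbol j A c →
      ∫⁻ p, ‖c (planePart p) * G p‖ₑ ≤ ENNReal.ofReal (C * A) * bourgainSq b G ^ (1 / 2 : ℝ) := by
  set Ψ := ∫⁻ x : ℝ, ENNReal.ofReal (jap x ^ (-(2 * b)))
  have hΨ : Ψ < ⊤ := lintegral_modulation_lt_top hb
  set D := (Ψ * (4 * volume (Metric.closedBall (0 : Plane) 1))) ^ (1 / 2 : ℝ) with hD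
  have hDt : D ≠ ⊤ := by
    have : volume (Metric.closedBall (0 : Plane) 1) < ⊤ := measure_closedBall_lt_top
    finiteness
  refine ⟨D.toReal, by positivity, fun {G} hG j A c h => ?_⟩
  refine (lintegral_enorm_symbol_mul_le (b := b) hG h.measurable).trans ?_
  gcongr
  rw [ENNReal.ofReal_mul (by positivity), ENNReal.ofReal_toReal hDt]
  have h1 : ∫⁻ ζ, ‖c ζ‖ₑ ^ 2 * ENNReal.ofReal (jap ζ ^ (-2 : ℝ)) ≤
      4 * volume (Metric.closedBall (0 : Plane) 1) * ENNReal.ofReal A ^ 2 := by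
    refine (lintegral_mono h.enorm_sq_mul_le).trans (le_of_eq ?_)
    rw [lintegral_indicator_const measurableSet_closedBall,
      Measure.addHaar_closedBall _ _ (by positivity), Measure.addHaar_closedBall _ _ zero_le_one]
    rw [← ENNReal.ofReal_pow (by have := h.nonneg; positivity), ← ENNReal.ofReal_pow h.nonneg,
      ← mul_assoc, ← mul_assoc, ← ENNReal.ofReal_mul (by have := h.nonneg; positivity)]
    have e4 : (4 : ℝ≥0∞) = ENNReal.ofReal 4 := by norm_num
    rw [e4, ← ENNReal.ofReal_mul (by norm_num), mul_right_comm, ← ENNReal.ofReal_mul (by positivity)]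
    congr 2
    simp only [finrank_euclideanSpace, Fintype.card_fin]
    field_simp
    ring
  calc (Ψ * ∫⁻ ζ, ‖c ζ‖ₑ ^ 2 * ENNReal.ofReal (jap ζ ^ (-2 : ℝ))) ^ (1 / 2 : ℝ)
      ≤ (Ψ * (4 * volume (Metric.closedBall (0 : Plane) 1) * ENNReal.ofReal A ^ 2)) ^
          (1 / 2 : ℝ) := by gcongr
    _ = D * ENNReal.ofReal A := by
        rw [← mul_assoc, ENNReal.mul_rpow_of_nonneg _ _ (by norm_num), hD]
        congr 1
        rw [← ENNReal.rpow_natCast, ← ENNReal.rpow_mul]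
        norm_num

/-- The function on space-time with the Fourier transform `c G`. -/
def stPiece (c : Plane → ℂ) (G : SpaceTime → ℂ) : SpaceTime → ℂ :=
  𝓕⁻ fun p => c (planePart p) * G p

theorem ShellSymbol.integrable {b : ℝ} (hb : 1 / 2 < b) {G : SpaceTime → ℂ}
    (hG : AEStronglyMeasurable G) (hX : bourgainSq b G < ⊤) {j : ℕ} {A : ℝ} {c : Plane → ℂ}
    (h : ShellSymbol j A c) : Integrable fun p => c (planePart p) * G p := by
  refine ⟨(h.measurable.comp measurable_planePart).aestronglyMeasurable.mul hG, ?_⟩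
  rw [hasFiniteIntegral_iff_enorm]
  obtain ⟨C, -, hC⟩ := exists_lintegral_enorm_shell_le hb
  exact (hC hG h).trans_lt (by finiteness)

theorem ShellSymbol.enorm_mul_le {b : ℝ} {G : SpaceTime → ℂ} {j : ℕ} {A : ℝ} {c : Plane → ℂ}
    (h : ShellSymbol j A c) (p : SpaceTime) : ‖c (planePart p) * G p‖ₑ ≤
      ENNReal.ofReal A * ENNReal.ofReal (stWeight b p)⁻¹ *
        (ENNReal.ofReal (stWeight b p) * ‖G p‖ₑ) := by
  rw [enorm_mul, mul_assoc, ← mul_assoc (ENNReal.ofReal (stWeight b p)⁻¹), ← ENNReal.ofReal_mul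
    (by have := stWeight_pos b p; positivity), inv_mul_cancel₀ (stWeight_pos b p).ne',
    ENNReal.ofReal_one, one_mul]
  gcongr
  rw [← ofReal_norm]
  exact ENNReal.ofReal_le_ofReal (h.norm_le _)

/-- The bilinear smoothing estimate for dyadic pieces. -/
theorem exists_lintegral_stPiece_mul_le {b e : ℝ} (hb : 1 / 2 < b) (he : 0 < e) (he2 : e ≤ 2) :
    ∃ C : ℝ, 0 ≤ C ∧ ∀ {G : SpaceTime → ℂ}, AEStronglyMeasurable G → bourgainSq b G < ⊤ →
      ∀ {j₁ j₂ : ℕ} {A₁ A₂ : ℝ} {c₁ c₂ : Plane → ℂ}, ShellSymbol j₁ A₁ c₁ →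
      ShellSymbol j₂ A₂ c₂ →
      ∫⁻ p, (‖stPiece c₁ G p‖ₑ * ‖stPiece c₂ G p‖ₑ) ^ 2 ≤
        (ENNReal.ofReal (C * A₁ * A₂ * (2 ^ (max j₁ j₂)) ^ (-(2 - e))) * bourgainSq b G) ^ 2 := by
  have hκ : 1 ≤ 4 * Real.pi ^ 2 := by nlinarith [Real.pi_gt_three]
  obtain ⟨C, hC, hB⟩ := bilBound_smoothing hκ hb he
  have hB' := hB.comp_equiv coordEquiv measurePreserving_coordEquiv fun x y => rfl
  refine ⟨(C ^ (1 / 2 : ℝ)).toReal, by positivity, fun {G} hG hX j₁ j₂ A₁ A₂ c₁ c₂ h₁ h₂ => ?_⟩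
  have hA₁ := h₁.nonneg
  have hA₂ := h₂.nonneg
  refine (lintegral_enorm_sq_fourierInv_mul_le (h₁.integrable hb hG hX)
    (h₂.integrable hb hG hX)).trans ?_
  obtain ⟨G', hG', hGG⟩ := hG
  set F : SpaceTime → ℝ≥0∞ := fun p => ENNReal.ofReal (stWeight b p) * ‖G' p‖ₑ with hF
  have hFm : Measurable F := by have := hG'.measurable; fun_prop
  set L : ℝ≥0∞ := ENNReal.ofReal (A₁ * A₂ * (2 ^ (max j₁ j₂)) ^ (-(2 - e))) with hL
  have hpt : ∀ y z : SpaceTime, ‖c₁ (planePart y) * G' y‖ₑ * ‖c₂ (planePart z) * G' z‖ₑ ≤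
      L * (stKernel (4 * Real.pi ^ 2) b (smoothingSymbol e) (coordEquiv y) (coordEquiv z) *
        (F y * F z)) := by
    intro y z
    by_cases hy : planePart y ∈ shell j₁
    swap
    · rw [h₁.eq_zero _ hy]; simp
    by_cases hz : planePart z ∈ shell j₂
    swap
    · rw [h₂.eq_zero _ hz]; simp
    refine (mul_le_mul' (h₁.enorm_mul_le (b := b) y) (h₂.enorm_mul_le (b := b) z)).trans ?_
    rw [mul_mul_mul_comm, ← mul_assoc L]
    refine mul_le_mul_left ?_ _
    simp only [stKernel, coordEquiv_apply, smoothingSymbol, ← jap_planePart, hL]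
    set m : ℝ := max (jap (planePart y)) (jap (planePart z)) with hm
    have hm0 : 0 < m := lt_max_of_lt_left (jap_pos _)
    have p1 := jap_pos (planePart y)
    have p2 := jap_pos (planePart z)
    have p3 := jap_pos (y.ofLp 2 - disp (4 * Real.pi ^ 2) (y.ofLp 0) (y.ofLp 1))
    have p4 := jap_pos (z.ofLp 2 - disp (4 * Real.pi ^ 2) (z.ofLp 0) (z.ofLp 1))
    have w1 := stWeight_pos b y
    have w2 := stWeight_pos b z
    rw [← ENNReal.ofReal_mul hA₁, ← ENNReal.ofReal_mul hA₂, ← ENNReal.ofReal_mul (by positivity),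
      ← ENNReal.ofReal_mul (by positivity), ← ENNReal.ofReal_mul (by positivity),
      ← ENNReal.ofReal_mul (by positivity)]
    refine ENNReal.ofReal_le_ofReal ?_
    have hmj : (2 : ℝ) ^ max j₁ j₂ ≤ m := by
      rcases max_cases j₁ j₂ with ⟨h, _⟩ | ⟨h, _⟩ <;> rw [h]
      · exact hy.1.trans (le_max_left _ _)
      · exact hz.1.trans (le_max_right _ _)
    -- On the two shells the larger bracket is at least `2^{max(j₁,j₂)}`, so the power in
    -- `smoothingSymbol` can be divided out as a numerical gain.
    have h5 : 1 ≤ (2 ^ max j₁ j₂ : ℝ) ^ (-(2 - e)) * m ^ (2 - e) := by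
      rw [Real.rpow_neg (by positivity), ← div_eq_inv_mul, one_le_div (by positivity)]
      exact Real.rpow_le_rpow (by positivity) hmj (by linarith)
    simp only [stWeight, Real.rpow_neg p3.le, Real.rpow_neg p4.le, mul_inv]
    set X₁ := (jap (planePart y))⁻¹
    set X₂ := (jap (planePart z))⁻¹
    set Y₁ := (jap (y.ofLp 2 - disp (4 * Real.pi ^ 2) (y.ofLp 0) (y.ofLp 1)) ^ b)⁻¹
    set Y₂ := (jap (z.ofLp 2 - disp (4 * Real.pi ^ 2) (z.ofLp 0) (z.ofLp 1)) ^ b)⁻¹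
    have : 0 ≤ A₁ * A₂ * (X₁ * X₂ * (Y₁ * Y₂)) := by positivity
    calc A₁ * (X₁ * Y₁) * (A₂ * (X₂ * Y₂)) = 1 * (A₁ * A₂ * (X₁ * X₂ * (Y₁ * Y₂))) := by ring
      _ ≤ (2 ^ max j₁ j₂ : ℝ) ^ (-(2 - e)) * m ^ (2 - e) * (A₁ * A₂ * (X₁ * X₂ * (Y₁ * Y₂))) := by
          gcongr
      _ = _ := by ring
  have hXe : bourgainSq b G = ∫⁻ p, F p ^ 2 :=
    lintegral_congr_ae (hGG.mono fun p hp => by simp only [hF, hp])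
  calc ∫⁻ x, (∫⁻ y, ‖c₁ (planePart y) * G y‖ₑ * ‖c₂ (planePart (x - y)) * G (x - y)‖ₑ) ^ 2
      ≤ ∫⁻ x, (∫⁻ y, L * (stKernel (4 * Real.pi ^ 2) b (smoothingSymbol e) (coordEquiv y)
          (coordEquiv (x - y)) * (F y * F (x - y)))) ^ 2 := by
        refine lintegral_mono fun x => pow_le_pow_left' (lintegral_mono_ae ?_) 2
        have h2 : ∀ᵐ y : SpaceTime, G (x - y) = G' (x - y) :=
          (volume.measurePreserving_sub_left x).quasiMeasurePreserving.ae_eq_comp hGG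
        filter_upwards [hGG, h2] with y h1 h2
        rw [h1, h2]
        exact hpt _ _
    _ = L ^ 2 * ∫⁻ x, (∫⁻ y, (stKernel (4 * Real.pi ^ 2) b (smoothingSymbol e) (coordEquiv y)
          (coordEquiv (x - y)) * (F y * F (x - y)))) ^ 2 := by
        rw [← lintegral_const_mul' _ _ (by finiteness)]
        refine lintegral_congr fun x => ?_
        rw [lintegral_const_mul' _ _ (by finiteness), mul_pow]
    _ ≤ L ^ 2 * (C * ((∫⁻ y, F y ^ 2) * ∫⁻ y, F y ^ 2)) := by
        gcongr
        exact hB' F F hFm hFm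
    _ = _ := by
        rw [← hXe, mul_assoc, mul_assoc, ← mul_assoc A₁, ENNReal.ofReal_mul (by positivity),
          ENNReal.ofReal_toReal (by finiteness), mul_pow, mul_pow, ennreal_sqrt_sq]
        ring

end

noncomputable section

/-! ### Time slices -/

theorem fourierInv_real_apply (f : ℝ → ℂ) (t : ℝ) :
    𝓕⁻ f t = ∫ τ, Real.fourierChar (τ * t) • f τ := by
  rw [Real.fourierInv_eq]
  refine integral_congr_ae (ae_of_all _ fun τ => ?_)
  simp [mul_comm]

theorem integrable_fourierChar_inner_smul {V : Type*} [NormedAddCommGroup V]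
    [InnerProductSpace ℝ V] [FiniteDimensional ℝ V] [MeasurableSpace V] [BorelSpace V] {F : V → ℂ}
    (hF : Integrable F) (w : V) : Integrable fun p => Real.fourierChar (inner ℝ p w) • F p := by
  refine hF.mono (AEStronglyMeasurable.smul ?_ hF.1) (ae_of_all _ fun p => by
    rw [Circle.norm_smul])
  have h : Continuous fun p : V => Real.fourierChar (inner ℝ p w) :=
    Real.continuous_fourierChar.comp (continuous_id.inner continuous_const)
  exact (continuous_subtype_val.comp h).aestronglyMeasurable

theorem fourierInv_pt {F : SpaceTime → ℂ} (hF : Integrable F) (z : Plane) (t : ℝ) :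
    𝓕⁻ F (pt z t) = 𝓕⁻ (fun ζ => 𝓕⁻ (fun τ => F (pt ζ τ)) t) z := by
  have hi : Integrable fun p : SpaceTime => Real.fourierChar (inner ℝ p (pt z t)) • F p :=
    integrable_fourierChar_inner_smul hF _
  rw [Real.fourierInv_eq, integral_spaceTime hi, Real.fourierInv_eq]
  refine integral_congr_ae (ae_of_all _ fun ζ => ?_)
  dsimp only
  rw [fourierInv_real_apply, Circle.smul_def, ← integral_smul]
  refine integral_congr_ae (ae_of_all _ fun τ => ?_)
  dsimp only
  rw [inner_pt, AddChar.map_add_eq_mul, mul_smul, Circle.smul_def]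

/-- The inverse Fourier transform in time. -/
def timeSlice (G : SpaceTime → ℂ) (t : ℝ) (ζ : Plane) : ℂ := 𝓕⁻ (fun τ => G (pt ζ τ)) t

theorem stPiece_pt {c : Plane → ℂ} {G : SpaceTime → ℂ}
    (hi : Integrable fun p => c (planePart p) * G p) (z : Plane) (t : ℝ) :
    stPiece c G (pt z t) = 𝓕⁻ (fun ζ => c ζ * timeSlice G t ζ) z := by
  rw [stPiece, fourierInv_pt hi]
  refine congrArg (fun f : Plane → ℂ => 𝓕⁻ f z) (funext fun ζ => ?_)
  simp only [planePart_pt, timeSlice, fourierInv_real_apply]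
  rw [← integral_const_mul]
  refine integral_congr_ae (ae_of_all _ fun τ => ?_)
  simp only [Circle.smul_def, smul_eq_mul]
  ring

theorem enorm_timeSlice_le (G : SpaceTime → ℂ) (t : ℝ) (ζ : Plane) :
    ‖timeSlice G t ζ‖ₑ ≤ ∫⁻ τ, ‖G (pt ζ τ)‖ₑ :=
  enorm_fourierInv_le _ _

theorem aestronglyMeasurable_timeSlice {G : SpaceTime → ℂ} (hG : AEStronglyMeasurable G) (t : ℝ) :
    AEStronglyMeasurable (timeSlice G t) := by
  have h1 : AEStronglyMeasurable (fun q : Plane × ℝ => Real.fourierChar (q.2 * t) • G (pt q.1 q.2))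
      (volume.prod volume) := by
    refine AEStronglyMeasurable.smul ?_ (hG.comp_quasiMeasurePreserving
      measurePreserving_ptEquiv.quasiMeasurePreserving)
    have h : Continuous fun q : Plane × ℝ => Real.fourierChar (q.2 * t) :=
      Real.continuous_fourierChar.comp (continuous_snd.mul continuous_const)
    exact (continuous_subtype_val.comp h).aestronglyMeasurable
  have := h1.integral_prod_right'
  refine this.congr (ae_of_all _ fun ζ => ?_)
  simp only [timeSlice, fourierInv_real_apply]

/-- Cauchy–Schwarz in `τ` with `b > 1/2`: functions in the Bourgain space have time slices in `L²`.
-/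
theorem lintegral_timeSlice_lt_top {b : ℝ} (hb : 1 / 2 < b) {G : SpaceTime → ℂ}
    (hG : AEStronglyMeasurable G) (hX : bourgainSq b G < ⊤) :
    ∫⁻ ζ, (∫⁻ τ, ‖G (pt ζ τ)‖ₑ) ^ 2 < ⊤ := by
  set Ψ := ∫⁻ x : ℝ, ENNReal.ofReal (jap x ^ (-(2 * b)))
  have hΨ : Ψ < ⊤ := lintegral_modulation_lt_top hb
  obtain ⟨G', hG', e⟩ := hG
  have e1 : ∀ᵐ ζ : Plane, ∀ᵐ τ : ℝ, G (pt ζ τ) = G' (pt ζ τ) :=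
    Measure.ae_ae_of_ae_prod
      (measurePreserving_ptEquiv.quasiMeasurePreserving.ae_eq_comp e)
  have hw : ∀ ζ : Plane, ∀ τ : ℝ, ‖G' (pt ζ τ)‖ₑ ≤ ENNReal.ofReal (jap (τ -
      disp (4 * Real.pi ^ 2) (ζ 0) (ζ 1)) ^ (-b)) * (ENNReal.ofReal (stWeight b (pt ζ τ)) *
        ‖G' (pt ζ τ)‖ₑ) := by
    intro ζ τ
    rw [← mul_assoc, ← ENNReal.ofReal_mul (Real.rpow_nonneg (jap_pos _).le _)]
    refine le_mul_of_one_le_left' ?_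
    rw [← ENNReal.ofReal_one]
    refine ENNReal.ofReal_le_ofReal ?_
    simp only [stWeight, pt_two, pt_zero, pt_one]
    rw [mul_left_comm, ← Real.rpow_add (jap_pos _)]
    simpa using one_le_jap _
  have hpt : Measurable fun q : Plane × ℝ => pt q.1 q.2 := continuous_pt.measurable
  have hm : ∀ ζ : Plane, Measurable fun τ : ℝ => pt ζ τ := fun ζ =>
    hpt.comp measurable_prodMk_left
  have hG'm := hG'.measurable
  calc ∫⁻ ζ, (∫⁻ τ, ‖G (pt ζ τ)‖ₑ) ^ 2
      ≤ ∫⁻ ζ, Ψ * ∫⁻ τ, (ENNReal.ofReal (stWeight b (pt ζ τ)) * ‖G' (pt ζ τ)‖ₑ) ^ 2 := by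
        refine lintegral_mono_ae ?_
        filter_upwards [e1] with ζ h1
        rw [lintegral_congr_ae (g := fun τ => ‖G' (pt ζ τ)‖ₑ) (h1.mono fun τ h => by simp only [h])]
        refine (pow_le_pow_left' (lintegral_mono (hw ζ)) 2).trans ?_
        have := hm ζ
        refine (sq_lintegral_mul_le _ (by fun_prop) (by fun_prop)).trans (le_of_eq ?_)
        congr 1
        simp_rw [ofReal_jap_rpow_sq]
        exact lintegral_sub_right_eq_self (fun x : ℝ => ENNReal.ofReal (jap x ^ (-(2 * b)))) _
    _ = Ψ * bourgainSq b G := by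
        have h2 : bourgainSq b G = bourgainSq b G' :=
          lintegral_congr_ae (e.mono fun p hp => by simp only [hp])
        rw [lintegral_const_mul _ (Measurable.lintegral_prod_right' (f := fun q : Plane × ℝ =>
            (ENNReal.ofReal (stWeight b (pt q.1 q.2)) * ‖G' (pt q.1 q.2)‖ₑ) ^ 2) (by fun_prop)),
          h2, bourgainSq, lintegral_spaceTime' (by fun_prop)]
    _ < ⊤ := by finiteness

theorem memLp_timeSlice {b : ℝ} (hb : 1 / 2 < b) {G : SpaceTime → ℂ}
    (hG : AEStronglyMeasurable G) (hX : bourgainSq b G < ⊤) (t : ℝ) :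
    MemLp (timeSlice G t) 2 volume :=
  memLp_two_of_lintegral_lt_top (aestronglyMeasurable_timeSlice hG t)
    ((lintegral_mono fun ζ => pow_le_pow_left' (enorm_timeSlice_le G t ζ) 2).trans_lt
      (lintegral_timeSlice_lt_top hb hG hX))

theorem integrable_symbol_mul {b : ℝ} (hb : 1 / 2 < b) {G : SpaceTime → ℂ}
    (hG : AEStronglyMeasurable G) (hX : bourgainSq b G < ⊤) {c : Plane → ℂ} (hc : Measurable c)
    (hc2 : MemLp c 2 volume) : Integrable fun p => c (planePart p) * G p := by
  refine ⟨(hc.comp measurable_planePart).aestronglyMeasurable.mul hG, ?_⟩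
  rw [hasFiniteIntegral_iff_enorm]
  refine (lintegral_enorm_symbol_mul_le (b := b) hG hc).trans_lt ?_
  have h1 := lintegral_modulation_lt_top hb
  have h2 : ∫⁻ ζ, ‖c ζ‖ₑ ^ 2 * ENNReal.ofReal (jap ζ ^ (-2 : ℝ)) < ⊤ := by
    refine (lintegral_mono fun ζ => mul_le_of_le_one_right' ?_).trans_lt
      (lintegral_lt_top_of_memLp_two hc2)
    rw [← ENNReal.ofReal_one]
    exact ENNReal.ofReal_le_ofReal
      (Real.rpow_le_one_of_one_le_of_nonpos (one_le_jap ζ) (by norm_num))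
  finiteness

/-- Pairings of the time slices are inverse transforms in time of integrable functions, hence
continuous in `t`. This is what allows statements at every single time. -/
theorem integral_mul_timeSlice {b : ℝ} (hb : 1 / 2 < b) {G : SpaceTime → ℂ}
    (hG : AEStronglyMeasurable G) (hX : bourgainSq b G < ⊤) {c : Plane → ℂ} (hc : Measurable c)
    (hc2 : MemLp c 2 volume) (t : ℝ) :
    ∫ ζ, c ζ * timeSlice G t ζ = 𝓕⁻ (fun τ => ∫ ζ, c ζ * G (pt ζ τ)) t := by
  have hi := integrable_symbol_mul hb hG hX hc hc2
  -- At `z = 0` the inverse spatial transform is the plain integral over `ζ`.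
  have h0 := stPiece_pt hi 0 t
  have e1 : 𝓕⁻ (fun ζ => c ζ * timeSlice G t ζ) 0 = ∫ ζ, c ζ * timeSlice G t ζ := by
    rw [Real.fourierInv_eq]; simp
  rw [← e1, ← h0, stPiece, Real.fourierInv_eq, integral_spaceTime_symm
    (integrable_fourierChar_inner_smul hi _), fourierInv_real_apply]
  refine integral_congr_ae (ae_of_all _ fun τ => ?_)
  dsimp only
  rw [Circle.smul_def, ← integral_smul]
  refine integral_congr_ae (ae_of_all _ fun ζ => ?_)
  simp only [← Circle.smul_def, inner_pt, planePart_pt, inner_zero_right, zero_add]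

theorem integrable_integral_symbol_mul {c : Plane → ℂ} {G : SpaceTime → ℂ}
    (hi : Integrable fun p => c (planePart p) * G p) :
    Integrable fun τ : ℝ => ∫ ζ, c ζ * G (pt ζ τ) := by
  have := (integrable_spaceTime_iff.2 hi).swap.integral_prod_left
  simpa using this

end

noncomputable section

/-! ### Identification of an extension with the curve -/

/-- The tensor product `ψ(t) χ(z)`. -/
def tensorFun (ψ : ℝ → ℝ) (χ : Plane → ℝ) (p : SpaceTime) : ℝ := ψ (p 2) * χ (planePart p)

theorem contDiff_planePart : ContDiff ℝ ∞ planePart := by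
  unfold planePart
  refine (PiLp.contDiff_toLp (𝕜 := ℝ) (p := 2)).comp (contDiff_pi.2 fun i => ?_)
  fin_cases i <;> simp <;> fun_prop

theorem contDiff_tensorFun {ψ : ℝ → ℝ} {χ : Plane → ℝ} (hψ : ContDiff ℝ ∞ ψ)
    (hχ : ContDiff ℝ ∞ χ) : ContDiff ℝ ∞ (tensorFun ψ χ) :=
  (hψ.comp (by fun_prop)).mul (hχ.comp contDiff_planePart)

theorem tsupport_tensorFun_subset (ψ : ℝ → ℝ) (χ : Plane → ℝ) :
    tsupport (tensorFun ψ χ) ⊆ ptEquiv '' (tsupport χ ×ˢ tsupport ψ) := by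
  have hpre : ptEquiv '' (tsupport χ ×ˢ tsupport ψ) =
      {p : SpaceTime | planePart p ∈ tsupport χ ∧ p 2 ∈ tsupport ψ} := by
    ext p
    constructor
    · rintro ⟨q, hq, rfl⟩
      simpa [ptEquiv_apply] using hq
    · intro hp
      exact ⟨(planePart p, p 2), hp, pt_planePart p⟩
  rw [hpre]
  refine closure_minimal (fun p hp => ?_) ?_
  · rw [Function.mem_support, tensorFun, mul_ne_zero_iff] at hp
    exact ⟨subset_tsupport _ hp.2, subset_tsupport _ hp.1⟩
  · exact ((isClosed_tsupport χ).preimage continuous_planePart).inter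
      ((isClosed_tsupport ψ).preimage (by fun_prop : Continuous fun p : SpaceTime => p 2))

theorem hasCompactSupport_tensorFun {ψ : ℝ → ℝ} {χ : Plane → ℝ} (hψ : HasCompactSupport ψ)
    (hχ : HasCompactSupport χ) : HasCompactSupport (tensorFun ψ χ) :=
  ((IsCompact.prod hχ hψ).image continuous_pt).of_isClosed_subset (isClosed_tsupport _)
    (tsupport_tensorFun_subset ψ χ)

theorem tsupport_tensorFun_subset_Ioo {ψ : ℝ → ℝ} (χ : Plane → ℝ) {T : ℝ}
    (h : tsupport ψ ⊆ Set.Ioo 0 T) :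
    tsupport (tensorFun ψ χ) ⊆ {p | 0 < p 2 ∧ p 2 < T} := by
  refine (tsupport_tensorFun_subset ψ χ).trans ?_
  rintro _ ⟨q, hq, rfl⟩
  exact h hq.2

theorem tensorFun_pt (ψ : ℝ → ℝ) (χ : Plane → ℝ) (z : Plane) (t : ℝ) :
    tensorFun ψ χ (pt z t) = ψ t * χ z := by
  rw [tensorFun, planePart_pt, pt_two]

theorem fourierInv_tensorFun_pt {ψ : ℝ → ℝ} {χ : Plane → ℝ}
    (hi : Integrable fun p => ((tensorFun ψ χ p : ℝ) : ℂ)) (ζ : Plane) (τ : ℝ) :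
    𝓕⁻ (fun p => ((tensorFun ψ χ p : ℝ) : ℂ)) (pt ζ τ) =
      𝓕⁻ (fun z => (χ z : ℂ)) ζ * 𝓕⁻ (fun t => (ψ t : ℂ)) τ := by
  rw [fourierInv_pt hi]
  simp only [tensorFun_pt, Complex.ofReal_mul]
  rw [Real.fourierInv_eq, Real.fourierInv_eq (fun z => (χ z : ℂ)), ← integral_mul_const]
  refine integral_congr_ae (ae_of_all _ fun z => ?_)
  simp only [fourierInv_real_apply, Circle.smul_def, smul_eq_mul]
  simp only [mul_assoc, ← integral_const_mul]
  refine integral_congr_ae (ae_of_all _ fun t => ?_)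
  simp only
  ring

theorem integral_mul_eq_inner (χ : 𝓢(Plane, ℂ)) (f : L2Plane) :
    ∫ z, χ z * f z = inner ℂ ((χ.memLp 2 volume).star.toLp _ : L2Plane) f := by
  rw [L2.inner_def]
  refine integral_congr_ae ?_
  filter_upwards [(χ.memLp 2 volume).star.coeFn_toLp] with z hz
  rw [hz, RCLike.inner_apply, Pi.star_apply, RCLike.star_def, Complex.conj_conj, mul_comm]

theorem continuousOn_integral_mul {w : ℝ → L2Plane} {S : Set ℝ} (hw : ContinuousOn w S)
    (χ : 𝓢(Plane, ℂ)) : ContinuousOn (fun t => ∫ z, χ z * w t z) S := by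
  simp_rw [integral_mul_eq_inner]
  exact continuousOn_const.inner hw

theorem eqOn_of_integral_mul_eq {T : ℝ} {A B : ℝ → ℂ} (hA : ContinuousOn A (Set.Ioo 0 T))
    (hB : ContinuousOn B (Set.Ioo 0 T))
    (h : ∀ ψ : ℝ → ℝ, ContDiff ℝ ∞ ψ → HasCompactSupport ψ → tsupport ψ ⊆ Set.Ioo 0 T →
      ∫ t, (ψ t : ℂ) * A t = ∫ t, (ψ t : ℂ) * B t) : Set.EqOn A B (Set.Ioo 0 T) := by
  have hi : ∀ {D : ℝ → ℂ}, ContinuousOn D (Set.Ioo 0 T) → ∀ ψ : ℝ → ℝ, ContDiff ℝ ∞ ψ →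
      HasCompactSupport ψ → tsupport ψ ⊆ Set.Ioo 0 T → Integrable fun t => (ψ t : ℂ) * D t := by
    intro D hD ψ h1 h2 h3
    have hc : Continuous fun t => (ψ t : ℂ) * D t := by
      rw [continuous_iff_continuousAt]
      intro t
      by_cases ht : t ∈ tsupport ψ
      · exact (Complex.continuous_ofReal.comp h1.continuous).continuousAt.mul
          (hD.continuousAt (isOpen_Ioo.mem_nhds (h3 ht)))
      · have : (fun t => (ψ t : ℂ) * D t) =ᶠ[𝓝 t] fun _ => 0 := by
          filter_upwards [(notMem_tsupport_iff_eventuallyEq.1 ht)] with x hx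
          rw [hx]; simp
        exact continuousAt_const.congr this.symm
    refine hc.integrable_of_hasCompactSupport ?_
    exact (h2.comp_left (g := fun y : ℝ => (y : ℂ)) Complex.ofReal_zero).mul_right
  have h0 : ∀ᵐ t, t ∈ Set.Ioo 0 T → A t - B t = 0 := by
    refine isOpen_Ioo.ae_eq_zero_of_integral_contDiff_smul_eq_zero
      ((hA.sub hB).locallyIntegrableOn measurableSet_Ioo) fun ψ h1 h2 h3 => ?_
    simp only [Complex.real_smul, mul_sub]
    rw [integral_sub (hi hA ψ h1 h2 h3) (hi hB ψ h1 h2 h3), h ψ h1 h2 h3, sub_self]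
  have h1 : A =ᵐ[volume.restrict (Set.Ioo 0 T)] B := by
    rw [Filter.EventuallyEq, ae_restrict_iff' measurableSet_Ioo]
    filter_upwards [h0] with t ht hm
    exact sub_eq_zero.1 (ht hm)
  exact Measure.eqOn_open_of_ae_eq h1 isOpen_Ioo hA hB

theorem ae_eq_of_integral_test {f g : L2Plane}
    (h : ∀ χ : Plane → ℝ, ∀ (h1 : ContDiff ℝ ∞ χ) (h2 : HasCompactSupport χ),
      ∫ z, schwartzOfReal χ h1 h2 z * f z = ∫ z, schwartzOfReal χ h1 h2 z * g z) : f = g := by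
  refine Lp.ext (ae_eq_of_integral_contDiff_smul_eq (locallyIntegrable_Lp_two _)
    (locallyIntegrable_Lp_two _) fun χ h1 h2 => ?_)
  simpa only [schwartzOfReal_apply, Complex.real_smul] using h χ h1 h2

/-- Testing with `ψ(t) χ(z)`, `ψ` supported in `(0,T)`, shows that the pairings of the two curves
with `χ` agree as distributions in time. Both pairings are continuous in `t`, so they agree at every
time and not only almost everywhere. -/
theorem timeSlice_eq_fourier {b : ℝ} (hb : 1 / 2 < b) {v : 𝓢'(SpaceTime, ℂ)} {G : SpaceTime → ℂ}
    (hv : FourierIsFunction v G) (hX : bourgainSq b G < ⊤) {T : ℝ} {w : ℝ → L2Plane}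
    (hw : ContinuousOn w (Set.Ioo 0 T)) (hvw : AgreeOn T v w) {t : ℝ} (ht : t ∈ Set.Ioo 0 T) :
    timeSlice G t =ᵐ[volume] (𝓕 (w t) : L2Plane) := by
  have hG := hv.aestronglyMeasurable
  have hm := fun t => memLp_timeSlice hb hG hX t
  suffices h : (𝓕⁻ ((hm t).toLp _ : L2Plane) : L2Plane) = w t by
    have h2 := congrArg (fun f : L2Plane => (𝓕 f : L2Plane)) h
    simp only [FourierInvPair.fourier_fourierInv_eq] at h2
    rw [← h2]
    exact (hm t).coeFn_toLp.symm
  refine ae_eq_of_integral_test fun χ hχ hχc => ?_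
  rw [integral_mul_fourierInv_Lp]
  set X := schwartzOfReal χ hχ hχc with hXdef
  set c : Plane → ℂ := ⇑(𝓕⁻ X : 𝓢(Plane, ℂ)) with hc
  have hcm : Measurable c := (𝓕⁻ X : 𝓢(Plane, ℂ)).continuous.measurable
  have hc2 : MemLp c 2 volume := (𝓕⁻ X : 𝓢(Plane, ℂ)).memLp 2 volume
  have hcG := integrable_symbol_mul hb hG hX hcm hc2
  have hgi := integrable_integral_symbol_mul hcG
  have e1 : ∀ t, ∫ z, c z * ((hm t).toLp _ : L2Plane) z =
      𝓕⁻ (fun τ => ∫ ζ, c ζ * G (pt ζ τ)) t := by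
    intro t
    rw [← integral_mul_timeSlice hb hG hX hcm hc2 t]
    exact integral_congr_ae ((hm t).coeFn_toLp.mono fun z hz => by simp only [hz])
  rw [e1]
  refine eqOn_of_integral_mul_eq (A := 𝓕⁻ (fun τ => ∫ ζ, c ζ * G (pt ζ τ)))
    (B := fun t => ∫ z, X z * w t z) (continuous_fourierInv hgi).continuousOn
    (continuousOn_integral_mul hw X) (fun ψ hψ hψc hψs => ?_) ht
  have hφ := contDiff_tensorFun hψ hχ
  have hφc := hasCompactSupport_tensorFun hψc hχc
  set Φ := schwartzOfReal (tensorFun ψ χ) hφ hφc with hΦ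
  have hΦs : tsupport Φ ⊆ {p | 0 < p 2 ∧ p 2 < T} := by
    refine (closure_mono ?_).trans (tsupport_tensorFun_subset_Ioo χ hψs)
    intro p hp
    simpa [hΦ, schwartzOfReal_apply] using hp
  have a1 := hvw Φ hΦs
  have a2 := (hv (𝓕⁻ Φ)).2
  rw [TemperedDistribution.fourier_apply, FourierInvPair.fourier_fourierInv_eq, a1] at a2
  have hψi : Integrable fun t => (ψ t : ℂ) := (schwartzOfReal ψ hψ hψc).integrable
  rw [← integral_fourierInv_mul_flip hψi hgi]
  have b1 : ∀ ζ τ, (𝓕⁻ Φ : 𝓢(SpaceTime, ℂ)) (pt ζ τ) = c ζ * 𝓕⁻ (fun t => (ψ t : ℂ)) τ := by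
    intro ζ τ
    rw [SchwartzMap.fourierInv_coe, hc, SchwartzMap.fourierInv_coe]
    exact fourierInv_tensorFun_pt Φ.integrable ζ τ
  rw [integral_spaceTime_symm (hv (𝓕⁻ Φ)).1] at a2
  simp only [b1] at a2
  have b2 : ∀ τ : ℝ, ∫ ζ : Plane, c ζ * 𝓕⁻ (fun t => (ψ t : ℂ)) τ * G (pt ζ τ) =
      𝓕⁻ (fun t => (ψ t : ℂ)) τ * ∫ ζ, c ζ * G (pt ζ τ) := by
    intro τ
    rw [← integral_const_mul]
    refine integral_congr_ae (ae_of_all _ fun ζ => ?_)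
    simp only
    ring
  simp only [b2] at a2
  rw [← a2]
  refine Eq.trans ?_ (setIntegral_eq_integral_of_forall_compl_eq_zero (s := Set.Icc 0 T) ?_)
  · refine integral_congr_ae (ae_of_all _ fun t => ?_)
    simp only
    rw [← integral_const_mul]
    refine integral_congr_ae (ae_of_all _ fun z => ?_)
    simp only [hΦ, schwartzOfReal_apply, tensorFun_pt, hXdef]
    push_cast; ring
  · intro t ht
    have : ψ t = 0 := by
      by_contra h
      exact ht (Set.Ioo_subset_Icc_self (hψs (subset_tsupport _ h)))
    simp [this]

theorem stPiece_eq_fInv {b : ℝ} (hb : 1 / 2 < b) {v : 𝓢'(SpaceTime, ℂ)} {G : SpaceTime → ℂ}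
    (hv : FourierIsFunction v G) (hX : bourgainSq b G < ⊤) {T : ℝ} {w : ℝ → L2Plane}
    (hw : ContinuousOn w (Set.Ioo 0 T)) (hvw : AgreeOn T v w) {t : ℝ} (ht : t ∈ Set.Ioo 0 T)
    {c : Plane → ℂ} (hc : BddSupp c) :
    (fInv (mulOp c (𝓕 (w t) : L2Plane)) : Plane → ℂ) =ᵐ[volume]
      fun z => stPiece c G (pt z t) := by
  have hi := integrable_symbol_mul hb hv.aestronglyMeasurable hX hc.1.1 hc.memLp_two
  filter_upwards [fInv_mulOp_ae hc (𝓕 (w t) : L2Plane)] with z hz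
  rw [hz, stPiece_pt hi]
  refine congrFun (fourierInv_congr_ae ?_) z
  filter_upwards [timeSlice_eq_fourier hb hv hX hw hvw ht] with ζ hζ
  rw [hζ]

end

noncomputable section

/-! ### Weak derivatives in time -/

theorem integral_deriv_mul_primitive {B : ℝ → ℂ} (hB : Continuous B) {ψ : ℝ → ℝ}
    (hψ : ContDiff ℝ ∞ ψ) (hc : HasCompactSupport ψ) :
    ∫ t, (((deriv ψ t : ℝ) : ℂ) * (∫ x in (0 : ℝ)..t, B x) + ψ t * B t) = 0 := by
  have hP : ∀ t, HasDerivAt (fun t => ∫ x in (0 : ℝ)..t, B x) (B t) t := fun t =>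
    intervalIntegral.integral_hasDerivAt_right (hB.intervalIntegrable _ _)
      hB.aestronglyMeasurable.stronglyMeasurableAtFilter hB.continuousAt
  have hPc : Continuous fun t => ∫ x in (0 : ℝ)..t, B x :=
    continuous_iff_continuousAt.2 fun t => (hP t).continuousAt
  have hψd : ∀ t, HasDerivAt (fun t => (ψ t : ℂ)) ((deriv ψ t : ℝ) : ℂ) t := fun t =>
    ((hψ.differentiable (by norm_num)) t).hasDerivAt.ofReal_comp
  have hψ' : Continuous (deriv ψ) := hψ.continuous_deriv (by norm_num)
  have c1 : HasCompactSupport fun t => (ψ t : ℂ) := hc.comp_left Complex.ofReal_zero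
  have c2 : HasCompactSupport fun t => ((deriv ψ t : ℝ) : ℂ) := hc.deriv.comp_left Complex.ofReal_zero
  refine integral_eq_zero_of_hasDerivAt_of_integrable
    (f := fun t => (ψ t : ℂ) * ∫ x in (0 : ℝ)..t, B x) (fun t => (hψd t).mul (hP t)) ?_ ?_
  · refine Continuous.integrable_of_hasCompactSupport ?_ (c2.mul_right.add c1.mul_right)
    exact ((Complex.continuous_ofReal.comp hψ').mul hPc).add
      ((Complex.continuous_ofReal.comp hψ.continuous).mul hB)
  · exact ((Complex.continuous_ofReal.comp hψ.continuous).mul hPc).integrable_of_hasCompactSupport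
      c1.mul_right

/-- Mollification: once the radius of the bump is less than the distance of `[t₁,t₂]` to the ends of
`(0,T)`, the mollified function has derivative zero on `[t₁,t₂]`, and the mollifications converge
pointwise. -/
theorem eq_of_weak_deriv_zero {D : ℝ → ℂ} (hD : Continuous D) {T : ℝ}
    (h : ∀ ψ : ℝ → ℝ, ContDiff ℝ ∞ ψ → HasCompactSupport ψ → tsupport ψ ⊆ Set.Ioo 0 T →
      ∫ t, ((deriv ψ t : ℝ) : ℂ) * D t = 0) {t₁ t₂ : ℝ} (h₁ : 0 < t₁) (h₁₂ : t₁ ≤ t₂) (h₂ : t₂ < T) :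
    D t₂ = D t₁ := by
  let φ : ℕ → ContDiffBump (0 : ℝ) := fun n =>
    ⟨1 / (n + 2), 1 / (n + 1), by positivity, by gcongr; linarith⟩
  have hφ : Tendsto (fun n => (φ n).rOut) atTop (𝓝 0) := tendsto_one_div_add_atTop_nhds_zero_nat
  have hlim := fun x => ContDiffBump.convolution_tendsto_right_of_continuous (μ := volume) hφ hD x
  refine tendsto_nhds_unique (hlim t₂) ((hlim t₁).congr' ?_)
  have hev : ∀ᶠ n in atTop, (φ n).rOut < min t₁ (T - t₂) :=
    hφ.eventually (gt_mem_nhds (lt_min h₁ (by linarith)))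
  filter_upwards [hev] with n hn
  set f := (φ n).normed volume with hf
  have hfs : ContDiff ℝ ∞ f := (φ n).contDiff_normed
  have hfc : HasCompactSupport f := (φ n).hasCompactSupport_normed
  have hd : ∀ s, HasDerivAt (convolution f D (ContinuousLinearMap.lsmul ℝ ℝ) volume)
      (convolution (deriv f) D (ContinuousLinearMap.lsmul ℝ ℝ) volume s) s := fun s =>
    hfc.hasDerivAt_convolution_left _ (hfs.of_le (by norm_num)) hD.locallyIntegrable s
  refine (constant_of_has_deriv_right_zero (a := t₁) (b := t₂)
    (fun s _ => (hd s).continuousAt.continuousWithinAt) (fun s hs => ?_) t₂ ⟨h₁₂, le_rfl⟩).symm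
  have hz : convolution (deriv f) D (ContinuousLinearMap.lsmul ℝ ℝ) volume s = 0 := by
    rw [convolution_eq_swap]
    have hψ := h (fun t => f (s - t)) (hfs.comp (by fun_prop))
      (hfc.comp_homeomorph (Homeomorph.subLeft s)) ?_
    · have hder : ∀ t, deriv (fun t => f (s - t)) t = - deriv f (s - t) := fun t =>
        deriv_comp_const_sub _ _ _
      simp only [hder, Complex.ofReal_neg, neg_mul, integral_neg, neg_eq_zero] at hψ
      simpa only [ContinuousLinearMap.lsmul_apply, Complex.real_smul] using hψ
    · have hcl : IsClosed (Metric.closedBall s (φ n).rOut) := Metric.isClosed_closedBall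
      refine (closure_minimal (fun t ht => ?_) hcl).trans fun t ht => ?_
      · have : s - t ∈ Metric.ball (0 : ℝ) (φ n).rOut := by
          rw [← (φ n).support_normed_eq (μ := volume)]; exact ht
        rw [Metric.mem_closedBall, dist_comm, Real.dist_eq]
        rw [mem_ball_zero_iff, Real.norm_eq_abs] at this
        exact this.le
      · rw [Metric.mem_closedBall, Real.dist_eq, abs_le] at ht
        have a1 := (lt_min_iff.1 hn).1
        have a2 := (lt_min_iff.1 hn).2
        exact ⟨by linarith [hs.1, ht.1], by linarith [hs.2, ht.2]⟩
  have := (hd s).hasDerivWithinAt (s := Set.Ici s)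
  rwa [hz] at this

theorem sub_eq_integral_of_weak_deriv {A B : ℝ → ℂ} (hA : Continuous A) (hB : Continuous B) {T : ℝ}
    (h : ∀ ψ : ℝ → ℝ, ContDiff ℝ ∞ ψ → HasCompactSupport ψ → tsupport ψ ⊆ Set.Ioo 0 T →
      ∫ t, (((deriv ψ t : ℝ) : ℂ) * A t + ψ t * B t) = 0) {t₁ t₂ : ℝ} (h₁ : 0 < t₁) (h₁₂ : t₁ ≤ t₂)
    (h₂ : t₂ < T) : A t₂ - A t₁ = ∫ t in t₁..t₂, B t := by
  have hPc : Continuous fun t => ∫ x in (0 : ℝ)..t, B x :=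
    intervalIntegral.continuous_primitive (fun a b => hB.intervalIntegrable a b) 0
  have key := eq_of_weak_deriv_zero (D := fun t => A t - ∫ x in (0 : ℝ)..t, B x) (hA.sub hPc)
    (T := T) (fun ψ h1 h2 h3 => ?_) h₁ h₁₂ h₂
  · rw [← intervalIntegral.integral_interval_sub_left (hB.intervalIntegrable 0 t₂)
      (hB.intervalIntegrable 0 t₁)]
    linear_combination key
  · have e1 := h ψ h1 h2 h3
    have e2 := integral_deriv_mul_primitive hB h1 h2
    have c1 : HasCompactSupport fun t => (ψ t : ℂ) := h2.comp_left Complex.ofReal_zero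
    have c2 : HasCompactSupport fun t => ((deriv ψ t : ℝ) : ℂ) := h2.deriv.comp_left Complex.ofReal_zero
    have k1 : Continuous fun t => (ψ t : ℂ) := Complex.continuous_ofReal.comp h1.continuous
    have k2 : Continuous fun t => ((deriv ψ t : ℝ) : ℂ) :=
      Complex.continuous_ofReal.comp (h1.continuous_deriv (by norm_num))
    have i1 : Integrable fun t => ((deriv ψ t : ℝ) : ℂ) * A t + ψ t * B t :=
      ((k2.mul hA).add (k1.mul hB)).integrable_of_hasCompactSupport (c2.mul_right.add c1.mul_right)
    have i2 : Integrable fun t => ((deriv ψ t : ℝ) : ℂ) * (∫ x in (0 : ℝ)..t, B x) + ψ t * B t :=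
      ((k2.mul hPc).add (k1.mul hB)).integrable_of_hasCompactSupport (c2.mul_right.add c1.mul_right)
    rw [← sub_zero (0 : ℂ)]
    nth_rw 1 [← e1]
    rw [← e2, ← integral_sub i1 i2]
    refine integral_congr_ae (ae_of_all _ fun t => ?_)
    simp only
    ring

end

noncomputable section

/-! ### Derivatives of test functions -/

/-- The partial derivatives of a function on the plane. -/
def planeDeriv (j : Fin 2) (χ : Plane → ℝ) : Plane → ℝ :=
  fun z => fderiv ℝ χ z (EuclideanSpace.single j 1)

theorem contDiff_planeDeriv (j : Fin 2) {χ : Plane → ℝ} (h : ContDiff ℝ ∞ χ) :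
    ContDiff ℝ ∞ (planeDeriv j χ) :=
  (h.fderiv_right (m := ∞) (by norm_num)).clm_apply contDiff_const

theorem hasCompactSupport_planeDeriv (j : Fin 2) {χ : Plane → ℝ} (h : HasCompactSupport χ) :
    HasCompactSupport (planeDeriv j χ) :=
  h.fderiv_apply ℝ _

/-- The linear map `planePart`. -/
def planePartL : SpaceTime →L[ℝ] Plane where
  toFun := planePart
  map_add' p q := by ext i; fin_cases i <;> rfl
  map_smul' c p := by ext i; fin_cases i <;> rfl
  cont := continuous_planePart

theorem hasFDerivAt_tensorFun {ψ : ℝ → ℝ} {χ : Plane → ℝ} (hψ : ContDiff ℝ ∞ ψ)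
    (hχ : ContDiff ℝ ∞ χ) (p v : SpaceTime) :
    fderiv ℝ (tensorFun ψ χ) p v =
      ψ (p 2) * fderiv ℝ χ (planePart p) (planePart v) +
        χ (planePart p) * (deriv ψ (p 2) * v 2) := by
  have h1 : HasFDerivAt (fun p : SpaceTime => χ (planePart p))
      ((fderiv ℝ χ (planePart p)).comp planePartL) p :=
    ((hχ.differentiable (by norm_num)) _).hasFDerivAt.comp p planePartL.hasFDerivAt
  have h2 : HasFDerivAt (fun p : SpaceTime => ψ (p 2))
      (deriv ψ (p 2) • (EuclideanSpace.proj 2 : SpaceTime →L[ℝ] ℝ)) p :=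
    ((hψ.differentiable (by norm_num)) _).hasDerivAt.comp_hasFDerivAt p
      (EuclideanSpace.proj (𝕜 := ℝ) (2 : Fin 3)).hasFDerivAt
  have h3 : HasFDerivAt (tensorFun ψ χ) _ p := h2.mul h1
  rw [h3.fderiv]
  rfl

theorem testDeriv_two_tensorFun {ψ : ℝ → ℝ} {χ : Plane → ℝ} (hψ : ContDiff ℝ ∞ ψ)
    (hχ : ContDiff ℝ ∞ χ) : testDeriv 2 (tensorFun ψ χ) = tensorFun (deriv ψ) χ := by
  ext p
  have e : planePart (EuclideanSpace.single 2 1) = 0 := by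
    ext i; fin_cases i <;> simp [planePart]
  rw [testDeriv, hasFDerivAt_tensorFun hψ hχ, e, map_zero, tensorFun]
  simp [mul_comm]

theorem testDeriv_zero_tensorFun {ψ : ℝ → ℝ} {χ : Plane → ℝ} (hψ : ContDiff ℝ ∞ ψ)
    (hχ : ContDiff ℝ ∞ χ) : testDeriv 0 (tensorFun ψ χ) = tensorFun ψ (planeDeriv 0 χ) := by
  ext p
  have e : planePart (EuclideanSpace.single 0 1) = EuclideanSpace.single 0 1 := by
    ext i; fin_cases i <;> simp [planePart]
  rw [testDeriv, hasFDerivAt_tensorFun hψ hχ, e, tensorFun, planeDeriv]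
  simp

theorem testDeriv_one_tensorFun {ψ : ℝ → ℝ} {χ : Plane → ℝ} (hψ : ContDiff ℝ ∞ ψ)
    (hχ : ContDiff ℝ ∞ χ) : testDeriv 1 (tensorFun ψ χ) = tensorFun ψ (planeDeriv 1 χ) := by
  ext p
  have e : planePart (EuclideanSpace.single 1 1) = EuclideanSpace.single 1 1 := by
    ext i; fin_cases i <;> simp [planePart]
  rw [testDeriv, hasFDerivAt_tensorFun hψ hχ, e, tensorFun, planeDeriv]
  simp

theorem fourierInv_planeDeriv (j : Fin 2) {χ : Plane → ℝ} (h : ContDiff ℝ ∞ χ)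
    (hc : HasCompactSupport χ) (ζ : Plane) :
    (𝓕⁻ (schwartzOfReal (planeDeriv j χ) (contDiff_planeDeriv j h)
      (hasCompactSupport_planeDeriv j hc)) : 𝓢(Plane, ℂ)) ζ =
      -(2 * Real.pi * Complex.I * ζ j) * (𝓕⁻ (schwartzOfReal χ h hc) : 𝓢(Plane, ℂ)) ζ := by
  have e : schwartzOfReal (planeDeriv j χ) (contDiff_planeDeriv j h)
      (hasCompactSupport_planeDeriv j hc) =
      LineDeriv.lineDerivOp (EuclideanSpace.single j (1 : ℝ) : Plane) (schwartzOfReal χ h hc) := by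
    ext z
    rw [schwartzOfReal_apply, SchwartzMap.lineDerivOp_apply_eq_fderiv, planeDeriv]
    have h1 : HasFDerivAt (fun z => (χ z : ℂ)) (Complex.ofRealCLM.comp (fderiv ℝ χ z)) z :=
      Complex.ofRealCLM.hasFDerivAt.comp z ((h.differentiable (by norm_num)) z).hasFDerivAt
    have h2 : (schwartzOfReal χ h hc : Plane → ℂ) = fun z => (χ z : ℂ) := rfl
    rw [h2, h1.fderiv]
    rfl
  rw [e, SchwartzMap.fourierInv_lineDerivOp_eq]
  have : (fun ζ : Plane => inner ℝ ζ (EuclideanSpace.single j (1 : ℝ))).HasTemperateGrowth := by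
    fun_prop
  rw [smul_apply, SchwartzMap.smulLeftCLM_apply_apply this]
  simp only [EuclideanSpace.inner_single_right, smul_eq_mul, Complex.real_smul]
  simp
  ring

/-- The sum `∂_x³ + ∂_y³` of a test function as a Schwartz function. -/
def cubicDeriv (χ : Plane → ℝ) (h : ContDiff ℝ ∞ χ) (hc : HasCompactSupport χ) : 𝓢(Plane, ℂ) :=
  schwartzOfReal (planeDeriv 0 (planeDeriv 0 (planeDeriv 0 χ)))
      (contDiff_planeDeriv 0 (contDiff_planeDeriv 0 (contDiff_planeDeriv 0 h)))
      (hasCompactSupport_planeDeriv 0 (hasCompactSupport_planeDeriv 0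
        (hasCompactSupport_planeDeriv 0 hc))) +
    schwartzOfReal (planeDeriv 1 (planeDeriv 1 (planeDeriv 1 χ)))
      (contDiff_planeDeriv 1 (contDiff_planeDeriv 1 (contDiff_planeDeriv 1 h)))
      (hasCompactSupport_planeDeriv 1 (hasCompactSupport_planeDeriv 1
        (hasCompactSupport_planeDeriv 1 hc)))

/-- The sum `∂_x + ∂_y` of a test function as a Schwartz function. -/
def diagDeriv (χ : Plane → ℝ) (h : ContDiff ℝ ∞ χ) (hc : HasCompactSupport χ) : 𝓢(Plane, ℂ) :=
  schwartzOfReal (planeDeriv 0 χ) (contDiff_planeDeriv 0 h) (hasCompactSupport_planeDeriv 0 hc) +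
    schwartzOfReal (planeDeriv 1 χ) (contDiff_planeDeriv 1 h) (hasCompactSupport_planeDeriv 1 hc)

/-- The symbol `2π (ξ + η)`. -/
def diagSymbol (ζ : Plane) : ℝ := 2 * Real.pi * (ζ 0 + ζ 1)

/-- The symbol `4π² (ξ² - ξη + η²)`. -/
def quadSymbol (ζ : Plane) : ℝ := 4 * Real.pi ^ 2 * (ζ 0 ^ 2 - ζ 0 * ζ 1 + ζ 1 ^ 2)

@[fun_prop]
theorem measurable_diagSymbol : Measurable diagSymbol := by unfold diagSymbol; fun_prop

@[fun_prop]
theorem measurable_quadSymbol : Measurable quadSymbol := by unfold quadSymbol; fun_prop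

/-- Under `𝓕⁻` each derivative becomes multiplication by `-2πi ζ_j`. Then `(-2πi)³ = 8π³ i`, and
`8π³(ξ³+η³)` factors as `diagSymbol` times `quadSymbol`. -/
theorem fourierInv_cubicDeriv {χ : Plane → ℝ} (h : ContDiff ℝ ∞ χ) (hc : HasCompactSupport χ)
    (ζ : Plane) : (𝓕⁻ (cubicDeriv χ h hc) : 𝓢(Plane, ℂ)) ζ =
      Complex.I * (diagSymbol ζ * quadSymbol ζ) *
        (𝓕⁻ (schwartzOfReal χ h hc) : 𝓢(Plane, ℂ)) ζ := by
  have a (j : Fin 2) := contDiff_planeDeriv j h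
  have b (j : Fin 2) := hasCompactSupport_planeDeriv j hc
  have a' (j : Fin 2) := contDiff_planeDeriv j (a j)
  have b' (j : Fin 2) := hasCompactSupport_planeDeriv j (b j)
  rw [cubicDeriv, FourierTransform.fourierInv_add, add_apply, fourierInv_planeDeriv 0 (a' 0) (b' 0),
    fourierInv_planeDeriv 0 (a 0) (b 0), fourierInv_planeDeriv 0 h hc,
    fourierInv_planeDeriv 1 (a' 1) (b' 1), fourierInv_planeDeriv 1 (a 1) (b 1),
    fourierInv_planeDeriv 1 h hc]
  simp only [diagSymbol, quadSymbol]
  push_cast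
  have hI : Complex.I ^ 3 = - Complex.I := Complex.I_pow_three
  linear_combination (-8 * (Real.pi : ℂ) ^ 3 * ((ζ 0 : ℂ) ^ 3 + (ζ 1 : ℂ) ^ 3) *
    (𝓕⁻ (schwartzOfReal χ h hc) : 𝓢(Plane, ℂ)) ζ) * hI

theorem fourierInv_diagDeriv {χ : Plane → ℝ} (h : ContDiff ℝ ∞ χ) (hc : HasCompactSupport χ)
    (ζ : Plane) : (𝓕⁻ (diagDeriv χ h hc) : 𝓢(Plane, ℂ)) ζ =
      -(Complex.I * diagSymbol ζ) * (𝓕⁻ (schwartzOfReal χ h hc) : 𝓢(Plane, ℂ)) ζ := by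
  rw [diagDeriv, FourierTransform.fourierInv_add, add_apply,
    fourierInv_planeDeriv 0 h hc, fourierInv_planeDeriv 1 h hc]
  simp only [diagSymbol]
  push_cast
  ring

/-! ### Test functions whose transform does not vanish on a ball -/

/-- A bump of integral 1 with tiny support works: for `‖ζ‖ ≤ r` the phase is at most `1/2` on the
support, so the transform differs from 1 by at most `1/2`. -/
theorem exists_test_fourierInv_ne_zero (r : ℝ) :
    ∃ (ρ : Plane → ℝ) (h : ContDiff ℝ ∞ ρ) (hc : HasCompactSupport ρ), ∀ ζ : Plane, ‖ζ‖ ≤ r →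
      (𝓕⁻ (schwartzOfReal ρ h hc) : 𝓢(Plane, ℂ)) ζ ≠ 0 := by
  set R : ℝ := 2 * Real.pi * (|r| + 1) with hR
  have hR0 : 0 < R := by positivity
  let β : ContDiffBump (0 : Plane) := ⟨R⁻¹ / 4, R⁻¹ / 2, by positivity, by
    have : 0 < R⁻¹ := by positivity
    linarith⟩
  refine ⟨β.normed volume, β.contDiff_normed, β.hasCompactSupport_normed, fun ζ hζ h0 => ?_⟩
  rw [SchwartzMap.fourierInv_coe, Real.fourierInv_eq] at h0
  simp only [schwartzOfReal_apply] at h0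
  have hint : Integrable fun z => ((β.normed volume z : ℝ) : ℂ) :=
    (schwartzOfReal _ (β.contDiff_normed (n := (⊤ : ℕ∞)) (μ := volume))
      β.hasCompactSupport_normed).integrable
  have h1 : ∫ z, ((β.normed volume z : ℝ) : ℂ) = 1 := by
    exact (integral_ofReal (f := fun z => β.normed volume z)).trans (by
      rw [β.integral_normed]; norm_num)
  have h2 : ∫ z, (Real.fourierChar (inner ℝ z ζ) • ((β.normed volume z : ℝ) : ℂ) -
      ((β.normed volume z : ℝ) : ℂ)) = -1 := by
    rw [integral_sub (integrable_fourierChar_inner_smul hint ζ) hint, h0, h1, zero_sub]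
  have h3 : ∀ z, ‖Real.fourierChar (inner ℝ z ζ) • ((β.normed volume z : ℝ) : ℂ) -
      ((β.normed volume z : ℝ) : ℂ)‖ ≤ 2⁻¹ * β.normed volume z := by
    intro z
    have hnn := β.nonneg_normed (μ := volume) z
    by_cases hz : z ∈ Metric.ball (0 : Plane) β.rOut
    · rw [Circle.smul_def, smul_eq_mul, ← sub_one_mul, norm_mul, Complex.norm_real,
        Real.norm_of_nonneg hnn]
      gcongr
      rw [Real.fourierChar_apply, mul_comm]
      refine (Real.norm_exp_I_mul_ofReal_sub_one_le).trans ?_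
      rw [Real.norm_eq_abs, abs_mul, abs_of_pos (by positivity : 0 < 2 * Real.pi)]
      have hz' : ‖z‖ ≤ R⁻¹ / 2 := (mem_ball_zero_iff.1 hz).le
      calc 2 * Real.pi * |inner ℝ z ζ| ≤ 2 * Real.pi * (‖z‖ * ‖ζ‖) := by
            gcongr; exact abs_real_inner_le_norm z ζ
        _ ≤ 2 * Real.pi * (R⁻¹ / 2 * (|r| + 1)) := by
            gcongr
            linarith [le_abs_self r]
        _ = R * R⁻¹ / 2 := by rw [hR]; ring
        _ = 2⁻¹ := by rw [mul_inv_cancel₀ hR0.ne']; norm_num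
    · have : β.normed volume z = 0 := by
        rw [← β.support_normed_eq (μ := volume)] at hz
        simpa using hz
      simp [this]
  have h4 := norm_integral_le_of_norm_le (β.integrable_normed.const_mul 2⁻¹) (ae_of_all _ h3)
  rw [h2, integral_const_mul, β.integral_normed] at h4
  norm_num at h4

end

noncomputable section

/-! ### The Sobolev lift of a solution -/

open Classical in
/-- The function `⟨2πζ⟩^s 𝓕 f` of an element of `H^s`. -/
def sobLift (s : ℝ) (f : L2Plane) : L2Plane :=
  if h : MemLp (fun ξ : Plane => ((jap ((2 * Real.pi) • ξ) ^ s : ℝ) : ℂ) *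
      ((𝓕 f : L2Plane) : Plane → ℂ) ξ) 2 volume
  then h.toLp _ else 0

theorem measurable_jap_rpow (s : ℝ) :
    Measurable fun ξ : Plane => ((jap ((2 * Real.pi) • ξ) ^ s : ℝ) : ℂ) :=
  Complex.measurable_ofReal.comp (by fun_prop)

theorem memLp_of_sobolevNorm {s : ℝ} {f : L2Plane} (h : sobolevNorm s f < ⊤) :
    MemLp (fun ξ : Plane => ((jap ((2 * Real.pi) • ξ) ^ s : ℝ) : ℂ) *
      ((𝓕 f : L2Plane) : Plane → ℂ) ξ) 2 volume :=
  ⟨(measurable_jap_rpow s).aestronglyMeasurable.mul (Lp.aestronglyMeasurable _), h⟩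

theorem sobLift_ae {s : ℝ} {f : L2Plane} (h : sobolevNorm s f < ⊤) :
    (sobLift s f : Plane → ℂ) =ᵐ[volume] fun ξ => ((jap ((2 * Real.pi) • ξ) ^ s : ℝ) : ℂ) *
      ((𝓕 f : L2Plane) : Plane → ℂ) ξ := by
  rw [sobLift, dif_pos (memLp_of_sobolevNorm h)]
  exact MemLp.coeFn_toLp _

theorem mulOp_japSymbol_sobLift {s : ℝ} (hs : 0 ≤ s) {f : L2Plane} (h : sobolevNorm s f < ⊤) :
    mulOp (japSymbol s) (sobLift s f) = (𝓕 f : L2Plane) := by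
  refine mulOp_eq_of_ae (bddSymbol_japSymbol hs) ?_
  filter_upwards [sobLift_ae h] with ξ hξ
  rw [hξ, japSymbol, ← mul_assoc, ← Complex.ofReal_mul, ← Real.rpow_add (jap_pos _)]
  simp

theorem besselL2_sobLift {s : ℝ} (hs : 0 ≤ s) {f : L2Plane} (h : sobolevNorm s f < ⊤) :
    besselL2 s (sobLift s f) = f := by
  rw [besselL2, ContinuousLinearMap.comp_apply, mulOp_japSymbol_sobLift hs h, fInv_apply,
    FourierPair.fourierInv_fourier_eq]

theorem enorm_sobLift_sub {s : ℝ} {f g : L2Plane} (hf : sobolevNorm s f < ⊤)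
    (hg : sobolevNorm s g < ⊤) : ‖sobLift s f - sobLift s g‖ₑ = sobolevNorm s (f - g) := by
  rw [Lp.enorm_def, sobolevNorm]
  refine eLpNorm_congr_ae ?_
  have e : (𝓕 (f - g) : L2Plane) = 𝓕 f - 𝓕 g := map_sub (Lp.fourierTransformₗᵢ Plane ℂ) f g
  rw [e]
  filter_upwards [Lp.coeFn_sub (sobLift s f) (sobLift s g), sobLift_ae hf, sobLift_ae hg,
    Lp.coeFn_sub (𝓕 f : L2Plane) (𝓕 g)] with ξ h1 h2 h3 h4
  rw [h1, Pi.sub_apply, h2, h3, h4, Pi.sub_apply, mul_sub]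

/-- The time `t` moved to the interval `[0, δ]`. -/
def clampTime (δ t : ℝ) : ℝ := max 0 (min δ t)

theorem clampTime_mem {δ : ℝ} (hδ : 0 < δ) (t : ℝ) : clampTime δ t ∈ Set.Icc 0 δ :=
  ⟨le_max_left _ _, max_le hδ.le (min_le_left _ _)⟩

theorem clampTime_of_mem {δ t : ℝ} (ht : t ∈ Set.Icc 0 δ) : clampTime δ t = t := by
  rw [clampTime, min_eq_right ht.2, max_eq_right ht.1]

/-- The function `⟨2πζ⟩^s 𝓕 u(t)` of a solution, continued to all times by constants. -/
def solLift (s δ : ℝ) (u : ℝ → L2Plane) (t : ℝ) : L2Plane := sobLift s (u (clampTime δ t))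

/-- Freezing the curve outside `[0,δ]` makes it continuous on the whole line, so integrals in time
need no further care at the end points. -/
theorem IsSolution.continuous_solLift {σ s δ : ℝ} {u : ℝ → L2Plane} (hu : IsSolution σ s δ u)
    (hδ : 0 < δ) : Continuous (solLift s δ u) := by
  have h1 : ContinuousOn (fun t => sobLift s (u t)) (Set.Icc 0 δ) := by
    intro t ht
    rw [ContinuousWithinAt, tendsto_iff_edist_tendsto_0]
    refine (hu.continuous t ht).congr' ?_
    filter_upwards [self_mem_nhdsWithin] with r hr
    rw [edist_eq_enorm_sub, enorm_sobLift_sub (hu.mem_Hs r hr) (hu.mem_Hs t ht)]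
  exact h1.comp_continuous (by unfold clampTime; fun_prop) (clampTime_mem hδ)

theorem IsSolution.mulOp_solLift {σ s δ : ℝ} {u : ℝ → L2Plane} (hu : IsSolution σ s δ u)
    (hs : 0 ≤ s) {t : ℝ} (ht : t ∈ Set.Icc 0 δ) :
    mulOp (japSymbol s) (solLift s δ u t) = (𝓕 (u t) : L2Plane) := by
  rw [solLift, clampTime_of_mem ht, mulOp_japSymbol_sobLift hs (hu.mem_Hs t ht)]

theorem IsSolution.besselL2_solLift {σ s δ : ℝ} {u : ℝ → L2Plane} (hu : IsSolution σ s δ u)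
    (hs : 0 ≤ s) {t : ℝ} (ht : t ∈ Set.Icc 0 δ) : besselL2 s (solLift s δ u t) = u t := by
  rw [solLift, clampTime_of_mem ht, besselL2_sobLift hs (hu.mem_Hs t ht)]

/-! ### Testing against Schwartz functions -/

/-- The pairing of a Schwartz function with square integrable functions. -/
def testL2 (φ : 𝓢(Plane, ℂ)) : L2Plane →L[ℂ] ℂ :=
  innerSL ℂ ((φ.memLp 2 volume).star.toLp _ : L2Plane)

theorem testL2_apply (φ : 𝓢(Plane, ℂ)) (f : L2Plane) : testL2 φ f = ∫ z, φ z * f z :=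
  (integral_mul_eq_inner φ f).symm

/-- The pairing of a Schwartz function with integrable functions. -/
def testL1 (φ : 𝓢(Plane, ℂ)) : L1Plane →L[ℂ] ℂ :=
  (ContinuousLinearMap.mul ℂ ℂ).lpPairing volume ⊤ 1 ((φ.memLp ⊤ volume).toLp _)

theorem testL1_apply (φ : 𝓢(Plane, ℂ)) (f : L1Plane) : testL1 φ f = ∫ z, φ z * f z := by
  rw [testL1, ContinuousLinearMap.lpPairing_eq_integral]
  refine integral_congr_ae ?_
  filter_upwards [(φ.memLp ⊤ volume).coeFn_toLp] with z hz
  rw [hz]; rfl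

theorem integrable_schwartz_mul_L2 (φ : 𝓢(Plane, ℂ)) (f : L2Plane) :
    Integrable fun z => φ z * f z := (φ.memLp 2 volume).integrable_mul (Lp.memLp f)

theorem integrable_schwartz_mul_L1 (φ : 𝓢(Plane, ℂ)) (f : L1Plane) :
    Integrable fun z => φ z * f z :=
  (L1.integrable_coeFn f).bdd_mul (c := SchwartzMap.seminorm ℝ 0 0 φ)
    φ.continuous.aestronglyMeasurable
    (ae_of_all _ fun z => SchwartzMap.norm_le_seminorm ℝ φ z)

/-- The cube of the solution. -/
def solCube (s δ : ℝ) (u : ℝ → L2Plane) (t : ℝ) : L1Plane :=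
  besselCube s (solLift s δ u t) (solLift s δ u t) (solLift s δ u t)

theorem IsSolution.continuous_solCube {σ s δ : ℝ} {u : ℝ → L2Plane} (hu : IsSolution σ s δ u)
    (hδ : 0 < δ) : Continuous (solCube s δ u) := by
  have h := hu.continuous_solLift hδ
  exact (((besselCube s).continuous.comp h).clm_apply h).clm_apply h

theorem IsSolution.solCube_ae {σ s δ : ℝ} {u : ℝ → L2Plane} (hu : IsSolution σ s δ u)
    (hs : 1 / 2 < s) {t : ℝ} (ht : t ∈ Set.Icc 0 δ) :
    (solCube s δ u t : Plane → ℂ) =ᵐ[volume] fun z => (u t z) ^ 3 := by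
  filter_upwards [besselCube_ae hs (solLift s δ u t) (solLift s δ u t) (solLift s δ u t)] with z hz
  rw [solCube, hz, hu.besselL2_solLift (by linarith) ht]
  ring

/-- Tensor test functions reduce the equation to a weak ordinary differential equation for the
pairings with `χ`. Since `u` is real-valued, the real parts in the equation can be replaced by the
complex multilinear expressions in the lift. -/
theorem IsSolution.weak_equation {σ s δ : ℝ} {u : ℝ → L2Plane} (hu : IsSolution σ s δ u)
    (hs : 1 / 2 < s) {χ : Plane → ℝ} (hχ : ContDiff ℝ ∞ χ)
    (hχc : HasCompactSupport χ) {ψ : ℝ → ℝ} (hψ : ContDiff ℝ ∞ ψ) (hψc : HasCompactSupport ψ)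
    (hψs : tsupport ψ ⊆ Set.Ioo 0 δ) :
    ∫ t, (((deriv ψ t : ℝ) : ℂ) * testL2 (schwartzOfReal χ hχ hχc) (besselL2 s (solLift s δ u t)) +
      ψ t * (testL2 (cubicDeriv χ hχ hχc) (besselL2 s (solLift s δ u t)) +
        σ * aConst * testL1 (diagDeriv χ hχ hχc) (solCube s δ u t))) = 0 := by
  have key := hu.equation (tensorFun ψ χ) (contDiff_tensorFun hψ hχ)
    (hasCompactSupport_tensorFun hψc hχc) (tsupport_tensorFun_subset_Ioo χ hψs)
  have p0 := contDiff_planeDeriv 0 hχ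
  have p1 := contDiff_planeDeriv 1 hχ
  rw [testDeriv_two_tensorFun hψ hχ, testDeriv_zero_tensorFun hψ hχ, testDeriv_one_tensorFun hψ hχ,
    testDeriv_zero_tensorFun hψ p0, testDeriv_zero_tensorFun hψ (contDiff_planeDeriv 0 p0),
    testDeriv_one_tensorFun hψ p1, testDeriv_one_tensorFun hψ (contDiff_planeDeriv 1 p1)] at key
  simp only [tensorFun_pt] at key
  have key2 := (integral_complex_ofReal (μ := volume.restrict (Set.Icc 0 δ))
    (f := fun t => ∫ z : Plane, _)).trans ((congrArg (fun x : ℝ => (x : ℂ)) key).trans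
      Complex.ofReal_zero)
  refine Eq.trans ?_ key2
  rw [← setIntegral_eq_integral_of_forall_compl_eq_zero (s := Set.Icc 0 δ)]
  · refine setIntegral_congr_fun measurableSet_Icc fun t ht => ?_
    have hreal := hu.real_valued t ht
    simp only [testL2_apply, testL1_apply]
    rw [hu.besselL2_solLift (by linarith) ht, ← integral_complex_ofReal]
    have i1 := integrable_schwartz_mul_L2 (schwartzOfReal χ hχ hχc) (u t)
    have i2 := integrable_schwartz_mul_L2 (cubicDeriv χ hχ hχc) (u t)
    have i3 := integrable_schwartz_mul_L1 (diagDeriv χ hχ hχc) (solCube s δ u t)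
    simp only [← integral_const_mul]
    rw [← integral_add i2 (i3.const_mul _), ← integral_const_mul]
    refine (integral_add (i1.const_mul _) ((i2.add (i3.const_mul _)).const_mul _)).symm.trans ?_
    refine integral_congr_ae ?_
    filter_upwards [hreal, hu.solCube_ae hs ht] with z h1 h2
    have h3 : u t z = ((u t z).re : ℂ) := Complex.ext (by simp) (by simpa using h1)
    simp only [Pi.add_apply, h2, cubicDeriv, diagDeriv, add_apply, schwartzOfReal_apply]
    generalize (u t z) = U at *
    rw [h3]
    push_cast
    simp only [Complex.ofReal_re]
    ring
  · intro t ht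
    have hψ0 : t ∉ tsupport ψ := fun h => ht (Set.Ioo_subset_Icc_self (hψs h))
    have h1 : ψ t = 0 := image_eq_zero_of_notMem_tsupport hψ0
    have h2 : deriv ψ t = 0 :=
      image_eq_zero_of_notMem_tsupport fun h => hψ0 (tsupport_deriv_subset h)
    simp [h1, h2]

end

noncomputable section

/-! ### The evolution of the Fourier transform of a solution -/

/-- The convolution of two test functions. -/
def realConv (ρ θ : Plane → ℝ) : Plane → ℝ :=
  MeasureTheory.convolution ρ θ (ContinuousLinearMap.mul ℝ ℝ) volume

theorem contDiff_realConv {ρ θ : Plane → ℝ} (hρ : ContDiff ℝ ∞ ρ) (hθ : ContDiff ℝ ∞ θ)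
    (hθc : HasCompactSupport θ) : ContDiff ℝ ∞ (realConv ρ θ) :=
  hθc.contDiff_convolution_right _ (hρ.continuous.locallyIntegrable) hθ

theorem hasCompactSupport_realConv {ρ θ : Plane → ℝ} (hρc : HasCompactSupport ρ)
    (hθc : HasCompactSupport θ) : HasCompactSupport (realConv ρ θ) :=
  hρc.convolution (ContinuousLinearMap.mul ℝ ℝ) hθc

theorem fourierInv_realConv {ρ θ : Plane → ℝ} (hρ : ContDiff ℝ ∞ ρ) (hρc : HasCompactSupport ρ)
    (hθ : ContDiff ℝ ∞ θ) (hθc : HasCompactSupport θ) (ζ : Plane) :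
    (𝓕⁻ (schwartzOfReal (realConv ρ θ) (contDiff_realConv hρ hθ hθc)
        (hasCompactSupport_realConv hρc hθc)) : 𝓢(Plane, ℂ)) ζ =
      (𝓕⁻ (schwartzOfReal ρ hρ hρc) : 𝓢(Plane, ℂ)) ζ *
        (𝓕⁻ (schwartzOfReal θ hθ hθc) : 𝓢(Plane, ℂ)) ζ := by
  simp only [SchwartzMap.fourierInv_coe]
  rw [← fourierInv_conv (schwartzOfReal ρ hρ hρc).integrable (schwartzOfReal θ hθ hθc).integrable]
  have e : (schwartzOfReal (realConv ρ θ) (contDiff_realConv hρ hθ hθc)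
        (hasCompactSupport_realConv hρc hθc) : Plane → ℂ) =
      conv (schwartzOfReal ρ hρ hρc) (schwartzOfReal θ hθ hθc) := by
    ext z
    rw [schwartzOfReal_apply]
    exact (integral_complex_ofReal (f := fun t => ρ t * θ (z - t))).symm.trans
      (integral_congr_ae (ae_of_all _ fun t => by simp [schwartzOfReal_apply]))
  rw [e]

/-- The Fourier transform of a solution, continued to all times by constants. -/
def solHat (s δ : ℝ) (u : ℝ → L2Plane) (t : ℝ) : L2Plane := mulOp (japSymbol s) (solLift s δ u t)

theorem IsSolution.continuous_solHat {σ s δ : ℝ} {u : ℝ → L2Plane} (hu : IsSolution σ s δ u)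
    (hδ : 0 < δ) : Continuous (solHat s δ u) :=
  (mulOp (japSymbol s)).continuous.comp (hu.continuous_solLift hδ)

/-- The right-hand side of the evolution equation of the low frequencies of a solution. -/
def evolRHS (σ s δ : ℝ) (u : ℝ → L2Plane) (c : Plane → ℂ) (t : ℝ) : L2Plane :=
  mulOp (fun ζ => Complex.I * (diagSymbol ζ * quadSymbol ζ) * c ζ) (solHat s δ u t) -
    (Complex.I * (σ * aConst)) • truncFourier (fun ζ => diagSymbol ζ * c ζ) (solCube s δ u t)

theorem IsSolution.continuous_evolRHS {σ s δ : ℝ} {u : ℝ → L2Plane} (hu : IsSolution σ s δ u)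
    (hδ : 0 < δ) (c : Plane → ℂ) : Continuous (evolRHS σ s δ u c) := by
  have h1 := hu.continuous_solHat hδ
  have h2 := hu.continuous_solCube hδ
  unfold evolRHS
  fun_prop

theorem memLp_schwartz_mul_fourier (φ : 𝓢(Plane, ℂ)) (g : L1Plane) :
    MemLp (fun ζ => φ ζ * 𝓕 (g : Plane → ℂ) ζ) 2 volume :=
  (φ.memLp 2 volume).of_le_mul (c := ‖g‖) (φ.continuous.aestronglyMeasurable.mul
    (continuous_fourier (L1.integrable_coeFn g)).aestronglyMeasurable) (ae_of_all _ fun ζ => by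
      rw [norm_mul, mul_comm]; gcongr; exact norm_fourier_L1_le g ζ)

theorem memLp_schwartz_mul (φ : 𝓢(Plane, ℂ)) (f : L2Plane) :
    MemLp (fun ζ => φ ζ * f ζ) 2 volume :=
  (Lp.memLp f).of_le_mul (c := SchwartzMap.seminorm ℝ 0 0 φ)
    (φ.continuous.aestronglyMeasurable.mul (Lp.aestronglyMeasurable f)) (ae_of_all _ fun ζ => by
      rw [norm_mul]; gcongr; exact SchwartzMap.norm_le_seminorm ℝ φ ζ)

theorem integrable_schwartz_mul_fourier (φ : 𝓢(Plane, ℂ)) (g : L1Plane) :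
    Integrable fun ζ => φ ζ * 𝓕 (g : Plane → ℂ) ζ :=
  φ.integrable.mul_bdd (c := ‖g‖)
    (continuous_fourier (L1.integrable_coeFn g)).aestronglyMeasurable
    (ae_of_all _ (norm_fourier_L1_le g))

/-- The integrated equation is known only after pairing with test functions, and the polynomial
symbols times transforms need not be square integrable. Testing with convolutions `ρ * θ` multiplies
everything by `𝓕⁻ρ`, which makes it square integrable. As `𝓕⁻ρ` has no zero on the ball of radius
`r`, it can be cancelled there. -/
theorem IsSolution.evolution_ae {σ s δ : ℝ} {u : ℝ → L2Plane} (hu : IsSolution σ s δ u)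
    (hs : 1 / 2 < s) (hδ : 0 < δ) {t₁ t₂ : ℝ} (h₁ : 0 < t₁) (h₁₂ : t₁ ≤ t₂) (h₂ : t₂ < δ) (r : ℝ) :
    ∀ᵐ ζ : Plane, ‖ζ‖ ≤ r → (solHat s δ u t₂ - solHat s δ u t₁) ζ =
      Complex.I * (diagSymbol ζ * quadSymbol ζ) * (∫ t in t₁..t₂, solHat s δ u t) ζ -
      Complex.I * (σ * aConst) * diagSymbol ζ *
        𝓕 ((∫ t in t₁..t₂, solCube s δ u t : L1Plane) : Plane → ℂ) ζ := by
  obtain ⟨ρ, hρ, hρc, hne⟩ := exists_test_fourierInv_ne_zero r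
  set W : L2Plane := solHat s δ u t₂ - solHat s δ u t₁ with hW
  set J : L2Plane := ∫ t in t₁..t₂, solHat s δ u t with hJ
  set g : L1Plane := ∫ t in t₁..t₂, solCube s δ u t with hg
  have hcH := hu.continuous_solHat hδ
  have hcC := hu.continuous_solCube hδ
  have hcU : Continuous fun t => besselL2 s (solLift s δ u t) :=
    (besselL2 s).continuous.comp (hu.continuous_solLift hδ)
  have eU (t : ℝ) : besselL2 s (solLift s δ u t) = fInv (solHat s δ u t) := rfl
  -- the identity tested against a test function
  have key (χ : Plane → ℝ) (hχ : ContDiff ℝ ∞ χ) (hχc : HasCompactSupport χ) :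
      ∫ ζ, (𝓕⁻ (schwartzOfReal χ hχ hχc) : 𝓢(Plane, ℂ)) ζ * W ζ =
        (∫ ζ, (𝓕⁻ (cubicDeriv χ hχ hχc) : 𝓢(Plane, ℂ)) ζ * J ζ) + σ * aConst *
          ∫ ζ, (𝓕⁻ (diagDeriv χ hχ hχc) : 𝓢(Plane, ℂ)) ζ * 𝓕 (g : Plane → ℂ) ζ := by
    have h := sub_eq_integral_of_weak_deriv (T := δ)
      (A := fun t => testL2 (schwartzOfReal χ hχ hχc) (besselL2 s (solLift s δ u t)))
      (B := fun t => testL2 (cubicDeriv χ hχ hχc) (besselL2 s (solLift s δ u t)) +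
        σ * aConst * testL1 (diagDeriv χ hχ hχc) (solCube s δ u t))
      (by fun_prop) (by fun_prop)
      (fun ψ h1 h2 h3 => hu.weak_equation hs hχ hχc h1 h2 h3) h₁ h₁₂ h₂
    have iU : IntervalIntegrable (fun t => besselL2 s (solLift s δ u t)) volume t₁ t₂ :=
      hcU.intervalIntegrable _ _
    have iC : IntervalIntegrable (solCube s δ u) volume t₁ t₂ := hcC.intervalIntegrable _ _
    have iH : IntervalIntegrable (solHat s δ u) volume t₁ t₂ := hcH.intervalIntegrable _ _
    rw [← map_sub, intervalIntegral.integral_add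
      (Continuous.intervalIntegrable (by fun_prop) _ _)
      (Continuous.intervalIntegrable (by fun_prop) _ _), intervalIntegral.integral_const_mul,
      ContinuousLinearMap.intervalIntegral_comp_comm _ iU,
      ContinuousLinearMap.intervalIntegral_comp_comm _ iC] at h
    simp only [eU] at h
    rw [ContinuousLinearMap.intervalIntegral_comp_comm _ iH, ← map_sub, testL2_apply, testL2_apply,
      testL1_apply] at h
    simp only [fInv_apply] at h
    rw [integral_mul_fourierInv_Lp, integral_mul_fourierInv_Lp] at h
    rw [h]
    congr 2
    rw [← integral_fourier_mul_flip (SchwartzMap.integrable _) (L1.integrable_coeFn g)]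
    have : 𝓕 ((𝓕⁻ (diagDeriv χ hχ hχc) : 𝓢(Plane, ℂ)) : Plane → ℂ) = diagDeriv χ hχ hχc := by
      rw [← SchwartzMap.fourier_coe, FourierInvPair.fourier_fourierInv_eq]
    rw [this]
  -- The defect of the equation multiplied by `𝓕⁻ρ`. Its inverse transform vanishes against every
  -- `θ`, hence it is zero.
  have hR : MemLp (fun ζ => (𝓕⁻ (schwartzOfReal ρ hρ hρc) : 𝓢(Plane, ℂ)) ζ * W ζ -
      (𝓕⁻ (cubicDeriv ρ hρ hρc) : 𝓢(Plane, ℂ)) ζ * J ζ - (σ * aConst) *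
        ((𝓕⁻ (diagDeriv ρ hρ hρc) : 𝓢(Plane, ℂ)) ζ * 𝓕 (g : Plane → ℂ) ζ)) 2 volume :=
    ((memLp_schwartz_mul _ W).sub (memLp_schwartz_mul _ J)).sub
      ((memLp_schwartz_mul_fourier _ g).const_mul _)
  set R : L2Plane := hR.toLp _ with hRdef
  have hR0 : (𝓕⁻ R : L2Plane) = 0 := by
    refine ae_eq_of_integral_test fun θ hθ hθc => ?_
    rw [integral_mul_fourierInv_Lp]
    have h0 : ∫ z, schwartzOfReal θ hθ hθc z * (0 : L2Plane) z = 0 := by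
      refine integral_eq_zero_of_ae ?_
      filter_upwards [Lp.coeFn_zero ℂ 2 (volume : Measure Plane)] with z hz
      rw [hz]; simp
    rw [h0]
    have hk := key _ (contDiff_realConv hρ hθ hθc) (hasCompactSupport_realConv hρc hθc)
    have i1 := integrable_schwartz_mul_L2 (𝓕⁻ (schwartzOfReal _ (contDiff_realConv hρ hθ hθc)
      (hasCompactSupport_realConv hρc hθc)) : 𝓢(Plane, ℂ)) W
    have i2 := integrable_schwartz_mul_L2 (𝓕⁻ (cubicDeriv _ (contDiff_realConv hρ hθ hθc)
      (hasCompactSupport_realConv hρc hθc)) : 𝓢(Plane, ℂ)) J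
    have i3 := integrable_schwartz_mul_fourier (𝓕⁻ (diagDeriv _ (contDiff_realConv hρ hθ hθc)
      (hasCompactSupport_realConv hρc hθc)) : 𝓢(Plane, ℂ)) g
    rw [← integral_const_mul, ← sub_eq_zero, ← sub_sub, ← integral_sub i1 i2] at hk
    refine Eq.trans ?_ ((integral_sub (i1.sub i2) (i3.const_mul _)).trans hk)
    refine integral_congr_ae ?_
    filter_upwards [hR.coeFn_toLp] with ζ hζ
    rw [hζ]
    simp only [Pi.sub_apply, fourierInv_cubicDeriv, fourierInv_diagDeriv,
      fourierInv_realConv hρ hρc hθ hθc]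
    ring
  have hR1 : R = 0 := by
    have := norm_fInv R
    rw [fInv_apply, hR0, norm_zero] at this
    exact norm_eq_zero.1 this.symm
  filter_upwards [hR.coeFn_toLp, Lp.coeFn_zero ℂ 2 (volume : Measure Plane)] with ζ h1 h2 hζ
  rw [← hRdef, hR1, h2, fourierInv_cubicDeriv, fourierInv_diagDeriv] at h1
  refine mul_left_cancel₀ (hne ζ hζ) ?_
  rw [Pi.zero_apply] at h1
  linear_combination -h1

theorem bddSymbol_of_continuous_mul {d c : Plane → ℂ} (hd : Continuous d) (hc : BddSupp c) :
    BddSupp fun ζ => d ζ * c ζ := by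
  obtain ⟨⟨hm, B, hB⟩, r, hr⟩ := hc
  obtain ⟨D, hD⟩ := (isCompact_closedBall (0 : Plane) r).exists_bound_of_continuousOn hd.continuousOn
  refine ⟨⟨hd.measurable.mul hm, |D| * |B|, fun ζ => ?_⟩, r, fun ζ h => by simp [hr ζ h]⟩
  by_cases h : ‖ζ‖ ≤ r
  · rw [norm_mul]
    exact mul_le_mul ((hD ζ (by simpa using h)).trans (le_abs_self _))
      ((hB ζ).trans (le_abs_self _)) (norm_nonneg _) (abs_nonneg _)
  · simp only [hr ζ (not_le.1 h), mul_zero, norm_zero]; positivity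

@[fun_prop]
theorem continuous_diagSymbol : Continuous diagSymbol := by unfold diagSymbol; fun_prop

@[fun_prop]
theorem continuous_quadSymbol : Continuous quadSymbol := by unfold quadSymbol; fun_prop

theorem IsSolution.evolution {σ s δ : ℝ} {u : ℝ → L2Plane} (hu : IsSolution σ s δ u)
    (hs : 1 / 2 < s) (hδ : 0 < δ) {t₁ t₂ : ℝ} (h₁ : 0 < t₁) (h₁₂ : t₁ ≤ t₂) (h₂ : t₂ < δ)
    {c : Plane → ℂ} (hc : BddSupp c) :
    mulOp c (solHat s δ u t₂) - mulOp c (solHat s δ u t₁) =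
      ∫ t in t₁..t₂, evolRHS σ s δ u c t := by
  have hcH := hu.continuous_solHat hδ
  have hcC := hu.continuous_solCube hδ
  have d1 : BddSupp fun ζ => Complex.I * (diagSymbol ζ * quadSymbol ζ) * c ζ :=
    bddSymbol_of_continuous_mul (by fun_prop) hc
  have d2 : BddSupp fun ζ => diagSymbol ζ * c ζ := bddSymbol_of_continuous_mul (by fun_prop) hc
  obtain ⟨r, hr⟩ := hc.2
  unfold evolRHS
  rw [← map_sub, intervalIntegral.integral_sub (Continuous.intervalIntegrable (by fun_prop) _ _)
    (Continuous.intervalIntegrable (by fun_prop) _ _), intervalIntegral.integral_smul,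
    ContinuousLinearMap.intervalIntegral_comp_comm _ (hcH.intervalIntegrable _ _),
    ContinuousLinearMap.intervalIntegral_comp_comm _ (hcC.intervalIntegrable _ _)]
  refine mulOp_eq_of_ae hc.1 ?_
  filter_upwards [hu.evolution_ae hs hδ h₁ h₁₂ h₂ r,
    Lp.coeFn_sub (mulOp (fun ζ => Complex.I * (diagSymbol ζ * quadSymbol ζ) * c ζ)
      (∫ t in t₁..t₂, solHat s δ u t)) ((Complex.I * (σ * aConst)) •
        truncFourier (fun ζ => diagSymbol ζ * c ζ) (∫ t in t₁..t₂, solCube s δ u t)),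
    mulOp_ae d1.1 (∫ t in t₁..t₂, solHat s δ u t),
    Lp.coeFn_smul (Complex.I * (σ * aConst)) (truncFourier (fun ζ => diagSymbol ζ * c ζ)
      (∫ t in t₁..t₂, solCube s δ u t)),
    truncFourier_ae d2 (∫ t in t₁..t₂, solCube s δ u t)] with ζ h1 h2 h3 h4 h5
  rw [h2, Pi.sub_apply, h3, h4, Pi.smul_apply, h5, smul_eq_mul]
  by_cases h : ‖ζ‖ ≤ r
  · rw [h1 h]; ring
  · rw [hr ζ (not_le.1 h)]; ring

theorem IsSolution.hasDerivAt {σ s δ : ℝ} {u : ℝ → L2Plane} (hu : IsSolution σ s δ u)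
    (hs : 1 / 2 < s) (hδ : 0 < δ) {t : ℝ} (ht : t ∈ Set.Ioo 0 δ)
    {c : Plane → ℂ} (hc : BddSupp c) :
    HasDerivAt (fun r => mulOp c (solHat s δ u r)) (evolRHS σ s δ u c t) t := by
  have hcont := hu.continuous_evolRHS hδ c
  set t₀ := t / 2
  have h0 : 0 < t₀ := half_pos ht.1
  have h1 : HasDerivAt (fun r => mulOp c (solHat s δ u t₀) + ∫ x in t₀..r, evolRHS σ s δ u c x)
      (evolRHS σ s δ u c t) t :=
    (intervalIntegral.integral_hasDerivAt_right (hcont.intervalIntegrable _ _)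
      (hcont.stronglyMeasurableAtFilter _ _) hcont.continuousAt).const_add _
  refine h1.congr_of_eventuallyEq ?_
  filter_upwards [Ioo_mem_nhds (half_lt_self ht.1) ht.2] with r hr
  rw [← hu.evolution hs hδ h0 hr.1.le hr.2 hc]
  abel

end

noncomputable section

/-! ### Multilinear space-time estimates for pieces in shells -/

/-- The gain of the bilinear smoothing estimate at the frequency `2^j`. -/
def smoothGain (e : ℝ) (j : ℕ) : ℝ := ((2 : ℝ) ^ j) ^ (-(2 - e))

theorem smoothGain_pos (e : ℝ) (j : ℕ) : 0 < smoothGain e j := by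
  unfold smoothGain; positivity

theorem smoothGain_anti {e : ℝ} (he : e ≤ 2) {i j : ℕ} (h : i ≤ j) :
    smoothGain e j ≤ smoothGain e i := by
  unfold smoothGain
  exact Real.rpow_le_rpow_of_nonpos (by positivity) (by gcongr; norm_num) (by linarith)

theorem ShellSymbol.continuous_stPiece {b : ℝ} (hb : 1 / 2 < b) {G : SpaceTime → ℂ}
    (hG : AEStronglyMeasurable G) (hX : bourgainSq b G < ⊤) {j : ℕ} {A : ℝ} {c : Plane → ℂ}
    (h : ShellSymbol j A c) : Continuous (stPiece c G) :=
  continuous_fourierInv (h.integrable hb hG hX)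

/-- Cauchy–Schwarz splits the four factors into two pairs. The factor of index 0 goes into one pair
and the largest of the other three into the other, so both gains are available at once; the
permutations place the largest frequency. -/
theorem exists_lintegral_four_stPiece_le {b e : ℝ} (hb : 1 / 2 < b) (he : 0 < e) (he2 : e ≤ 2) :
    ∃ C : ℝ, 0 ≤ C ∧ ∀ {G : SpaceTime → ℂ}, AEStronglyMeasurable G → bourgainSq b G < ⊤ →
      ∀ {j₀ j₁ j₂ j₃ : ℕ} {A₀ A₁ A₂ A₃ : ℝ} {c₀ c₁ c₂ c₃ : Plane → ℂ}, ShellSymbol j₀ A₀ c₀ →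
      ShellSymbol j₁ A₁ c₁ → ShellSymbol j₂ A₂ c₂ → ShellSymbol j₃ A₃ c₃ →
      ∫⁻ p, ‖stPiece c₀ G p‖ₑ * (‖stPiece c₁ G p‖ₑ * ‖stPiece c₂ G p‖ₑ * ‖stPiece c₃ G p‖ₑ) ≤
        ENNReal.ofReal (C * (A₀ * (A₁ * A₂ * A₃)) *
          (smoothGain e j₀ * smoothGain e (max (max j₁ j₂) j₃))) * bourgainSq b G ^ 2 := by
  obtain ⟨C, hC0, hC⟩ := exists_lintegral_stPiece_mul_le hb he he2
  refine ⟨C * C, by positivity, fun {G} hG hX => ?_⟩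
  have key : ∀ {j₀ j₁ j₂ j₃ : ℕ} {A₀ A₁ A₂ A₃ : ℝ} {c₀ c₁ c₂ c₃ : Plane → ℂ},
      ShellSymbol j₀ A₀ c₀ → ShellSymbol j₁ A₁ c₁ → ShellSymbol j₂ A₂ c₂ → ShellSymbol j₃ A₃ c₃ →
      ∫⁻ p, (‖stPiece c₀ G p‖ₑ * ‖stPiece c₃ G p‖ₑ) * (‖stPiece c₁ G p‖ₑ * ‖stPiece c₂ G p‖ₑ) ≤
        ENNReal.ofReal (C * C * (A₀ * (A₁ * A₂ * A₃)) *
          (smoothGain e j₀ * smoothGain e j₁)) * bourgainSq b G ^ 2 := by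
    intro j₀ j₁ j₂ j₃ A₀ A₁ A₂ A₃ c₀ c₁ c₂ c₃ h₀ h₁ h₂ h₃
    have m (j : ℕ) (A : ℝ) (c : Plane → ℂ) (h : ShellSymbol j A c) :
        Measurable fun p => ‖stPiece c G p‖ₑ := (h.continuous_stPiece hb hG hX).measurable.enorm
    have n₀ := h₀.nonneg
    have n₁ := h₁.nonneg
    have n₂ := h₂.nonneg
    have n₃ := h₃.nonneg
    refine (lintegral_mul_le_sqrt volume ((m _ _ _ h₀).mul (m _ _ _ h₃)).aemeasurable
      ((m _ _ _ h₁).mul (m _ _ _ h₂)).aemeasurable).trans ?_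
    refine (mul_le_mul' (ennreal_sqrt_le_of_le_sq (hC hG hX h₀ h₃))
      (ennreal_sqrt_le_of_le_sq (hC hG hX h₁ h₂))).trans ?_
    have g₀ : ((2 : ℝ) ^ (max j₀ j₃)) ^ (-(2 - e)) ≤ smoothGain e j₀ :=
      smoothGain_anti he2 (le_max_left j₀ j₃)
    have g₁ : ((2 : ℝ) ^ (max j₁ j₂)) ^ (-(2 - e)) ≤ smoothGain e j₁ :=
      smoothGain_anti he2 (le_max_left j₁ j₂)
    rw [mul_mul_mul_comm, ← sq, ← ENNReal.ofReal_mul (by positivity)]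
    gcongr ENNReal.ofReal ?_ * _
    have p₀ := smoothGain_pos e j₀
    calc C * A₀ * A₃ * (2 ^ max j₀ j₃) ^ (-(2 - e)) * (C * A₁ * A₂ * (2 ^ max j₁ j₂) ^ (-(2 - e)))
        ≤ C * A₀ * A₃ * smoothGain e j₀ * (C * A₁ * A₂ * smoothGain e j₁) := by gcongr
      _ = _ := by ring
  intro j₀ j₁ j₂ j₃ A₀ A₁ A₂ A₃ c₀ c₁ c₂ c₃ h₀ h₁ h₂ h₃
  rcases max_choice (max j₁ j₂) j₃ with h | h <;> rw [h]
  · rcases max_choice j₁ j₂ with h' | h' <;> rw [h']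
    · refine le_trans (le_of_eq ?_) (key h₀ h₁ h₂ h₃)
      refine lintegral_congr fun p => ?_
      ring
    · refine le_trans (le_of_eq ?_) ((key h₀ h₂ h₁ h₃).trans_eq ?_)
      · refine lintegral_congr fun p => ?_
        ring
      · rw [mul_comm A₂ A₁]
  · refine le_trans (le_of_eq ?_) ((key h₀ h₃ h₂ h₁).trans_eq ?_)
    · refine lintegral_congr fun p => ?_
      ring
    · rw [show A₃ * A₂ * A₁ = A₁ * A₂ * A₃ by ring]

/-- The bilinear estimate is used for a pair that contains the largest frequency, and the third
factor is taken in the sup norm without loss. -/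
theorem exists_lintegral_three_stPiece_le {b e : ℝ} (hb : 1 / 2 < b) (he : 0 < e) (he2 : e ≤ 2) :
    ∃ C : ℝ, 0 ≤ C ∧ ∀ {G : SpaceTime → ℂ}, AEStronglyMeasurable G → bourgainSq b G < ⊤ →
      ∀ {j₁ j₂ j₃ : ℕ} {A₁ A₂ A₃ : ℝ} {c₁ c₂ c₃ : Plane → ℂ},
      ShellSymbol j₁ A₁ c₁ → ShellSymbol j₂ A₂ c₂ → ShellSymbol j₃ A₃ c₃ →
      ∫⁻ p, (‖stPiece c₁ G p‖ₑ * ‖stPiece c₂ G p‖ₑ * ‖stPiece c₃ G p‖ₑ) ^ 2 ≤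
        ENNReal.ofReal (C * (A₁ * A₂ * A₃) * smoothGain e (max (max j₁ j₂) j₃)) ^ 2 *
          bourgainSq b G ^ 3 := by
  obtain ⟨C, hC0, hC⟩ := exists_lintegral_stPiece_mul_le hb he he2
  obtain ⟨D, hD0, hD⟩ := exists_lintegral_enorm_shell_le hb
  refine ⟨C * D, by positivity, fun {G} hG hX => ?_⟩
  have key : ∀ {j₁ j₂ j₃ : ℕ} {A₁ A₂ A₃ : ℝ} {c₁ c₂ c₃ : Plane → ℂ},
      ShellSymbol j₁ A₁ c₁ → ShellSymbol j₂ A₂ c₂ → ShellSymbol j₃ A₃ c₃ →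
      ∫⁻ p, (‖stPiece c₁ G p‖ₑ * ‖stPiece c₂ G p‖ₑ * ‖stPiece c₃ G p‖ₑ) ^ 2 ≤
        ENNReal.ofReal (C * D * (A₁ * A₂ * A₃) * smoothGain e j₁) ^ 2 * bourgainSq b G ^ 3 := by
    intro j₁ j₂ j₃ A₁ A₂ A₃ c₁ c₂ c₃ h₁ h₂ h₃
    have m (j : ℕ) (A : ℝ) (c : Plane → ℂ) (h : ShellSymbol j A c) :
        Measurable fun p => ‖stPiece c G p‖ₑ := (h.continuous_stPiece hb hG hX).measurable.enorm
    have n₁ := h₁.nonneg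
    have n₂ := h₂.nonneg
    have n₃ := h₃.nonneg
    have g₁ : ((2 : ℝ) ^ (max j₁ j₂)) ^ (-(2 - e)) ≤ smoothGain e j₁ :=
      smoothGain_anti he2 (le_max_left j₁ j₂)
    have m₁ := m _ _ _ h₁
    have m₂ := m _ _ _ h₂
    calc ∫⁻ p, (‖stPiece c₁ G p‖ₑ * ‖stPiece c₂ G p‖ₑ * ‖stPiece c₃ G p‖ₑ) ^ 2
        ≤ ∫⁻ p, (‖stPiece c₁ G p‖ₑ * ‖stPiece c₂ G p‖ₑ) ^ 2 *
            (ENNReal.ofReal (D * A₃) * bourgainSq b G ^ (1 / 2 : ℝ)) ^ 2 := by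
          refine lintegral_mono fun p => ?_
          rw [mul_pow]
          gcongr
          exact (enorm_fourierInv_le _ _).trans (hD hG h₃)
      _ = (∫⁻ p, (‖stPiece c₁ G p‖ₑ * ‖stPiece c₂ G p‖ₑ) ^ 2) *
            (ENNReal.ofReal (D * A₃) ^ 2 * bourgainSq b G) := by
          rw [lintegral_mul_const _ (by fun_prop), mul_pow, ennreal_sqrt_sq]
      _ ≤ (ENNReal.ofReal (C * A₁ * A₂ * smoothGain e j₁) * bourgainSq b G) ^ 2 *
            (ENNReal.ofReal (D * A₃) ^ 2 * bourgainSq b G) := by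
          gcongr
          refine (hC hG hX h₁ h₂).trans ?_
          gcongr
      _ = _ := by
          rw [show C * D * (A₁ * A₂ * A₃) * smoothGain e j₁ =
            (C * A₁ * A₂ * smoothGain e j₁) * (D * A₃) by ring,
            ENNReal.ofReal_mul (p := C * A₁ * A₂ * smoothGain e j₁)
              (by have := smoothGain_pos e j₁; positivity)]
          ring
  intro j₁ j₂ j₃ A₁ A₂ A₃ c₁ c₂ c₃ h₁ h₂ h₃
  rcases max_choice (max j₁ j₂) j₃ with h | h <;> rw [h]
  · rcases max_choice j₁ j₂ with h' | h' <;> rw [h']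
    · exact key h₁ h₂ h₃
    · refine le_trans (le_of_eq ?_) ((key h₂ h₁ h₃).trans_eq ?_)
      · refine lintegral_congr fun p => ?_
        ring
      · rw [mul_comm A₂ A₁]
  · refine le_trans (le_of_eq ?_) ((key h₃ h₂ h₁).trans_eq ?_)
    · refine lintegral_congr fun p => ?_
      ring
    · rw [show A₃ * A₂ * A₁ = A₁ * A₂ * A₃ by ring]

/-- The curve `L` consists of the lifts of the time slices of a space-time function with the
Fourier transform `G`. -/
structure IsSpaceTimeLift (s T : ℝ) (L : ℝ → L2Plane) (G : SpaceTime → ℂ) : Prop where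
  aestronglyMeasurable : AEStronglyMeasurable G
  slice : ∀ t ∈ Set.Ioo 0 T, ∀ c : Plane → ℂ, BddSupp c →
    (besselL2 s (mulOp c (L t)) : Plane → ℂ) =ᵐ[volume] fun z => stPiece c G (pt z t)

/-- The truncated Fourier transform of a product of three pieces. -/
def triProd (s : ℝ) (κ c₁ c₂ c₃ : Plane → ℂ) (f : L2Plane) : L2Plane :=
  truncFourier κ (besselCube s (mulOp c₁ f) (mulOp c₂ f) (mulOp c₃ f))

/-- The output multiplier `κ` is moved to the other factor, where it is absorbed in the symbol of
the piece. -/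
theorem enorm_inner_triProd_le {s : ℝ} (hs : 1 / 2 < s) {κ c₀ : Plane → ℂ} (hκ : BddSupp κ)
    (h₀ : BddSupp c₀) (c₁ c₂ c₃ : Plane → ℂ) (f : L2Plane) :
    ‖inner ℂ (mulOp c₀ (mulOp (japSymbol s) f)) (triProd s κ c₁ c₂ c₃ f)‖ₑ ≤
      ∫⁻ z, ‖besselL2 s (mulOp (fun ζ => (starRingEnd ℂ) (κ ζ) * c₀ ζ) f) z‖ₑ *
        (‖besselL2 s (mulOp c₁ f) z‖ₑ * ‖besselL2 s (mulOp c₂ f) z‖ₑ *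
          ‖besselL2 s (mulOp c₃ f) z‖ₑ) := by
  have hJ := bddSymbol_japSymbol (s := s) (by linarith)
  have e : fInv (mulOp (fun ζ => (starRingEnd ℂ) (κ ζ)) (mulOp c₀ (mulOp (japSymbol s) f))) =
      besselL2 s (mulOp (fun ζ => (starRingEnd ℂ) (κ ζ) * c₀ ζ) f) := by
    rw [besselL2, ContinuousLinearMap.comp_apply, mulOp_mulOp hκ.conj.1 h₀.1,
      mulOp_mulOp (hκ.conj.1.mul h₀.1) hJ, mulOp_mulOp hJ (hκ.conj.1.mul h₀.1)]
    exact congrArg (fun c => fInv (mulOp c f)) (funext fun ζ => mul_comm _ _)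
  rw [triProd, inner_truncFourier hκ, e]
  refine (enorm_integral_le_lintegral_enorm _).trans (le_of_eq (lintegral_congr_ae ?_))
  filter_upwards [besselCube_ae hs (mulOp c₁ f) (mulOp c₂ f) (mulOp c₃ f)] with z hz
  rw [hz]
  simp only [enorm_mul, RCLike.enorm_conj]

theorem enorm_triProd_sq_le {s : ℝ} (hs : 1 / 2 < s) {κ : Plane → ℂ} (hκ : BddSupp κ) {B : ℝ}
    (hB : ∀ ζ, ‖κ ζ‖ ≤ B) (c₁ c₂ c₃ : Plane → ℂ) (f : L2Plane) :
    ‖triProd s κ c₁ c₂ c₃ f‖ₑ ^ 2 ≤ ENNReal.ofReal B ^ 2 *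
      ∫⁻ z, (‖besselL2 s (mulOp c₁ f) z‖ₑ * ‖besselL2 s (mulOp c₂ f) z‖ₑ *
          ‖besselL2 s (mulOp c₃ f) z‖ₑ) ^ 2 := by
  refine (norm_truncFourier_le hκ hB _).trans_eq ?_
  congr 1
  refine lintegral_congr_ae ?_
  filter_upwards [besselCube_ae hs (mulOp c₁ f) (mulOp c₂ f) (mulOp c₃ f)] with z hz
  rw [hz, enorm_mul, enorm_mul]

theorem exists_lintegral_inner_triProd_le {s b e : ℝ} (hs : 1 / 2 < s) (hb : 1 / 2 < b)
    (he : 0 < e) (he2 : e ≤ 2) :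
    ∃ C : ℝ, 0 ≤ C ∧ ∀ {T : ℝ} {L : ℝ → L2Plane} {G : SpaceTime → ℂ}, IsSpaceTimeLift s T L G →
      bourgainSq b G < ⊤ → ∀ {j₀ j₁ j₂ j₃ : ℕ} {A₀ A₁ A₂ A₃ : ℝ} {κ c₀ c₁ c₂ c₃ : Plane → ℂ},
      BddSupp κ → (∀ ζ, ‖κ ζ‖ ≤ 1) → ShellSymbol j₀ A₀ c₀ →
      ShellSymbol j₁ A₁ c₁ → ShellSymbol j₂ A₂ c₂ → ShellSymbol j₃ A₃ c₃ →
      ∫⁻ t in Set.Ioo 0 T, ‖inner ℂ (mulOp c₀ (mulOp (japSymbol s) (L t)))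
          (triProd s κ c₁ c₂ c₃ (L t))‖ₑ ≤
        ENNReal.ofReal (C * (A₀ * (A₁ * A₂ * A₃)) *
          (smoothGain e j₀ * smoothGain e (max (max j₁ j₂) j₃))) * bourgainSq b G ^ 2 := by
  obtain ⟨C, hC0, hC⟩ := exists_lintegral_four_stPiece_le hb he he2
  refine ⟨C, hC0, fun {T L G} hL hX {j₀ j₁ j₂ j₃ A₀ A₁ A₂ A₃ κ c₀ c₁ c₂ c₃} hκ hκ1 h₀ h₁ h₂ h₃ => ?_⟩
  have h₀' : ShellSymbol j₀ A₀ fun ζ => (starRingEnd ℂ) (κ ζ) * c₀ ζ :=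
    ⟨hκ.conj.1.1.mul h₀.measurable, fun ζ => by
      rw [norm_mul, RCLike.norm_conj]
      exact (mul_le_of_le_one_left (norm_nonneg _) (hκ1 ζ)).trans (h₀.norm_le ζ),
      fun ζ h => by simp [h₀.eq_zero ζ h]⟩
  have hG := hL.aestronglyMeasurable
  refine le_trans ?_ (hC hG hX h₀' h₁ h₂ h₃)
  have m (j : ℕ) (A : ℝ) (c : Plane → ℂ) (h : ShellSymbol j A c) :
      Measurable fun p => ‖stPiece c G p‖ₑ := (h.continuous_stPiece hb hG hX).measurable.enorm
  have m₀ := m _ _ _ h₀'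
  have m₁ := m _ _ _ h₁
  have m₂ := m _ _ _ h₂
  have m₃ := m _ _ _ h₃
  rw [lintegral_spaceTime (Measurable.aemeasurable (by fun_prop))]
  refine le_trans (setLIntegral_mono' measurableSet_Ioo fun t ht => ?_)
    (setLIntegral_le_lintegral _ _)
  refine (enorm_inner_triProd_le hs hκ h₀.bddSupp c₁ c₂ c₃ (L t)).trans_eq
    (lintegral_congr_ae ?_)
  filter_upwards [hL.slice t ht _ h₀'.bddSupp, hL.slice t ht _ h₁.bddSupp,
    hL.slice t ht _ h₂.bddSupp, hL.slice t ht _ h₃.bddSupp] with z e₀ e₁ e₂ e₃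
  rw [e₀, e₁, e₂, e₃]

theorem exists_lintegral_triProd_le {s b e : ℝ} (hs : 1 / 2 < s) (hb : 1 / 2 < b)
    (he : 0 < e) (he2 : e ≤ 2) :
    ∃ C : ℝ, 0 ≤ C ∧ ∀ {T : ℝ} {L : ℝ → L2Plane} {G : SpaceTime → ℂ}, IsSpaceTimeLift s T L G →
      bourgainSq b G < ⊤ → ∀ {j₁ j₂ j₃ : ℕ} {A₁ A₂ A₃ B : ℝ} {κ c₁ c₂ c₃ : Plane → ℂ},
      BddSupp κ → (∀ ζ, ‖κ ζ‖ ≤ B) →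
      ShellSymbol j₁ A₁ c₁ → ShellSymbol j₂ A₂ c₂ → ShellSymbol j₃ A₃ c₃ →
      ∫⁻ t in Set.Ioo 0 T, ‖triProd s κ c₁ c₂ c₃ (L t)‖ₑ ^ 2 ≤
        ENNReal.ofReal (C * B * (A₁ * A₂ * A₃) * smoothGain e (max (max j₁ j₂) j₃)) ^ 2 *
          bourgainSq b G ^ 3 := by
  obtain ⟨C, hC0, hC⟩ := exists_lintegral_three_stPiece_le hb he he2
  refine ⟨C, hC0, fun {T L G} hL hX {j₁ j₂ j₃ A₁ A₂ A₃ B κ c₁ c₂ c₃} hκ hB h₁ h₂ h₃ => ?_⟩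
  have hB0 : 0 ≤ B := (norm_nonneg _).trans (hB 0)
  have hG := hL.aestronglyMeasurable
  have m (j : ℕ) (A : ℝ) (c : Plane → ℂ) (h : ShellSymbol j A c) :
      Measurable fun p => ‖stPiece c G p‖ₑ := (h.continuous_stPiece hb hG hX).measurable.enorm
  have m₁ := m _ _ _ h₁
  have m₂ := m _ _ _ h₂
  have m₃ := m _ _ _ h₃
  calc ∫⁻ t in Set.Ioo 0 T, ‖triProd s κ c₁ c₂ c₃ (L t)‖ₑ ^ 2
      ≤ ∫⁻ t in Set.Ioo 0 T, ENNReal.ofReal B ^ 2 * ∫⁻ z : Plane, (‖stPiece c₁ G (pt z t)‖ₑ *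
          ‖stPiece c₂ G (pt z t)‖ₑ * ‖stPiece c₃ G (pt z t)‖ₑ) ^ 2 := by
        refine setLIntegral_mono' measurableSet_Ioo fun t ht => ?_
        refine (enorm_triProd_sq_le hs hκ hB c₁ c₂ c₃ (L t)).trans_eq ?_
        congr 1
        refine lintegral_congr_ae ?_
        filter_upwards [hL.slice t ht _ h₁.bddSupp, hL.slice t ht _ h₂.bddSupp,
          hL.slice t ht _ h₃.bddSupp] with z e₁ e₂ e₃
        rw [e₁, e₂, e₃]
    _ ≤ ENNReal.ofReal B ^ 2 * ∫⁻ p, (‖stPiece c₁ G p‖ₑ * ‖stPiece c₂ G p‖ₑ *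
          ‖stPiece c₃ G p‖ₑ) ^ 2 := by
        rw [lintegral_const_mul' _ _ (by finiteness), 
          lintegral_spaceTime (Measurable.aemeasurable (by fun_prop))]
        gcongr
        exact Measure.restrict_le_self
    _ ≤ ENNReal.ofReal B ^ 2 * (ENNReal.ofReal (C * (A₁ * A₂ * A₃) *
          smoothGain e (max (max j₁ j₂) j₃)) ^ 2 * bourgainSq b G ^ 3) := by
        gcongr
        exact hC hG hX h₁ h₂ h₃
    _ = _ := by
        rw [show C * B * (A₁ * A₂ * A₃) * smoothGain e (max (max j₁ j₂) j₃) =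
          B * (C * (A₁ * A₂ * A₃) * smoothGain e (max (max j₁ j₂) j₃)) by ring,
          ENNReal.ofReal_mul hB0]
        ring

end

noncomputable section

/-! ### Summation over dyadic frequencies -/

/-- The bound for the inverse of the symbol of `I_N` on a shell. -/
def invBound (s N : ℝ) (j : ℕ) : ℝ := 2 * (max 1 (12 * Real.pi * 2 ^ j / N)) ^ (1 - s)

/-- The ratio of the geometric series in the dyadic sums. -/
def dyadicRatio (e : ℝ) : ℝ := (2 : ℝ) ^ (-e / 4)

theorem dyadicRatio_pos (e : ℝ) : 0 < dyadicRatio e := by unfold dyadicRatio; positivity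

theorem dyadicRatio_lt_one {e : ℝ} (he : 0 < e) : dyadicRatio e < 1 :=
  Real.rpow_lt_one_of_one_lt_of_neg (by norm_num) (by linarith)

/-- Decay at the largest frequency is distributed over several indices of total size at most `4j +
3`, each receiving the ratio `2^{-e/4}`. The excess 3 costs `2^{3e/4} ≤ 2`. -/
theorem two_pow_rpow_neg_le {e : ℝ} (he : 0 < e) {j n : ℕ} (h : n ≤ 4 * j + 3) (he1 : e ≤ 1) :
    ((2 : ℝ) ^ j) ^ (-e) ≤ 2 * dyadicRatio e ^ n := by
  have h1 : ((2 : ℝ) ^ j) ^ (-e) = dyadicRatio e ^ (4 * j) := by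
    rw [dyadicRatio, ← Real.rpow_natCast, ← Real.rpow_natCast, ← Real.rpow_mul (by norm_num),
      ← Real.rpow_mul (by norm_num)]
    congr 1; push_cast; ring
  have h2 : (1 : ℝ) ≤ 2 * dyadicRatio e ^ 3 := by
    rw [dyadicRatio, ← Real.rpow_natCast, ← Real.rpow_mul (by norm_num)]
    rw [← Real.rpow_one_add' (by norm_num) (by push_cast; linarith)]
    refine Real.one_le_rpow (by norm_num) ?_
    push_cast; linarith
  have h3 : dyadicRatio e ^ (4 * j + 3) ≤ dyadicRatio e ^ n :=
    pow_le_pow_of_le_one (dyadicRatio_pos e).le (dyadicRatio_lt_one he).le h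
  rw [h1]
  calc dyadicRatio e ^ (4 * j) ≤ dyadicRatio e ^ (4 * j) * (2 * dyadicRatio e ^ 3) :=
        le_mul_of_one_le_right (pow_nonneg (dyadicRatio_pos e).le _) h2
    _ = 2 * dyadicRatio e ^ (4 * j + 3) := by rw [pow_add]; ring
    _ ≤ _ := by gcongr

theorem one_le_invBound {s N : ℝ} (hs : s ≤ 1) (j : ℕ) : 1 ≤ invBound s N j := by
  have : (1 : ℝ) ≤ (max 1 (12 * Real.pi * 2 ^ j / N)) ^ (1 - s) :=
    Real.one_le_rpow (le_max_left _ _) (by linarith)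
  unfold invBound; linarith

theorem invBound_mono {s N : ℝ} (hs : s ≤ 1) (hN : 0 < N) {i j : ℕ} (h : i ≤ j) :
    invBound s N i ≤ invBound s N j := by
  unfold invBound
  have : 0 ≤ 1 - s := sub_nonneg.2 hs
  gcongr
  norm_num

theorem invBound_triple_le {s N : ℝ} (hs : s ≤ 1) (hN : 0 < N) (j₁ j₂ j₃ : ℕ) :
    invBound s N j₁ * invBound s N j₂ * invBound s N j₃ ≤
      invBound s N (max (max j₁ j₂) j₃) ^ 3 := by
  have h0 (j : ℕ) : 0 ≤ invBound s N j := zero_le_one.trans (one_le_invBound hs j)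
  have h1 : invBound s N j₁ ≤ invBound s N (max (max j₁ j₂) j₃) := invBound_mono hs hN (by simp)
  have h2 : invBound s N j₂ ≤ invBound s N (max (max j₁ j₂) j₃) := invBound_mono hs hN (by simp)
  have h3 : invBound s N j₃ ≤ invBound s N (max (max j₁ j₂) j₃) := invBound_mono hs hN (by simp)
  rw [pow_three']
  have := h0 j₁; have := h0 j₂; have := h0 j₃; have := h0 (max (max j₁ j₂) j₃)
  gcongr

theorem invBound_pow_three_le_of_low {s N : ℝ} (hN : 0 < N) {j : ℕ} (h : 12 * Real.pi * 2 ^ j ≤ N) :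
    invBound s N j ^ 3 = 8 := by
  rw [invBound, max_eq_left ((div_le_one hN).2 h), Real.one_rpow]; norm_num

/-- Here `s > 3/4` enters: `3(1-s) < 3/4 ≤ 1 - 3e`, and the base is at least 1. -/
theorem invBound_pow_three_le_of_high {s N e : ℝ} (hs : 3 / 4 < s) (he : e ≤ 1 / 12) (hN : 0 < N)
    {j : ℕ} (h : N ≤ 12 * Real.pi * 2 ^ j) :
    invBound s N j ^ 3 ≤ 8 * ((12 * Real.pi) ^ (1 - 3 * e) * ((2 : ℝ) ^ j) ^ (1 - 3 * e) *
      N ^ (-1 + 3 * e)) := by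
  have hx : 1 ≤ 12 * Real.pi * 2 ^ j / N := (one_le_div hN).2 h
  have hπ := Real.pi_pos
  rw [invBound, max_eq_right hx, mul_pow,
    ← Real.rpow_natCast ((12 * Real.pi * 2 ^ j / N) ^ (1 - s)) 3, ← Real.rpow_mul (by positivity)]
  have h1 : (12 * Real.pi * 2 ^ j / N) ^ ((1 - s) * ((3 : ℕ) : ℝ)) ≤
      (12 * Real.pi * 2 ^ j / N) ^ (1 - 3 * e) :=
    Real.rpow_le_rpow_of_exponent_le hx (by push_cast; linarith)
  have h2 : (12 * Real.pi * 2 ^ j / N) ^ (1 - 3 * e) = (12 * Real.pi) ^ (1 - 3 * e) *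
      ((2 : ℝ) ^ j) ^ (1 - 3 * e) * N ^ (-1 + 3 * e) := by
    rw [Real.div_rpow (by positivity) hN.le, Real.mul_rpow (by positivity) (by positivity),
      show -1 + 3 * e = -(1 - 3 * e) by ring, Real.rpow_neg hN.le, div_eq_mul_inv]
  rw [← h2]
  norm_num
  exact_mod_cast h1

theorem twelve_pi_rpow_le {x : ℝ} (hx : x ≤ 1) : (12 * Real.pi) ^ x ≤ 48 := by
  have hπ := Real.pi_gt_three
  have hπ4 := Real.pi_lt_four
  calc (12 * Real.pi) ^ x ≤ (12 * Real.pi) ^ (1 : ℝ) :=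
        Real.rpow_le_rpow_of_exponent_le (by linarith) hx
    _ ≤ 48 := by rw [Real.rpow_one]; linarith

/-- Power counting at the largest frequency `2^k` of the cube. The dispersion symbol costs `8^{j₀}`
with `j₀ ≤ k + 3`, the two bilinear gains give `-(2-e)` each, and the inverse multipliers of `I_N`
cost `1 - 3e` together with the factor `N^{-1+3e}`. -/
theorem quartic_dyadic_le {s N e : ℝ} (hs : 3 / 4 < s) (hs1 : s ≤ 1) (he : 0 < e) (he1 : e ≤ 1 / 12)
    (hN : 0 < N) {j₀ j₁ j₂ j₃ : ℕ} (h₀ : j₀ ≤ max (max j₁ j₂) j₃ + 3)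
    (h : N ≤ 12 * Real.pi * 2 ^ (max (max j₁ j₂) j₃)) :
    8 ^ j₀ * (invBound s N j₁ * invBound s N j₂ * invBound s N j₃) *
      (smoothGain e j₀ * smoothGain e (max (max j₁ j₂) j₃)) ≤
      50000 * N ^ (-1 + 3 * e) * dyadicRatio e ^ (j₀ + (j₁ + j₂ + j₃)) := by
  have hm := invBound_triple_le hs1 hN j₁ j₂ j₃
  have l1 : j₁ ≤ max (max j₁ j₂) j₃ := by simp
  have l2 : j₂ ≤ max (max j₁ j₂) j₃ := by simp
  have l3 : j₃ ≤ max (max j₁ j₂) j₃ := by simp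
  set k := max (max j₁ j₂) j₃
  have hp := hm.trans (invBound_pow_three_le_of_high hs he1 hN h)
  have hr := two_pow_rpow_neg_le he (j := k) (n := j₀ + (j₁ + j₂ + j₃)) (by omega) (by linarith)
  -- The exponent is `3 - (2 - e) = 1 + e`, and `2^{j₀} ≤ 8 · 2^k` produces `8^{1+e} ≤ 64`.
  have g₀ : (8 : ℝ) ^ j₀ * smoothGain e j₀ ≤ 64 * ((2 : ℝ) ^ k) ^ (1 + e) := by
    have e1 : (8 : ℝ) ^ j₀ = ((2 : ℝ) ^ j₀) ^ (3 : ℝ) := by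
      rw [show (3 : ℝ) = ((3 : ℕ) : ℝ) by norm_num, Real.rpow_natCast, ← pow_mul, mul_comm, pow_mul]
      norm_num
    rw [e1, smoothGain, ← Real.rpow_add (by positivity), show (3 : ℝ) + -(2 - e) = 1 + e by ring]
    have e2 : (2 : ℝ) ^ j₀ ≤ 8 * 2 ^ k := by
      calc (2 : ℝ) ^ j₀ ≤ 2 ^ (k + 3) := by gcongr; norm_num
        _ = 8 * 2 ^ k := by rw [pow_add]; ring
    calc ((2 : ℝ) ^ j₀) ^ (1 + e) ≤ (8 * 2 ^ k) ^ (1 + e) := by gcongr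
      _ = 8 ^ (1 + e) * ((2 : ℝ) ^ k) ^ (1 + e) := Real.mul_rpow (by norm_num) (by positivity)
      _ ≤ 64 * ((2 : ℝ) ^ k) ^ (1 + e) := by
          gcongr
          calc (8 : ℝ) ^ (1 + e) ≤ 8 ^ (2 : ℝ) :=
                Real.rpow_le_rpow_of_exponent_le (by norm_num) (by linarith)
            _ = 64 := by norm_num
  have hq : (0 : ℝ) < 2 ^ k := by positivity
  have hNp : 0 < N ^ (-1 + 3 * e) := Real.rpow_pos_of_pos hN _
  -- The balance of exponents: `(1 + e) - (2 - e) + (1 - 3e) = -e`.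
  have hcomb : ((2 : ℝ) ^ k) ^ (1 + e) * smoothGain e k * ((2 : ℝ) ^ k) ^ (1 - 3 * e) =
      ((2 : ℝ) ^ k) ^ (-e) := by
    rw [smoothGain, ← Real.rpow_add hq, ← Real.rpow_add hq]; congr 1; ring
  have hθ : 0 ≤ invBound s N j₁ * invBound s N j₂ * invBound s N j₃ := by
    have h0 (j : ℕ) : 0 ≤ invBound s N j := zero_le_one.trans (one_le_invBound hs1 j)
    have := h0 j₁; have := h0 j₂; have := h0 j₃
    positivity
  have hg := smoothGain_pos e k
  have hg0 := smoothGain_pos e j₀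
  have hπ : 0 < (12 * Real.pi) ^ (1 - 3 * e) := Real.rpow_pos_of_pos (by positivity) _
  calc 8 ^ j₀ * (invBound s N j₁ * invBound s N j₂ * invBound s N j₃) *
      (smoothGain e j₀ * smoothGain e k)
      = (8 ^ j₀ * smoothGain e j₀) * smoothGain e k *
        (invBound s N j₁ * invBound s N j₂ * invBound s N j₃) := by ring
    _ ≤ (64 * ((2 : ℝ) ^ k) ^ (1 + e)) * smoothGain e k *
        (8 * ((12 * Real.pi) ^ (1 - 3 * e) * ((2 : ℝ) ^ k) ^ (1 - 3 * e) * N ^ (-1 + 3 * e))) := by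
        gcongr
    _ = 512 * (12 * Real.pi) ^ (1 - 3 * e) * N ^ (-1 + 3 * e) * (((2 : ℝ) ^ k) ^ (1 + e) *
        smoothGain e k * ((2 : ℝ) ^ k) ^ (1 - 3 * e)) := by ring
    _ ≤ 512 * 48 * N ^ (-1 + 3 * e) * (2 * dyadicRatio e ^ (j₀ + (j₁ + j₂ + j₃))) := by
        rw [hcomb]
        gcongr
        exact twelve_pi_rpow_le (by linarith)
    _ ≤ _ := by
        have := pow_pos (dyadicRatio_pos e) (j₀ + (j₁ + j₂ + j₃))
        have : 0 < N ^ (-1 + 3 * e) * dyadicRatio e ^ (j₀ + (j₁ + j₂ + j₃)) := by positivity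
        nlinarith

/-- If the rough cube contains a high frequency, the factor in `N` comes from its inverse
multipliers, and the smooth cube has decay to spare. If only the smooth cube does, the inverse
multipliers are bounded and the factor in `N` comes from the surplus in `2^{l(-1+e)}`. -/
theorem sextic_dyadic_le {s N e : ℝ} (hs : 3 / 4 < s) (hs1 : s ≤ 1) (he : 0 < e) (he1 : e ≤ 1 / 12)
    (hN : 1 ≤ N) {i₁ i₂ i₃ j₁ j₂ j₃ : ℕ}
    (h : N ≤ 12 * Real.pi * 2 ^ (max (max i₁ i₂) i₃) ∨
      N ≤ 12 * Real.pi * 2 ^ (max (max j₁ j₂) j₃)) :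
    2 ^ (max (max i₁ i₂) i₃) * smoothGain e (max (max i₁ i₂) i₃) *
      ((invBound s N j₁ * invBound s N j₂ * invBound s N j₃) *
        smoothGain e (max (max j₁ j₂) j₃)) ≤
      50000 * N ^ (-1 + 3 * e) * dyadicRatio e ^ ((i₁ + i₂ + i₃) + (j₁ + j₂ + j₃)) := by
  have hN0 : 0 < N := by linarith
  have hm := invBound_triple_le hs1 hN0 j₁ j₂ j₃
  have l1 : i₁ ≤ max (max i₁ i₂) i₃ := by simp
  have l2 : i₂ ≤ max (max i₁ i₂) i₃ := by simp
  have l3 : i₃ ≤ max (max i₁ i₂) i₃ := by simp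
  have k1 : j₁ ≤ max (max j₁ j₂) j₃ := by simp
  have k2 : j₂ ≤ max (max j₁ j₂) j₃ := by simp
  have k3 : j₃ ≤ max (max j₁ j₂) j₃ := by simp
  set l := max (max i₁ i₂) i₃
  set k := max (max j₁ j₂) j₃
  have hr := two_pow_rpow_neg_le he (j := k) (n := j₁ + j₂ + j₃) (by omega) (by linarith)
  have hr' := two_pow_rpow_neg_le he (j := l) (n := i₁ + i₂ + i₃) (by omega) (by linarith)
  have hq : (0 : ℝ) < 2 ^ k := by positivity
  have hq1 : (1 : ℝ) ≤ 2 ^ k := one_le_pow₀ (by norm_num)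
  have hp : (0 : ℝ) < 2 ^ l := by positivity
  have hp1 : (1 : ℝ) ≤ 2 ^ l := one_le_pow₀ (by norm_num)
  have hNp : 0 < N ^ (-1 + 3 * e) := Real.rpow_pos_of_pos hN0 _
  have hπ : 0 < (12 * Real.pi) ^ (1 - 3 * e) := Real.rpow_pos_of_pos (by positivity) _
  have hg := smoothGain_pos e k
  have e1 : (2 : ℝ) ^ l * smoothGain e l = ((2 : ℝ) ^ l) ^ (-1 + e) := by
    nth_rewrite 1 [smoothGain, ← Real.rpow_one ((2 : ℝ) ^ l)]
    rw [← Real.rpow_add hp]; congr 1; ring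
  have hrr : (2 * dyadicRatio e ^ (i₁ + i₂ + i₃)) * (2 * dyadicRatio e ^ (j₁ + j₂ + j₃)) =
      4 * dyadicRatio e ^ ((i₁ + i₂ + i₃) + (j₁ + j₂ + j₃)) := by rw [pow_add]; ring
  have hd := pow_pos (dyadicRatio_pos e) ((i₁ + i₂ + i₃) + (j₁ + j₂ + j₃))
  have hdi := pow_pos (dyadicRatio_pos e) (i₁ + i₂ + i₃)
  have hdj := pow_pos (dyadicRatio_pos e) (j₁ + j₂ + j₃)
  have hND : 0 < N ^ (-1 + 3 * e) * dyadicRatio e ^ ((i₁ + i₂ + i₃) + (j₁ + j₂ + j₃)) := by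
    positivity
  have hθ : 0 ≤ invBound s N j₁ * invBound s N j₂ * invBound s N j₃ := by
    have h0 (j : ℕ) : 0 ≤ invBound s N j := zero_le_one.trans (one_le_invBound hs1 j)
    have := h0 j₁; have := h0 j₂; have := h0 j₃
    positivity
  rw [e1]
  rcases le_or_gt N (12 * Real.pi * 2 ^ k) with hk | hk
  · have hb := hm.trans (invBound_pow_three_le_of_high hs he1 hN0 hk)
    have hcomb : ((2 : ℝ) ^ k) ^ (1 - 3 * e) * smoothGain e k ≤ ((2 : ℝ) ^ k) ^ (-e) := by
      rw [smoothGain, ← Real.rpow_add hq]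
      exact Real.rpow_le_rpow_of_exponent_le hq1 (by linarith)
    calc ((2 : ℝ) ^ l) ^ (-1 + e) *
          ((invBound s N j₁ * invBound s N j₂ * invBound s N j₃) * smoothGain e k)
        ≤ ((2 : ℝ) ^ l) ^ (-e) * ((8 * ((12 * Real.pi) ^ (1 - 3 * e) *
          ((2 : ℝ) ^ k) ^ (1 - 3 * e) * N ^ (-1 + 3 * e))) * smoothGain e k) := by
          gcongr
          linarith
      _ = 8 * (12 * Real.pi) ^ (1 - 3 * e) * N ^ (-1 + 3 * e) * (((2 : ℝ) ^ l) ^ (-e) *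
          (((2 : ℝ) ^ k) ^ (1 - 3 * e) * smoothGain e k)) := by ring
      _ ≤ 8 * 48 * N ^ (-1 + 3 * e) * ((2 * dyadicRatio e ^ (i₁ + i₂ + i₃)) *
          (2 * dyadicRatio e ^ (j₁ + j₂ + j₃))) := by
          gcongr ?_ * _ * (?_ * ?_)
          · gcongr
            exact twelve_pi_rpow_le (by linarith)
          · exact hcomb.trans hr
      _ ≤ _ := by rw [hrr]; nlinarith
  · have hl : N ≤ 12 * Real.pi * 2 ^ l := h.resolve_right (not_le.2 hk)
    have hb := hm.trans_eq (invBound_pow_three_le_of_low hN0 hk.le)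
    have hcomb : smoothGain e k ≤ ((2 : ℝ) ^ k) ^ (-e) :=
      Real.rpow_le_rpow_of_exponent_le hq1 (by linarith)
    -- One splits off `2^{-le}` for summation; the rest, `2^{l(-1+2e)}`, is evaluated at `2^l ≥
    -- N/(12π)`.
    have hl2 : ((2 : ℝ) ^ l) ^ (-1 + e) ≤ 48 * N ^ (-1 + 3 * e) * ((2 : ℝ) ^ l) ^ (-e) := by
      rw [show -1 + e = (-1 + 2 * e) + -e by ring, Real.rpow_add hp]
      gcongr
      have h1 : N / (12 * Real.pi) ≤ 2 ^ l := by
        rw [div_le_iff₀ (by positivity)]; linarith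
      calc ((2 : ℝ) ^ l) ^ (-1 + 2 * e) ≤ (N / (12 * Real.pi)) ^ (-1 + 2 * e) :=
            Real.rpow_le_rpow_of_nonpos (by positivity) h1 (by linarith)
        _ = (12 * Real.pi) ^ (1 - 2 * e) * N ^ (-1 + 2 * e) := by
            rw [Real.div_rpow hN0.le (by positivity), div_eq_mul_inv, ← Real.rpow_neg (by positivity),
              mul_comm]
            congr 2; ring
        _ ≤ 48 * N ^ (-1 + 3 * e) := by
            gcongr ?_ * ?_
            · exact twelve_pi_rpow_le (by linarith)
            · exact Real.rpow_le_rpow_of_exponent_le hN (by linarith)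
    calc ((2 : ℝ) ^ l) ^ (-1 + e) *
          ((invBound s N j₁ * invBound s N j₂ * invBound s N j₃) * smoothGain e k)
        ≤ (48 * N ^ (-1 + 3 * e) * (2 * dyadicRatio e ^ (i₁ + i₂ + i₃))) *
          (8 * (2 * dyadicRatio e ^ (j₁ + j₂ + j₃))) := by
          refine mul_le_mul (hl2.trans (by gcongr)) ?_ (by positivity) (by positivity)
          exact mul_le_mul hb (hcomb.trans hr) hg.le (by norm_num)
      _ = 48 * 8 * N ^ (-1 + 3 * e) * ((2 * dyadicRatio e ^ (i₁ + i₂ + i₃)) *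
          (2 * dyadicRatio e ^ (j₁ + j₂ + j₃))) := by ring
      _ ≤ _ := by rw [hrr]; nlinarith

theorem sum_dyadicRatio_le {e : ℝ} (he : 0 < e) (M : ℕ) :
    ∑ j ∈ Finset.range M, dyadicRatio e ^ j ≤ (1 - dyadicRatio e)⁻¹ :=
  (Summable.sum_le_tsum _ (fun _ _ => pow_nonneg (dyadicRatio_pos e).le _)
    (summable_geometric_of_lt_one (dyadicRatio_pos e).le (dyadicRatio_lt_one he))).trans_eq
    (tsum_geometric_of_lt_one (dyadicRatio_pos e).le (dyadicRatio_lt_one he))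

/-- Triples of indices below a bound. -/
def triples (M : ℕ) : Finset (ℕ × ℕ × ℕ) :=
  Finset.range M ×ˢ Finset.range M ×ˢ Finset.range M

theorem sum_triples_dyadicRatio_le {e : ℝ} (he : 0 < e) (M : ℕ) :
    ∑ p ∈ triples M, dyadicRatio e ^ (p.1 + p.2.1 + p.2.2) ≤ ((1 - dyadicRatio e)⁻¹) ^ 3 := by
  have h := sum_dyadicRatio_le he M
  have h0 : 0 ≤ ∑ j ∈ Finset.range M, dyadicRatio e ^ j :=
    Finset.sum_nonneg fun j _ => pow_nonneg (dyadicRatio_pos e).le _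
  calc ∑ p ∈ triples M, dyadicRatio e ^ (p.1 + p.2.1 + p.2.2)
      = (∑ j ∈ Finset.range M, dyadicRatio e ^ j) ^ 3 := by
        rw [triples, pow_three]
        simp only [Finset.sum_product, pow_add, mul_assoc, ← Finset.mul_sum, ← Finset.sum_mul]
    _ ≤ _ := by gcongr

end

noncomputable section

/-! ### The symbol of `I_N` -/

theorem exists_norm_eq_plane (r : ℝ) (hr : 0 ≤ r) : ∃ ζ : Plane, ‖ζ‖ = r :=
  ⟨EuclideanSpace.single 0 r, by simp [abs_of_nonneg hr]⟩

theorem IsISymbol.le_one {s N : ℝ} {m : Plane → ℝ} (hm : IsISymbol s N m) (hN : 0 < N)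
    (ζ : Plane) : m ζ ≤ 1 := by
  rw [← hm.eq_one 0 (by simpa using hN.le)]
  exact hm.antitone _ _ (by simp)

/-- In the transition region between `N` and `2N` the symbol has no formula. Monotonicity compares
it with its value at a point of norm `max(2N, ‖ζ‖)`, where the power law holds. -/
theorem IsISymbol.rpow_le {s N : ℝ} {m : Plane → ℝ} (hm : IsISymbol s N m) (hN : 0 < N)
    (ζ : Plane) : (max 2 (‖ζ‖ / N))⁻¹ ^ (1 - s) ≤ m ζ := by
  obtain ⟨ζ', h⟩ := exists_norm_eq_plane (max (2 * N) ‖ζ‖) (by positivity)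
  have h1 := hm.antitone ζ ζ' (h ▸ le_max_right _ _)
  rw [hm.eq_rpow ζ' (h ▸ le_max_left _ _), h] at h1
  refine le_of_eq_of_le ?_ h1
  congr 1
  rw [inv_eq_iff_eq_inv, inv_div, ← max_div_div_right hN.le, mul_div_cancel_right₀ _ hN.ne']

theorem IsISymbol.pos {s N : ℝ} {m : Plane → ℝ} (hm : IsISymbol s N m) (hN : 0 < N)
    (ζ : Plane) : 0 < m ζ :=
  lt_of_lt_of_le (Real.rpow_pos_of_pos (by positivity) _) (hm.rpow_le hN ζ)

theorem IsISymbol.inv_le {s N : ℝ} {m : Plane → ℝ} (hm : IsISymbol s N m) (hN : 0 < N)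
    (ζ : Plane) : (m ζ)⁻¹ ≤ (max 2 (‖ζ‖ / N)) ^ (1 - s) := by
  have h := hm.rpow_le hN ζ
  rw [Real.inv_rpow (by positivity)] at h
  exact inv_le_of_inv_le₀ (Real.rpow_pos_of_pos (by positivity) _) h

/-- The symbol of `I_N` in the frequency variable of `𝓕`. -/
def scaledSymbol (m : Plane → ℝ) (ζ : Plane) : ℂ := (m ((2 * Real.pi) • ζ) : ℂ)

theorem IsISymbol.measurable_scaledSymbol {s N : ℝ} {m : Plane → ℝ} (hm : IsISymbol s N m) :
    Measurable (scaledSymbol m) :=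
  Complex.measurable_ofReal.comp (hm.smooth.continuous.measurable.comp (by fun_prop))

theorem IsISymbol.norm_scaledSymbol_le {s N : ℝ} {m : Plane → ℝ} (hm : IsISymbol s N m)
    (hN : 0 < N) (ζ : Plane) : ‖scaledSymbol m ζ‖ ≤ 1 := by
  rw [scaledSymbol, Complex.norm_real, Real.norm_of_nonneg (hm.pos hN _).le]
  exact hm.le_one hN _

theorem IsISymbol.bddSymbol {s N : ℝ} {m : Plane → ℝ} (hm : IsISymbol s N m) (hN : 0 < N) :
    BddSymbol (scaledSymbol m) := ⟨hm.measurable_scaledSymbol, 1, hm.norm_scaledSymbol_le hN⟩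

theorem IsISymbol.scaledSymbol_ne_zero {s N : ℝ} {m : Plane → ℝ} (hm : IsISymbol s N m)
    (hN : 0 < N) (ζ : Plane) : scaledSymbol m ζ ≠ 0 :=
  Complex.ofReal_ne_zero.2 (hm.pos hN _).ne'

theorem norm_two_pi_smul (ζ : Plane) : ‖(2 * Real.pi) • ζ‖ = 2 * Real.pi * ‖ζ‖ := by
  rw [norm_smul, Real.norm_of_nonneg (by positivity)]

theorem IsISymbol.scaledSymbol_eq_one {s N : ℝ} {m : Plane → ℝ} (hm : IsISymbol s N m)
    {ζ : Plane} (h : 2 * Real.pi * ‖ζ‖ ≤ N) : scaledSymbol m ζ = 1 := by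
  rw [scaledSymbol, hm.eq_one _ (by rwa [norm_two_pi_smul]), Complex.ofReal_one]

/-! ### Frequency cut-offs -/

/-- The cut-off to the shells below `K`. -/
def lowCut (K : ℕ) : Plane → ℂ := indSymbol {ζ | jap ζ < 2 ^ K}

theorem measurableSet_jap_lt (K : ℕ) : MeasurableSet {ζ : Plane | jap ζ < 2 ^ K} :=
  measurableSet_lt measurable_jap measurable_const

theorem bddSupp_lowCut (K : ℕ) : BddSupp (lowCut K) :=
  bddSupp_indSymbol (measurableSet_jap_lt K) (r := 2 ^ K) fun ζ h =>
    (norm_le_jap ζ).trans (le_of_lt h)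

theorem norm_lowCut_le (K : ℕ) (ζ : Plane) : ‖lowCut K ζ‖ ≤ 1 := norm_indSymbol_le _ _

theorem lowCut_mul_self (K : ℕ) (ζ : Plane) : lowCut K ζ * lowCut K ζ = lowCut K ζ := by
  unfold lowCut indSymbol
  by_cases h : ζ ∈ {ζ : Plane | jap ζ < 2 ^ K} <;> simp [h]

theorem lowCut_eq_sum (K : ℕ) (ζ : Plane) :
    lowCut K ζ = ∑ j ∈ Finset.range K, indSymbol (shell j) ζ := by
  induction K with
  | zero =>
    have : ¬ jap ζ < 1 := not_lt.2 (one_le_jap ζ)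
    simp [lowCut, indSymbol, this]
  | succ K ih =>
    rw [Finset.sum_range_succ, ← ih]
    simp only [lowCut, indSymbol, Set.indicator_apply, Set.mem_ofPred_eq, shell]
    have h2 : (2 : ℝ) ^ K ≤ 2 ^ (K + 1) := by gcongr <;> norm_num
    by_cases h : jap ζ < 2 ^ K
    · simp [h, not_le.2 h, h.trans_le h2]
    · simp [h, not_lt.1 h]

theorem shellSymbol_indSymbol (j : ℕ) : ShellSymbol j 1 (indSymbol (shell j)) :=
  ⟨measurable_indSymbol (measurableSet_shell j), norm_indSymbol_le _, fun ζ h => by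
    simp [indSymbol, h]⟩

/-- The cut-off to the shell `j` if `j < K`. -/
def cutShell (K j : ℕ) (ζ : Plane) : ℂ := if j < K then indSymbol (shell j) ζ else 0

theorem shellSymbol_cutShell (K j : ℕ) : ShellSymbol j 1 (cutShell K j) := by
  by_cases h : j < K
  · have : cutShell K j = indSymbol (shell j) := by ext ζ; simp [cutShell, h]
    rw [this]; exact shellSymbol_indSymbol j
  · have : cutShell K j = fun _ => 0 := by ext ζ; simp [cutShell, h]
    rw [this]; exact ⟨measurable_const, fun _ => by simp, fun _ _ => rfl⟩

/-- The cut-off to the shell `j` divided by the symbol of `I_N`. -/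
def invShell (m : Plane → ℝ) (j : ℕ) (ζ : Plane) : ℂ :=
  indSymbol (shell j) ζ * (scaledSymbol m ζ)⁻¹

theorem IsISymbol.shellSymbol_invShell {s N : ℝ} {m : Plane → ℝ} (hm : IsISymbol s N m)
    (hN : 0 < N) (hs0 : 0 ≤ s) (hs1 : s ≤ 1) (j : ℕ) :
    ShellSymbol j (invBound s N j) (invShell m j) := by
  refine ⟨(measurable_indSymbol (measurableSet_shell j)).mul hm.measurable_scaledSymbol.inv,
    fun ζ => ?_, fun ζ h => by simp [invShell, indSymbol, h]⟩
  by_cases h : ζ ∈ shell j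
  · rw [invShell, norm_mul, norm_inv, scaledSymbol, Complex.norm_real,
      Real.norm_of_nonneg (hm.pos hN _).le]
    have h1 : (m ((2 * Real.pi) • ζ))⁻¹ ≤ invBound s N j := by
      refine (hm.inv_le hN _).trans ?_
      have hπ := Real.pi_pos
      have h2 : max 2 (‖(2 * Real.pi) • ζ‖ / N) ≤ 2 * max 1 (12 * Real.pi * 2 ^ j / N) := by
        rw [mul_max_of_nonneg _ _ (by norm_num), mul_one]
        refine max_le_max le_rfl ?_
        rw [norm_two_pi_smul, ← mul_div_assoc]
        refine div_le_div_of_nonneg_right ?_ hN.le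
        have := norm_le_of_mem_shell h
        rw [pow_succ] at this
        nlinarith [mul_le_mul_of_nonneg_left this hπ.le,
          mul_pos hπ (pow_pos (by norm_num : (0 : ℝ) < 2) j)]
      calc (max 2 (‖(2 * Real.pi) • ζ‖ / N)) ^ (1 - s)
          ≤ (2 * max 1 (12 * Real.pi * 2 ^ j / N)) ^ (1 - s) :=
            Real.rpow_le_rpow (by positivity) h2 (by linarith)
        _ = 2 ^ (1 - s) * (max 1 (12 * Real.pi * 2 ^ j / N)) ^ (1 - s) :=
            Real.mul_rpow (by norm_num) (by positivity)
        _ ≤ invBound s N j := by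
            unfold invBound
            gcongr
            calc (2 : ℝ) ^ (1 - s) ≤ 2 ^ (1 : ℝ) :=
                  Real.rpow_le_rpow_of_exponent_le (by norm_num) (by linarith)
              _ = 2 := Real.rpow_one 2
    have h3 := norm_indSymbol_le (shell j) ζ
    have h4 := hm.pos hN ((2 * Real.pi) • ζ)
    calc ‖indSymbol (shell j) ζ‖ * (m ((2 * Real.pi) • ζ))⁻¹ ≤ 1 * invBound s N j := by
          gcongr
      _ = _ := one_mul _
  · have := one_le_invBound (N := N) hs1 j
    simp [invShell, indSymbol, h]
    linarith

theorem abs_diagSymbol_le (ζ : Plane) : |diagSymbol ζ| ≤ 4 * Real.pi * ‖ζ‖ := by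
  have h0 : |ζ 0| ≤ ‖ζ‖ := by simpa using PiLp.norm_apply_le ζ 0
  have h1 : |ζ 1| ≤ ‖ζ‖ := by simpa using PiLp.norm_apply_le ζ 1
  have hπ := Real.pi_pos
  rw [diagSymbol, abs_mul, abs_of_pos (by positivity)]
  calc 2 * Real.pi * |ζ 0 + ζ 1| ≤ 2 * Real.pi * (‖ζ‖ + ‖ζ‖) := by
        gcongr; exact (abs_add_le _ _).trans (add_le_add h0 h1)
    _ = _ := by ring

theorem abs_quadSymbol_le (ζ : Plane) : |quadSymbol ζ| ≤ 8 * Real.pi ^ 2 * ‖ζ‖ ^ 2 := by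
  have h : ‖ζ‖ ^ 2 = ζ 0 ^ 2 + ζ 1 ^ 2 := by
    rw [EuclideanSpace.real_norm_sq_eq, Fin.sum_univ_two]
  have hπ := Real.pi_pos
  rw [quadSymbol, abs_mul, abs_of_pos (by positivity), h,
    abs_of_nonneg (by nlinarith [sq_nonneg (ζ 0 - ζ 1), sq_nonneg (ζ 0), sq_nonneg (ζ 1)])]
  have : ζ 0 ^ 2 - ζ 0 * ζ 1 + ζ 1 ^ 2 ≤ 2 * (ζ 0 ^ 2 + ζ 1 ^ 2) := by
    nlinarith [sq_nonneg (ζ 0 + ζ 1), sq_nonneg (ζ 0), sq_nonneg (ζ 1)]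
  calc 4 * Real.pi ^ 2 * (ζ 0 ^ 2 - ζ 0 * ζ 1 + ζ 1 ^ 2)
      ≤ 4 * Real.pi ^ 2 * (2 * (ζ 0 ^ 2 + ζ 1 ^ 2)) := by gcongr
    _ = _ := by ring

/-- The dispersion symbol cut off to the shell `j`. -/
def dispShell (j : ℕ) (ζ : Plane) : ℂ := (diagSymbol ζ * quadSymbol ζ) * indSymbol (shell j) ζ

theorem shellSymbol_dispShell (j : ℕ) :
    ShellSymbol j (256 * Real.pi ^ 3 * 8 ^ j) (dispShell j) := by
  refine ⟨?_, fun ζ => ?_, fun ζ h => by simp [dispShell, indSymbol, h]⟩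
  · have : Measurable fun ζ : Plane => ((diagSymbol ζ : ℂ) * (quadSymbol ζ : ℂ)) := by fun_prop
    exact this.mul (measurable_indSymbol (measurableSet_shell j))
  · have hπ := Real.pi_pos
    by_cases h : ζ ∈ shell j
    · rw [dispShell, norm_mul, norm_mul, Complex.norm_real, Complex.norm_real]
      have h1 := norm_le_of_mem_shell h
      calc ‖diagSymbol ζ‖ * ‖quadSymbol ζ‖ * ‖indSymbol (shell j) ζ‖
          ≤ (4 * Real.pi * 2 ^ (j + 1)) * (8 * Real.pi ^ 2 * (2 ^ (j + 1)) ^ 2) * 1 := by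
            gcongr
            · exact (abs_diagSymbol_le ζ).trans (by gcongr)
            · exact (abs_quadSymbol_le ζ).trans (by gcongr)
            · exact norm_indSymbol_le _ _
        _ = _ := by
            have : (8 : ℝ) ^ j = (2 ^ j) ^ 3 := by rw [← pow_mul, mul_comm, pow_mul]; norm_num
            rw [this]; ring
    · simp only [dispShell, indSymbol, Set.indicator_of_notMem h, mul_zero, norm_zero]
      positivity

/-! ### Vanishing configurations -/

theorem ShellSymbol.eq_zero_of_lt {j k : ℕ} (hjk : j ≤ k) {A : ℝ} {c : Plane → ℂ}
    (h : ShellSymbol j A c) (ζ : Plane) (hζ : 2 ^ (k + 1) < ‖ζ‖) : c ζ = 0 :=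
  h.eq_zero ζ fun hm => absurd ((norm_le_of_mem_shell hm).trans
    (pow_le_pow_right₀ (by norm_num) (by omega : j + 1 ≤ k + 1))) (not_le.2 hζ)

/-- The radius is three times `2^{k+1}`, with `k` the largest index, since the shell `j` lies in the
ball of radius `2^{j+1}`. -/
theorem fourier_shell_besselCube {s : ℝ} (hs : 1 / 2 < s) {j₁ j₂ j₃ : ℕ} {A₁ A₂ A₃ : ℝ}
    {c₁ c₂ c₃ : Plane → ℂ} (h₁ : ShellSymbol j₁ A₁ c₁) (h₂ : ShellSymbol j₂ A₂ c₂)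
    (h₃ : ShellSymbol j₃ A₃ c₃) (f : L2Plane) :
    ∀ᵐ ζ, 6 * 2 ^ (max (max j₁ j₂) j₃) < ‖ζ‖ →
      𝓕 (besselCube s (mulOp c₁ f) (mulOp c₂ f) (mulOp c₃ f) : Plane → ℂ) ζ = 0 := by
  filter_upwards [fourier_besselCube_support hs h₁.bddSupp.1 h₂.bddSupp.1 h₃.bddSupp.1
    (h₁.eq_zero_of_lt (k := max (max j₁ j₂) j₃) (by simp)) (h₂.eq_zero_of_lt (by simp))
    (h₃.eq_zero_of_lt (by simp)) f f f] with ζ h hζ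
  exact h (by rw [pow_succ]; linarith)

theorem triProd_congr {s : ℝ} (hs : 1 / 2 < s) {j₁ j₂ j₃ : ℕ} {A₁ A₂ A₃ : ℝ}
    {κ κ' c₁ c₂ c₃ : Plane → ℂ} (hκ : BddSupp κ) (hκ' : BddSupp κ') (h₁ : ShellSymbol j₁ A₁ c₁)
    (h₂ : ShellSymbol j₂ A₂ c₂) (h₃ : ShellSymbol j₃ A₃ c₃)
    (h : ∀ ζ, ‖ζ‖ ≤ 6 * 2 ^ (max (max j₁ j₂) j₃) → κ ζ = κ' ζ) (f : L2Plane) :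
    triProd s κ c₁ c₂ c₃ f = triProd s κ' c₁ c₂ c₃ f := by
  refine Lp.ext ?_
  filter_upwards [truncFourier_ae hκ (besselCube s (mulOp c₁ f) (mulOp c₂ f) (mulOp c₃ f)),
    truncFourier_ae hκ' (besselCube s (mulOp c₁ f) (mulOp c₂ f) (mulOp c₃ f)),
    fourier_shell_besselCube hs h₁ h₂ h₃ f] with ζ e₁ e₂ e₃
  rw [triProd, e₁, triProd, e₂]
  rcases le_or_gt ‖ζ‖ (6 * 2 ^ (max (max j₁ j₂) j₃)) with hζ | hζ
  · rw [h ζ hζ]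
  · rw [e₃ hζ, mul_zero, mul_zero]

/-- On a shell of index at least `k + 4` one has `‖ζ‖ ≥ 16 · 2^k - 1`, while the cube has
frequencies at most `6 · 2^k`. The output index is thus at most 3 above the largest input index. -/
theorem inner_triProd_eq_zero {s : ℝ} (hs : 1 / 2 < s) {j₀ j₁ j₂ j₃ : ℕ} {A₀ A₁ A₂ A₃ : ℝ}
    {κ c₀ c₁ c₂ c₃ : Plane → ℂ} (hκ : BddSupp κ) (h₀ : ShellSymbol j₀ A₀ c₀)
    (h₁ : ShellSymbol j₁ A₁ c₁) (h₂ : ShellSymbol j₂ A₂ c₂) (h₃ : ShellSymbol j₃ A₃ c₃)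
    (h : max (max j₁ j₂) j₃ + 4 ≤ j₀) (g f : L2Plane) :
    inner ℂ (mulOp c₀ g) (triProd s κ c₁ c₂ c₃ f) = 0 := by
  rw [L2.inner_def]
  refine integral_eq_zero_of_ae ?_
  filter_upwards [truncFourier_ae hκ (besselCube s (mulOp c₁ f) (mulOp c₂ f) (mulOp c₃ f)),
    mulOp_ae h₀.bddSupp.1 g, fourier_shell_besselCube hs h₁ h₂ h₃ f] with ζ e₁ e₂ e₃
  rw [triProd, e₁, e₂]
  rcases le_or_gt ‖ζ‖ (6 * 2 ^ (max (max j₁ j₂) j₃)) with hζ | hζ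
  · have : c₀ ζ = 0 := h₀.eq_zero ζ fun hm => by
      have h1 := hm.1
      have h2 := jap_le_one_add_norm ζ
      have h3 : (2 : ℝ) ^ (max (max j₁ j₂) j₃ + 4) ≤ 2 ^ j₀ := pow_le_pow_right₀ (by norm_num) h
      have h4 : (1 : ℝ) ≤ 2 ^ (max (max j₁ j₂) j₃) := one_le_pow₀ (by norm_num)
      rw [pow_add] at h3
      linarith
    simp [this]
  · simp [e₃ hζ]

end

noncomputable section

/-! ### Estimates of the terms of the dyadic decomposition -/

/-- A piece of the truncated Fourier transform of the cube of `I_N u`. -/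
def smoothPiece (s : ℝ) (K : ℕ) (p : ℕ × ℕ × ℕ) (f : L2Plane) : L2Plane :=
  triProd s (lowCut K) (cutShell K p.1) (cutShell K p.2.1) (cutShell K p.2.2) f

/-- A piece of the truncated Fourier transform of `I_N` applied to the cube of `u`. -/
def roughPiece (s : ℝ) (m : Plane → ℝ) (K : ℕ) (p : ℕ × ℕ × ℕ) (f : L2Plane) : L2Plane :=
  triProd s (fun ζ => scaledSymbol m ζ * lowCut K ζ)
    (invShell m p.1) (invShell m p.2.1) (invShell m p.2.2) f

/-- The largest of three indices. -/
def topIndex (p : ℕ × ℕ × ℕ) : ℕ := max (max p.1 p.2.1) p.2.2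

/-- All three frequencies are low. -/
def IsLow (N : ℝ) (p : ℕ × ℕ × ℕ) : Prop := 12 * Real.pi * 2 ^ topIndex p ≤ N

theorem continuous_triProd (s : ℝ) (κ c₁ c₂ c₃ : Plane → ℂ) : Continuous (triProd s κ c₁ c₂ c₃) := by
  unfold triProd
  fun_prop

theorem IsISymbol.bddSupp_mul_lowCut {s N : ℝ} {m : Plane → ℝ} (hm : IsISymbol s N m) (hN : 0 < N)
    (K : ℕ) : BddSupp fun ζ => scaledSymbol m ζ * lowCut K ζ :=
  BddSupp.mul_left (hm.bddSymbol hN) (bddSupp_lowCut K)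

theorem IsISymbol.norm_mul_lowCut_le {s N : ℝ} {m : Plane → ℝ} (hm : IsISymbol s N m) (hN : 0 < N)
    (K : ℕ) (ζ : Plane) : ‖scaledSymbol m ζ * lowCut K ζ‖ ≤ 1 := by
  rw [norm_mul]
  exact mul_le_one₀ (hm.norm_scaledSymbol_le hN ζ) (norm_nonneg _) (norm_lowCut_le K ζ)

theorem IsISymbol.invShell_eq_cutShell {s N : ℝ} {m : Plane → ℝ} (hm : IsISymbol s N m) {K j : ℕ}
    (hK : N < 2 ^ K) (hj : 12 * Real.pi * 2 ^ j ≤ N) : invShell m j = cutShell K j := by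
  have hπ := Real.pi_gt_three
  have h2 : (0 : ℝ) < 2 ^ j := by positivity
  have hjK : j < K := by
    have : (2 : ℝ) ^ j < 2 ^ K := by nlinarith
    exact (pow_lt_pow_iff_right₀ (by norm_num)).1 this
  ext ζ
  by_cases h : ζ ∈ shell j
  · have h1 := norm_le_of_mem_shell h
    rw [pow_succ] at h1
    rw [invShell, cutShell, if_pos hjK, hm.scaledSymbol_eq_one (by nlinarith), inv_one, mul_one]
  · simp [invShell, cutShell, hjK, indSymbol, h]

/-- For low triples all multipliers of `I_N`, those on the three factors and the one on the output,
are 1. The condition `N < 2^K` ensures that the cut-off `K` does not remove the low shells. -/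
theorem IsISymbol.roughPiece_eq_smoothPiece {s N : ℝ} {m : Plane → ℝ} (hm : IsISymbol s N m)
    (hs : 1 / 2 < s) (hN : 0 < N) {K : ℕ} (hK : N < 2 ^ K) {p : ℕ × ℕ × ℕ} (hp : IsLow N p)
    (f : L2Plane) : roughPiece s m K p f = smoothPiece s K p f := by
  have hπ := Real.pi_gt_three
  have le (j : ℕ) (hj : j ≤ topIndex p) : 12 * Real.pi * 2 ^ j ≤ N := by
    refine le_trans ?_ hp
    gcongr; norm_num
  rw [roughPiece, smoothPiece, hm.invShell_eq_cutShell hK (le p.1 (by simp [topIndex])),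
    hm.invShell_eq_cutShell hK (le p.2.1 (by simp [topIndex])),
    hm.invShell_eq_cutShell hK (le p.2.2 (by simp [topIndex]))]
  refine triProd_congr hs (hm.bddSupp_mul_lowCut hN K) (bddSupp_lowCut K)
    (shellSymbol_cutShell K _) (shellSymbol_cutShell K _) (shellSymbol_cutShell K _)
    (fun ζ hζ => ?_) f
  change ‖ζ‖ ≤ 6 * 2 ^ topIndex p at hζ
  unfold IsLow at hp
  -- The constant in `IsLow` is chosen for this step: `2π · 6 = 12π`, with 6 from the frequency
  -- support of the cube and `2π` from the scaling of the symbol.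
  rw [hm.scaledSymbol_eq_one (by nlinarith), one_mul]

/-- The difference vanishes for low triples, and both pieces vanish against a shell far above the
input frequencies. In the remaining cases no cancellation is needed: the two pieces are estimated
separately, the smooth one being dominated because `invBound` is at least 1. -/
theorem exists_quartic_piece_le {s b e : ℝ} (hs : 3 / 4 < s) (hs1 : s ≤ 1) (hb : 1 / 2 < b)
    (he : 0 < e) (he1 : e ≤ 1 / 12) :
    ∃ C : ℝ, 0 ≤ C ∧ ∀ {N : ℝ} {m : Plane → ℝ}, IsISymbol s N m → 0 < N → ∀ {K : ℕ}, N < 2 ^ K →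
      ∀ {T : ℝ} {L : ℝ → L2Plane} {G : SpaceTime → ℂ}, IsSpaceTimeLift s T L G → Continuous L →
      bourgainSq b G < ⊤ → ∀ (j : ℕ) (p : ℕ × ℕ × ℕ),
      ∫⁻ t in Set.Ioo 0 T, ‖inner ℂ (mulOp (dispShell j) (mulOp (japSymbol s) (L t)))
          (smoothPiece s K p (L t) - roughPiece s m K p (L t))‖ₑ ≤
        ENNReal.ofReal (C * N ^ (-1 + 3 * e) * dyadicRatio e ^ (j + (p.1 + p.2.1 + p.2.2))) *
          bourgainSq b G ^ 2 := by
  obtain ⟨C, hC0, hC⟩ := exists_lintegral_inner_triProd_le (s := s) (by linarith) hb he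
    (by linarith)
  have hπ := Real.pi_pos
  refine ⟨C * (2 * (256 * Real.pi ^ 3)) * 50000, by positivity,
    fun {N m} hm hN {K} hK {T L G} hL hLc hX j p => ?_⟩
  by_cases hlow : IsLow N p
  · simp [hm.roughPiece_eq_smoothPiece (by linarith) hN hK hlow]
  have hS := fun j => shellSymbol_cutShell K j
  have hR := fun j => hm.shellSymbol_invShell hN (by linarith) hs1 j
  by_cases hj : topIndex p + 4 ≤ j
  · have h1 (t : ℝ) : inner ℂ (mulOp (dispShell j) (mulOp (japSymbol s) (L t)))
        (smoothPiece s K p (L t) - roughPiece s m K p (L t)) = 0 := by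
      rw [inner_sub_right, smoothPiece, roughPiece,
        inner_triProd_eq_zero (by linarith) (bddSupp_lowCut K) (shellSymbol_dispShell j)
          (hS _) (hS _) (hS _) hj,
        inner_triProd_eq_zero (by linarith) (hm.bddSupp_mul_lowCut hN K) (shellSymbol_dispShell j)
          (hR _) (hR _) (hR _) hj, sub_zero]
    simp [h1]
  have hq := quartic_dyadic_le (s := s) (N := N) hs hs1 he he1 hN (j₀ := j) (j₁ := p.1)
    (j₂ := p.2.1) (j₃ := p.2.2) (by change j ≤ topIndex p + 3; omega) (not_le.1 hlow).le
  change 8 ^ j * _ * (smoothGain e j * smoothGain e (topIndex p)) ≤ _ at hq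
  have o (j : ℕ) := one_le_invBound (N := N) hs1 j
  have g := smoothGain_pos e (topIndex p)
  have g' := smoothGain_pos e j
  have o1 : 1 * 1 * 1 ≤ invBound s N p.1 * invBound s N p.2.1 * invBound s N p.2.2 := by
    have := o p.1; have := o p.2.1; have := o p.2.2
    gcongr
  have i1 := hC hL hX (bddSupp_lowCut K) (norm_lowCut_le K) (shellSymbol_dispShell j)
    (hS p.1) (hS p.2.1) (hS p.2.2)
  have i2 := hC hL hX (hm.bddSupp_mul_lowCut hN K) (hm.norm_mul_lowCut_le hN K)
    (shellSymbol_dispShell j) (hR p.1) (hR p.2.1) (hR p.2.2)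
  set θ := invBound s N p.1 * invBound s N p.2.1 * invBound s N p.2.2 with hθ
  calc ∫⁻ t in Set.Ioo 0 T, ‖inner ℂ (mulOp (dispShell j) (mulOp (japSymbol s) (L t)))
          (smoothPiece s K p (L t) - roughPiece s m K p (L t))‖ₑ
      ≤ ∫⁻ t in Set.Ioo 0 T, (‖inner ℂ (mulOp (dispShell j) (mulOp (japSymbol s) (L t)))
          (smoothPiece s K p (L t))‖ₑ + ‖inner ℂ (mulOp (dispShell j) (mulOp (japSymbol s) (L t)))
          (roughPiece s m K p (L t))‖ₑ) := by
        refine lintegral_mono fun t => ?_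
        rw [inner_sub_right]
        exact enorm_sub_le
    _ = (∫⁻ t in Set.Ioo 0 T, ‖inner ℂ (mulOp (dispShell j) (mulOp (japSymbol s) (L t)))
          (smoothPiece s K p (L t))‖ₑ) + ∫⁻ t in Set.Ioo 0 T,
          ‖inner ℂ (mulOp (dispShell j) (mulOp (japSymbol s) (L t)))
          (roughPiece s m K p (L t))‖ₑ := by
        refine lintegral_add_left (Continuous.measurable ?_) _
        have h1 := (continuous_triProd s (lowCut K) (cutShell K p.1) (cutShell K p.2.1)
          (cutShell K p.2.2)).comp hLc
        refine Continuous.enorm (Continuous.inner ?_ h1)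
        fun_prop
    _ ≤ ENNReal.ofReal (C * (256 * Real.pi ^ 3 * 8 ^ j * θ) *
          (smoothGain e j * smoothGain e (topIndex p))) * bourgainSq b G ^ 2 +
        ENNReal.ofReal (C * (256 * Real.pi ^ 3 * 8 ^ j * θ) *
          (smoothGain e j * smoothGain e (topIndex p))) * bourgainSq b G ^ 2 := by
        refine add_le_add (i1.trans ?_) i2
        gcongr
        exact le_rfl
    _ = ENNReal.ofReal (C * (2 * (256 * Real.pi ^ 3)) * (8 ^ j * θ *
          (smoothGain e j * smoothGain e (topIndex p)))) * bourgainSq b G ^ 2 := by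
        have : 0 ≤ θ := by linarith
        rw [← add_mul, ← ENNReal.ofReal_add (by positivity) (by positivity)]
        congr 2; ring
    _ ≤ _ := by
        rw [mul_assoc (C * (2 * (256 * Real.pi ^ 3))) 50000, mul_assoc (C * (2 * (256 * Real.pi ^ 3)))]
        gcongr

/-- The derivative symbol cut off to the shells below `K`. -/
def diagCut (K : ℕ) (ζ : Plane) : ℂ := diagSymbol ζ * lowCut K ζ

theorem bddSupp_diagCut (K : ℕ) : BddSupp (diagCut K) :=
  bddSymbol_of_continuous_mul (by fun_prop) (bddSupp_lowCut K)

theorem exists_lintegral_diagCut_smoothPiece_le {s b e : ℝ} (hs : 1 / 2 < s) (hb : 1 / 2 < b)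
    (he : 0 < e) (he2 : e ≤ 2) :
    ∃ C : ℝ, 0 ≤ C ∧ ∀ {T : ℝ} {L : ℝ → L2Plane} {G : SpaceTime → ℂ}, IsSpaceTimeLift s T L G →
      bourgainSq b G < ⊤ → ∀ (K : ℕ) (p : ℕ × ℕ × ℕ),
      ∫⁻ t in Set.Ioo 0 T, ‖mulOp (diagCut K) (smoothPiece s K p (L t))‖ₑ ^ 2 ≤
        ENNReal.ofReal (C * (2 ^ topIndex p * smoothGain e (topIndex p))) ^ 2 *
          bourgainSq b G ^ 3 := by
  obtain ⟨C, hC0, hC⟩ := exists_lintegral_triProd_le hs hb he he2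
  have hπ := Real.pi_pos
  refine ⟨C * (24 * Real.pi), by positivity, fun {T L G} hL hX K p => ?_⟩
  have hS := fun j => shellSymbol_cutShell K j
  -- The cut-off to `‖ζ‖ ≤ 6 · 2^{topIndex p}` changes nothing, by the frequency support of the
  -- cube, and bounds the derivative symbol by a multiple of `2^{topIndex p}` instead of `2^K`.
  set κ : Plane → ℂ := fun ζ => diagCut K ζ * lowCut K ζ *
    indSymbol {ζ | ‖ζ‖ ≤ 6 * 2 ^ topIndex p} ζ with hκdef
  have h1 : BddSupp fun ζ => diagCut K ζ * lowCut K ζ :=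
    BddSupp.mul_left (bddSupp_diagCut K).1 (bddSupp_lowCut K)
  have hκ : BddSupp κ := h1.mul_right (bddSymbol_indSymbol (measurableSet_norm_le _))
  have e1 (t : ℝ) : mulOp (diagCut K) (smoothPiece s K p (L t)) =
      triProd s κ (cutShell K p.1) (cutShell K p.2.1) (cutShell K p.2.2) (L t) := by
    rw [smoothPiece, triProd, mulOp_truncFourier (bddSupp_diagCut K).1 (bddSupp_lowCut K)]
    refine triProd_congr hs h1 hκ (hS _) (hS _) (hS _) (fun ζ hζ => ?_) (L t)
    have : ζ ∈ {ζ : Plane | ‖ζ‖ ≤ 6 * 2 ^ topIndex p} := hζ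
    simp [hκdef, indSymbol, this]
  have hκB (ζ : Plane) : ‖κ ζ‖ ≤ 24 * Real.pi * 2 ^ topIndex p := by
    by_cases h : ζ ∈ {ζ : Plane | ‖ζ‖ ≤ 6 * 2 ^ topIndex p}
    · have h' : ‖ζ‖ ≤ 6 * 2 ^ topIndex p := h
      simp only [hκdef, diagCut, norm_mul, Complex.norm_real]
      have n1 := norm_lowCut_le K ζ
      have n2 := norm_indSymbol_le {ζ : Plane | ‖ζ‖ ≤ 6 * 2 ^ topIndex p} ζ
      calc ‖diagSymbol ζ‖ * ‖lowCut K ζ‖ * ‖lowCut K ζ‖ *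
            ‖indSymbol {ζ : Plane | ‖ζ‖ ≤ 6 * 2 ^ topIndex p} ζ‖
          ≤ (4 * Real.pi * (6 * 2 ^ topIndex p)) * 1 * 1 * 1 := by
            gcongr
            exact (abs_diagSymbol_le ζ).trans (by gcongr)
        _ = _ := by ring
    · simp only [hκdef, indSymbol, Set.indicator_of_notMem h, mul_zero, norm_zero]
      positivity
  simp only [e1]
  refine (hC hL hX hκ hκB (hS p.1) (hS p.2.1) (hS p.2.2)).trans_eq ?_
  congr 3
  change C * (24 * Real.pi * 2 ^ topIndex p) * (1 * 1 * 1) * smoothGain e (topIndex p) = _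
  ring

/-- Cauchy–Schwarz in frequency and then in time reduces the pairing to the two `L²` estimates of
trilinear products. The derivative falls on the smooth cube, which carries no inverse multipliers.
-/
theorem exists_sextic_piece_le {s b e : ℝ} (hs : 3 / 4 < s) (hs1 : s ≤ 1) (hb : 1 / 2 < b)
    (he : 0 < e) (he1 : e ≤ 1 / 12) :
    ∃ C : ℝ, 0 ≤ C ∧ ∀ {N : ℝ} {m : Plane → ℝ}, IsISymbol s N m → 1 ≤ N → ∀ {K : ℕ},
      ∀ {T : ℝ} {L : ℝ → L2Plane} {G : SpaceTime → ℂ}, IsSpaceTimeLift s T L G → Continuous L →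
      bourgainSq b G < ⊤ → ∀ (p q : ℕ × ℕ × ℕ), ¬ (IsLow N p ∧ IsLow N q) →
      ∫⁻ t in Set.Ioo 0 T, ‖inner ℂ (mulOp (diagCut K) (smoothPiece s K p (L t)))
          (roughPiece s m K q (L t))‖ₑ ≤
        ENNReal.ofReal (C * N ^ (-1 + 3 * e) *
          dyadicRatio e ^ ((p.1 + p.2.1 + p.2.2) + (q.1 + q.2.1 + q.2.2))) *
          bourgainSq b G ^ 3 := by
  obtain ⟨C, hC0, hC⟩ := exists_lintegral_diagCut_smoothPiece_le (s := s) (by linarith) hb he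
    (by linarith)
  obtain ⟨D, hD0, hD⟩ := exists_lintegral_triProd_le (s := s) (by linarith) hb he (by linarith)
  refine ⟨C * D * 50000, by positivity, fun {N m} hm hN {K T L G} hL hLc hX p q hpq => ?_⟩
  have hN0 : 0 < N := by linarith
  have hR := fun j => hm.shellSymbol_invShell hN0 (by linarith) hs1 j
  have i1 := hC hL hX K p
  have i2 := hD hL hX (hm.bddSupp_mul_lowCut hN0 K) (hm.norm_mul_lowCut_le hN0 K)
    (hR q.1) (hR q.2.1) (hR q.2.2)
  have hpq' : N ≤ 12 * Real.pi * 2 ^ topIndex p ∨ N ≤ 12 * Real.pi * 2 ^ topIndex q := by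
    by_contra! h
    exact hpq ⟨h.1.le, h.2.le⟩
  have hq := sextic_dyadic_le (s := s) (N := N) hs hs1 he he1 hN hpq'
  change 2 ^ topIndex p * smoothGain e (topIndex p) * (_ * smoothGain e (topIndex q)) ≤ _ at hq
  change _ ≤ ENNReal.ofReal (D * 1 * _ * smoothGain e (topIndex q)) ^ 2 * _ at i2
  set θ := invBound s N q.1 * invBound s N q.2.1 * invBound s N q.2.2 with hθ
  have c1 : Continuous fun t => smoothPiece s K p (L t) := (continuous_triProd s _ _ _ _).comp hLc
  have c2 : Continuous fun t => roughPiece s m K q (L t) := (continuous_triProd s _ _ _ _).comp hLc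
  have hsq (x : ℝ≥0∞) (y : ℝ≥0∞) : (x ^ 2 * y ^ 3) ^ (1 / 2 : ℝ) = x * (y ^ 3) ^ (1 / 2 : ℝ) := by
    rw [ENNReal.mul_rpow_of_nonneg _ _ (by norm_num), ← ENNReal.rpow_natCast x 2, ← ENNReal.rpow_mul]
    norm_num
  calc ∫⁻ t in Set.Ioo 0 T, ‖inner ℂ (mulOp (diagCut K) (smoothPiece s K p (L t)))
          (roughPiece s m K q (L t))‖ₑ
      ≤ ∫⁻ t in Set.Ioo 0 T, ‖mulOp (diagCut K) (smoothPiece s K p (L t))‖ₑ *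
          ‖roughPiece s m K q (L t)‖ₑ := by
        refine lintegral_mono fun t => ?_
        rw [← ofReal_norm, ← ofReal_norm, ← ofReal_norm, ← ENNReal.ofReal_mul (norm_nonneg _)]
        exact ENNReal.ofReal_le_ofReal (norm_inner_le_norm _ _)
    _ ≤ (ENNReal.ofReal (C * (2 ^ topIndex p * smoothGain e (topIndex p))) ^ 2 *
          bourgainSq b G ^ 3) ^ (1 / 2 : ℝ) *
        (ENNReal.ofReal (D * 1 * θ * smoothGain e (topIndex q)) ^ 2 *
          bourgainSq b G ^ 3) ^ (1 / 2 : ℝ) := by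
        refine (lintegral_mul_le_sqrt _ (Continuous.aemeasurable (by fun_prop))
          (Continuous.aemeasurable (by fun_prop))).trans ?_
        gcongr
        exact i2
    _ = ENNReal.ofReal (C * D * (2 ^ topIndex p * smoothGain e (topIndex p) *
          (θ * smoothGain e (topIndex q)))) * bourgainSq b G ^ 3 := by
        have g := smoothGain_pos e (topIndex p)
        rw [hsq, hsq, mul_mul_mul_comm, ← sq, ennreal_sqrt_sq, ← ENNReal.ofReal_mul (by positivity)]
        congr 2; ring
    _ ≤ _ := by
        rw [mul_assoc (C * D) 50000, mul_assoc (C * D)]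
        gcongr

end

noncomputable section

/-! ### The dyadic decomposition of the rate of change of the modified energy -/

theorem mulOp_sum {ι : Type*} (S : Finset ι) {c : Plane → ℂ} {d : ι → Plane → ℂ}
    (hc : BddSymbol c) (hd : ∀ i ∈ S, BddSymbol (d i)) (h : ∀ ζ, c ζ = ∑ i ∈ S, d i ζ) (f : L2Plane) :
    mulOp c f = ∑ i ∈ S, mulOp (d i) f := by
  refine mulOp_eq_of_ae hc ?_
  have h1 : ∀ᵐ ζ : Plane, ∀ i ∈ S, mulOp (d i) f ζ = d i ζ * f ζ := by
    rw [Finset.eventually_all]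
    exact fun i hi => mulOp_ae (hd i hi) f
  have h2 : ((∑ i ∈ S, mulOp (d i) f : L2Plane) : Plane → ℂ) =ᵐ[volume]
      fun ζ => ∑ i ∈ S, mulOp (d i) f ζ := by
    have := Lp.coeFn_finsetSum S (fun i => mulOp (d i) f)
    filter_upwards [this] with ζ hζ
    rw [hζ, Finset.sum_apply]
  filter_upwards [h1, h2] with ζ e1 e2
  rw [e2, h, Finset.sum_mul]
  exact Finset.sum_congr rfl fun i hi => e1 i hi

theorem truncFourier_besselCube_sum (s : ℝ) (κ : Plane → ℂ) (M : ℕ) (x : ℕ → L2Plane) :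
    truncFourier κ (besselCube s (∑ j ∈ Finset.range M, x j) (∑ j ∈ Finset.range M, x j)
      (∑ j ∈ Finset.range M, x j)) =
      ∑ p ∈ triples M, truncFourier κ (besselCube s (x p.1) (x p.2.1) (x p.2.2)) := by
  rw [triples, Finset.sum_product, map_sum (besselCube s), sum_apply, sum_apply, map_sum]
  refine Finset.sum_congr rfl fun i _ => ?_
  rw [Finset.sum_product, map_sum (besselCube s (x i)), sum_apply, map_sum]
  refine Finset.sum_congr rfl fun j _ => ?_
  rw [map_sum, map_sum]

/-- The truncated Fourier transform of the cube of the low frequencies of `I_N u`. -/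
def smoothCube (s : ℝ) (K : ℕ) (f : L2Plane) : L2Plane :=
  truncFourier (lowCut K) (besselCube s (mulOp (lowCut K) f) (mulOp (lowCut K) f) (mulOp (lowCut K) f))

/-- The cut-off to the shells below `M` divided by the symbol of `I_N`. -/
def invCut (m : Plane → ℝ) (M : ℕ) (ζ : Plane) : ℂ := lowCut M ζ * (scaledSymbol m ζ)⁻¹

/-- The truncated Fourier transform of `I_N` applied to the cube of the low frequencies of `u`. -/
def roughCube (s : ℝ) (m : Plane → ℝ) (K M : ℕ) (f : L2Plane) : L2Plane :=
  truncFourier (fun ζ => scaledSymbol m ζ * lowCut K ζ)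
    (besselCube s (mulOp (invCut m M) f) (mulOp (invCut m M) f) (mulOp (invCut m M) f))

theorem smoothCube_eq_sum (s : ℝ) {K M : ℕ} (hKM : K ≤ M) (f : L2Plane) :
    smoothCube s K f = ∑ p ∈ triples M, smoothPiece s K p f := by
  have h : mulOp (lowCut K) f = ∑ j ∈ Finset.range M, mulOp (cutShell K j) f := by
    refine mulOp_sum _ (bddSupp_lowCut K).1 (fun j _ => (shellSymbol_cutShell K j).bddSupp.1)
      (fun ζ => ?_) f
    rw [lowCut_eq_sum, ← Finset.sum_subset (Finset.range_mono hKM)]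
    · exact Finset.sum_congr rfl fun j hj => by rw [cutShell, if_pos (Finset.mem_range.1 hj)]
    · intro j _ hj
      rw [cutShell, if_neg (by simpa using hj)]
  rw [smoothCube, h, truncFourier_besselCube_sum]
  rfl

theorem IsISymbol.bddSupp_invCut {s N : ℝ} {m : Plane → ℝ} (hm : IsISymbol s N m) (hN : 0 < N)
    (hs0 : 0 ≤ s) (hs1 : s ≤ 1) (M : ℕ) : BddSupp (invCut m M) := by
  have h : invCut m M = fun ζ => ∑ j ∈ Finset.range M, invShell m j ζ := by
    ext ζ
    rw [invCut, lowCut_eq_sum, Finset.sum_mul]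
    rfl
  refine ⟨⟨?_, ∑ j ∈ Finset.range M, invBound s N j, fun ζ => ?_⟩, 2 ^ M, fun ζ hζ => ?_⟩
  · exact (bddSupp_lowCut M).1.1.mul hm.measurable_scaledSymbol.inv
  · rw [h]
    exact (norm_sum_le _ _).trans (Finset.sum_le_sum fun j _ =>
      (hm.shellSymbol_invShell hN hs0 hs1 j).norm_le ζ)
  · have : ¬ jap ζ < 2 ^ M := not_lt.2 (hζ.le.trans (norm_le_jap ζ))
    simp [invCut, lowCut, indSymbol, this]

theorem IsISymbol.roughCube_eq_sum {s N : ℝ} {m : Plane → ℝ} (hm : IsISymbol s N m) (hN : 0 < N)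
    (hs0 : 0 ≤ s) (hs1 : s ≤ 1) (K M : ℕ) (f : L2Plane) :
    roughCube s m K M f = ∑ p ∈ triples M, roughPiece s m K p f := by
  have h : mulOp (invCut m M) f = ∑ j ∈ Finset.range M, mulOp (invShell m j) f := by
    refine mulOp_sum _ (hm.bddSupp_invCut hN hs0 hs1 M).1
      (fun j _ => (hm.shellSymbol_invShell hN hs0 hs1 j).bddSupp.1) (fun ζ => ?_) f
    rw [invCut, lowCut_eq_sum, Finset.sum_mul]
    rfl
  rw [roughCube, h, truncFourier_besselCube_sum]
  rfl

/-- The dispersion symbol cut off to the shells below `K`. -/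
def dispCut (K : ℕ) (ζ : Plane) : ℂ := (diagSymbol ζ * quadSymbol ζ) * lowCut K ζ

theorem bddSupp_dispCut (K : ℕ) : BddSupp (dispCut K) :=
  bddSymbol_of_continuous_mul (by fun_prop) (bddSupp_lowCut K)

theorem mulOp_dispCut (K : ℕ) (f : L2Plane) :
    mulOp (dispCut K) f = ∑ j ∈ Finset.range K, mulOp (dispShell j) f := by
  refine mulOp_sum _ (bddSupp_dispCut K).1 (fun j _ => (shellSymbol_dispShell j).bddSupp.1)
    (fun ζ => ?_) f
  rw [dispCut, lowCut_eq_sum, Finset.mul_sum]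
  rfl

theorem im_inner_mulOp_self {c : Plane → ℂ} (hc : BddSymbol c)
    (hr : ∀ ζ, (starRingEnd ℂ) (c ζ) = c ζ) (f : L2Plane) : (inner ℂ (mulOp c f) f).im = 0 := by
  have h := inner_mulOp hc f f
  simp only [hr] at h
  rw [← inner_conj_symm] at h
  exact Complex.conj_eq_iff_im.1 h

theorem conj_lowCut (K : ℕ) (ζ : Plane) : (starRingEnd ℂ) (lowCut K ζ) = lowCut K ζ := by
  unfold lowCut indSymbol
  by_cases h : ζ ∈ {ζ : Plane | jap ζ < 2 ^ K} <;> simp [h]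

theorem conj_diagCut (K : ℕ) (ζ : Plane) : (starRingEnd ℂ) (diagCut K ζ) = diagCut K ζ := by
  rw [diagCut, map_mul, conj_lowCut, Complex.conj_ofReal]

/-- The rate of change of the modified energy, with truncated frequencies. -/
def energyRate (σ s : ℝ) (m : Plane → ℝ) (K M : ℕ) (f : L2Plane) : ℝ :=
  σ * aConst * (inner ℂ (mulOp (dispCut K) (mulOp (japSymbol s) f))
      (smoothCube s K f - roughCube s m K M f)).im +
    aConst ^ 2 * (inner ℂ (mulOp (diagCut K) (smoothCube s K f)) (roughCube s m K M f)).im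

theorem aConst_pos : 0 < aConst := by unfold aConst; positivity

theorem aConst_le_one : aConst ≤ 1 :=
  Real.rpow_le_one_of_one_le_of_nonpos (by norm_num) (by norm_num)

-- Both terms are expanded over dyadic pieces. In the sextic term the block where both triples are
-- low drops out before absolute values are taken, by a cancellation of the whole block and not of
-- its single terms.
open Classical in
theorem IsISymbol.enorm_energyRate_le {s N : ℝ} {m : Plane → ℝ} (hm : IsISymbol s N m) (hN : 0 < N)
    (hs : 1 / 2 < s) (hs1 : s ≤ 1) {σ : ℝ} (hσ : |σ| ≤ 1) {K M : ℕ} (hKM : K ≤ M) (hK : N < 2 ^ K)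
    (f : L2Plane) :
    ‖energyRate σ s m K M f‖ₑ ≤
      (∑ j ∈ Finset.range K, ∑ p ∈ triples M,
        ‖inner ℂ (mulOp (dispShell j) (mulOp (japSymbol s) f))
          (smoothPiece s K p f - roughPiece s m K p f)‖ₑ) +
      ∑ r ∈ (triples M ×ˢ triples M).filter (fun r => ¬ (IsLow N r.1 ∧ IsLow N r.2)),
        ‖inner ℂ (mulOp (diagCut K) (smoothPiece s K r.1 f)) (roughPiece s m K r.2 f)‖ₑ := by
  have e1 : inner ℂ (mulOp (dispCut K) (mulOp (japSymbol s) f))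
      (smoothCube s K f - roughCube s m K M f) = ∑ j ∈ Finset.range K, ∑ p ∈ triples M,
        inner ℂ (mulOp (dispShell j) (mulOp (japSymbol s) f))
          (smoothPiece s K p f - roughPiece s m K p f) := by
    rw [mulOp_dispCut, smoothCube_eq_sum s hKM, hm.roughCube_eq_sum hN (by linarith) hs1,
      ← Finset.sum_sub_distrib, sum_inner]
    refine Finset.sum_congr rfl fun j _ => ?_
    rw [inner_sum]
  have e2 : (inner ℂ (mulOp (diagCut K) (smoothCube s K f)) (roughCube s m K M f)).im =
      (∑ r ∈ (triples M ×ˢ triples M).filter (fun r => ¬ (IsLow N r.1 ∧ IsLow N r.2)),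
        inner ℂ (mulOp (diagCut K) (smoothPiece s K r.1 f)) (roughPiece s m K r.2 f)).im := by
    have h1 : inner ℂ (mulOp (diagCut K) (smoothCube s K f)) (roughCube s m K M f) =
        ∑ r ∈ triples M ×ˢ triples M,
          inner ℂ (mulOp (diagCut K) (smoothPiece s K r.1 f)) (roughPiece s m K r.2 f) := by
      rw [smoothCube_eq_sum s hKM, hm.roughCube_eq_sum hN (by linarith) hs1, map_sum, sum_inner,
        Finset.sum_product]
      refine Finset.sum_congr rfl fun p _ => ?_
      rw [inner_sum]
    rw [h1, ← Finset.sum_filter_add_sum_filter_not _ (fun r => IsLow N r.1 ∧ IsLow N r.2),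
      Complex.add_im]
    -- On low triples rough and smooth pieces coincide, so the block is the quadratic form of a real
    -- multiplier at a single vector, which has no imaginary part.
    have h2 : ∑ r ∈ (triples M ×ˢ triples M).filter (fun r => IsLow N r.1 ∧ IsLow N r.2),
        inner ℂ (mulOp (diagCut K) (smoothPiece s K r.1 f)) (roughPiece s m K r.2 f) =
        inner ℂ (mulOp (diagCut K) (∑ p ∈ (triples M).filter (IsLow N), smoothPiece s K p f))
          (∑ p ∈ (triples M).filter (IsLow N), smoothPiece s K p f) := by
      rw [Finset.filter_product, map_sum, sum_inner, Finset.sum_product]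
      refine Finset.sum_congr rfl fun p _ => ?_
      rw [inner_sum]
      refine Finset.sum_congr rfl fun q hq => ?_
      rw [hm.roughPiece_eq_smoothPiece hs hN hK (Finset.mem_filter.1 hq).2]
    rw [h2, im_inner_mulOp_self (bddSupp_diagCut K).1 (conj_diagCut K), zero_add]
  have him (z : ℂ) : ‖z.im‖ₑ ≤ ‖z‖ₑ := by
    rw [← ofReal_norm, ← ofReal_norm]
    exact ENNReal.ofReal_le_ofReal (Complex.abs_im_le_norm z)
  have ha := aConst_pos
  have ha1 := aConst_le_one
  have hc (c x : ℝ) (h : |c| ≤ 1) : ‖c * x‖ₑ ≤ ‖x‖ₑ := by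
    rw [← ofReal_norm, ← ofReal_norm, norm_mul]
    exact ENNReal.ofReal_le_ofReal (mul_le_of_le_one_left (norm_nonneg _) h)
  rw [energyRate, e1, e2]
  refine (enorm_add_le _ _).trans (add_le_add ?_ ?_)
  · refine (hc _ _ ?_).trans ((him _).trans ((enorm_sum_le _ _).trans
      (Finset.sum_le_sum fun j _ => enorm_sum_le _ _)))
    rw [abs_mul, abs_of_pos ha]
    exact mul_le_one₀ hσ ha.le ha1
  · refine (hc _ _ ?_).trans ((him _).trans (enorm_sum_le _ _))
    rw [abs_of_pos (by positivity)]
    exact pow_le_one₀ ha.le ha1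

-- The bounds for the pieces are products of geometric sequences in all indices, so the sums are
-- bounded independently of the truncations `K` and `M`. This uniformity allows the truncations to
-- be removed.
open Classical in
theorem exists_lintegral_energyRate_le {s b e : ℝ} (hs : 3 / 4 < s) (hs1 : s ≤ 1) (hb : 1 / 2 < b)
    (he : 0 < e) (he1 : e ≤ 1 / 12) :
    ∃ C : ℝ, 0 ≤ C ∧ ∀ {N : ℝ} {m : Plane → ℝ}, IsISymbol s N m → 1 ≤ N → ∀ {σ : ℝ}, |σ| ≤ 1 →
      ∀ {K M : ℕ}, K ≤ M → N < 2 ^ K →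
      ∀ {T : ℝ} {L : ℝ → L2Plane} {G : SpaceTime → ℂ}, IsSpaceTimeLift s T L G → Continuous L →
      bourgainSq b G < ⊤ →
      ∫⁻ t in Set.Ioo 0 T, ‖energyRate σ s m K M (L t)‖ₑ ≤
        ENNReal.ofReal (C * N ^ (-1 + 3 * e)) * (bourgainSq b G ^ 2 + bourgainSq b G ^ 3) := by
  obtain ⟨C, hC0, hC⟩ := exists_quartic_piece_le hs hs1 hb he he1
  obtain ⟨D, hD0, hD⟩ := exists_sextic_piece_le hs hs1 hb he he1
  set R := (1 - dyadicRatio e)⁻¹ with hR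
  have hR0 : 0 < R := inv_pos.2 (sub_pos.2 (dyadicRatio_lt_one he))
  have hr0 := (dyadicRatio_pos e).le
  refine ⟨C * (R * R ^ 3) + D * (R ^ 3 * R ^ 3), by positivity,
    fun {N m} hm hN {σ} hσ {K M} hKM hK {T L G} hL hLc hX => ?_⟩
  have hN0 : 0 < N := by linarith
  have hNp : 0 < N ^ (-1 + 3 * e) := Real.rpow_pos_of_pos hN0 _
  have c1 (p : ℕ × ℕ × ℕ) : Continuous fun t => smoothPiece s K p (L t) :=
    (continuous_triProd s _ _ _ _).comp hLc
  have c2 (p : ℕ × ℕ × ℕ) : Continuous fun t => roughPiece s m K p (L t) :=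
    (continuous_triProd s _ _ _ _).comp hLc
  have m1 (j : ℕ) (p : ℕ × ℕ × ℕ) : Measurable fun t =>
      ‖inner ℂ (mulOp (dispShell j) (mulOp (japSymbol s) (L t)))
        (smoothPiece s K p (L t) - roughPiece s m K p (L t))‖ₑ := by
    have := c1 p; have := c2 p
    exact (Continuous.enorm (Continuous.inner (by fun_prop) (by fun_prop))).measurable
  have m2 (p q : ℕ × ℕ × ℕ) : Measurable fun t =>
      ‖inner ℂ (mulOp (diagCut K) (smoothPiece s K p (L t))) (roughPiece s m K q (L t))‖ₑ := by
    have := c1 p; have := c2 q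
    exact (Continuous.enorm (Continuous.inner (by fun_prop) (by fun_prop))).measurable
  have s1 : ∑ j ∈ Finset.range K, ∑ p ∈ triples M,
      C * N ^ (-1 + 3 * e) * dyadicRatio e ^ (j + (p.1 + p.2.1 + p.2.2)) ≤
        C * N ^ (-1 + 3 * e) * (R * R ^ 3) := by
    simp only [pow_add _ _ (_ + _ + _), ← Finset.mul_sum, ← Finset.sum_mul]
    gcongr
    · exact sum_dyadicRatio_le he K
    · exact sum_triples_dyadicRatio_le he M
  have s2 : ∑ r ∈ (triples M ×ˢ triples M).filter (fun r => ¬ (IsLow N r.1 ∧ IsLow N r.2)),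
      D * N ^ (-1 + 3 * e) * dyadicRatio e ^
        ((r.1.1 + r.1.2.1 + r.1.2.2) + (r.2.1 + r.2.2.1 + r.2.2.2)) ≤
        D * N ^ (-1 + 3 * e) * (R ^ 3 * R ^ 3) := by
    refine (Finset.sum_le_sum_of_subset_of_nonneg (Finset.filter_subset _ _)
      fun r _ _ => by positivity).trans ?_
    rw [← Finset.mul_sum, Finset.sum_product]
    simp only [pow_add _ (_ + _ + _) (_ + _ + _), ← Finset.mul_sum, ← Finset.sum_mul]
    gcongr
    · exact sum_triples_dyadicRatio_le he M
    · exact sum_triples_dyadicRatio_le he M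
  calc ∫⁻ t in Set.Ioo 0 T, ‖energyRate σ s m K M (L t)‖ₑ
      ≤ ∫⁻ t in Set.Ioo 0 T, ((∑ j ∈ Finset.range K, ∑ p ∈ triples M,
        ‖inner ℂ (mulOp (dispShell j) (mulOp (japSymbol s) (L t)))
          (smoothPiece s K p (L t) - roughPiece s m K p (L t))‖ₑ) +
      ∑ r ∈ (triples M ×ˢ triples M).filter (fun r => ¬ (IsLow N r.1 ∧ IsLow N r.2)),
        ‖inner ℂ (mulOp (diagCut K) (smoothPiece s K r.1 (L t))) (roughPiece s m K r.2 (L t))‖ₑ) :=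
        lintegral_mono fun t => hm.enorm_energyRate_le hN0 (by linarith) hs1 hσ hKM hK (L t)
    _ = (∑ j ∈ Finset.range K, ∑ p ∈ triples M, ∫⁻ t in Set.Ioo 0 T,
        ‖inner ℂ (mulOp (dispShell j) (mulOp (japSymbol s) (L t)))
          (smoothPiece s K p (L t) - roughPiece s m K p (L t))‖ₑ) +
      ∑ r ∈ (triples M ×ˢ triples M).filter (fun r => ¬ (IsLow N r.1 ∧ IsLow N r.2)),
        ∫⁻ t in Set.Ioo 0 T,
        ‖inner ℂ (mulOp (diagCut K) (smoothPiece s K r.1 (L t))) (roughPiece s m K r.2 (L t))‖ₑ := by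
        rw [lintegral_add_left (Finset.measurable_fun_sum _ fun j _ =>
          Finset.measurable_fun_sum _ fun p _ => m1 j p),
          lintegral_finsetSum _ fun j _ => Finset.measurable_fun_sum _ fun p _ => m1 j p,
          lintegral_finsetSum _ fun r _ => m2 r.1 r.2]
        congr 1
        exact Finset.sum_congr rfl fun j _ => lintegral_finsetSum _ fun p _ => m1 j p
    _ ≤ (∑ j ∈ Finset.range K, ∑ p ∈ triples M, ENNReal.ofReal
          (C * N ^ (-1 + 3 * e) * dyadicRatio e ^ (j + (p.1 + p.2.1 + p.2.2))) *
          bourgainSq b G ^ 2) +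
        ∑ r ∈ (triples M ×ˢ triples M).filter (fun r => ¬ (IsLow N r.1 ∧ IsLow N r.2)),
          ENNReal.ofReal (D * N ^ (-1 + 3 * e) * dyadicRatio e ^
            ((r.1.1 + r.1.2.1 + r.1.2.2) + (r.2.1 + r.2.2.1 + r.2.2.2))) * bourgainSq b G ^ 3 :=
        add_le_add (Finset.sum_le_sum fun j _ => Finset.sum_le_sum fun p _ =>
          hC hm hN0 hK hL hLc hX j p) (Finset.sum_le_sum fun r hr =>
          hD hm hN hL hLc hX r.1 r.2 (Finset.mem_filter.1 hr).2)
    _ ≤ ENNReal.ofReal (C * N ^ (-1 + 3 * e) * (R * R ^ 3)) * bourgainSq b G ^ 2 +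
        ENNReal.ofReal (D * N ^ (-1 + 3 * e) * (R ^ 3 * R ^ 3)) * bourgainSq b G ^ 3 := by
        simp only [← Finset.sum_mul]
        refine add_le_add ?_ ?_
        · gcongr
          refine le_trans (le_of_eq ?_) (ENNReal.ofReal_le_ofReal s1)
          rw [ENNReal.ofReal_sum_of_nonneg fun j _ => Finset.sum_nonneg fun p _ => by positivity]
          exact Finset.sum_congr rfl fun j _ =>
            (ENNReal.ofReal_sum_of_nonneg fun p _ => by positivity).symm
        · gcongr
          refine le_trans (le_of_eq ?_) (ENNReal.ofReal_le_ofReal s2)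
          exact (ENNReal.ofReal_sum_of_nonneg fun r _ => by positivity).symm
    _ ≤ _ := by
        rw [mul_add]
        gcongr ENNReal.ofReal ?_ * _ + ENNReal.ofReal ?_ * _
        · have : 0 ≤ D * (R ^ 3 * R ^ 3) * N ^ (-1 + 3 * e) := by positivity
          linarith
        · have : 0 ≤ C * (R * R ^ 3) * N ^ (-1 + 3 * e) := by positivity
          linarith

end

noncomputable section

/-! ### The truncated modified energy and its derivative -/

/-- The weight `⟨2πζ⟩^s` cut off to the shells below `K`. -/
def bracketCut (s : ℝ) (K : ℕ) (ζ : Plane) : ℂ :=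
  ((jap ((2 * Real.pi) • ζ) ^ s : ℝ) : ℂ) * lowCut K ζ

theorem bddSupp_bracketCut (s : ℝ) (K : ℕ) : BddSupp (bracketCut s K) := by
  refine bddSymbol_of_continuous_mul (Complex.continuous_ofReal.comp ?_) (bddSupp_lowCut K)
  refine Continuous.rpow_const ?_ fun ζ => Or.inl (jap_pos _).ne'
  unfold jap
  fun_prop

theorem japSymbol_mul_bracketCut (s : ℝ) (K : ℕ) (ζ : Plane) :
    japSymbol s ζ * bracketCut s K ζ = lowCut K ζ := by
  rw [japSymbol, bracketCut, ← mul_assoc, ← Complex.ofReal_mul, ← Real.rpow_add (jap_pos _)]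
  simp

/-- The quadratic symbol cut off to the shells below `K`. -/
def quadCut (K : ℕ) (ζ : Plane) : ℂ := quadSymbol ζ * lowCut K ζ

theorem bddSupp_quadCut (K : ℕ) : BddSupp (quadCut K) :=
  bddSymbol_of_continuous_mul (by fun_prop) (bddSupp_lowCut K)

theorem conj_quadCut (K : ℕ) (ζ : Plane) : (starRingEnd ℂ) (quadCut K ζ) = quadCut K ζ := by
  rw [quadCut, map_mul, conj_lowCut, Complex.conj_ofReal]

/-- The energy of a function with bounded frequencies, in terms of its Fourier transform `y`. -/
def truncEnergy (σ s : ℝ) (K : ℕ) (y : L2Plane) : ℝ :=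
  1 / 2 * (inner ℂ y (mulOp (quadCut K) y)).re - σ * aConst / 4 *
    ‖besselMul s (mulOp (bracketCut s K) y) (mulOp (bracketCut s K) y)‖ ^ 2

theorem continuous_truncEnergy (σ s : ℝ) (K : ℕ) : Continuous (truncEnergy σ s K) := by
  unfold truncEnergy
  fun_prop

/-- The truncated Fourier transform of the cube, in terms of the Fourier transform `y`. -/
def cubeOf (s : ℝ) (K : ℕ) (y : L2Plane) : L2Plane :=
  truncFourier (lowCut K) (besselCube s (mulOp (bracketCut s K) y) (mulOp (bracketCut s K) y)
    (mulOp (bracketCut s K) y))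

/-- With `w` the real function of transform `y` and `w'` that of `y'`, both cut off below `K`, both
sides are the integral of `w³ w'`. This identifies the cube as the gradient of the quartic part of
the energy. -/
theorem inner_besselMul_eq {s : ℝ} (hs : 1 / 2 < s) (K : ℕ) {y : L2Plane}
    (hy : ∀ᵐ z, (besselL2 s (mulOp (bracketCut s K) y) z).im = 0) (y' : L2Plane) :
    inner ℂ (besselMul s (mulOp (bracketCut s K) y) (mulOp (bracketCut s K) y))
      (besselMul s (mulOp (bracketCut s K) y) (mulOp (bracketCut s K) y')) =
      inner ℂ (cubeOf s K y) y' := by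
  have hb : besselL2 s (mulOp (bracketCut s K) y') =
      fInv (mulOp (fun ζ => (starRingEnd ℂ) (lowCut K ζ)) y') := by
    rw [besselL2, ContinuousLinearMap.comp_apply,
      mulOp_mulOp (bddSymbol_japSymbol (by linarith)) (bddSupp_bracketCut s K).1]
    simp only [japSymbol_mul_bracketCut, conj_lowCut]
  rw [← inner_conj_symm (cubeOf s K y), cubeOf, inner_truncFourier (bddSupp_lowCut K), ← hb,
    ← integral_conj, L2.inner_def]
  refine integral_congr_ae ?_
  filter_upwards [besselMul_ae hs (mulOp (bracketCut s K) y) (mulOp (bracketCut s K) y),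
    besselMul_ae hs (mulOp (bracketCut s K) y) (mulOp (bracketCut s K) y'),
    besselCube_ae hs (mulOp (bracketCut s K) y) (mulOp (bracketCut s K) y)
      (mulOp (bracketCut s K) y), hy] with z h1 h2 h3 h4
  have h5 := Complex.conj_eq_iff_im.2 h4
  rw [h1, h2, h3]
  simp only [RCLike.inner_apply, map_mul, h5, Complex.conj_conj]
  ring

theorem besselMul_comm (s : ℝ) (f g : L2Plane) : besselMul s f g = besselMul s g f := by
  refine Lp.ext ?_
  filter_upwards [mulL4_ae (besselL4 s f) (besselL4 s g),
    mulL4_ae (besselL4 s g) (besselL4 s f)] with z h1 h2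
  exact h1.trans ((mul_comm _ _).trans h2.symm)

/-- The gradient of the energy at `y` is `Q y - σa` times the transform of the cube. The factors
`1/2` and `1/4` are cancelled by the two equal contributions of the quadratic form and the four of
the quartic one. -/
theorem hasDerivAt_truncEnergy {σ s : ℝ} (hs : 1 / 2 < s) (K : ℕ) {y : ℝ → L2Plane} {y' : L2Plane}
    {t : ℝ} (h : HasDerivAt y y' t)
    (hy : ∀ᵐ z, (besselL2 s (mulOp (bracketCut s K) (y t)) z).im = 0) :
    HasDerivAt (fun r => truncEnergy σ s K (y r))
      (inner ℂ (mulOp (quadCut K) (y t) - ((σ * aConst : ℝ) : ℂ) • cubeOf s K (y t)) y').re t := by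
  have hQ : HasDerivAt (fun r => mulOp (quadCut K) (y r)) (mulOp (quadCut K) y') t :=
    ((mulOp (quadCut K)).hasFDerivAt.restrictScalars ℝ).comp_hasDerivAt t h
  have hB : HasDerivAt (fun r => mulOp (bracketCut s K) (y r)) (mulOp (bracketCut s K) y') t :=
    ((mulOp (bracketCut s K)).hasFDerivAt.restrictScalars ℝ).comp_hasDerivAt t h
  have hP : HasDerivAt (fun r => besselMul s (mulOp (bracketCut s K) (y r))
      (mulOp (bracketCut s K) (y r)))
      (besselMul s (mulOp (bracketCut s K) (y t)) (mulOp (bracketCut s K) y') +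
        besselMul s (mulOp (bracketCut s K) y') (mulOp (bracketCut s K) (y t))) t := by
    have hF := ((besselMul s).isBoundedBilinearMap.hasFDerivAt (mulOp (bracketCut s K) (y t),
      mulOp (bracketCut s K) (y t))).restrictScalars ℝ
    have h0 := HasFDerivAt.comp_hasDerivAt t hF (hB.prodMk hB)
    exact h0
  have h1 := HasDerivAt.inner ℂ h hQ
  have h1' : HasDerivAt (fun r => (inner ℂ (y r) (mulOp (quadCut K) (y r))).re)
      (inner ℂ (y t) (mulOp (quadCut K) y') + inner ℂ y' (mulOp (quadCut K) (y t))).re t :=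
    (Complex.reCLM.hasFDerivAt).comp_hasDerivAt t h1
  have h2 := HasDerivAt.inner ℂ hP hP
  have h2' := (Complex.reCLM.hasFDerivAt).comp_hasDerivAt t h2
  have e2 : ∀ r, ‖besselMul s (mulOp (bracketCut s K) (y r)) (mulOp (bracketCut s K) (y r))‖ ^ 2 =
      (inner ℂ (besselMul s (mulOp (bracketCut s K) (y r)) (mulOp (bracketCut s K) (y r)))
        (besselMul s (mulOp (bracketCut s K) (y r)) (mulOp (bracketCut s K) (y r)))).re := fun r =>
    (inner_self_eq_norm_sq (𝕜 := ℂ) _).symm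
  unfold truncEnergy
  simp only [e2]
  refine ((h1'.const_mul (1 / 2)).sub (h2'.const_mul (σ * aConst / 4))).congr_deriv ?_
  have s1 : inner ℂ (y t) (mulOp (quadCut K) y') = inner ℂ (mulOp (quadCut K) (y t)) y' := by
    rw [inner_mulOp (bddSupp_quadCut K).1]
    simp only [conj_quadCut]
  have s2 : (inner ℂ y' (mulOp (quadCut K) (y t))).re = (inner ℂ (mulOp (quadCut K) (y t)) y').re :=
    inner_re_symm (𝕜 := ℂ) _ _
  have s3 : (inner ℂ (besselMul s (mulOp (bracketCut s K) (y t)) (mulOp (bracketCut s K) y'))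
      (besselMul s (mulOp (bracketCut s K) (y t)) (mulOp (bracketCut s K) (y t)))).re =
      (inner ℂ (cubeOf s K (y t)) y').re := by
    rw [← inner_besselMul_eq hs K hy]
    exact inner_re_symm (𝕜 := ℂ) _ _
  rw [besselMul_comm s (mulOp (bracketCut s K) y')]
  simp only [Complex.reCLM_apply, Complex.add_re, inner_add_left, inner_add_right,
    inner_besselMul_eq hs K hy, s1, s2, s3, inner_sub_left, inner_smul_left, Complex.sub_re,
    Complex.conj_ofReal, Complex.re_ofReal_mul]
  ring

/-- The rate of change of the modified energy, for the truncated nonlinearity `n`. -/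
def rateOf (σ s : ℝ) (K : ℕ) (f n : L2Plane) : ℝ :=
  σ * aConst * (inner ℂ (mulOp (dispCut K) (mulOp (japSymbol s) f)) (smoothCube s K f - n)).im +
    aConst ^ 2 * (inner ℂ (mulOp (diagCut K) (smoothCube s K f)) n).im

theorem energyRate_eq_rateOf (σ s : ℝ) (m : Plane → ℝ) (K M : ℕ) (f : L2Plane) :
    energyRate σ s m K M f = rateOf σ s K f (roughCube s m K M f) := rfl

/-- With `X = Q y`, the identity `Re⟨X, iDX⟩ = 0` for the real multiplier `D` removes the linear
flow. The two cross terms combine to the pairing with the difference of the cubes, and `σ² = 1`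
leaves the coefficient `a²` in the sextic term. -/
theorem inner_re_eq_neg_rateOf {σ s : ℝ} (hσ : σ ^ 2 = 1) (hs : 0 ≤ s) (K : ℕ) (f n : L2Plane) :
    (inner ℂ (mulOp (quadCut K) (mulOp (japSymbol s) (mulOp (lowCut K) f)) -
        ((σ * aConst : ℝ) : ℂ) • smoothCube s K f)
      (Complex.I • mulOp (dispCut K) (mulOp (japSymbol s) f) -
        (Complex.I * (σ * aConst)) • mulOp (diagCut K) n)).re = - rateOf σ s K f n := by
  have hJ := bddSymbol_japSymbol hs
  set X := mulOp (quadCut K) (mulOp (japSymbol s) (mulOp (lowCut K) f)) with hX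
  have hDX : mulOp (dispCut K) (mulOp (japSymbol s) f) = mulOp (diagCut K) X := by
    rw [hX, mulOp_mulOp hJ (bddSupp_lowCut K).1,
      mulOp_mulOp (bddSupp_quadCut K).1 (hJ.mul (bddSupp_lowCut K).1),
      mulOp_mulOp (bddSupp_diagCut K).1 ((bddSupp_quadCut K).1.mul (hJ.mul (bddSupp_lowCut K).1)),
      mulOp_mulOp (bddSupp_dispCut K).1 hJ]
    refine congrArg (fun c => mulOp c f) (funext fun ζ => ?_)
    simp only [dispCut, diagCut, quadCut]
    have h := lowCut_mul_self K ζ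
    linear_combination (-(diagSymbol ζ : ℂ) * quadSymbol ζ * japSymbol s ζ * (1 + lowCut K ζ)) * h
  have hD (v w : L2Plane) : inner ℂ v (mulOp (diagCut K) w) = inner ℂ (mulOp (diagCut K) v) w := by
    rw [inner_mulOp (bddSupp_diagCut K).1]
    simp only [conj_diagCut]
  rw [rateOf, hDX]
  set n0 := smoothCube s K f
  have e1 : (inner ℂ (mulOp (diagCut K) X) X).im = 0 :=
    im_inner_mulOp_self (bddSupp_diagCut K).1 (conj_diagCut K) X
  have e2 : (inner ℂ (mulOp (diagCut K) n0) X).im = -(inner ℂ (mulOp (diagCut K) X) n0).im := by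
    rw [← hD, ← inner_conj_symm, Complex.conj_im]
  simp only [map_sub, map_smul, inner_sub_left, inner_sub_right, inner_smul_left, inner_smul_right, hD,
    Complex.conj_ofReal, Complex.sub_re, Complex.sub_im, Complex.mul_re, Complex.mul_im,
    Complex.I_re, Complex.I_im, Complex.ofReal_re, Complex.ofReal_im, e1, e2]
  linear_combination (-(aConst ^ 2) * (inner ℂ (mulOp (diagCut K) n0) n).im) * hσ

end

noncomputable section

/-! ### The truncated modified energy of a solution -/

/-- The lift of `I_N u`. -/
def modLift (s δ : ℝ) (m : Plane → ℝ) (u : ℝ → L2Plane) (t : ℝ) : L2Plane :=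
  mulOp (scaledSymbol m) (solLift s δ u t)

theorem IsSolution.continuous_modLift {σ s δ : ℝ} {u : ℝ → L2Plane} (hu : IsSolution σ s δ u)
    (hδ : 0 < δ) (m : Plane → ℝ) : Continuous (modLift s δ m u) :=
  (mulOp (scaledSymbol m)).continuous.comp (hu.continuous_solLift hδ)

theorem IsISymbol.IOp_eq {s N : ℝ} {m : Plane → ℝ} (hm : IsISymbol s N m) (hN : 0 < N)
    (f : L2Plane) : IOp m f = fInv (mulOp (scaledSymbol m) (𝓕 f : L2Plane)) := by
  have h : MemLp (fun ξ : Plane => (m ((2 * Real.pi) • ξ) : ℂ) *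
      ((𝓕 f : L2Plane) : Plane → ℂ) ξ) 2 volume := (hm.bddSymbol hN).memLp_mul (Lp.memLp _)
  rw [IOp, fourierMult, dif_pos h, fInv_apply]
  congr 1
  exact (mulOp_eq_of_ae (hm.bddSymbol hN) h.coeFn_toLp).symm

theorem IsISymbol.mulOp_japSymbol_modLift {s N : ℝ} {m : Plane → ℝ} (hm : IsISymbol s N m)
    (hN : 0 < N) (hs : 0 ≤ s) (δ : ℝ) (u : ℝ → L2Plane) (t : ℝ) :
    mulOp (japSymbol s) (modLift s δ m u t) = mulOp (scaledSymbol m) (solHat s δ u t) := by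
  rw [modLift, solHat, mulOp_mulOp (bddSymbol_japSymbol hs) (hm.bddSymbol hN),
    mulOp_mulOp (hm.bddSymbol hN) (bddSymbol_japSymbol hs)]
  exact congrArg (fun c => mulOp c _) (funext fun ζ => mul_comm _ _)

theorem IsSolution.besselL2_modLift {σ s δ : ℝ} {u : ℝ → L2Plane} (hu : IsSolution σ s δ u)
    {N : ℝ} {m : Plane → ℝ} (hm : IsISymbol s N m) (hN : 0 < N) (hs : 0 ≤ s) {t : ℝ}
    (ht : t ∈ Set.Icc 0 δ) : besselL2 s (modLift s δ m u t) = IOp m (u t) := by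
  rw [besselL2, ContinuousLinearMap.comp_apply, hm.mulOp_japSymbol_modLift hN hs, solHat,
    hu.mulOp_solLift hs ht, hm.IOp_eq hN]

theorem IsISymbol.mulOp_invCut_modLift {s N : ℝ} {m : Plane → ℝ} (hm : IsISymbol s N m)
    (hN : 0 < N) (hs0 : 0 ≤ s) (hs1 : s ≤ 1) (M : ℕ) (δ : ℝ) (u : ℝ → L2Plane) (t : ℝ) :
    mulOp (invCut m M) (modLift s δ m u t) = mulOp (lowCut M) (solLift s δ u t) := by
  rw [modLift, mulOp_mulOp (hm.bddSupp_invCut hN hs0 hs1 M).1 (hm.bddSymbol hN)]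
  refine congrArg (fun c => mulOp c _) (funext fun ζ => ?_)
  rw [invCut, mul_assoc, inv_mul_cancel₀ (hm.scaledSymbol_ne_zero hN ζ), mul_one]

theorem IsISymbol.conj_scaledSymbol {s N : ℝ} {m : Plane → ℝ} (hm : IsISymbol s N m) (ζ : Plane) :
    scaledSymbol m ζ = (starRingEnd ℂ) (scaledSymbol m (-ζ)) := by
  rw [scaledSymbol, scaledSymbol, Complex.conj_ofReal, hm.radial _ ((2 * Real.pi) • -ζ) (by simp)]

theorem jap_neg (ζ : Plane) : jap (-ζ) = jap ζ := by rw [jap, jap, norm_neg]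

theorem lowCut_neg (K : ℕ) (ζ : Plane) : lowCut K ζ = (starRingEnd ℂ) (lowCut K (-ζ)) := by
  rw [conj_lowCut]
  simp only [lowCut, indSymbol, Set.indicator_apply, Set.mem_ofPred_eq, jap_neg]

/-- The low frequencies of the Fourier transform of `I_N u`. -/
def lowHat (s δ : ℝ) (m : Plane → ℝ) (u : ℝ → L2Plane) (K : ℕ) (t : ℝ) : L2Plane :=
  mulOp (fun ζ => scaledSymbol m ζ * lowCut K ζ) (solHat s δ u t)

theorem IsISymbol.lowHat_eq {s N : ℝ} {m : Plane → ℝ} (hm : IsISymbol s N m)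
    (hN : 0 < N) (hs : 0 ≤ s) (δ : ℝ) (u : ℝ → L2Plane) (K : ℕ) (t : ℝ) :
    lowHat s δ m u K t = mulOp (lowCut K) (mulOp (japSymbol s) (modLift s δ m u t)) := by
  rw [hm.mulOp_japSymbol_modLift hN hs, mulOp_mulOp (bddSupp_lowCut K).1 (hm.bddSymbol hN), lowHat]
  exact congrArg (fun c => mulOp c _) (funext fun ζ => mul_comm _ _)

theorem IsISymbol.lowHat_eq' {s N : ℝ} {m : Plane → ℝ} (hm : IsISymbol s N m)
    (hN : 0 < N) (hs : 0 ≤ s) (δ : ℝ) (u : ℝ → L2Plane) (K : ℕ) (t : ℝ) :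
    lowHat s δ m u K t = mulOp (japSymbol s) (mulOp (lowCut K) (modLift s δ m u t)) := by
  rw [hm.lowHat_eq hN hs, mulOp_mulOp (bddSupp_lowCut K).1 (bddSymbol_japSymbol hs),
    mulOp_mulOp (bddSymbol_japSymbol hs) (bddSupp_lowCut K).1]
  exact congrArg (fun c => mulOp c _) (funext fun ζ => mul_comm _ _)

theorem IsISymbol.mulOp_bracketCut_lowHat {s N : ℝ} {m : Plane → ℝ} (hm : IsISymbol s N m)
    (hN : 0 < N) (hs : 0 ≤ s) (δ : ℝ) (u : ℝ → L2Plane) (K : ℕ) (t : ℝ) :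
    mulOp (bracketCut s K) (lowHat s δ m u K t) = mulOp (lowCut K) (modLift s δ m u t) := by
  rw [hm.lowHat_eq hN hs, mulOp_mulOp (bddSupp_lowCut K).1 (bddSymbol_japSymbol hs),
    mulOp_mulOp (bddSupp_bracketCut s K).1 ((bddSupp_lowCut K).1.mul (bddSymbol_japSymbol hs))]
  refine congrArg (fun c => mulOp c _) (funext fun ζ => ?_)
  have h1 := japSymbol_mul_bracketCut s K ζ
  have h2 := lowCut_mul_self K ζ
  linear_combination lowCut K ζ * h1 + h2

/-- The symbol of `I_N` and the frequency cut-off are real and even, so they preserve the Hermitian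
symmetry of the transform of `u`. -/
theorem IsSolution.lowHat_real {σ s δ : ℝ} {u : ℝ → L2Plane} (hu : IsSolution σ s δ u)
    {N : ℝ} {m : Plane → ℝ} (hm : IsISymbol s N m) (hN : 0 < N) (hs : 0 ≤ s) (K : ℕ) {t : ℝ}
    (ht : t ∈ Set.Icc 0 δ) :
    ∀ᵐ z, (besselL2 s (mulOp (bracketCut s K) (lowHat s δ m u K t)) z).im = 0 := by
  have e : besselL2 s (mulOp (bracketCut s K) (lowHat s δ m u K t)) = fInv (lowHat s δ m u K t) := by
    rw [hm.mulOp_bracketCut_lowHat hN hs, hm.lowHat_eq' hN hs]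
    rfl
  rw [e, lowHat, solHat, hu.mulOp_solLift hs ht]
  refine ((isHermitian_fourier (hu.real_valued t ht)).mulOp (hm.bddSupp_mul_lowCut hN K).1
    fun ζ => ?_).fInv_im
  rw [map_mul, ← hm.conj_scaledSymbol, ← lowCut_neg]

theorem IsISymbol.evolRHS_eq {s N : ℝ} {m : Plane → ℝ} (hm : IsISymbol s N m)
    (hN : 0 < N) (hs : 0 ≤ s) (σ δ : ℝ) (u : ℝ → L2Plane) (K : ℕ) (t : ℝ) :
    evolRHS σ s δ u (fun ζ => scaledSymbol m ζ * lowCut K ζ) t =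
      Complex.I • mulOp (dispCut K) (mulOp (japSymbol s) (modLift s δ m u t)) -
        (Complex.I * (σ * aConst)) • mulOp (diagCut K)
          (truncFourier (fun ζ => scaledSymbol m ζ * lowCut K ζ) (solCube s δ u t)) := by
  have hc := hm.bddSupp_mul_lowCut hN K
  have h1 : BddSupp fun ζ => Complex.I * (diagSymbol ζ * quadSymbol ζ) *
      (scaledSymbol m ζ * lowCut K ζ) := bddSymbol_of_continuous_mul (by fun_prop) hc
  rw [evolRHS, hm.mulOp_japSymbol_modLift hN hs, mulOp_mulOp (bddSupp_dispCut K).1 (hm.bddSymbol hN),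
    mulOp_truncFourier (bddSupp_diagCut K).1 hc]
  congr 1
  · refine mulOp_eq_of_ae h1.1 ?_
    filter_upwards [Lp.coeFn_smul Complex.I (mulOp (fun ζ => dispCut K ζ * scaledSymbol m ζ)
      (solHat s δ u t)), mulOp_ae ((bddSupp_dispCut K).1.mul (hm.bddSymbol hN)) (solHat s δ u t)]
      with ζ e1 e2
    rw [e1, Pi.smul_apply, e2, dispCut, smul_eq_mul]
    ring
  · refine congrArg (fun c => (Complex.I * (σ * aConst : ℂ)) • truncFourier c (solCube s δ u t))
      (funext fun ζ => ?_)
    rw [diagCut]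
    linear_combination (-(diagSymbol ζ : ℂ) * scaledSymbol m ζ) * lowCut_mul_self K ζ

theorem IsSolution.hasDerivAt_truncEnergy {σ s δ : ℝ} {u : ℝ → L2Plane} (hu : IsSolution σ s δ u)
    (hσ : σ ^ 2 = 1) (hs : 1 / 2 < s) (hδ : 0 < δ) {N : ℝ} {m : Plane → ℝ} (hm : IsISymbol s N m)
    (hN : 0 < N) (K : ℕ) {t : ℝ} (ht : t ∈ Set.Ioo 0 δ) :
    HasDerivAt (fun r => truncEnergy σ s K (lowHat s δ m u K r))
      (- rateOf σ s K (modLift s δ m u t)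
        (truncFourier (fun ζ => scaledSymbol m ζ * lowCut K ζ) (solCube s δ u t))) t := by
  have hs0 : 0 ≤ s := by linarith
  have h := SymmetrizedMZK.hasDerivAt_truncEnergy (σ := σ) hs K
    (hu.hasDerivAt hs hδ ht (hm.bddSupp_mul_lowCut hN K))
    (hu.lowHat_real hm hN hs0 K (Set.Ioo_subset_Icc_self ht))
  refine h.congr_deriv ?_
  rw [← inner_re_eq_neg_rateOf hσ hs0, hm.evolRHS_eq hN hs0]
  have e1 : mulOp (fun ζ => scaledSymbol m ζ * lowCut K ζ) (solHat s δ u t) =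
      lowHat s δ m u K t := rfl
  rw [e1, cubeOf, hm.mulOp_bracketCut_lowHat hN hs0, hm.lowHat_eq' hN hs0]
  rfl

/-- Dividing the lift of `I_N u` by the symbol of `I_N` gives back that of `u`. Thus `roughCube` is
built from the cube of `u` with frequencies cut off at `M`, and the trilinear map is continuous. -/
theorem IsISymbol.tendsto_roughCube {s N : ℝ} {m : Plane → ℝ} (hm : IsISymbol s N m)
    (hN : 0 < N) (hs : 0 ≤ s) (hs1 : s ≤ 1) (δ : ℝ) (u : ℝ → L2Plane) (K : ℕ) (t : ℝ) :
    Tendsto (fun M => roughCube s m K M (modLift s δ m u t)) atTop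
      (𝓝 (truncFourier (fun ζ => scaledSymbol m ζ * lowCut K ζ) (solCube s δ u t))) := by
  have h : Tendsto (fun M => mulOp (lowCut M) (solLift s δ u t)) atTop (𝓝 (solLift s δ u t)) := by
    refine tendsto_mulOp_indSymbol measurableSet_jap_lt (fun ζ => ?_) _
    exact (tendsto_pow_atTop_atTop_of_one_lt (by norm_num : (1 : ℝ) < 2)).eventually_gt_atTop _
  have hc : Continuous fun f : L2Plane => truncFourier (fun ζ => scaledSymbol m ζ * lowCut K ζ)
      (besselCube s f f f) := by fun_prop
  refine ((hc.tendsto _).comp h).congr fun M => ?_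
  rw [roughCube, hm.mulOp_invCut_modLift hN hs hs1]
  rfl

theorem continuous_rateOf {X : Type*} [TopologicalSpace X] (σ s : ℝ) (K : ℕ)
    {f n : X → L2Plane} (hf : Continuous f) (hn : Continuous n) :
    Continuous fun x => rateOf σ s K (f x) (n x) := by
  have h1 : Continuous fun x => smoothCube s K (f x) := by
    unfold smoothCube
    fun_prop
  have h2 : Continuous fun x => mulOp (dispCut K) (mulOp (japSymbol s) (f x)) := by fun_prop
  have h3 : Continuous fun x => mulOp (diagCut K) (smoothCube s K (f x)) :=
    (mulOp (diagCut K)).continuous.comp h1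
  unfold rateOf
  exact ((Complex.continuous_im.comp (h2.inner (h1.sub hn))).const_mul _).add
    ((Complex.continuous_im.comp (h3.inner hn)).const_mul _)

/-- The fundamental theorem of calculus followed by Fatou's lemma in `M`. No uniform convergence of
the rates is required, only a common bound of their integrals. -/
theorem enorm_sub_le_of_hasDerivAt_of_tendsto {δ : ℝ} (hδ : 0 < δ) {E r : ℝ → ℝ} {F : ℕ → ℝ → ℝ}
    (hE : Continuous E) (hr : Continuous r) (hF : ∀ M, Continuous (F M))
    (hd : ∀ t ∈ Set.Ioo 0 δ, HasDerivAt E (- r t) t)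
    (hlim : ∀ t, Tendsto (fun M => F M t) atTop (𝓝 (r t))) {B : ℝ≥0∞} {K : ℕ}
    (hB : ∀ M, K ≤ M → ∫⁻ t in Set.Ioo 0 δ, ‖F M t‖ₑ ≤ B) : ‖E δ - E 0‖ₑ ≤ B := by
  rw [← intervalIntegral.integral_eq_sub_of_hasDerivAt_of_le hδ.le hE.continuousOn hd
    (hr.neg.intervalIntegrable _ _), intervalIntegral.integral_of_le hδ.le,
    ← restrict_Ioo_eq_restrict_Ioc]
  refine (enorm_integral_le_lintegral_enorm _).trans ?_
  simp only [enorm_neg]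
  calc ∫⁻ t in Set.Ioo 0 δ, ‖r t‖ₑ
      = ∫⁻ t in Set.Ioo 0 δ, liminf (fun M => ‖F M t‖ₑ) atTop :=
        lintegral_congr fun t => ((continuous_enorm.tendsto _).comp (hlim t)).liminf_eq.symm
    _ ≤ liminf (fun M => ∫⁻ t in Set.Ioo 0 δ, ‖F M t‖ₑ) atTop :=
        lintegral_liminf_le fun M => (hF M).enorm.measurable
    _ ≤ B := by
        refine liminf_le_of_frequently_le' (Eventually.frequently ?_)
        filter_upwards [eventually_ge_atTop K] with M hM using hB M hM

theorem continuous_roughCube (s : ℝ) (m : Plane → ℝ) (K M : ℕ) :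
    Continuous (roughCube s m K M) := by
  unfold roughCube
  fun_prop

theorem IsSolution.enorm_truncEnergy_sub_le {σ s δ : ℝ} {u : ℝ → L2Plane} (hu : IsSolution σ s δ u)
    (hσ : σ ^ 2 = 1) (hs : 1 / 2 < s) (hs1 : s ≤ 1) (hδ : 0 < δ) {N : ℝ} {m : Plane → ℝ}
    (hm : IsISymbol s N m) (hN : 0 < N) (K : ℕ) {B : ℝ≥0∞}
    (hB : ∀ M, K ≤ M → ∫⁻ t in Set.Ioo 0 δ, ‖energyRate σ s m K M (modLift s δ m u t)‖ₑ ≤ B) :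
    ‖truncEnergy σ s K (lowHat s δ m u K δ) - truncEnergy σ s K (lowHat s δ m u K 0)‖ₑ ≤ B := by
  have hs0 : 0 ≤ s := by linarith
  have hcl := hu.continuous_modLift hδ m
  have hcn : Continuous fun t => truncFourier (fun ζ => scaledSymbol m ζ * lowCut K ζ)
      (solCube s δ u t) := (truncFourier _).continuous.comp (hu.continuous_solCube hδ)
  have hcy : Continuous fun t => lowHat s δ m u K t :=
    (mulOp _).continuous.comp (hu.continuous_solHat hδ)
  refine enorm_sub_le_of_hasDerivAt_of_tendsto hδ
    (E := fun t => truncEnergy σ s K (lowHat s δ m u K t))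
    (r := fun t => rateOf σ s K (modLift s δ m u t)
      (truncFourier (fun ζ => scaledSymbol m ζ * lowCut K ζ) (solCube s δ u t)))
    (F := fun M t => energyRate σ s m K M (modLift s δ m u t))
    ((continuous_truncEnergy σ s K).comp hcy)
    (continuous_rateOf σ s K hcl hcn) (fun M => ?_)
    (fun t ht => hu.hasDerivAt_truncEnergy hσ hs hδ hm hN K ht) (fun t => ?_) hB
  · simp only [energyRate_eq_rateOf]
    exact continuous_rateOf σ s K hcl ((continuous_roughCube s m K M).comp hcl)
  · simp only [energyRate_eq_rateOf]
    have h1 := hm.tendsto_roughCube hN hs0 hs1 δ u K t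
    have h2 := continuous_rateOf σ s K
      (continuous_const (y := modLift s δ m u t)) continuous_id
    exact (h2.tendsto _).comp h1

end

noncomputable section

/-! ### The energy in terms of the Fourier transform -/

theorem norm_sq_eq_integral (f : L2Plane) : ‖f‖ ^ 2 = ∫ z, ‖f z‖ ^ 2 := by
  have h := inner_self_eq_norm_sq_to_K (𝕜 := ℂ) f
  rw [L2.inner_def] at h
  have e : ∀ z, inner ℂ (f z) (f z) = ((‖f z‖ ^ 2 : ℝ) : ℂ) := fun z => by
    rw [inner_self_eq_norm_sq_to_K]; simp
  simp only [e, integral_complex_ofReal] at h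
  rw [← RCLike.ofReal_pow] at h
  exact (Complex.ofReal_injective h).symm

theorem integrable_norm_sq (f : L2Plane) : Integrable fun z => ‖f z‖ ^ 2 :=
  (memLp_two_iff_integrable_sq_norm (Lp.aestronglyMeasurable f)).1 (Lp.memLp f)

theorem integral_re_mul_re {f g : L2Plane} (hf : ∀ᵐ z, (f z).im = 0) (hg : ∀ᵐ z, (g z).im = 0) :
    ∫ z, (f z).re * (g z).re = (inner ℂ f g).re := by
  have e : inner ℂ f g = ∫ z, (((f z).re * (g z).re : ℝ) : ℂ) := by
    rw [L2.inner_def]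
    refine integral_congr_ae ?_
    filter_upwards [hf, hg] with z h1 h2
    rw [RCLike.inner_apply, Complex.conj_eq_iff_im.2 h1]
    apply Complex.ext <;> simp [h1, h2, mul_comm]
  rw [e, integral_complex_ofReal, Complex.ofReal_re]

theorem inner_fInv (f g : L2Plane) : inner ℂ (fInv f) (fInv g) = inner ℂ f g :=
  LinearIsometryEquiv.inner_map_map _ f g

theorem fourierMult_eq_fInv {a : Plane → ℂ} {f h : L2Plane}
    (H : (h : Plane → ℂ) =ᵐ[volume] fun ξ => a ((2 * Real.pi) • ξ) * (𝓕 f : L2Plane) ξ) :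
    fourierMult a f = fInv h := by
  have hm := (memLp_congr_ae H).1 (Lp.memLp h)
  rw [fourierMult, dif_pos hm, fInv_apply]
  congr 1
  exact Lp.ext (hm.coeFn_toLp.trans H.symm)

theorem mulOp_add_symbol {c d : Plane → ℂ} (hc : BddSymbol c) (hd : BddSymbol d)
    (hcd : BddSymbol fun ζ => c ζ + d ζ) (f : L2Plane) :
    mulOp (fun ζ => c ζ + d ζ) f = mulOp c f + mulOp d f := by
  refine mulOp_eq_of_ae hcd ?_
  filter_upwards [mulOp_ae hc f, mulOp_ae hd f, Lp.coeFn_add (mulOp c f) (mulOp d f)]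
    with ζ h1 h2 h3
  rw [h3, Pi.add_apply, h1, h2, add_mul]

theorem mulOp_sub_symbol {c d : Plane → ℂ} (hc : BddSymbol c) (hd : BddSymbol d)
    (hcd : BddSymbol fun ζ => c ζ - d ζ) (f : L2Plane) :
    mulOp (fun ζ => c ζ - d ζ) f = mulOp c f - mulOp d f := by
  refine mulOp_eq_of_ae hcd ?_
  filter_upwards [mulOp_ae hc f, mulOp_ae hd f, Lp.coeFn_sub (mulOp c f) (mulOp d f)]
    with ζ h1 h2 h3
  rw [h3, Pi.sub_apply, h1, h2, sub_mul]

theorem IsHermitian.congr_mul {k k' : L2Plane} (hk : IsHermitian k) {c : Plane → ℂ}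
    (h : (k' : Plane → ℂ) =ᵐ[volume] fun ζ => c ζ * k ζ)
    (he : ∀ ζ, c ζ = (starRingEnd ℂ) (c (-ζ))) : IsHermitian k' := by
  have h1 : ∀ᵐ ζ : Plane, k' (-ζ) = c (-ζ) * k (-ζ) :=
    (Measure.measurePreserving_neg (volume : Measure Plane)).quasiMeasurePreserving.ae_eq_comp h
  filter_upwards [hk, h, h1] with ζ h1 h2 h3
  rw [h2, h3, map_mul, ← he, ← h1]

/-- The symbol of the partial derivatives. -/
def derivSymbol (j : Fin 2) (ζ : Plane) : ℂ := Complex.I * ((2 * Real.pi * ζ j : ℝ) : ℂ)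

theorem continuous_derivSymbol (j : Fin 2) : Continuous (derivSymbol j) := by
  unfold derivSymbol
  fun_prop

theorem norm_derivSymbol_le (j : Fin 2) (ζ : Plane) :
    ‖derivSymbol j ζ‖ ≤ ‖(2 * Real.pi) • ζ‖ := by
  rw [derivSymbol, norm_mul, Complex.norm_I, one_mul, Complex.norm_real]
  exact PiLp.norm_apply_le ((2 * Real.pi) • ζ) j

/-- The symbol of the partial derivatives of `I_N f` acting on `⟨2πζ⟩^s 𝓕 f`. -/
def gradSymbol (s : ℝ) (m : Plane → ℝ) (j : Fin 2) (ζ : Plane) : ℂ :=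
  derivSymbol j ζ * (scaledSymbol m ζ * japSymbol s ζ)

/-- The operator `I_N` gains `1 - s` derivatives: for large frequencies `|ζ| (N/|ζ|)^{1-s} |ζ|^{-s}
= N^{1-s}`. Hence the gradient of `I_N u` depends continuously on the `H^s` lift of `u`. -/
theorem IsISymbol.bddSymbol_gradSymbol {s N : ℝ} {m : Plane → ℝ} (hm : IsISymbol s N m)
    (hN : 0 < N) (hs : 0 ≤ s) (j : Fin 2) : BddSymbol (gradSymbol s m j) := by
  refine ⟨(continuous_derivSymbol j).measurable.mul
    (hm.measurable_scaledSymbol.mul (measurable_japSymbol s)), max (2 * N) (N ^ (1 - s)),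
    fun ζ => ?_⟩
  rw [gradSymbol, norm_mul, norm_mul, norm_japSymbol]
  have h1 := norm_derivSymbol_le j ζ
  have h2 := hm.norm_scaledSymbol_le hN ζ
  set z := (2 * Real.pi) • ζ with hz
  have h3 : jap z ^ (-s) ≤ 1 := Real.rpow_le_one_of_one_le_of_nonpos (one_le_jap z) (by linarith)
  have h4 : 0 ≤ jap z ^ (-s) := Real.rpow_nonneg (jap_pos z).le _
  rcases le_total ‖z‖ (2 * N) with h | h
  · refine le_max_of_le_left ?_
    calc ‖derivSymbol j ζ‖ * (‖scaledSymbol m ζ‖ * jap z ^ (-s)) ≤ 2 * N * (1 * 1) := by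
          gcongr
          exact h1.trans h
      _ = 2 * N := by ring
  · refine le_max_of_le_right ?_
    have hz0 : 0 < ‖z‖ := by linarith
    have h5 : jap z ^ (-s) ≤ ‖z‖ ^ (-s) :=
      Real.rpow_le_rpow_of_nonpos hz0 (norm_le_jap z) (by linarith)
    have h6 : ‖scaledSymbol m ζ‖ = (N / ‖z‖) ^ (1 - s) := by
      rw [scaledSymbol, Complex.norm_real, Real.norm_of_nonneg (hm.pos hN _).le, hm.eq_rpow _ h]
    calc ‖derivSymbol j ζ‖ * (‖scaledSymbol m ζ‖ * jap z ^ (-s))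
        ≤ ‖z‖ * ((N / ‖z‖) ^ (1 - s) * ‖z‖ ^ (-s)) := by
          rw [h6]
          gcongr
      _ = N ^ (1 - s) := by
          rw [Real.div_rpow hN.le hz0.le, Real.rpow_neg hz0.le, Real.rpow_sub hz0, Real.rpow_one]
          have := (Real.rpow_pos_of_pos hz0 s).ne'
          field_simp

theorem IsSolution.solLift_ae {σ s δ : ℝ} {u : ℝ → L2Plane} (hu : IsSolution σ s δ u) {t : ℝ}
    (ht : t ∈ Set.Icc 0 δ) :
    (solLift s δ u t : Plane → ℂ) =ᵐ[volume] fun ξ => ((jap ((2 * Real.pi) • ξ) ^ s : ℝ) : ℂ) *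
      (𝓕 (u t) : L2Plane) ξ := by
  rw [solLift, clampTime_of_mem ht]
  exact sobLift_ae (hu.mem_Hs t ht)

theorem IsISymbol.fourier_IOp {s N : ℝ} {m : Plane → ℝ} (hm : IsISymbol s N m) (hN : 0 < N)
    (f : L2Plane) : (𝓕 (IOp m f) : L2Plane) = mulOp (scaledSymbol m) (𝓕 f : L2Plane) := by
  rw [hm.IOp_eq hN, fInv_apply, FourierInvPair.fourier_fourierInv_eq]

theorem japSymbol_mul_rpow (s : ℝ) (ζ : Plane) :
    japSymbol s ζ * ((jap ((2 * Real.pi) • ζ) ^ s : ℝ) : ℂ) = 1 := by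
  rw [japSymbol, ← Complex.ofReal_mul, ← Real.rpow_add (jap_pos _)]
  simp

section Gradient

variable {σ s δ : ℝ} {u : ℝ → L2Plane} {N : ℝ} {m : Plane → ℝ} {t : ℝ}

theorem IsSolution.mulOp_gradSymbol_ae (hu : IsSolution σ s δ u)
    (hm : IsISymbol s N m) (hN : 0 < N) (hs : 0 ≤ s) (ht : t ∈ Set.Icc 0 δ) (j : Fin 2) :
    (mulOp (gradSymbol s m j) (solLift s δ u t) : Plane → ℂ) =ᵐ[volume]
      fun ζ => derivSymbol j ζ * scaledSymbol m ζ * (𝓕 (u t) : L2Plane) ζ := by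
  filter_upwards [mulOp_ae (hm.bddSymbol_gradSymbol hN hs j) (solLift s δ u t),
    hu.solLift_ae ht] with ζ h1 h2
  rw [h1, h2, gradSymbol]
  linear_combination (derivSymbol j ζ * scaledSymbol m ζ * (𝓕 (u t) : L2Plane) ζ) *
    japSymbol_mul_rpow s ζ

theorem IsSolution.partialDeriv_IOp (hu : IsSolution σ s δ u)
    (hm : IsISymbol s N m) (hN : 0 < N) (hs : 0 ≤ s) (ht : t ∈ Set.Icc 0 δ) (j : Fin 2) :
    partialDeriv j (IOp m (u t)) = fInv (mulOp (gradSymbol s m j) (solLift s δ u t)) := by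
  refine fourierMult_eq_fInv ?_
  rw [hm.fourier_IOp hN]
  filter_upwards [hu.mulOp_gradSymbol_ae hm hN hs ht j,
    mulOp_ae (hm.bddSymbol hN) (𝓕 (u t) : L2Plane)] with ζ h1 h2
  rw [h1, h2, derivSymbol, mul_assoc]
  rfl

theorem IsSolution.partialDeriv_IOp_real (hu : IsSolution σ s δ u)
    (hm : IsISymbol s N m) (hN : 0 < N) (hs : 0 ≤ s) (ht : t ∈ Set.Icc 0 δ) (j : Fin 2) :
    ∀ᵐ z, (partialDeriv j (IOp m (u t)) z).im = 0 := by
  rw [hu.partialDeriv_IOp hm hN hs ht]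
  refine ((isHermitian_fourier (hu.real_valued t ht)).congr_mul
    (hu.mulOp_gradSymbol_ae hm hN hs ht j) fun ζ => ?_).fInv_im
  rw [map_mul, ← hm.conj_scaledSymbol, derivSymbol, derivSymbol, map_mul, Complex.conj_I,
    Complex.conj_ofReal]
  simp

theorem IsSolution.IOp_real (hu : IsSolution σ s δ u) (hm : IsISymbol s N m) (hN : 0 < N)
    (ht : t ∈ Set.Icc 0 δ) : ∀ᵐ z, (IOp m (u t) z).im = 0 := by
  rw [hm.IOp_eq hN]
  exact ((isHermitian_fourier (hu.real_valued t ht)).mulOp (hm.bddSymbol hN)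
    hm.conj_scaledSymbol).fInv_im

/-- The energy in terms of the transforms of the derivatives and of the lift. -/
def liftEnergy (σ s : ℝ) (p q f : L2Plane) : ℝ :=
  1 / 2 * (inner ℂ p p + inner ℂ q q - inner ℂ p q).re - σ * aConst / 4 * ‖besselMul s f f‖ ^ 2

theorem IsSolution.energy_IOp (hu : IsSolution σ s δ u)
    (hm : IsISymbol s N m) (hN : 0 < N) (hs : 1 / 2 < s) (ht : t ∈ Set.Icc 0 δ) :
    energy σ (IOp m (u t)) = liftEnergy σ s (mulOp (gradSymbol s m 0) (solLift s δ u t))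
      (mulOp (gradSymbol s m 1) (solLift s δ u t)) (modLift s δ m u t) := by
  have hs0 : 0 ≤ s := by linarith
  have h4 : ∫ z, (IOp m (u t) z).re ^ 4 =
      ‖besselMul s (modLift s δ m u t) (modLift s δ m u t)‖ ^ 2 := by
    rw [norm_sq_eq_integral]
    refine integral_congr_ae ?_
    have h := besselMul_ae hs (modLift s δ m u t) (modLift s δ m u t)
    rw [hu.besselL2_modLift hm hN hs0 ht] at h
    filter_upwards [h, hu.IOp_real hm hN ht] with z h1 h2
    have h3 : IOp m (u t) z = ((IOp m (u t) z).re : ℂ) := by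
      apply Complex.ext <;> simp [h2]
    rw [h1, h3, ← Complex.ofReal_mul, Complex.norm_real, Real.norm_eq_abs, sq_abs, Complex.ofReal_re]
    ring
  rw [energy, integral_add (integrable_norm_sq _) (integrable_norm_sq _),
    ← norm_sq_eq_integral, ← norm_sq_eq_integral,
    integral_re_mul_re (hu.partialDeriv_IOp_real hm hN hs0 ht 0)
      (hu.partialDeriv_IOp_real hm hN hs0 ht 1), h4, hu.partialDeriv_IOp hm hN hs0 ht,
    hu.partialDeriv_IOp hm hN hs0 ht, inner_fInv, norm_fInv, norm_fInv, liftEnergy,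
    Complex.sub_re, Complex.add_re]
  have e (f : L2Plane) : (inner ℂ f f).re = ‖f‖ ^ 2 := inner_self_eq_norm_sq (𝕜 := ℂ) f
  rw [e, e]
  ring

end Gradient

theorem continuous_liftEnergy (σ s : ℝ) {X : Type*} [TopologicalSpace X] {p q f : X → L2Plane}
    (hp : Continuous p) (hq : Continuous q) (hf : Continuous f) :
    Continuous fun x => liftEnergy σ s (p x) (q x) (f x) := by
  unfold liftEnergy
  have h1 : Continuous fun x => besselMul s (f x) (f x) := by fun_prop
  exact ((Complex.continuous_re.comp (((hp.inner hp).add (hq.inner hq)).sub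
    (hp.inner hq))).const_mul _).sub ((h1.norm.pow 2).const_mul _)

theorem bddSupp_derivSymbol_mul_lowCut (j : Fin 2) (K : ℕ) :
    BddSupp fun ζ => derivSymbol j ζ * lowCut K ζ :=
  bddSymbol_of_continuous_mul (continuous_derivSymbol j) (bddSupp_lowCut K)

theorem inner_mulOp_quadCut (K : ℕ) (y : L2Plane) :
    inner ℂ y (mulOp (quadCut K) y) =
      inner ℂ (mulOp (fun ζ => derivSymbol 0 ζ * lowCut K ζ) y)
        (mulOp (fun ζ => derivSymbol 0 ζ * lowCut K ζ) y) +
      inner ℂ (mulOp (fun ζ => derivSymbol 1 ζ * lowCut K ζ) y)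
        (mulOp (fun ζ => derivSymbol 1 ζ * lowCut K ζ) y) -
      inner ℂ (mulOp (fun ζ => derivSymbol 0 ζ * lowCut K ζ) y)
        (mulOp (fun ζ => derivSymbol 1 ζ * lowCut K ζ) y) := by
  set P : Fin 2 → Plane → ℂ := fun j ζ => derivSymbol j ζ * lowCut K ζ with hP
  have hb (j : Fin 2) : BddSymbol (P j) := (bddSupp_derivSymbol_mul_lowCut j K).1
  have key (i j : Fin 2) : inner ℂ (mulOp (P i) y) (mulOp (P j) y) =
      inner ℂ y (mulOp (fun ζ => (starRingEnd ℂ) (P i ζ) * P j ζ) y) := by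
    rw [← mulOp_mulOp (hb i).conj (hb j), inner_mulOp (hb i).conj]
    simp only [Complex.conj_conj]
  have hbb (i j : Fin 2) : BddSymbol fun ζ => (starRingEnd ℂ) (P i ζ) * P j ζ :=
    (hb i).conj.mul (hb j)
  have h1 : BddSymbol fun ζ => (starRingEnd ℂ) (P 0 ζ) * P 0 ζ + (starRingEnd ℂ) (P 1 ζ) * P 1 ζ := by
    obtain ⟨A, hA⟩ := (hbb 0 0).2
    obtain ⟨B, hB⟩ := (hbb 1 1).2
    exact ⟨(hbb 0 0).1.add (hbb 1 1).1, A + B, fun ζ =>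
      (norm_add_le _ _).trans (add_le_add (hA ζ) (hB ζ))⟩
  have e : quadCut K = fun ζ => ((starRingEnd ℂ) (P 0 ζ) * P 0 ζ + (starRingEnd ℂ) (P 1 ζ) * P 1 ζ) -
      (starRingEnd ℂ) (P 0 ζ) * P 1 ζ := by
    funext ζ
    have h := lowCut_mul_self K ζ
    simp only [hP, map_mul, conj_lowCut, derivSymbol, quadCut, quadSymbol, Complex.conj_I,
      Complex.conj_ofReal]
    push_cast
    linear_combination (4 * Real.pi ^ 2 * (ζ 0 ^ 2 - ζ 0 * ζ 1 + ζ 1 ^ 2) : ℂ) *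
      (lowCut K ζ ^ 2 * Complex.I_sq - h)
  have h2 : BddSymbol fun ζ => ((starRingEnd ℂ) (P 0 ζ) * P 0 ζ +
      (starRingEnd ℂ) (P 1 ζ) * P 1 ζ) - (starRingEnd ℂ) (P 0 ζ) * P 1 ζ := e ▸ (bddSupp_quadCut K).1
  rw [show inner ℂ y (mulOp (quadCut K) y) = _ from by rw [e]]
  rw [mulOp_sub_symbol h1 (hbb 0 1) h2, mulOp_add_symbol (hbb 0 0) (hbb 1 1) h1, inner_sub_right,
    inner_add_right, ← key, ← key, ← key]

theorem IsISymbol.truncEnergy_lowHat {s N : ℝ} {m : Plane → ℝ} (hm : IsISymbol s N m)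
    (hN : 0 < N) (hs : 0 ≤ s) (σ δ : ℝ) (u : ℝ → L2Plane) (K : ℕ) (t : ℝ) :
    truncEnergy σ s K (lowHat s δ m u K t) =
      liftEnergy σ s (mulOp (gradSymbol s m 0) (mulOp (lowCut K) (solLift s δ u t)))
        (mulOp (gradSymbol s m 1) (mulOp (lowCut K) (solLift s δ u t)))
        (mulOp (scaledSymbol m) (mulOp (lowCut K) (solLift s δ u t))) := by
  have e (j : Fin 2) : mulOp (fun ζ => derivSymbol j ζ * lowCut K ζ) (lowHat s δ m u K t) =
      mulOp (gradSymbol s m j) (mulOp (lowCut K) (solLift s δ u t)) := by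
    have hb := (hm.bddSupp_mul_lowCut hN K).1
    rw [lowHat, solHat, mulOp_mulOp hb (bddSymbol_japSymbol hs),
      mulOp_mulOp (bddSupp_derivSymbol_mul_lowCut j K).1 (hb.mul (bddSymbol_japSymbol hs)),
      mulOp_mulOp (hm.bddSymbol_gradSymbol hN hs j) (bddSupp_lowCut K).1]
    refine congrArg (fun c => mulOp c _) (funext fun ζ => ?_)
    rw [gradSymbol]
    linear_combination (derivSymbol j ζ * scaledSymbol m ζ * japSymbol s ζ) * lowCut_mul_self K ζ
  have e' : mulOp (lowCut K) (modLift s δ m u t) =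
      mulOp (scaledSymbol m) (mulOp (lowCut K) (solLift s δ u t)) := by
    rw [modLift, mulOp_mulOp (bddSupp_lowCut K).1 (hm.bddSymbol hN),
      mulOp_mulOp (hm.bddSymbol hN) (bddSupp_lowCut K).1]
    exact congrArg (fun c => mulOp c _) (funext fun ζ => mul_comm _ _)
  rw [truncEnergy, inner_mulOp_quadCut, e, e, hm.mulOp_bracketCut_lowHat hN hs, e', liftEnergy]

theorem tendsto_mulOp_lowCut (f : L2Plane) :
    Tendsto (fun K => mulOp (lowCut K) f) atTop (𝓝 f) :=
  tendsto_mulOp_indSymbol measurableSet_jap_lt (fun _ =>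
    (tendsto_pow_atTop_atTop_of_one_lt (by norm_num : (1 : ℝ) < 2)).eventually_gt_atTop _) f

/-- The truncated energy is the untruncated energy functional at the truncated lift, and this
functional is continuous on `L²`. -/
theorem IsSolution.tendsto_truncEnergy {σ s δ : ℝ} {u : ℝ → L2Plane} (hu : IsSolution σ s δ u)
    {N : ℝ} {m : Plane → ℝ} (hm : IsISymbol s N m) (hN : 0 < N) (hs : 1 / 2 < s) {t : ℝ}
    (ht : t ∈ Set.Icc 0 δ) :
    Tendsto (fun K => truncEnergy σ s K (lowHat s δ m u K t)) atTop
      (𝓝 (modifiedEnergy σ m u t)) := by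
  have hc : Continuous fun f : L2Plane => liftEnergy σ s (mulOp (gradSymbol s m 0) f)
      (mulOp (gradSymbol s m 1) f) (mulOp (scaledSymbol m) f) :=
    continuous_liftEnergy σ s (by fun_prop) (by fun_prop) (by fun_prop)
  rw [modifiedEnergy, hu.energy_IOp hm hN hs ht]
  simp only [hm.truncEnergy_lowHat hN (by linarith : 0 ≤ s)]
  exact (hc.tendsto _).comp (tendsto_mulOp_lowCut _)

end

noncomputable section

/-! ### The almost conservation law -/

theorem IsSolution.isSpaceTimeLift {σ s δ : ℝ} {u : ℝ → L2Plane} (hu : IsSolution σ s δ u)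
    {N : ℝ} {m : Plane → ℝ} (hm : IsISymbol s N m) (hN : 0 < N) (hs : 0 ≤ s) (hδ : 0 < δ)
    {b : ℝ} (hb : 1 / 2 < b) {v : 𝓢'(SpaceTime, ℂ)} {G : SpaceTime → ℂ}
    (hv : FourierIsFunction v G) (hX : bourgainSq b G < ⊤)
    (hvw : AgreeOn δ v fun t => IOp m (u t)) : IsSpaceTimeLift s δ (modLift s δ m u) G where
  aestronglyMeasurable := hv.aestronglyMeasurable
  slice t ht c hc := by
    have hw : ContinuousOn (fun t => IOp m (u t)) (Set.Ioo 0 δ) :=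
      ((besselL2 s).continuous.comp (hu.continuous_modLift hδ m)).continuousOn.congr
        fun t ht => (hu.besselL2_modLift hm hN hs (Set.Ioo_subset_Icc_self ht)).symm
    have h := stPiece_eq_fInv hb hv hX hw hvw ht hc
    have e : (𝓕 (IOp m (u t)) : L2Plane) = mulOp (japSymbol s) (modLift s δ m u t) := by
      rw [hm.fourier_IOp hN, hm.mulOp_japSymbol_modLift hN hs, solHat,
        hu.mulOp_solLift hs (Set.Ioo_subset_Icc_self ht)]
    have e2 : besselL2 s (mulOp c (modLift s δ m u t)) =
        fInv (mulOp c (𝓕 (IOp m (u t)) : L2Plane)) := by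
      rw [e, besselL2, ContinuousLinearMap.comp_apply, mulOp_mulOp hc.1 (bddSymbol_japSymbol hs),
        mulOp_mulOp (bddSymbol_japSymbol hs) hc.1]
      exact congrArg (fun c => fInv (mulOp c _)) (funext fun ζ => mul_comm _ _)
    rw [e2]
    exact h

/-- A continuous increasing function commutes with infima. The condition at `⊤` covers the empty
infimum, when no extension exists, as well as extensions of infinite norm. -/
theorem le_of_forall_bourgain {b T : ℝ} {w : ℝ → L2Plane} {Φ : ℝ≥0∞ → ℝ≥0∞} (hc : Continuous Φ)
    (hmono : Monotone Φ) (htop : Φ ⊤ = ⊤) {x : ℝ≥0∞}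
    (h : ∀ v : 𝓢'(SpaceTime, ℂ), AgreeOn T v w → ∀ g, FourierIsFunction v g →
      eLpNorm (fun p => (bourgainWeight 1 b p : ℂ) * g ((2 * Real.pi)⁻¹ • p)) 2 volume < ⊤ →
      x ≤ Φ (eLpNorm (fun p => (bourgainWeight 1 b p : ℂ) * g ((2 * Real.pi)⁻¹ • p)) 2 volume)) :
    x ≤ Φ (localBourgainNorm 1 b T w) := by
  have hm : Φ (localBourgainNorm 1 b T w) = ⨅ (v : 𝓢'(SpaceTime, ℂ)) (_ : AgreeOn T v w)
      (g : SpaceTime → ℂ) (_ : FourierIsFunction v g),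
      Φ (eLpNorm (fun p => (bourgainWeight 1 b p : ℂ) * g ((2 * Real.pi)⁻¹ • p)) 2 volume) := by
    simp only [localBourgainNorm, bourgainNorm,
      Monotone.map_iInf_of_continuousAt hc.continuousAt hmono htop, Function.comp_def]
  rw [hm]
  refine le_iInf fun v => le_iInf fun hv => le_iInf fun g => le_iInf fun hg => ?_
  rcases lt_or_eq_of_le (le_top (a := eLpNorm (fun p => (bourgainWeight 1 b p : ℂ) *
    g ((2 * Real.pi)⁻¹ • p)) 2 volume)) with h1 | h1
  · exact h v hv g hg h1
  · rw [h1, htop]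
    exact le_top

/-- The limit `K → ∞`, after the limit in `M` has been taken for fixed `K`. Since the limit only
sees large `K`, the bound is needed only when `N < 2^K`. -/
theorem IsSolution.enorm_modifiedEnergy_sub_le {σ s δ : ℝ} {u : ℝ → L2Plane}
    (hu : IsSolution σ s δ u) (hσ : σ ^ 2 = 1) (hs : 1 / 2 < s) (hs1 : s ≤ 1) (hδ : 0 < δ)
    {N : ℝ} {m : Plane → ℝ} (hm : IsISymbol s N m) (hN : 0 < N) {B : ℝ≥0∞}
    (hB : ∀ K M : ℕ, K ≤ M → N < 2 ^ K →
      ∫⁻ t in Set.Ioo 0 δ, ‖energyRate σ s m K M (modLift s δ m u t)‖ₑ ≤ B) :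
    ‖modifiedEnergy σ m u δ - modifiedEnergy σ m u 0‖ₑ ≤ B := by
  have h := (hu.tendsto_truncEnergy hm hN hs (Set.right_mem_Icc.2 hδ.le)).sub
    (hu.tendsto_truncEnergy hm hN hs (Set.left_mem_Icc.2 hδ.le))
  refine le_of_tendsto ((continuous_enorm.tendsto _).comp h) ?_
  filter_upwards [(tendsto_pow_atTop_atTop_of_one_lt (by norm_num : (1 : ℝ) < 2)).eventually_gt_atTop
    N] with K hK
  exact hu.enorm_truncEnergy_sub_le hσ hs hs1 hδ hm hN K fun M hM => hB K M hM hK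

end

end SymmetrizedMZK

theorem proposition5p2 (s : ℝ) (hs : 3 / 4 < s) (hs1 : s < 1)
    (ε : ℝ) (hε : 0 < ε) (ε' : ℝ) (hε' : 0 < ε') :
    ∃ C N₀ : ℝ, 0 < C ∧ 1 ≤ N₀ ∧
      ∀ (σ : ℝ), (σ = 1 ∨ σ = -1) →
      ∀ (N : ℝ), N₀ ≤ N →
      ∀ (m : SymmetrizedMZK.Plane → ℝ), SymmetrizedMZK.IsISymbol s N m →
      ∀ (δ : ℝ), 0 < δ →
      ∀ (u : ℝ → SymmetrizedMZK.L2Plane), SymmetrizedMZK.IsSolution σ s δ u →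
        ENNReal.ofReal |SymmetrizedMZK.modifiedEnergy σ m u δ
            - SymmetrizedMZK.modifiedEnergy σ m u 0|
          ≤ ENNReal.ofReal (C * N ^ (-1 + ε)) *
            (SymmetrizedMZK.localBourgainNorm 1 (1 / 2 + ε') δ
                (fun t => SymmetrizedMZK.IOp m (u t)) ^ 4
              + SymmetrizedMZK.localBourgainNorm 1 (1 / 2 + ε') δ
                (fun t => SymmetrizedMZK.IOp m (u t)) ^ 6) := by
  open SymmetrizedMZK in
  have hb : 1 / 2 < 1 / 2 + ε' := by linarith
  -- With this `e` the exponent satisfies `-1 + 3e ≤ -1 + ε`, and the minimum with `1/4` gives `e ≤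
  -- 1/12`, as the dyadic power counting requires.
  have he : 0 < min ε (1 / 4) / 3 := by positivity
  obtain ⟨C, hC, hmain⟩ := exists_lintegral_energyRate_le hs hs1.le hb he
    (by linarith [min_le_right ε (1 / 4)])
  -- The constant is increased by 1 to be strictly positive. Otherwise the right-hand side might
  -- vanish instead of being infinite when the local norm is infinite.
  refine ⟨C + 1, 1, by linarith, le_rfl, fun σ hσ N hN m hm δ hδ u hu => ?_⟩
  have hN0 : 0 < N := by linarith
  have hσ2 : σ ^ 2 = 1 := by rcases hσ with rfl | rfl <;> norm_num
  have hσ1 : |σ| ≤ 1 := by rcases hσ with rfl | rfl <;> norm_num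
  have hκ : 0 < (C + 1) * N ^ (-1 + ε) := by positivity
  have hle : C * N ^ (-1 + 3 * (min ε (1 / 4) / 3)) ≤ (C + 1) * N ^ (-1 + ε) := by
    gcongr
    · linarith
    · linarith [min_le_left ε (1 / 4)]
  have hpow (k : ℕ) : Continuous fun x : ℝ≥0∞ => x ^ k := ENNReal.continuous_pow k
  refine le_of_forall_bourgain (Φ := fun x => ENNReal.ofReal ((C + 1) * N ^ (-1 + ε)) *
    (x ^ 4 + x ^ 6)) ?_ ?_ ?_ fun v hv g hg hfin => ?_
  · exact (ENNReal.continuous_const_mul ENNReal.ofReal_ne_top).comp ((hpow 4).add (hpow 6))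
  · intro x y hxy
    dsimp only
    gcongr
  · simp [ENNReal.mul_top, hκ]
  · have hq := bourgainSq_le (b := 1 / 2 + ε') (by linarith) g
    have hX : bourgainSq (1 / 2 + ε') g < ⊤ := hq.trans_lt (ENNReal.pow_lt_top hfin)
    rw [← Real.norm_eq_abs, ofReal_norm]
    refine (hu.enorm_modifiedEnergy_sub_le hσ2 (by linarith) hs1.le hδ hm hN0 fun K M hKM hK =>
      hmain hm hN hσ1 hKM hK (hu.isSpaceTimeLift hm hN0 (by linarith) hδ hb hg hX hv)
        (hu.continuous_modLift hδ m) hX).trans ?_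
    refine mul_le_mul' (ENNReal.ofReal_le_ofReal hle) (add_le_add ?_ ?_)
    -- `bourgainSq` is bounded by a squared norm, so its square and its cube give the fourth and the
    -- sixth power.
    · exact (pow_le_pow_left' hq 2).trans_eq (by ring)
    · exact (pow_le_pow_left' hq 3).trans_eq (by ring)
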